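/- **Setting.** Let $\varepsilon_\infty>0$ and let $f\in C^2(\mathbb R)$ be such that $f''$ is piecewise monotone with finitely many intervals of (non-strict) monotonicity, and $\int_{\mathbb R}e^{-|t|/\varepsilon_\infty}\,df''(t)$ converges absolutely; $f'''$ denotes the signed measure $df''$. For $\varepsilon>0$ put $\Omega_\varepsilon=\{x\in\mathbb R^2: x_1^2\le x_2\le x_1^2+\varepsilon^2\}$; the curves $x_2=x_1^2$ and $x_2=x_1^2+\varepsilon^2$ are its fixed and free boundary. **Essential roots.** A system of essential roots of $f'''$ is a sequence $c_0<v_1<c_1<\dots<v_n<c_n$ ($n\ge 0$) of disjoint closed intervals, possibly single points, such that $f''$ is constant on each of them; $f''$ is non-decreasing between a $v$ (or $-\infty$) and the next $c$, and non-increasing between a $c$ and the next $v$ (or $+\infty$); and $f''$ is not constant on any one-sided outer neighbourhood of an end of any of these intervals. Thus $f'''$ changes its sign from $-$ to $+$ at $v_k$ and from $+$ to $-$ at $c_i$. (An interval on which $f'''$ vanishes without changing its sign is not listed.) The $v_k$ are bounded. The interval $c_0$ may be a ray $(-\infty,p]$, and $c_0=-\infty$ is allowed as a point at infinity (the case when $f'''$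 is negative at $-\infty$); symmetrically, $c_n$ may be $[p,+\infty)$ or $+\infty$; and $c_0=\mathbb R$ if $f''$ is constant. **Bellman candidates.** A function $B$ on $\Omega_\varepsilon$ is a Bellman candidate if it is continuous, concave on every convex subset of $\Omega_\varepsilon$, satisfies $B(u,u^2)=f(u)$, and $\Omega_\varepsilon$ is a finite union of domains (each an open connected set united with a part of its boundary) on each of which $B$ is $C^1$ and is either linear (affine) or such that the domain is foliated by extremals, that is, by chords (segments in $\Omega_\varepsilon$ with both ends on the fixed boundary) or tangents (segments in $\Omega_\varepsilon$ from the fixed boundary to a point of tangency with the free boundary), pairwise disjoint outside the fixed boundary, with $B$ linear and $dB$ constant along each. **Figures and standard candidates.** The right (left) tangent at $u$ joins $(u,u^2)$ to its point of tangency with the free boundary over $u-\varepsilon$ (over $u+\varepsilon$). * *Tangent domain* $\Omega_R(u_1,u_2)$ (resp. $\Omega_L(u_1,u_2)$), $-\infty\le u_1\le u_2\le+\infty$: the union of the right (left) tangents at $u\in[u_1,u_2]$. Standard candidate: $B(x)=m(u)(x_1-u)+f(u)$ on the tangent at $u$, where $m$ is continuous on $[u_1,u_2]$ and, inside, $\varepsilon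 m'+m=f'$ and $m''<0$ (resp. $-\varepsilon m'+m=f'$ and $m''>0$). If $u_1=-\infty$ in $\Omega_R$, then $m(u)=\varepsilon^{-1}e^{-u/\varepsilon}\int_{-\infty}^u f'(t)e^{t/\varepsilon}\,dt$; if $u_2=+\infty$ in $\Omega_L$, then $m(u)=\varepsilon^{-1}e^{u/\varepsilon}\int_u^{\infty}f'(t)e^{-t/\varepsilon}\,dt$ (absolutely convergent integrals). * *Full cup* with origin $c$: the region on and below the long chord $[A(2\varepsilon),B(2\varepsilon)]$, foliated by chords $[A(l),B(l)]$, $A(l)=(a(l),a(l)^2)$, $B(l)=(b(l),b(l)^2)$, $0<l\le2\varepsilon$, with $b(l)-a(l)=l$, $a(0)=b(0)=c$, $a,b$ continuous. Standard candidate: $B$ is linear on each chord with boundary values $f$, where, with $\langle g\rangle$ the mean of $g$ over $[a(l),b(l)]$, one has $\langle f'\rangle=\tfrac12\big(f'(a(l))+f'(b(l))\big)$ for $0<l\le 2\varepsilon$, and $a'<0<b'$, $f''(a(l))<\langle f''\rangle$, $f''(b(l))<\langle f''\rangle$ for $0<l<2\varepsilon$; moreover $f''(a)\ne\langle f''\rangle\ne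 f''(b)$ for the long chord ($l=2\varepsilon$), and along the long chord $B$ agrees with one affine function whose graph is tangent to the curve $(t,t^2,f(t))$ at both ends of the chord. * *Multicup* on a single closed interval $\mathfrak a$ of length at least $2\varepsilon$ (possibly a ray or $\mathbb R$): the part of $\Omega_\varepsilon$ between the left tangent at the left end of $\mathfrak a$ and the right tangent at its right end (no bound at an infinite end). *Angle* with vertex $w$: the part of $\Omega_\varepsilon$ between the right tangent at $w$ and the left tangent at $w$. Standard candidate in both: $B$ is affine and its graph is tangent to the curve $(t,t^2,f(t))$ at all $t\in\mathfrak a$, resp. at $t=w$. **Graphs.** The vertices of the foliation graph are the angles, the multicups, the long chords and origins of the full cups, and the infinities $\pm\infty$ up to which tangent domains last. Each full cup gives an edge from its long chord to its origin; each tangent domain gives an edge, directed from left to right for $\Omega_R$ and from right to left for $\Omega_L$, which joins the two figures adjacent to it along its two bounding tangents. Each vertex has exactly one edge for each tangent or chord that bounds its figure in this way; the graph is a tree if the directions are disregarded; and its figures cover $\Omega_\varepsilon$ and have pairwise disjoint interiors. A foliation graph (in general it may also have other kinds of figures) is *simple* if it has no oriented paths of length greater than one and no closed multicups. A function $B$ is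 *constructed from* $\Gamma$, $f$ and $\varepsilon$ if it is continuous on $\Omega_\varepsilon$ and is the standard candidate on every figure of $\Gamma$. **Theorem.** The measure $f'''$ has a system of essential roots. For any such system $c_0<v_1<c_1<\dots<v_n<c_n$ there exists $\varepsilon_1>0$ such that for every $\varepsilon\in(0,\varepsilon_1)$ there is a simple graph $\Gamma_\varepsilon$ with a collection of numerical parameters (consisting only of the figures described above) for which: 1. the function $B$ constructed from $\Gamma_\varepsilon$, $f$ and $\varepsilon$ is a $C^1$-smooth Bellman candidate on the whole of $\Omega_\varepsilon$; 2. the origins of the cups are exactly those $c_i$ that are single (finite) points; 3. the multicups sit exactly on those $c_i$ that are non-degenerate intervals (rays and the line included); 4. there are exactly $n$ angles, with vertices $w_1<\dots<w_n$, and $w_k=w_k(\varepsilon)$ lies strictly between $c_{k-1}$ and $c_k$. Moreover, for each $k=1,\dots,n$, $w_k(\varepsilon)\to v_k$ as $\varepsilon\to0^+$, that is, every neighbourhood of the point or interval $v_k$ contains $w_k(\varepsilon)$ for all sufficiently small $\varepsilon>0$. -/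

import Mathlib

open Set Filter Topology MeasureTheory

noncomputable section

namespace Bellman

/-! ## Conditions on the boundary function -/

/-- `f` is twice continuously differentiable and `f''` is piecewise monotone with finitely many
intervals of (not necessarily strict) monotonicity. -/
def Regular (f : ℝ → ℝ) : Prop :=
  ContDiff ℝ 2 f ∧ ∃ S : Finset ℝ, ∀ I : Set ℝ, I.OrdConnected → Disjoint I (S : Set ℝ) →
    MonotoneOn (deriv (deriv f)) I ∨ AntitoneOn (deriv (deriv f)) I

/-- `μ` is the total variation measure `|dg|` of a continuous function `g` of locally bounded
variation. -/
def IsVariationMeasure (g : ℝ → ℝ) (μ : Measure ℝ) : Prop :=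
  ∀ a b : ℝ, a ≤ b → μ (Ioc a b) = eVariationOn g (Icc a b)

/-- The integral `∫ exp (-|t| / ε∞) df''(t)` converges absolutely. -/
def SummabilityCondition (f : ℝ → ℝ) (εinf : ℝ) : Prop :=
  ∃ μ : Measure ℝ, IsVariationMeasure (deriv (deriv f)) μ ∧
    Integrable (fun t : ℝ => Real.exp (-|t| / εinf)) μ

/-- The essential roots `c₀ < v₁ < c₁ < ⋯ < vₙ < cₙ` of the measure `f'''`: the maximal closed
intervals (possibly single points) on which `f'''` vanishes and at which it changes its sign, from
`-` to `+` at `v` and from `+` to `-` at `c`.  The root `c i` is the interval with endpoints `cl i`,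
`cr i`, and `v k`, `k : Fin n`, is `[vl k, vr k]`; it lies between `c k` and `c (k + 1)`.
If `f'''` is negative at `-∞` then `c₀ = -∞` is encoded by `cl 0 = cr 0 = ⊥`, and if `f'''` vanishes
on a ray `(-∞, p]` and is negative to the right of `p`, then `c₀` is this ray; symmetrically at
`+∞`. If `f''` is constant, then `c₀` is the whole line. -/
structure EssentialRoots (f : ℝ → ℝ) where
  n : ℕ
  cl : Fin (n + 1) → EReal
  cr : Fin (n + 1) → EReal
  vl : Fin n → ℝ
  vr : Fin n → ℝ
  cl_le_cr : ∀ i, cl i ≤ cr i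
  cr_lt_vl : ∀ k, cr k.castSucc < vl k
  vl_le_vr : ∀ k, vl k ≤ vr k
  vr_lt_cl : ∀ k, vr k < cl k.succ
  /-- `f''` is constant on each root. -/
  const_c : ∀ i, ∀ x y : ℝ, cl i ≤ x → x ≤ cr i → cl i ≤ y → y ≤ cr i →
    deriv (deriv f) x = deriv (deriv f) y
  const_v : ∀ k, ∀ x y : ℝ, x ∈ Icc (vl k) (vr k) → y ∈ Icc (vl k) (vr k) →
    deriv (deriv f) x = deriv (deriv f) y
  /-- `f''' ≥ 0` between a `v` (or `-∞`) and the next `c`. -/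
  monotone_before_c : ∀ i, ∀ x y : ℝ,
    (Fin.cons (α := fun _ => EReal) ⊥ (fun k => (vr k : EReal)) : Fin (n + 1) → EReal) i ≤ x →
    x ≤ y → y ≤ cl i → deriv (deriv f) x ≤ deriv (deriv f) y
  /-- `f''' ≤ 0` between a `c` and the next `v` (or `+∞`). -/
  antitone_after_c : ∀ i, ∀ x y : ℝ, cr i ≤ x → x ≤ y →
    y ≤ (Fin.snoc (α := fun _ => EReal) (fun k => (vl k : EReal)) ⊤ : Fin (n + 1) → EReal) i →
    deriv (deriv f) y ≤ deriv (deriv f) x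
  /-- The sign changes are genuine, and the roots are maximal: `f'''` does not vanish
  identically on any one-sided neighbourhood of an end of a root. -/
  pos_before_c : ∀ i, ∀ x : ℝ,
    (Fin.cons (α := fun _ => EReal) ⊥ (fun k => (vr k : EReal)) : Fin (n + 1) → EReal) i < x →
    x < cl i → ∃ y : ℝ, x < y ∧ y < cl i ∧ deriv (deriv f) x < deriv (deriv f) y
  neg_after_c : ∀ i, ∀ x : ℝ, cr i < x →
    x < (Fin.snoc (α := fun _ => EReal) (fun k => (vl k : EReal)) ⊤ : Fin (n + 1) → EReal) i →
    ∃ y : ℝ, cr i < y ∧ y < x ∧ deriv (deriv f) x < deriv (deriv f) y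
  neg_before_v : ∀ k, ∀ x : ℝ, cr k.castSucc < x → x < vl k →
    ∃ y : ℝ, x < y ∧ y < vl k ∧ deriv (deriv f) y < deriv (deriv f) x
  pos_after_v : ∀ k, ∀ x : ℝ, vr k < x → x < cl k.succ →
    ∃ y : ℝ, vr k < y ∧ y < x ∧ deriv (deriv f) y < deriv (deriv f) x

/-! ## The parabolic strip and Bellman candidates -/

/-- The parabolic strip `Ω_ε`. -/
def strip (ε : ℝ) : Set (ℝ × ℝ) := {x | x.1 ^ 2 ≤ x.2 ∧ x.2 ≤ x.1 ^ 2 + ε ^ 2}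

def fixedBoundary : Set (ℝ × ℝ) := {x | x.2 = x.1 ^ 2}

def freeBoundary (ε : ℝ) : Set (ℝ × ℝ) := {x | x.2 = x.1 ^ 2 + ε ^ 2}

/-- An open connected set united with a part of its boundary. -/
def IsPlanarDomain (D : Set (ℝ × ℝ)) : Prop :=
  ∃ U : Set (ℝ × ℝ), IsOpen U ∧ IsConnected U ∧ U ⊆ D ∧ D ⊆ closure U

def LocallyConcaveOn (Ω : Set (ℝ × ℝ)) (B : ℝ × ℝ → ℝ) : Prop :=
  ∀ C : Set (ℝ × ℝ), Convex ℝ C → C ⊆ Ω → ConcaveOn ℝ C B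

/-- `[P, Q]` is a possible extremal in `Ω_ε`: a chord (both ends on the fixed boundary) or a tangent
(one end on the fixed boundary, the other one a point of tangency with the free boundary). -/
def IsExtremalSegment (ε : ℝ) (P Q : ℝ × ℝ) : Prop :=
  P ≠ Q ∧ P ∈ fixedBoundary ∧ segment ℝ P Q ⊆ strip ε ∧
    (Q ∈ fixedBoundary ∨ (Q ∈ freeBoundary ε ∧ Q.2 - P.2 = 2 * Q.1 * (Q.1 - P.1)))

/-- `G` is a continuous differential of `B` on `D`. -/
def IsC1DifferentialOn (B : ℝ × ℝ → ℝ) (G : ℝ × ℝ → (ℝ × ℝ →L[ℝ] ℝ)) (D : Set (ℝ × ℝ)) : Prop :=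
  ContinuousOn G D ∧ ∀ x ∈ D, HasFDerivWithinAt B (G x) D x

/-- `D` is foliated by extremals (two of which may meet on the fixed boundary only) along which `B`
is linear and its differential `G` is constant. -/
def FoliatedByExtremals (ε : ℝ) (D : Set (ℝ × ℝ)) (B : ℝ × ℝ → ℝ)
    (G : ℝ × ℝ → (ℝ × ℝ →L[ℝ] ℝ)) : Prop :=
  ∃ F : Set ((ℝ × ℝ) × (ℝ × ℝ)),
    (∀ e ∈ F, IsExtremalSegment ε e.1 e.2 ∧ segment ℝ e.1 e.2 ⊆ D ∧
      ∀ x ∈ segment ℝ e.1 e.2, G x = G e.1 ∧ B x = B e.1 + G e.1 (x - e.1)) ∧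
    ∀ x ∈ D, x ∉ fixedBoundary → ∃! e, e ∈ F ∧ x ∈ segment ℝ e.1 e.2

def LinearOn (D : Set (ℝ × ℝ)) (B : ℝ × ℝ → ℝ) : Prop :=
  ∃ β₀ β₁ β₂ : ℝ, ∀ x ∈ D, B x = β₀ + β₁ * x.1 + β₂ * x.2

/-- `B` is a Bellman candidate on `Ω ⊆ Ω_ε` for the boundary function `f`. -/
def IsBellmanCandidate (f : ℝ → ℝ) (ε : ℝ) (Ω : Set (ℝ × ℝ)) (B : ℝ × ℝ → ℝ) : Prop :=
  ContinuousOn B Ω ∧ LocallyConcaveOn Ω B ∧ (∀ u : ℝ, (u, u ^ 2) ∈ Ω → B (u, u ^ 2) = f u) ∧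
    ∃ (N : ℕ) (D : Fin N → Set (ℝ × ℝ)), Ω = ⋃ i, D i ∧
      ∀ i, IsPlanarDomain (D i) ∧ ∃ G, IsC1DifferentialOn B G (D i) ∧
        (LinearOn (D i) B ∨ FoliatedByExtremals ε (D i) B G)

/-! ## The cup equation and the differentials -/

/-- The average of `g` over `[a, b]`. -/
def average (g : ℝ → ℝ) (a b : ℝ) : ℝ := (∫ t in a..b, g t) / (b - a)

def CupEquation (f : ℝ → ℝ) (a b : ℝ) : Prop :=
  average (deriv f) a b = (deriv f a + deriv f b) / 2

/-- The left differential `D_L(a, b)`. -/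
def diffL (f : ℝ → ℝ) (a b : ℝ) : ℝ := deriv (deriv f) a - average (deriv (deriv f)) a b

/-- The right differential `D_R(a, b)`. -/
def diffR (f : ℝ → ℝ) (a b : ℝ) : ℝ := deriv (deriv f) b - average (deriv (deriv f)) a b

/-! ## Foliation graphs: vertices and edges with their numerical parameters -/

/-- Right tangents lie to the right of their points of tangency with the free boundary, left
tangents lie to the left of them. -/
inductive Orient
  | L
  | R

def Orient.sign : Orient → ℝ
  | .L => -1
  | .R => 1

/-- The first coordinate `u_R(x)` or `u_L(x)` of the point where the right (left) tangent through
`x` meets the fixed boundary. -/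
def foot (ε : ℝ) (o : Orient) (x : ℝ × ℝ) : ℝ :=
  x.1 + o.sign * (ε - √(x.1 ^ 2 + ε ^ 2 - x.2))

/-- The vertices of foliation graphs with their numerical parameters. An arc is a closed interval,
possibly a point or unbounded, given by its two endpoints in `EReal`. -/
inductive Vertex
  | angle (w : ℝ)
  | trolleybus (o : Orient) (a b : ℝ)
  | birdie (a b : ℝ)
  | multicup (arcs : List (EReal × EReal))
  | multitrolleybus (o : Orient) (arcs : List (EReal × EReal))
  | multibirdie (arcs : List (EReal × EReal))
  | closedMulticup (arcs : List (EReal × EReal))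
  /-- A long chord with non-zero differentials (fictitious vertex). -/
  | longChord (a b : ℝ)
  /-- The origin of a cup (fictitious vertex). -/
  | origin (c : ℝ)
  /-- A chord pasted between two chordal domains, or a long chord one or both of whose differentials
  vanish (fictitious vertex). -/
  | chord (a b : ℝ)
  /-- The infinities, with tangents of the given orientation near them (fictitious vertices). -/
  | negInfinity (o : Orient)
  | posInfinity (o : Orient)
  /-- A single tangent (fictitious vertex). -/
  | tangent (o : Orient) (u : ℝ)

/-- The edges of foliation graphs: the tangent domain `Ω_R(u₁, u₂)` or `Ω_L(u₁, u₂)`, and the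
chordal domain consisting of the chords `[A(l), B(l)]`, `l₁ ≤ l ≤ l₀`. -/
inductive Edge
  | tangents (o : Orient) (u₁ u₂ : EReal)
  | chords (l₁ l₀ : ℝ) (a b : ℝ → ℝ)

/-- The ways in which a figure can be adjacent to a domain of extremals: along a tangent with an end
at `(u, u²)`, the domain being an outgoing or incoming edge, or along a chord, which is the top
chord (outgoing edge) or the bottom chord (incoming edge) of the chordal domain. -/
inductive Port
  | outTangent (o : Orient) (u : EReal)
  | inTangent (o : Orient) (u : EReal)
  | outChord (a b : EReal)
  | inChord (a b : EReal)

/-- An `opened lo ro` figure reaches the free boundary and is bounded by an `lo`-tangent on the left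
and by an `ro`-tangent on the right; a `closed` one is separated from the free boundary. -/
inductive Shape
  | opened (lo ro : Orient)
  | closed
  | infinite

def Vertex.arcs : Vertex → List (EReal × EReal)
  | .angle w => [((w : EReal), (w : EReal))]
  | .trolleybus _ a b => [((a : EReal), (a : EReal)), ((b : EReal), (b : EReal))]
  | .birdie a b => [((a : EReal), (a : EReal)), ((b : EReal), (b : EReal))]
  | .multicup arcs => arcs
  | .multitrolleybus _ arcs => arcs
  | .multibirdie arcs => arcs
  | .closedMulticup arcs => arcs
  | .longChord a b => [((a : EReal), (a : EReal)), ((b : EReal), (b : EReal))]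
  | .origin c => [((c : EReal), (c : EReal))]
  | .chord a b => [((a : EReal), (a : EReal)), ((b : EReal), (b : EReal))]
  | .negInfinity _ => []
  | .posInfinity _ => []
  | .tangent _ u => [((u : EReal), (u : EReal))]

open Classical in
def Vertex.shape (ε : ℝ) : Vertex → Shape
  | .angle _ => .opened .R .L
  | .trolleybus o _ _ => .opened o o
  | .birdie _ _ => .opened .R .L
  | .multicup _ => .opened .L .R
  | .multitrolleybus o _ => .opened o o
  | .multibirdie _ => .opened .R .L
  | .closedMulticup _ => .closed
  | .longChord _ _ => .opened .L .R
  | .origin _ => .closed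
  | .chord a b => if b - a = 2 * ε then .opened .L .R else .closed
  | .negInfinity _ => .infinite
  | .posInfinity _ => .infinite
  | .tangent o _ => .opened o o

def leftEnd (arcs : List (EReal × EReal)) : EReal := (arcs.head?.map Prod.fst).getD ⊥

def rightEnd (arcs : List (EReal × EReal)) : EReal := (arcs.getLast?.map Prod.snd).getD ⊤

/-- The pairs (right end of an arc, left end of the next arc). -/
def gaps (arcs : List (EReal × EReal)) : List (EReal × EReal) :=
  (arcs.zip arcs.tail).map fun p => (p.1.2, p.2.1)

/-- The arcs are non-empty, consecutive and disjoint, and the chords between them lie in `Ω_ε`. -/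
def ArcsOK (ε : ℝ) (arcs : List (EReal × EReal)) : Prop :=
  arcs ≠ [] ∧ (∀ p ∈ arcs, p.1 ≤ p.2 ∧ p.1 ≠ ⊤ ∧ p.2 ≠ ⊥) ∧
    ∀ g ∈ gaps arcs, g.1 < g.2 ∧ g.2 ≤ g.1 + ((2 * ε : ℝ) : EReal)

/-- Restrictions on the numerical parameters of a vertex. -/
def Vertex.WellFormed (ε : ℝ) : Vertex → Prop
  | .angle _ => True
  | .trolleybus _ a b => a < b ∧ b - a ≤ 2 * ε
  | .birdie a b => a < b ∧ b - a ≤ 2 * ε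
  | .multicup arcs => ArcsOK ε arcs ∧ leftEnd arcs + ((2 * ε : ℝ) : EReal) ≤ rightEnd arcs
  | .multitrolleybus .R arcs => ArcsOK ε arcs ∧ leftEnd arcs ≠ ⊥
  | .multitrolleybus .L arcs => ArcsOK ε arcs ∧ rightEnd arcs ≠ ⊤
  | .multibirdie arcs => ArcsOK ε arcs ∧ leftEnd arcs ≠ ⊥ ∧ rightEnd arcs ≠ ⊤
  | .closedMulticup arcs => ArcsOK ε arcs ∧ leftEnd arcs ≠ ⊥ ∧ rightEnd arcs ≠ ⊤ ∧
      leftEnd arcs < rightEnd arcs ∧ rightEnd arcs < leftEnd arcs + ((2 * ε : ℝ) : EReal)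
  | .longChord a b => b - a = 2 * ε
  | .origin _ => True
  | .chord a b => a < b ∧ b - a ≤ 2 * ε
  | .negInfinity _ => True
  | .posInfinity _ => True
  | .tangent _ _ => True

/-- `x` lies on the chord (or tangent at a point, if `p = q`) through `(p, p²)`, `(q, q²)`
or above it. -/
def AboveChord (p q : ℝ) (x : ℝ × ℝ) : Prop := (p + q) * x.1 - p * q ≤ x.2

def BelowChord (p q : ℝ) (x : ℝ × ℝ) : Prop := x.2 ≤ (p + q) * x.1 - p * q

/-- The (possibly degenerate) linearity domain represented by a vertex. -/
def Vertex.domain (ε : ℝ) (v : Vertex) : Set (ℝ × ℝ) :=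
  match v.shape ε with
  | .opened lo ro => {x | x ∈ strip ε ∧ leftEnd v.arcs ≤ foot ε lo x ∧
      foot ε ro x ≤ rightEnd v.arcs ∧ ∀ g ∈ gaps v.arcs, AboveChord g.1.toReal g.2.toReal x}
  | .closed => {x | x ∈ strip ε ∧ BelowChord (leftEnd v.arcs).toReal (rightEnd v.arcs).toReal x ∧
      ∀ g ∈ gaps v.arcs, AboveChord g.1.toReal g.2.toReal x}
  | .infinite => ∅

/-- The edges that a vertex must have. A tangent that bounds a figure on the left (right) and is a
left (right) tangent belongs to an outgoing edge, otherwise it belongs to an incoming one; a figure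
that lasts to an infinity has no tangent there. The chords under a figure belong to outgoing
edges, the upper chord of a closed figure belongs to an incoming one. -/
def Vertex.ports (ε : ℝ) (v : Vertex) : Set Port :=
  match v with
  | .negInfinity .R => {.outTangent .R ⊥}
  | .negInfinity .L => {.inTangent .L ⊥}
  | .posInfinity .R => {.inTangent .R ⊤}
  | .posInfinity .L => {.outTangent .L ⊤}
  | v => {p | ∃ g ∈ gaps v.arcs, p = .outChord g.1 g.2} ∪
      match v.shape ε with
      | .opened lo ro =>
        {p | leftEnd v.arcs ≠ ⊥ ∧ p = match lo with
          | .L => .outTangent .L (leftEnd v.arcs)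
          | .R => .inTangent .R (leftEnd v.arcs)} ∪
        {p | rightEnd v.arcs ≠ ⊤ ∧ p = match ro with
          | .R => .outTangent .R (rightEnd v.arcs)
          | .L => .inTangent .L (rightEnd v.arcs)}
      | .closed => {.inChord (leftEnd v.arcs) (rightEnd v.arcs)}
      | .infinite => ∅

/-- Where an edge begins. Edges of right tangents are oriented from left to right, edges of left
tangents from right to left, and edges of chordal domains downwards. -/
def Edge.sourcePort : Edge → Port
  | .tangents .R u₁ _ => .outTangent .R u₁
  | .tangents .L _ u₂ => .outTangent .L u₂
  | .chords _ l₀ a b => .outChord (a l₀) (b l₀)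

/-- Where an edge ends. -/
def Edge.targetPort : Edge → Port
  | .tangents .R _ u₂ => .inTangent .R u₂
  | .tangents .L u₁ _ => .inTangent .L u₁
  | .chords l₁ _ a b => .inChord (a l₁) (b l₁)

/-- Restrictions on the numerical parameters of an edge. -/
def Edge.WellFormed (ε : ℝ) : Edge → Prop
  | .tangents _ u₁ u₂ => u₁ ≤ u₂ ∧ u₁ ≠ ⊤ ∧ u₂ ≠ ⊥
  | .chords l₁ l₀ a b => 0 ≤ l₁ ∧ l₁ < l₀ ∧ l₀ ≤ 2 * ε ∧ (∀ l ∈ Icc l₁ l₀, b l - a l = l) ∧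
      AntitoneOn a (Icc l₁ l₀) ∧ MonotoneOn b (Icc l₁ l₀)

/-- The domain of extremals represented by an edge. -/
def Edge.domain (ε : ℝ) : Edge → Set (ℝ × ℝ)
  | .tangents o u₁ u₂ => {x | x ∈ strip ε ∧ u₁ ≤ foot ε o x ∧ foot ε o x ≤ u₂}
  | .chords l₁ l₀ a b =>
      {x | x ∈ strip ε ∧ BelowChord (a l₀) (b l₀) x ∧ AboveChord (a l₁) (b l₁) x}

structure FoliationGraph where
  vertices : Finset Vertex
  edges : Finset Edge

/-- The domain of the figure represented by a vertex or by an edge. -/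
def figureDomain (ε : ℝ) : Vertex ⊕ Edge → Set (ℝ × ℝ)
  | .inl v => v.domain ε
  | .inr e => e.domain ε

namespace FoliationGraph

variable (Γ : FoliationGraph)

def figures : Set (Vertex ⊕ Edge) :=
  {x | (∃ v ∈ Γ.vertices, x = .inl v) ∨ ∃ e ∈ Γ.edges, x = .inr e}

/-- There is an edge of `Γ` from `v` to `v'`. -/
def Adj (ε : ℝ) (v v' : Vertex) : Prop :=
  v ∈ Γ.vertices ∧ v' ∈ Γ.vertices ∧
    ∃ e ∈ Γ.edges, e.sourcePort ∈ v.ports ε ∧ e.targetPort ∈ v'.ports ε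

/-- `Γ` is the graph of a foliation of `Ω_ε`: every edge leads from exactly one vertex to exactly
one vertex, the vertices have exactly the edges prescribed to their types, the graph is a tree if
one disregards the orientation, and its figures cover `Ω_ε` without overlaps. -/
def IsFoliationGraph (ε : ℝ) : Prop :=
  (∀ v ∈ Γ.vertices, v.WellFormed ε) ∧ (∀ e ∈ Γ.edges, e.WellFormed ε) ∧
  (∀ e ∈ Γ.edges, (∃! v, v ∈ Γ.vertices ∧ e.sourcePort ∈ v.ports ε) ∧
    ∃! v, v ∈ Γ.vertices ∧ e.targetPort ∈ v.ports ε) ∧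
  (∀ v ∈ Γ.vertices, ∀ p ∈ v.ports ε,
    ∃! e, e ∈ Γ.edges ∧ (e.sourcePort = p ∨ e.targetPort = p)) ∧
  (∀ v ∈ Γ.vertices, ∀ v' ∈ Γ.vertices, Relation.EqvGen (Γ.Adj ε) v v') ∧
  Γ.edges.card + 1 = Γ.vertices.card ∧
  strip ε = ⋃ x ∈ Γ.figures, figureDomain ε x ∧
  Γ.figures.PairwiseDisjoint fun x => interior (figureDomain ε x)

/-- A simple graph: there are no oriented paths longer than one and no closed multicups. -/
def IsSimple (ε : ℝ) : Prop :=
  (∀ v₁ v₂ v₃, Γ.Adj ε v₁ v₂ → ¬ Γ.Adj ε v₂ v₃) ∧ ∀ arcs, Vertex.closedMulticup arcs ∉ Γ.vertices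

end FoliationGraph

/-! ## Standard candidates and the function generated by a graph -/

/-- `B` is a standard candidate on the linearity domain represented by `v`: it is linear there, and
the plane is tangent to the curve `(t, t², f(t))` at all points of the domain on the fixed
boundary. -/
def Vertex.IsStandard (f : ℝ → ℝ) (ε : ℝ) (v : Vertex) (B : ℝ × ℝ → ℝ) : Prop :=
  ∃ β₀ β₁ β₂ : ℝ,
    (∀ x ∈ v.domain ε, B x = β₀ + β₁ * x.1 + β₂ * x.2) ∧
    (∀ p ∈ v.arcs, ∀ t : ℝ, p.1 ≤ t → t ≤ p.2 →
      f t = β₀ + β₁ * t + β₂ * t ^ 2 ∧ deriv f t = β₁ + 2 * β₂ * t) ∧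
    match v with
    | .longChord a b => diffL f a b ≠ 0 ∧ diffR f a b ≠ 0
    | .tangent _ u => β₂ = deriv (deriv f) u / 2
    | _ => True

/-- `B` is a standard candidate on the tangent domain `Ω_o(u₁, u₂)`. -/
def StandardTangents (f : ℝ → ℝ) (ε : ℝ) (o : Orient) (u₁ u₂ : EReal) (B : ℝ × ℝ → ℝ) : Prop :=
  ∃ m : ℝ → ℝ,
    (∀ x ∈ (Edge.tangents o u₁ u₂).domain ε,
      B x = m (foot ε o x) * (x.1 - foot ε o x) + f (foot ε o x)) ∧
    ContinuousOn m {u : ℝ | u₁ ≤ u ∧ u ≤ u₂} ∧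
    (∀ u : ℝ, u₁ < u → u < u₂ →
      HasDerivAt m (o.sign * (deriv f u - m u) / ε) u ∧ o.sign * deriv (deriv m) u < 0) ∧
    match o with
    | .R => u₁ = ⊥ → ∀ u : ℝ, u ≤ u₂ →
        IntegrableOn (fun t => deriv f t * Real.exp (t / ε)) (Iic u) ∧
        m u = ε⁻¹ * Real.exp (-u / ε) * ∫ t in Iic u, deriv f t * Real.exp (t / ε)
    | .L => u₂ = ⊤ → ∀ u : ℝ, u₁ ≤ u →
        IntegrableOn (fun t => deriv f t * Real.exp (-t / ε)) (Ici u) ∧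
        m u = ε⁻¹ * Real.exp (u / ε) * ∫ t in Ici u, deriv f t * Real.exp (-t / ε)

/-- `B` is a standard candidate on the chordal domain consisting of the chords `[A(l), B(l)]`,
`l₁ ≤ l ≤ l₀`. -/
def StandardChords (f : ℝ → ℝ) (l₁ l₀ : ℝ) (a b : ℝ → ℝ) (B : ℝ × ℝ → ℝ) : Prop :=
  ContinuousOn a (Icc l₁ l₀) ∧ ContinuousOn b (Icc l₁ l₀) ∧
  (∀ l ∈ Ioo l₁ l₀, DifferentiableAt ℝ a l ∧ DifferentiableAt ℝ b l ∧
    deriv a l < 0 ∧ 0 < deriv b l ∧ diffL f (a l) (b l) < 0 ∧ diffR f (a l) (b l) < 0) ∧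
  ∀ l ∈ Icc l₁ l₀, 0 < l → CupEquation f (a l) (b l) ∧
    ∀ x ∈ segment ℝ (a l, a l ^ 2) (b l, b l ^ 2),
      B x = (f (b l) - f (a l)) / (b l - a l) * x.1 +
        (b l * f (a l) - a l * f (b l)) / (b l - a l)

def Edge.IsStandard (f : ℝ → ℝ) (ε : ℝ) (e : Edge) (B : ℝ × ℝ → ℝ) : Prop :=
  match e with
  | .tangents o u₁ u₂ => StandardTangents f ε o u₁ u₂ B
  | .chords l₁ l₀ a b => StandardChords f l₁ l₀ a b B

/-- `B` is the function on `Ω_ε` constructed from the graph `Γ`: the standard candidates on the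
figures of `Γ`, glued continuously. (On `Ω_ε`, it is uniquely determined by `f`, `ε` and a
simple graph `Γ`.) -/
def IsGenerated (f : ℝ → ℝ) (ε : ℝ) (Γ : FoliationGraph) (B : ℝ × ℝ → ℝ) : Prop :=
  ContinuousOn B (strip ε) ∧ (∀ v ∈ Γ.vertices, v.IsStandard f ε B) ∧
    ∀ e ∈ Γ.edges, e.IsStandard f ε B

/-- The figures of a simple picture: angles, long chords over cups, origins of cups, multicups
on single arcs, and the infinities. -/
def Vertex.IsSimpleFigure : Vertex → Prop
  | .angle _ => True
  | .longChord _ _ => True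
  | .origin _ => True
  | .multicup arcs => arcs.length = 1
  | .negInfinity _ => True
  | .posInfinity _ => True
  | _ => False

end Bellman

end

open Set Filter Topology MeasureTheory

noncomputable section

namespace Bellman

/-! ## Existence of essential roots -/

section roots

variable {g : ℝ → ℝ} {p q r : EReal}

/-! The function B is obtained from a field of affine functions. To every point x of the strip one
attaches the affine function P_x that agrees with B along the extremal through x; each P_x is
tangent to the curve (t, t², f(t)) at the ends of that extremal on the fixed boundary. If x ↦ P_x is
continuous and P_y(y) ≤ P_x(y) for all nearby x, y whose segment lies in the strip, then x ↦ P_x(x)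
is locally concave and C¹ with differential grad P_x (`LocallySupported.locallyConcaveOn`,
`LocallySupported.hasFDerivWithinAt`). What remains is to find such planes for small ε.

Peaks. At a one-point root c the second derivative has a strict local maximum. When a chord of small
fixed length slides from the left of c to the right of c, the defect of the cup equation changes its
sign, and at each of its zeros both differentials are negative (`CupData.diff_left_neg`). Hence
there is exactly one chord of every small length, depending differentiably on the length
(`CupData.hasDerivAt_left`), and these chords fill a full cup. On a non-degenerate root f is a
quadratic polynomial, and a single plane serves the whole multicup.

Tangents. Let the plane of the right tangent at u be tangent to the curve at u, with second
coefficient M(u)/2. The planes fit together exactly if εM' + M = f'', so M is the exponential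
average of the past of f'', where everything to the left of the end b of the peak is replaced by a
constant K (`branch`). The slope m = f' - εM satisfies m' = M and m'' = (f'' - M)/ε, so the sign
condition on m'' reads M > f''. It holds while f'' descends from the peak, because the past is
larger than the present (`lt_branch`). Once f'' has begun to grow beyond v, a small ε makes the
average forget the past, and M drops below f'' at any prescribed point (`eventually_branch_lt`). The
left branch of the next peak behaves symmetrically. Therefore the two branches take a common value
at some w near v; there the two planes coincide, and this plane fills an angle with vertex w
(`Valley.exists_isAngleVertex`). The points that enclose w can be prescribed arbitrarily close to v,
whence w → v as ε → 0.

Support inequality. For fixed y the value at y of the plane of a moving extremal is monotone: its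
derivative is a quantity of known sign times the equation of the extremal evaluated at y
(`right_branch_anti`, `CupData.hasDerivAt_chordPlane_ev`). The equation of a tangent factors in the
coordinates uL, uR (`right_tangent_factor`), and a segment [x, y] in the strip enters only through
uR(x) ≤ uL(y) + 2ε (`uR_le_of_segment`).

Graph. Peaks and angles alternate along a path, to which origins of cups and infinities are attached
as leaves. Every edge leaves a peak and no edge enters one, so the graph is a simple tree. -/

def ConstE (g : ℝ → ℝ) (p q : EReal) : Prop :=
  ∀ x y : ℝ, p ≤ x → x ≤ q → p ≤ y → y ≤ q → g x = g y

def MonoE (g : ℝ → ℝ) (p q : EReal) : Prop :=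
  ∀ x y : ℝ, p ≤ x → x ≤ y → y ≤ q → g x ≤ g y

def AntiE (g : ℝ → ℝ) (p q : EReal) : Prop :=
  ∀ x y : ℝ, p ≤ x → x ≤ y → y ≤ q → g y ≤ g x

lemma EReal.exists_coe_of_between {x y : ℝ} {q : EReal} (h1 : x ≤ q) (h2 : q ≤ y) :
    ∃ t : ℝ, q = t := by
  have a1 : q ≠ ⊤ := fun h => by rw [h] at h2; exact absurd h2 (EReal.coe_lt_top _).not_ge
  have a2 : q ≠ ⊥ := fun h => by rw [h] at h1; exact absurd h1 (EReal.bot_lt_coe _).not_ge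
  exact ⟨q.toReal, (EReal.coe_toReal a1 a2).symm⟩

lemma MonoE.trans (h1 : MonoE g p q) (h2 : MonoE g q r) : MonoE g p r := by
  intro x y hx hxy hy
  rcases le_total (x : EReal) q with hxq | hxq
  · rcases le_total (y : EReal) q with hyq | hyq
    · exact h1 x y hx hxy hyq
    · obtain ⟨t, rfl⟩ := EReal.exists_coe_of_between hxq hyq
      exact (h1 x t hx (by exact_mod_cast hxq) le_rfl).trans
        (h2 t y le_rfl (by exact_mod_cast hyq) hy)
  · exact h2 x y hxq hxy hy

lemma monoE_neg : MonoE (fun t => -g t) p q ↔ AntiE g p q := by simp [MonoE, AntiE]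

lemma antiE_neg : AntiE (fun t => -g t) p q ↔ MonoE g p q := by simp [MonoE, AntiE]

lemma constE_neg : ConstE (fun t => -g t) p q ↔ ConstE g p q := by simp [ConstE]

lemma constE_comp_neg : ConstE (fun t => g (-t)) (-q) (-p) ↔ ConstE g p q := by
  constructor
  · intro h x y h1 h2 h3 h4
    have := h (-x) (-y) (by simpa using h2) (by simpa using h1) (by simpa using h4)
      (by simpa using h3)
    simpa using this
  · intro h x y h1 h2 h3 h4
    exact h _ _ (by rw [EReal.coe_neg]; exact EReal.le_neg_of_le_neg h2)
      (by rw [EReal.coe_neg]; exact EReal.neg_le_of_neg_le h1)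
      (by rw [EReal.coe_neg]; exact EReal.le_neg_of_le_neg h4)
      (by rw [EReal.coe_neg]; exact EReal.neg_le_of_neg_le h3)

lemma AntiE.trans (h1 : AntiE g p q) (h2 : AntiE g q r) : AntiE g p r :=
  monoE_neg.1 ((monoE_neg.2 h1).trans (monoE_neg.2 h2))

lemma ConstE.monoE (h : ConstE g p q) : MonoE g p q := fun x y hx hxy hy =>
  have hxy' : (x : EReal) ≤ y := by exact_mod_cast hxy
  (h x y hx (hxy'.trans hy) (hx.trans hxy') hy).le

lemma ConstE.antiE (h : ConstE g p q) : AntiE g p q := fun x y hx hxy hy =>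
  have hxy' : (x : EReal) ≤ y := by exact_mod_cast hxy
  (h x y hx (hxy'.trans hy) (hx.trans hxy') hy).ge

/-- Two overlapping intervals of constancy. -/
lemma ConstE.union {p' q' : EReal} (h1 : ConstE g p q) (h2 : ConstE g p' q') {t : ℝ}
    (ht1 : p ≤ t) (ht2 : t ≤ q) (ht3 : p' ≤ t) (ht4 : t ≤ q') : ConstE g p q' := by
  have key : ∀ x : ℝ, p ≤ x → x ≤ q' → g x = g t := by
    intro x hx hx'
    rcases le_total x t with h | h
    · have h' : (x : EReal) ≤ t := by exact_mod_cast h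
      exact h1 x t hx (h'.trans ht2) ht1 ht2
    · have h' : (t : EReal) ≤ x := by exact_mod_cast h
      exact h2 x t (ht3.trans h') hx' ht3 ht4
  intro x y hx hx' hy hy'
  rw [key x hx hx', key y hy hy']

/-- The maximal extension to the right of an interval of constancy. -/
lemma exists_max_const_right (hg : Continuous g) {p e : EReal} (hpe : p ≤ e) (h : AntiE g p e) :
    ∃ q, p ≤ q ∧ q ≤ e ∧ ConstE g p q ∧
      ∀ x : ℝ, q < x → x ≤ e → ∃ y : ℝ, q < y ∧ y < x ∧ g x < g y := by
  -- The required end is the supremum of the ends of intervals of constancy that start at p;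
  -- continuity carries the constancy over to the supremum itself.
  set T : Set EReal := {q | p ≤ q ∧ q ≤ e ∧ ConstE g p q} with hT
  have hpT : p ∈ T := by
    refine ⟨le_rfl, hpe, fun x y h1 h2 h3 h4 => ?_⟩
    have : (x : EReal) = y := (le_antisymm h2 h1).trans (le_antisymm h3 h4)
    rw [EReal.coe_eq_coe_iff.1 this]
  have hpq : p ≤ sSup T := le_sSup hpT
  have hclosed : ∀ t : ℝ, IsClosed {z | g z = g t} := fun t => isClosed_eq hg continuous_const
  have key : ∀ x y : ℝ, p ≤ x → x < y → y ≤ sSup T → g y = g x := by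
    intro x y hx hxy hy
    have hsub : Ico x y ⊆ {z | g z = g x} := by
      intro z hz
      have hzq : (z : EReal) < sSup T := lt_of_lt_of_le (by exact_mod_cast hz.2) hy
      obtain ⟨q', hq', hzq'⟩ := lt_sSup_iff.1 hzq
      have hxz : (x : EReal) ≤ z := by exact_mod_cast hz.1
      exact hq'.2.2 z x (hx.trans hxz) hzq'.le hx (hxz.trans hzq'.le)
    have := closure_minimal hsub (hclosed x)
    rw [closure_Ico hxy.ne] at this
    exact this ⟨hxy.le, le_rfl⟩
  have hconst : ConstE g p (sSup T) := by
    intro x y hx hx' hy hy'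
    rcases lt_trichotomy x y with h | rfl | h
    · exact (key x y hx h hy').symm
    · rfl
    · exact key y x hy h hx'
  refine ⟨sSup T, hpq, sSup_le fun q hq => hq.2.1, hconst, ?_⟩
  intro x hx hxe
  -- If no value just after the supremum exceeded g x, antitonicity would make g constant on (sup T,
  -- x], hence on [p, x], and x would itself belong to T.
  by_contra! hcon
  have heq : ∀ y : ℝ, sSup T < y → y ≤ x → g y = g x := by
    intro y hy hyx
    rcases hyx.eq_or_lt with rfl | hyx
    · rfl
    · exact le_antisymm (hcon y hy hyx) (h y x (hpq.trans hy.le) hyx.le hxe)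
  have hall : ∀ z : ℝ, p ≤ z → z ≤ x → g z = g x := by
    intro z hz hzx
    rcases lt_or_ge (sSup T) (z : EReal) with hlt | hge
    · exact heq z hlt hzx
    · obtain ⟨t, ht⟩ := EReal.exists_coe_of_between hge hx.le
      rw [ht] at hx hge
      have htx : t < x := by exact_mod_cast hx
      have hsub : Ioc t x ⊆ {z | g z = g x} := fun y hy =>
        heq y (by rw [ht]; exact_mod_cast hy.1) hy.2
      have := closure_minimal hsub (hclosed x)
      rw [closure_Ioc htx.ne] at this
      have h1 : g t = g x := this ⟨le_rfl, htx.le⟩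
      rw [← h1]
      exact hconst z t hz (by rw [ht]; exact hge) (by rw [← ht]; exact hpq) (by rw [ht])
  have : (x : EReal) ∈ T := ⟨hpq.trans hx.le, hxe, fun y z h1 h2 h3 h4 => by
    rw [hall y h1 (by exact_mod_cast h2), hall z h3 (by exact_mod_cast h4)]⟩
  exact absurd (le_sSup this) hx.not_ge

lemma exists_max_const_left (hg : Continuous g) {p e : EReal} (hep : e ≤ p) (h : MonoE g e p) :
    ∃ q, e ≤ q ∧ q ≤ p ∧ ConstE g q p ∧
      ∀ x : ℝ, x < q → e ≤ x → ∃ y : ℝ, x < y ∧ y < q ∧ g x < g y := by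
  obtain ⟨q, h1, h2, h3, h4⟩ := exists_max_const_right (g := fun t => g (-t)) (by fun_prop)
    (p := -p) (e := -e) (EReal.neg_le_neg_iff.2 hep) (by
      intro x y hx hxy hy
      exact h _ _ (by rw [EReal.coe_neg]; exact EReal.le_neg_of_le_neg hy) (by linarith)
        (by rw [EReal.coe_neg]; exact EReal.neg_le_of_neg_le hx))
  refine ⟨-q, EReal.le_neg_of_le_neg h2, EReal.neg_le_of_neg_le h1, ?_, ?_⟩
  · rw [← constE_comp_neg, neg_neg]; exact h3
  · intro x hx hx'
    obtain ⟨y, hy1, hy2, hy3⟩ := h4 (-x) (by rw [EReal.coe_neg]; exact EReal.lt_neg_of_lt_neg hx)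
      (by rw [EReal.coe_neg]; exact EReal.neg_le_neg_iff.2 hx')
    refine ⟨-y, by linarith, ?_, by simpa using hy3⟩
    rw [EReal.coe_neg]; exact EReal.neg_lt_neg_iff.2 hy1

/-- A subdivision of the line into intervals where `g` is alternately non-decreasing and
non-increasing. -/
structure WeakRoots (g : ℝ → ℝ) (n : ℕ) (c V : ℕ → EReal) : Prop where
  V_zero : V 0 = ⊥
  V_top : V (n + 1) = ⊤
  V_real : ∀ i, 1 ≤ i → i ≤ n → ∃ r : ℝ, V i = r
  V_le_c : ∀ i ≤ n, V i ≤ c i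
  c_le_V : ∀ i ≤ n, c i ≤ V (i + 1)
  mono : ∀ i ≤ n, MonoE g (V i) (c i)
  anti : ∀ i ≤ n, AntiE g (c i) (V (i + 1))

/-- When the descent from c i is flat, the ascents on both of its sides merge into one: c i and V (i
+ 1) are dropped. Together with `WeakRoots.remove_left` this forces genuine sign changes in a
subdivision of minimal size. -/
lemma WeakRoots.remove_right {n i : ℕ} {c V : ℕ → EReal} (h : WeakRoots g (n + 1) c V)
    (hi : i ≤ n) (hc : ConstE g (c i) (V (i + 1))) :
    WeakRoots g n (fun j => if j < i then c j else c (j + 1))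
      (fun j => if j ≤ i then V j else V (j + 1)) where
  V_zero := by simp [h.V_zero]
  V_top := by rw [if_neg (by omega)]; exact h.V_top
  V_real := by
    intro j h1 h2
    split_ifs
    · exact h.V_real j h1 (by omega)
    · exact h.V_real (j + 1) (by omega) (by omega)
  V_le_c := by
    intro j hj
    rcases lt_trichotomy j i with hlt | rfl | hgt
    · rw [if_pos hlt.le, if_pos hlt]; exact h.V_le_c j (by omega)
    · rw [if_pos le_rfl, if_neg (lt_irrefl _)]
      exact (h.V_le_c j (by omega)).trans ((h.c_le_V j (by omega)).trans (h.V_le_c _ (by omega)))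
    · rw [if_neg (by omega), if_neg (by omega)]; exact h.V_le_c _ (by omega)
  c_le_V := by
    intro j hj
    split_ifs <;> first | exact h.c_le_V _ (by omega) | omega
  mono := by
    intro j hj
    rcases lt_trichotomy j i with hlt | rfl | hgt
    · rw [if_pos hlt.le, if_pos hlt]; exact h.mono j (by omega)
    · rw [if_pos le_rfl, if_neg (lt_irrefl _)]
      exact (h.mono j (by omega)).trans (hc.monoE.trans (h.mono _ (by omega)))
    · rw [if_neg (by omega), if_neg (by omega)]; exact h.mono _ (by omega)
  anti := by
    intro j hj
    split_ifs <;> first | exact h.anti _ (by omega) | omega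

/-- The counterpart for a flat ascent: the descents around it merge, and V (i + 1), c (i + 1) are
dropped. -/
lemma WeakRoots.remove_left {n i : ℕ} {c V : ℕ → EReal} (h : WeakRoots g (n + 1) c V)
    (hi : i ≤ n) (hc : ConstE g (V (i + 1)) (c (i + 1))) :
    WeakRoots g n (fun j => if j ≤ i then c j else c (j + 1))
      (fun j => if j ≤ i then V j else V (j + 1)) where
  V_zero := by simp [h.V_zero]
  V_top := by rw [if_neg (by omega)]; exact h.V_top
  V_real := by
    intro j h1 h2
    split_ifs
    · exact h.V_real j h1 (by omega)
    · exact h.V_real (j + 1) (by omega) (by omega)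
  V_le_c := by
    intro j hj
    split_ifs <;> exact h.V_le_c _ (by omega)
  c_le_V := by
    intro j hj
    rcases lt_trichotomy j i with hlt | rfl | hgt
    · rw [if_pos hlt.le, if_pos (by omega)]; exact h.c_le_V j (by omega)
    · rw [if_pos le_rfl, if_neg (by omega)]
      exact (h.c_le_V j (by omega)).trans ((h.V_le_c _ (by omega)).trans (h.c_le_V _ (by omega)))
    · rw [if_neg (by omega), if_neg (by omega)]; exact h.c_le_V _ (by omega)
  mono := by
    intro j hj
    split_ifs <;> exact h.mono _ (by omega)
  anti := by
    intro j hj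
    rcases lt_trichotomy j i with hlt | rfl | hgt
    · rw [if_pos hlt.le, if_pos (by omega)]; exact h.anti j (by omega)
    · rw [if_pos le_rfl, if_neg (by omega)]
      exact (h.anti j (by omega)).trans (hc.antiE.trans (h.anti _ (by omega)))
    · rw [if_neg (by omega), if_neg (by omega)]; exact h.anti _ (by omega)

/-- `Regular` gives monotonicity only off the exceptional points; continuity extends it to the ends
of each piece. -/
lemma le_of_monotoneOn_Ioo {s : Set ℝ} (hg : Continuous g) (h : MonotoneOn g s) {x y : ℝ} (hxy : x ≤ y) (hsub : Ioo x y ⊆ s) : g x ≤ g y := by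
  rcases hxy.eq_or_lt with rfl | hlt
  · exact le_rfl
  have h1 : MonotoneOn g (Ioo x y) := h.mono hsub
  have hne : (x + y) / 2 ∈ Ioo x y := ⟨by linarith, by linarith⟩
  have hx : g x ≤ g ((x + y) / 2) := by
    have hsub' : Ioo x ((x + y) / 2) ⊆ {z | g z ≤ g ((x + y) / 2)} := fun z hz =>
      h1 ⟨hz.1, hz.2.trans hne.2⟩ hne hz.2.le
    have := closure_minimal hsub' (isClosed_le hg continuous_const)
    rw [closure_Ioo hne.1.ne] at this
    exact this ⟨le_rfl, hne.1.le⟩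
  have hy : g ((x + y) / 2) ≤ g y := by
    have hsub' : Ioo ((x + y) / 2) y ⊆ {z | g ((x + y) / 2) ≤ g z} := fun z hz =>
      h1 hne ⟨hne.1.trans hz.1, hz.2⟩ hz.1.le
    have := closure_minimal hsub' (isClosed_le continuous_const hg)
    rw [closure_Ioo hne.2.ne] at this
    exact this ⟨hne.2.le, le_rfl⟩
  exact hx.trans hy

lemma exists_weakRoots (hg : Continuous g) (S : Finset ℝ)
    (hS : ∀ I : Set ℝ, I.OrdConnected → Disjoint I (S : Set ℝ) → MonotoneOn g I ∨ AntitoneOn g I) :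
    ∃ n c V, WeakRoots g n c V := by
  classical
  set m := S.card with hm
  set s := S.orderEmbOfFin hm.symm with hs
  -- The exceptional points in increasing order, shifted by one to make room for V 0 = -∞;
  -- everything after them is +∞.
  set V : ℕ → EReal := fun i => if i = 0 then ⊥ else if h : i - 1 < m then (s ⟨i - 1, h⟩ : EReal) else ⊤ with hV
  have hV0 : V 0 = ⊥ := by simp [hV]
  have hVs : ∀ i (h : i < m), V (i + 1) = s ⟨i, h⟩ := by intro i h; simp [hV, h]
  have hVtop : V (m + 1) = ⊤ := by simp [hV]
  have hle : ∀ i ≤ m, V i ≤ V (i + 1) := by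
    intro i hi
    rcases Nat.eq_zero_or_pos i with rfl | h0
    · rw [hV0]; exact bot_le
    obtain ⟨j, rfl⟩ : ∃ j, i = j + 1 := ⟨i - 1, by omega⟩
    rcases hi.eq_or_lt with h | h
    · rw [h, hVtop]; exact le_top
    · rw [hVs j (by omega), hVs (j + 1) h]
      exact_mod_cast s.monotone (by simp [Fin.le_def])
  have hpiece : ∀ i ≤ m, MonoE g (V i) (V (i + 1)) ∨ AntiE g (V i) (V (i + 1)) := by
    intro i hi
    set I : Set ℝ := {x | V i < x ∧ (x : EReal) < V (i + 1)} with hI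
    have hord : I.OrdConnected := by
      refine ⟨fun x hx y hy z hz => ⟨hx.1.trans_le ?_, lt_of_le_of_lt ?_ hy.2⟩⟩
      · exact_mod_cast hz.1
      · exact_mod_cast hz.2
    have hdisj : Disjoint I (S : Set ℝ) := by
      rw [Set.disjoint_left]
      rintro x ⟨hx1, hx2⟩ hxS
      have : x ∈ range s := by rw [hs, Finset.range_orderEmbOfFin]; exact hxS
      obtain ⟨j, rfl⟩ := this
      have h1 : i ≤ j := by
        rcases Nat.eq_zero_or_pos i with rfl | h0
        · omega
        obtain ⟨i', rfl⟩ : ∃ i', i = i' + 1 := ⟨i - 1, by omega⟩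
        rw [hVs i' (by omega)] at hx1
        have h3 : s ⟨i', by omega⟩ < s j := by exact_mod_cast hx1
        have := s.lt_iff_lt.1 h3
        rw [Fin.lt_def] at this
        exact this
      have h2 : (j : ℕ) < i := by
        rcases hi.eq_or_lt with h | h
        · rw [h]; exact j.2
        · rw [hVs i h] at hx2
          have h3 : s j < s ⟨i, h⟩ := by exact_mod_cast hx2
          have := s.lt_iff_lt.1 h3
          rwa [Fin.lt_def] at this
      omega
    have hsub : ∀ x y : ℝ, V i ≤ x → y ≤ V (i + 1) → Ioo x y ⊆ I := fun x y hx hy z hz =>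
      ⟨hx.trans_lt (by exact_mod_cast hz.1), lt_of_lt_of_le (by exact_mod_cast hz.2) hy⟩
    rcases hS I hord hdisj with h | h
    · exact Or.inl fun x y hx hxy hy => le_of_monotoneOn_Ioo hg h hxy (hsub x y hx hy)
    · refine Or.inr (monoE_neg.1 fun x y hx hxy hy => ?_)
      exact le_of_monotoneOn_Ioo (g := fun t => -g t) hg.neg h.neg hxy
        (hsub x y hx hy)
  -- Each piece is monotone in one direction only, so its peak c i is put at the right end of a
  -- non-decreasing piece and at the left end of any other; the complementary half is then a single
  -- point.
  refine ⟨m, fun i => if MonoE g (V i) (V (i + 1)) then V (i + 1) else V i, V, hV0, hVtop, ?_, ?_, ?_,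
    ?_, ?_⟩
  · intro i h1 h2
    obtain ⟨j, rfl⟩ : ∃ j, i = j + 1 := ⟨i - 1, by omega⟩
    exact ⟨_, hVs j (by omega)⟩
  · intro i hi
    split_ifs
    · exact hle i hi
    · exact le_rfl
  · intro i hi
    split_ifs
    · exact le_rfl
    · exact hle i hi
  · intro i hi
    split_ifs with h
    · exact h
    · intro x y hx hxy hy
      have : (x : EReal) ≤ y := by exact_mod_cast hxy
      have : (x : EReal) = y := le_antisymm this (hy.trans hx)
      rw [EReal.coe_eq_coe_iff.1 this]
  · intro i hi
    split_ifs with h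
    · intro x y hx hxy hy
      have : (x : EReal) ≤ y := by exact_mod_cast hxy
      have : (x : EReal) = y := le_antisymm this (hy.trans hx)
      rw [EReal.coe_eq_coe_iff.1 this]
    · exact (hpiece i hi).resolve_left h

/-- In a weak subdivision with the least number of pieces no inner ascent or descent is flat, since
it could be removed. The roots are the maximal intervals of constancy around the points of this
subdivision. -/
theorem exists_essentialRoots {f : ℝ → ℝ} (hf : Regular f) : Nonempty (EssentialRoots f) := by
  classical
  obtain ⟨hC, S, hS⟩ := hf
  set g := deriv (deriv f) with hgdef
  have hg : Continuous g := by
    have h1 : ContDiff ℝ 1 (deriv f) := ((contDiff_succ_iff_deriv (n := 1)).1 hC).2.2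
    exact h1.continuous_deriv le_rfl
  have hex := exists_weakRoots hg S hS
  set n := Nat.find hex with hn
  obtain ⟨c, V, h⟩ := Nat.find_spec hex
  rw [← hn] at h
  have hmin : ∀ m < n, ∀ c V, ¬ WeakRoots g m c V := fun m hm c V h' =>
    Nat.find_min hex hm ⟨c, V, h'⟩
  have hright : ∀ i < n, ¬ ConstE g (c i) (V (i + 1)) := by
    intro i hi hc
    obtain ⟨m, hm⟩ : ∃ m, n = m + 1 := ⟨n - 1, by omega⟩
    rw [hm] at h
    exact hmin m (by omega) _ _ (h.remove_right (by omega) hc)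
  have hleft : ∀ i < n, ¬ ConstE g (V (i + 1)) (c (i + 1)) := by
    intro i hi hc
    obtain ⟨m, hm⟩ : ∃ m, n = m + 1 := ⟨n - 1, by omega⟩
    rw [hm] at h
    exact hmin m (by omega) _ _ (h.remove_left (by omega) hc)
  -- Each point c i and V (k + 1) is enlarged on both sides to a maximal interval of constancy; for
  -- V the function -g is used, which interchanges ascents and descents.
  have hcr := fun i : Fin (n + 1) => exists_max_const_right hg (h.c_le_V i (by omega))
    (h.anti i (by omega))
  have hcl := fun i : Fin (n + 1) => exists_max_const_left hg (h.V_le_c i (by omega))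
    (h.mono i (by omega))
  have hvr := fun k : Fin n => exists_max_const_right (g := fun t => -g t) hg.neg
    (h.V_le_c (k + 1) (by omega)) (antiE_neg.2 (h.mono (k + 1) (by omega)))
  have hvl := fun k : Fin n => exists_max_const_left (g := fun t => -g t) hg.neg
    (h.c_le_V k (by omega)) (monoE_neg.2 (h.anti k (by omega)))
  choose cr cr1 cr2 cr3 cr4 using hcr
  choose cl cl1 cl2 cl3 cl4 using hcl
  choose VR vr1 vr2 vr3 vr4 using hvr
  choose VL vl1 vl2 vl3 vl4 using hvl
  choose v hv using fun k : Fin n => h.V_real (k + 1) (by omega) (by omega)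
  -- An infinite end would make the whole ascent to the next peak flat, contrary to minimality.
  have hVR : ∀ k, ∃ r : ℝ, VR k = r := by
    intro k
    have h1 : VR k ≠ ⊥ := by
      intro hb; have := vr1 k; rw [hb, hv] at this
      exact absurd this (EReal.bot_lt_coe _).not_ge
    have h2 : VR k ≠ ⊤ := by
      intro ht
      have e : c (k + 1) = ⊤ := top_le_iff.1 (ht ▸ vr2 k)
      have := constE_neg.1 (vr3 k)
      rw [ht, ← e] at this
      exact hleft k k.2 this
    exact ⟨_, (EReal.coe_toReal h2 h1).symm⟩
  have hVL : ∀ k, ∃ r : ℝ, VL k = r := by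
    intro k
    have h1 : VL k ≠ ⊤ := by
      intro hb; have := vl2 k; rw [hb, hv] at this
      exact absurd this (EReal.coe_lt_top _).not_ge
    have h2 : VL k ≠ ⊥ := by
      intro ht
      have e : c k = ⊥ := le_bot_iff.1 (ht ▸ vl1 k)
      have := constE_neg.1 (vl3 k)
      rw [ht, ← e] at this
      exact hright k k.2 this
    exact ⟨_, (EReal.coe_toReal h1 h2).symm⟩
  choose vr hvr' using hVR
  choose vl hvl' using hVL
  simp only [hvr', hvl'] at vr1 vr2 vr3 vr4 vl1 vl2 vl3 vl4
  simp only [hv] at vr1 vr3 vl2 vl3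
  have hVcons : ∀ i : Fin (n + 1), V i ≤
      (Fin.cons (α := fun _ => EReal) ⊥ (fun k => (vr k : EReal)) : Fin (n + 1) → EReal) i := by
    intro i
    refine Fin.cases ?_ (fun k => ?_) i
    · simp [h.V_zero]
    · rw [Fin.cons_succ, Fin.val_succ, hv]; exact vr1 k
  have hVsnoc : ∀ i : Fin (n + 1),
      (Fin.snoc (α := fun _ => EReal) (fun k => (vl k : EReal)) ⊤ : Fin (n + 1) → EReal) i ≤
        V (i + 1) := by
    intro i
    refine Fin.lastCases ?_ (fun k => ?_) i
    · simp [h.V_top]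
    · rw [Fin.snoc_castSucc, Fin.val_castSucc, hv]; exact vl2 k
  refine ⟨{
      n := n
      cl := cl
      cr := cr
      vl := vl
      vr := vr
      cl_le_cr := fun i => (cl2 i).trans (cr1 i)
      cr_lt_vl := ?_
      vl_le_vr := fun k => by exact_mod_cast (vl2 k).trans (vr1 k)
      vr_lt_cl := ?_
      const_c := ?_
      const_v := ?_
      monotone_before_c := fun i x y hx hxy hy =>
        h.mono i (by omega) x y ((hVcons i).trans hx) hxy (hy.trans (cl2 i))
      antitone_after_c := fun i x y hx hxy hy =>
        h.anti i (by omega) x y ((cr1 i).trans hx) hxy (hy.trans (hVsnoc i))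
      pos_before_c := fun i x hx hx' => cl4 i x hx' ((hVcons i).trans hx.le)
      neg_after_c := fun i x hx hx' => cr4 i x hx (hx'.le.trans (hVsnoc i))
      neg_before_v := ?_
      pos_after_v := ?_ }⟩
  · intro k
    -- If the intervals around c k and V (k + 1) overlapped, g would be constant on the whole
    -- descent between these points.
    by_contra! hcon
    refine hright k k.2 ?_
    have := (cr3 k.castSucc).union (constE_neg.1 (vl3 k)) (vl1 k) hcon le_rfl (vl2 k)
    rwa [Fin.val_castSucc, ← hv] at this
  · intro k
    by_contra! hcon
    refine hleft k k.2 ?_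
    have := (constE_neg.1 (vr3 k)).union (cl3 k.succ) (vr1 k) le_rfl hcon (vr2 k)
    rwa [Fin.val_succ, ← hv] at this
  · intro i x y h1 h2 h3 h4
    have key : ∀ z : ℝ, cl i ≤ z → z ≤ cr i → ∀ t : ℝ, cl i ≤ t → t ≤ cr i → z ≤ t → g z = g t := by
      intro z hz1 hz2 t ht1 ht2 hzt
      rcases le_total (c i) (z : EReal) with h | h
      · exact cr3 i z t h hz2 (h.trans (by exact_mod_cast hzt)) ht2
      rcases le_total (t : EReal) (c i) with h' | h'
      · exact cl3 i z t hz1 h ht1 h'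
      obtain ⟨r, hr⟩ := EReal.exists_coe_of_between h h'
      have e1 := cl2 i
      have e2 := cr1 i
      rw [hr] at h h' e1 e2
      rw [cl3 i z r hz1 (by rw [hr]; exact h) e1 (by rw [hr]),
        cr3 i r t (by rw [hr]) e2 (by rw [hr]; exact h') ht2]
    rcases le_total x y with hxy | hxy
    · exact key x h1 h2 y h3 h4 hxy
    · exact (key y h3 h4 x h1 h2 hxy).symm
  · intro k x y hx hy
    have := (constE_neg.1 (vl3 k)).union (constE_neg.1 (vr3 k)) (vl2 k) le_rfl le_rfl (vr1 k)
    exact this x y (by exact_mod_cast hx.1) (by exact_mod_cast hx.2) (by exact_mod_cast hy.1)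
      (by exact_mod_cast hy.2)
  · intro k x hx hx'
    obtain ⟨y, hy1, hy2, hy3⟩ := vl4 k x (by exact_mod_cast hx') ((cr1 k.castSucc).trans hx.le)
    exact ⟨y, hy1, by exact_mod_cast hy2, by simpa using hy3⟩
  · intro k x hx hx'
    obtain ⟨y, hy1, hy2, hy3⟩ := vr4 k x (by exact_mod_cast hx) (hx'.le.trans (cl2 k.succ))
    exact ⟨y, by exact_mod_cast hy1, hy2, by simpa using hy3⟩

end roots

/-! ## Exponential averages -/

/-- `∫ q(t) exp ((t - u) / ε) dt / ε` over `(-∞, u]`. -/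
def avR (ε : ℝ) (q : ℝ → ℝ) (u : ℝ) : ℝ :=
  ε⁻¹ * Real.exp (-u / ε) * ∫ t in Iic u, q t * Real.exp (t / ε)

/-- `∫ q(t) exp ((u - t) / ε) dt / ε` over `[u, ∞)`. -/
def avL (ε : ℝ) (q : ℝ → ℝ) (u : ℝ) : ℝ :=
  ε⁻¹ * Real.exp (u / ε) * ∫ t in Ici u, q t * Real.exp (-t / ε)

def ExpBound (C Λ : ℝ) (q : ℝ → ℝ) : Prop := ∀ t, |q t| ≤ C * Real.exp (Λ * |t|)

lemma avL_eq (ε : ℝ) (q : ℝ → ℝ) (u : ℝ) : avL ε q u = avR ε (fun t => q (-t)) (-u) := by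
  have := integral_comp_neg_Iic (-u) fun t => q t * Real.exp (-t / ε)
  rw [neg_neg] at this
  rw [avL, avR, neg_neg, integral_Ici_eq_integral_Ioi, ← this]
  simp

lemma ExpBound.comp_neg {C Λ : ℝ} {q : ℝ → ℝ} (h : ExpBound C Λ q) :
    ExpBound C Λ fun t => q (-t) := fun t => by simpa using h (-t)

lemma ExpBound.nonneg {C Λ : ℝ} {q : ℝ → ℝ} (h : ExpBound C Λ q) : 0 ≤ C := by
  have := (abs_nonneg _).trans (h 0)
  simpa using this

section average

variable {ε C Λ : ℝ} {q : ℝ → ℝ} (hε : 0 < ε) (hΛ : 0 ≤ Λ) (hεΛ : Λ * ε < 1)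

/-- Replacing the bound by a sum of two pure exponentials makes the integrals over half-lines
explicit. -/
lemma exp_abs_le (t : ℝ) :
    Real.exp (Λ * |t|) ≤ Real.exp (-Λ * t) + Real.exp (Λ * t) := by
  rcases abs_cases t with ⟨h, _⟩ | ⟨h, _⟩ <;> rw [h]
  · linarith [Real.exp_pos (-Λ * t)]
  · have : Λ * -t = -Λ * t := by ring
    rw [this]; linarith [Real.exp_pos (Λ * t)]

include hε in
lemma exp_split (t : ℝ) : (Real.exp (-Λ * t) + Real.exp (Λ * t)) * Real.exp (t / ε) =
    Real.exp ((ε⁻¹ - Λ) * t) + Real.exp ((ε⁻¹ + Λ) * t) := by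
  rw [add_mul, ← Real.exp_add, ← Real.exp_add]
  congr 2 <;> field_simp <;> ring

include hε in
lemma integrableOn_exp_div (u : ℝ) : IntegrableOn (fun t => Real.exp (t / ε)) (Iic u) := by
  have := integrableOn_exp_mul_Iic (inv_pos.2 hε) u
  simpa [div_eq_inv_mul] using this

include hε in
lemma integral_exp_div (u : ℝ) : ∫ t in Iic u, Real.exp (t / ε) = ε * Real.exp (u / ε) := by
  have := integral_exp_mul_Iic (inv_pos.2 hε) u
  simp only [← div_eq_inv_mul] at this
  rw [this, div_inv_eq_mul, mul_comm]

lemma exp_rate_pos (hε : 0 < ε) (hΛ : 0 ≤ Λ) (hεΛ : Λ * ε < 1) : 0 < ε⁻¹ - Λ ∧ 0 < ε⁻¹ + Λ := by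
  have h1 : Λ < ε⁻¹ := by rw [← one_div, lt_div_iff₀ hε]; exact hεΛ
  constructor <;> linarith

include hε hΛ hεΛ in
lemma integrableOn_exp_abs_mul (u : ℝ) :
    IntegrableOn (fun t => Real.exp (Λ * |t|) * Real.exp (t / ε)) (Iic u) := by
  obtain ⟨h1, h2⟩ := exp_rate_pos hε hΛ hεΛ
  have hi := (integrableOn_exp_mul_Iic h1 u).add (integrableOn_exp_mul_Iic h2 u)
  refine Integrable.mono' hi (by fun_prop) (Eventually.of_forall fun t => ?_)
  rw [Real.norm_eq_abs, abs_of_pos (by positivity)]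
  have := mul_le_mul_of_nonneg_right (exp_abs_le (Λ := Λ) t) (Real.exp_pos (t / ε)).le
  exact this.trans (exp_split hε t).le

include hε hΛ hεΛ in
lemma ExpBound.integrableOn (hq : Measurable q) (hb : ExpBound C Λ q) (u : ℝ) :
    IntegrableOn (fun t => q t * Real.exp (t / ε)) (Iic u) := by
  refine Integrable.mono' ((integrableOn_exp_abs_mul hε hΛ hεΛ u).const_mul C) ?_
    (Eventually.of_forall fun t => ?_)
  · exact (hq.mul (by fun_prop)).aestronglyMeasurable
  · rw [Real.norm_eq_abs, abs_mul, abs_of_pos (Real.exp_pos (t / ε)), ← mul_assoc]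
    exact mul_le_mul_of_nonneg_right (hb t) (Real.exp_pos _).le

include hε in
-- The weight has total mass one, so a constant may be moved under the integral; comparing the
-- average with G becomes a question about the sign of an integral.
lemma avR_sub_const {u G : ℝ} (hi : IntegrableOn (fun t => q t * Real.exp (t / ε)) (Iic u)) :
    avR ε q u - G = ε⁻¹ * Real.exp (-u / ε) * ∫ t in Iic u, (q t - G) * Real.exp (t / ε) := by
  have h1 : ∫ t in Iic u, (q t - G) * Real.exp (t / ε) =
      (∫ t in Iic u, q t * Real.exp (t / ε)) - G * (ε * Real.exp (u / ε)) := by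
    simp only [sub_mul]
    rw [integral_sub hi ((integrableOn_exp_div hε u).const_mul G), integral_const_mul,
      integral_exp_div hε]
  have h2 : Real.exp (-u / ε) * Real.exp (u / ε) = 1 := by
    rw [← Real.exp_add, neg_div, neg_add_cancel, Real.exp_zero]
  rw [h1, avR]
  have h3 : ε⁻¹ * ε = 1 := inv_mul_cancel₀ hε.ne'
  have h4 : ε⁻¹ * Real.exp (-u / ε) * (G * (ε * Real.exp (u / ε))) = G :=
    calc _ = G * (ε⁻¹ * ε) * (Real.exp (-u / ε) * Real.exp (u / ε)) := by ring
      _ = G := by rw [h2, h3]; ring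
  rw [mul_sub, h4]

include hε in
lemma avR_eq_of_const {u K : ℝ} (h : ∀ t ≤ u, q t = K) : avR ε q u = K := by
  have h1 : ∫ t in Iic u, q t * Real.exp (t / ε) = K * (ε * Real.exp (u / ε)) := by
    rw [← integral_exp_div hε, ← integral_const_mul]
    exact setIntegral_congr_fun measurableSet_Iic fun t ht => by simp only [h t ht]
  have h2 : Real.exp (-u / ε) * Real.exp (u / ε) = 1 := by
    rw [← Real.exp_add, neg_div, neg_add_cancel, Real.exp_zero]
  rw [avR, h1]
  have h3 : ε⁻¹ * ε = 1 := inv_mul_cancel₀ hε.ne'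
  calc ε⁻¹ * Real.exp (-u / ε) * (K * (ε * Real.exp (u / ε)))
      = K * (ε⁻¹ * ε) * (Real.exp (-u / ε) * Real.exp (u / ε)) := by ring
    _ = K := by rw [h2, h3]; ring

include hε hΛ hεΛ in
-- The weight is positive everywhere, so a strict inequality on a half-line survives averaging.
lemma lt_avR (hq : Measurable q) (hb : ExpBound C Λ q) {u y G : ℝ} (hyu : y ≤ u)
    (h1 : ∀ t ≤ u, G ≤ q t) (h2 : ∀ t ≤ y, G < q t) : G < avR ε q u := by
  have hi := hb.integrableOn hε hΛ hεΛ hq u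
  have hi' : IntegrableOn (fun t => (q t - G) * Real.exp (t / ε)) (Iic u) := by
    simp only [sub_mul]
    exact hi.sub ((integrableOn_exp_div hε u).const_mul G)
  have hpos : 0 < ∫ t in Iic u, (q t - G) * Real.exp (t / ε) := by
    rw [setIntegral_pos_iff_support_of_nonneg_ae _ hi']
    · refine lt_of_lt_of_le ?_ (measure_mono (?_ : Iic y ⊆ _))
      · rw [Real.volume_Iic]; exact ENNReal.zero_lt_top
      · intro t ht
        refine ⟨?_, le_trans ht hyu⟩
        rw [Function.mem_support]
        exact (mul_pos (sub_pos.2 (h2 t ht)) (Real.exp_pos _)).ne'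
    · refine (ae_restrict_iff' measurableSet_Iic).2 (Eventually.of_forall fun t ht => ?_)
      exact mul_nonneg (sub_nonneg.2 (h1 t ht)) (Real.exp_pos _).le
  have := avR_sub_const (G := G) hε hi
  have h3 : 0 < ε⁻¹ * Real.exp (-u / ε) := by positivity
  have := mul_pos h3 hpos
  linarith

include hε hΛ hεΛ in
lemma continuous_avR (hq : Measurable q) (hb : ExpBound C Λ q) : Continuous (avR ε q) := by
  have hi := hb.integrableOn hε hΛ hεΛ hq
  have hii : ∀ a b, IntervalIntegrable (fun t => q t * Real.exp (t / ε)) volume a b := fun a b =>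
    ⟨(hi b).mono_set Ioc_subset_Iic_self, (hi a).mono_set Ioc_subset_Iic_self⟩
  have : avR ε q = fun u => ε⁻¹ * Real.exp (-u / ε) * ((∫ t in Iic 0, q t * Real.exp (t / ε)) +
      ∫ t in (0 : ℝ)..u, q t * Real.exp (t / ε)) := by
    funext u
    rw [avR, ← intervalIntegral.integral_Iic_sub_Iic (hi 0) (hi u)]; ring
  rw [this]
  have := intervalIntegral.continuous_primitive hii 0
  fun_prop

include hε hΛ hεΛ in
-- The average solves εM' + M = q. Only continuity at the point is asked for, because the functions
-- averaged below may jump where a branch begins.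
lemma hasDerivAt_avR (hq : Measurable q) (hb : ExpBound C Λ q) {u : ℝ} (hc : ContinuousAt q u) :
    HasDerivAt (avR ε q) ((q u - avR ε q u) / ε) u := by
  have hi := hb.integrableOn hε hΛ hεΛ hq
  have hii : ∀ a b, IntervalIntegrable (fun t => q t * Real.exp (t / ε)) volume a b := fun a b =>
    ⟨(hi b).mono_set Ioc_subset_Iic_self, (hi a).mono_set Ioc_subset_Iic_self⟩
  have heq : avR ε q = fun u => ε⁻¹ * Real.exp (-u / ε) * ((∫ t in Iic 0, q t * Real.exp (t / ε)) +
      ∫ t in (0 : ℝ)..u, q t * Real.exp (t / ε)) := by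
    funext u
    rw [avR, ← intervalIntegral.integral_Iic_sub_Iic (hi 0) (hi u)]; ring
  have hmeas : Measurable fun t => q t * Real.exp (t / ε) := hq.mul (by fun_prop)
  have hd := intervalIntegral.integral_hasDerivAt_right (hii 0 u)
    (hmeas.stronglyMeasurable.stronglyMeasurableAtFilter) (hc.mul (by fun_prop))
  have he : HasDerivAt (fun u => ε⁻¹ * Real.exp (-u / ε)) (ε⁻¹ * (Real.exp (-u / ε) * (-1 / ε))) u :=
    (((hasDerivAt_id u).neg.div_const ε).exp).const_mul _
  have h2 : Real.exp (-u / ε) * Real.exp (u / ε) = 1 := by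
    rw [← Real.exp_add, neg_div, neg_add_cancel, Real.exp_zero]
  have := he.mul (hd.const_add (∫ t in Iic 0, q t * Real.exp (t / ε)))
  refine (this.congr_of_eventuallyEq (Eventually.of_forall (congrFun heq))).congr_deriv ?_
  rw [congrFun heq u]
  set X := (∫ t in Iic 0, q t * Real.exp (t / ε)) + ∫ t in (0 : ℝ)..u, q t * Real.exp (t / ε)
  calc _ = ε⁻¹ * (q u * (Real.exp (-u / ε) * Real.exp (u / ε))) -
        ε⁻¹ * (ε⁻¹ * Real.exp (-u / ε) * X) := by ring
    _ = _ := by rw [h2]; ring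

include hε hΛ hεΛ in
/-- If `q ≤ G` on `(u, w]` and the average at `u` is at most `G` then so is the average at `w`. -/
lemma avR_le_of_le (hq : Measurable q) (hb : ExpBound C Λ q) {u w G : ℝ} (huw : u ≤ w)
    (h1 : avR ε q u ≤ G) (h2 : ∀ t, u < t → t ≤ w → q t ≤ G) : avR ε q w ≤ G := by
  have hi := hb.integrableOn hε hΛ hεΛ hq
  have hi' : ∀ v, IntegrableOn (fun t => (q t - G) * Real.exp (t / ε)) (Iic v) := fun v => by
    simp only [sub_mul]
    exact (hi v).sub ((integrableOn_exp_div hε v).const_mul G)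
  have e1 := avR_sub_const (G := G) hε (hi u)
  have e2 := avR_sub_const (G := G) hε (hi w)
  have e3 := intervalIntegral.integral_Iic_sub_Iic (hi' u) (hi' w)
  have h3 : ∫ t in u..w, (q t - G) * Real.exp (t / ε) ≤ 0 := by
    rw [intervalIntegral.integral_of_le huw]
    refine setIntegral_nonpos measurableSet_Ioc fun t ht => ?_
    exact mul_nonpos_of_nonpos_of_nonneg (sub_nonpos.2 (h2 t ht.1 ht.2)) (Real.exp_pos _).le
  have h4 : ∫ t in Iic u, (q t - G) * Real.exp (t / ε) ≤ 0 := by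
    by_contra! hpos
    have : 0 < ε⁻¹ * Real.exp (-u / ε) := by positivity
    have := mul_pos this hpos
    linarith
  have h5 : 0 < ε⁻¹ * Real.exp (-w / ε) := by positivity
  have := mul_nonpos_of_nonneg_of_nonpos h5.le
    (show ∫ t in Iic w, (q t - G) * Real.exp (t / ε) ≤ 0 by linarith)
  linarith

include hε hΛ hεΛ in
/-- Integration by parts. -/
lemma sub_avR_eq {F F' : ℝ → ℝ} {C' : ℝ} (hF : ∀ t, HasDerivAt F (F' t) t) (hF' : Measurable F')
    (hb : ExpBound C Λ F) (hb' : ExpBound C' Λ F') (u : ℝ) :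
    F u - ε * avR ε F' u = avR ε F u := by
  have hFc : Continuous F := continuous_iff_continuousAt.2 fun t => (hF t).continuousAt
  have hi := hb.integrableOn hε hΛ hεΛ hFc.measurable u
  have hi' := hb'.integrableOn hε hΛ hεΛ hF' u
  obtain ⟨h1, h2⟩ := exp_rate_pos hε hΛ hεΛ
  have hlim : Tendsto (fun t => F t * Real.exp (t / ε)) atBot (𝓝 0) := by
    have hb1 : Tendsto (fun t => C * (Real.exp ((ε⁻¹ - Λ) * t) + Real.exp ((ε⁻¹ + Λ) * t))) atBot
        (𝓝 0) := by
      have a1 : Tendsto (fun t => Real.exp ((ε⁻¹ - Λ) * t)) atBot (𝓝 0) :=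
        Real.tendsto_exp_atBot.comp (tendsto_id.const_mul_atBot h1)
      have a2 : Tendsto (fun t => Real.exp ((ε⁻¹ + Λ) * t)) atBot (𝓝 0) :=
        Real.tendsto_exp_atBot.comp (tendsto_id.const_mul_atBot h2)
      simpa using (a1.add a2).const_mul C
    refine squeeze_zero_norm (fun t => ?_) hb1
    rw [Real.norm_eq_abs, abs_mul, abs_of_pos (Real.exp_pos (t / ε))]
    have := mul_le_mul_of_nonneg_right ((hb t).trans (mul_le_mul_of_nonneg_left (exp_abs_le t)
      hb.nonneg)) (Real.exp_pos (t / ε)).le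
    rwa [mul_assoc, exp_split hε] at this
  have hd : ∀ t ∈ Iic u, HasDerivAt (fun t => F t * Real.exp (t / ε))
      (F' t * Real.exp (t / ε) + ε⁻¹ * (F t * Real.exp (t / ε))) t := by
    intro t _
    have he : HasDerivAt (fun t => Real.exp (t / ε)) (Real.exp (t / ε) * (1 / ε)) t :=
      ((hasDerivAt_id t).div_const ε).exp
    refine ((hF t).mul he).congr_deriv ?_
    ring
  have := integral_Iic_of_hasDerivAt_of_tendsto' hd (hi'.add (hi.const_mul ε⁻¹)) hlim
  rw [integral_add hi' (hi.const_mul ε⁻¹), integral_const_mul, sub_zero] at this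
  have h2 : Real.exp (-u / ε) * Real.exp (u / ε) = 1 := by
    rw [← Real.exp_add, neg_div, neg_add_cancel, Real.exp_zero]
  have h3 : ε * ε⁻¹ = 1 := mul_inv_cancel₀ hε.ne'
  rw [avR, avR]
  linear_combination (-F u) * h2 - Real.exp (-u / ε) * this +
    (-(Real.exp (-u / ε) * ∫ t in Iic u, F' t * Real.exp (t / ε))) * h3

end average

/-- If `q` is at most `G` on `(z, d]` and smaller on `(z, y]` then its average at `d` is smaller than
`G` for small `ε`, whatever `q` is beyond `z` within an exponential bound. -/
lemma eventually_avR_lt {C Λ z y d G η : ℝ} (hΛ : 0 ≤ Λ) (hzy : z < y) (hyd : y ≤ d) (hη : 0 < η) :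
    ∀ᶠ ε in 𝓝[>] (0 : ℝ), ∀ q : ℝ → ℝ, Measurable q → (∃ C', ExpBound C' Λ q) →
      (∀ t ≤ z, q t ≤ C * Real.exp (Λ * |t|)) → (∀ t, z < t → t ≤ y → q t ≤ G - η) →
      (∀ t, y < t → t ≤ d → q t ≤ G) → avR ε q d < G := by
  set C₁ := |C| + |G| with hC₁
  have hC₁0 : 0 ≤ C₁ := by positivity
  -- The half-line (-∞, z] contributes at most A times ε exp(z/ε): C₁ absorbs both the growth bound
  -- and G, and the factor 2 comes from (1/ε ± Λ)⁻¹ ≤ 2ε.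
  set A := 2 * C₁ * (Real.exp (-Λ * z) + Real.exp (Λ * z)) with hA
  -- In the same unit ε exp(z/ε), the gain on (z, y] is η(exp((y - z)/ε) - 1), which eventually
  -- beats the fixed number A.
  have hlim : Tendsto (fun ε : ℝ => η * (Real.exp ((y - z) / ε) - 1)) (𝓝[>] 0) atTop := by
    have h1 : Tendsto (fun ε : ℝ => (y - z) / ε) (𝓝[>] 0) atTop := by
      simp only [div_eq_mul_inv]
      exact tendsto_inv_nhdsGT_zero.const_mul_atTop (by linarith)
    have h2 := Real.tendsto_exp_atTop.comp h1
    exact (tendsto_atTop_add_const_right _ (-1) h2).const_mul_atTop hη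
  have hsmall : ∀ᶠ ε in 𝓝[>] (0 : ℝ), 2 * Λ * ε < 1 := by
    have : Tendsto (fun ε : ℝ => 2 * Λ * ε) (𝓝[>] 0) (𝓝 (2 * Λ * 0)) :=
      (tendsto_id.const_mul (2 * Λ)).mono_left nhdsWithin_le_nhds
    rw [mul_zero] at this
    exact this.eventually (gt_mem_nhds one_pos)
  filter_upwards [hlim.eventually_gt_atTop A, hsmall, self_mem_nhdsWithin] with ε hεA hεs hε q hq
    ⟨C', hb⟩ h1 h2 h3
  replace hε : 0 < ε := hε
  have hεΛ : Λ * ε < 1 := by nlinarith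
  have hi := hb.integrableOn hε hΛ hεΛ hq
  have hi' : ∀ v, IntegrableOn (fun t => (q t - G) * Real.exp (t / ε)) (Iic v) := fun v => by
    simp only [sub_mul]
    exact (hi v).sub ((integrableOn_exp_div hε v).const_mul G)
  have e1 := avR_sub_const (G := G) hε (hi d)
  have e2 := intervalIntegral.integral_Iic_sub_Iic (hi' z) (hi' y)
  have e3 := intervalIntegral.integral_Iic_sub_Iic (hi' y) (hi' d)
  have b3 : ∫ t in y..d, (q t - G) * Real.exp (t / ε) ≤ 0 := by
    rw [intervalIntegral.integral_of_le hyd]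
    refine setIntegral_nonpos measurableSet_Ioc fun t ht => ?_
    exact mul_nonpos_of_nonpos_of_nonneg (sub_nonpos.2 (h3 t ht.1 ht.2)) (Real.exp_pos _).le
  have b2 : ∫ t in z..y, (q t - G) * Real.exp (t / ε) ≤
      -η * (ε * Real.exp (y / ε) - ε * Real.exp (z / ε)) := by
    rw [← integral_exp_div hε, ← integral_exp_div hε, intervalIntegral.integral_Iic_sub_Iic
      (integrableOn_exp_div hε z) (integrableOn_exp_div hε y), ← intervalIntegral.integral_const_mul,
      intervalIntegral.integral_of_le hzy.le, intervalIntegral.integral_of_le hzy.le]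
    refine setIntegral_mono_on ((hi' y).mono_set Ioc_subset_Iic_self)
      (((integrableOn_exp_div hε y).mono_set Ioc_subset_Iic_self).const_mul _) measurableSet_Ioc
      fun t ht => ?_
    exact mul_le_mul_of_nonneg_right (by linarith [h2 t ht.1 ht.2]) (Real.exp_pos _).le
  obtain ⟨r1, r2⟩ := exp_rate_pos hε hΛ hεΛ
  have r1' : (ε⁻¹ - Λ)⁻¹ ≤ 2 * ε := by
    rw [inv_le_comm₀ r1 (by positivity)]
    have : (2 * ε)⁻¹ = ε⁻¹ / 2 := by field_simp
    rw [this]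
    have : 2 * Λ < ε⁻¹ := by rw [← one_div, lt_div_iff₀ hε]; exact hεs
    linarith
  have r2' : (ε⁻¹ + Λ)⁻¹ ≤ 2 * ε := by
    refine le_trans ?_ r1'
    exact inv_anti₀ r1 (by linarith)
  have b1 : ∫ t in Iic z, (q t - G) * Real.exp (t / ε) ≤ ε * Real.exp (z / ε) * A := by
    have hint := (integrableOn_exp_mul_Iic r1 z).add (integrableOn_exp_mul_Iic r2 z)
    calc ∫ t in Iic z, (q t - G) * Real.exp (t / ε)
        ≤ ∫ t in Iic z, C₁ * (Real.exp ((ε⁻¹ - Λ) * t) + Real.exp ((ε⁻¹ + Λ) * t)) := by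
          refine setIntegral_mono_on (hi' z) (hint.const_mul C₁) measurableSet_Iic fun t ht => ?_
          have a1 : q t - G ≤ C₁ * Real.exp (Λ * |t|) := by
            have c1 : C * Real.exp (Λ * |t|) ≤ |C| * Real.exp (Λ * |t|) :=
              mul_le_mul_of_nonneg_right (le_abs_self C) (Real.exp_pos _).le
            have c2 : 1 ≤ Real.exp (Λ * |t|) := Real.one_le_exp (by positivity)
            have c3 := mul_le_mul_of_nonneg_left c2 (abs_nonneg G)
            have c4 := neg_abs_le G
            rw [hC₁, add_mul]
            linarith [h1 t ht]
          have := mul_le_mul_of_nonneg_right (a1.trans (mul_le_mul_of_nonneg_left (exp_abs_le t)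
            hC₁0)) (Real.exp_pos (t / ε)).le
          rwa [mul_assoc C₁, exp_split hε] at this
      _ = C₁ * (Real.exp ((ε⁻¹ - Λ) * z) * (ε⁻¹ - Λ)⁻¹ + Real.exp ((ε⁻¹ + Λ) * z) * (ε⁻¹ + Λ)⁻¹) := by
          rw [integral_const_mul, integral_add (integrableOn_exp_mul_Iic r1 z)
            (integrableOn_exp_mul_Iic r2 z), integral_exp_mul_Iic r1, integral_exp_mul_Iic r2]
          rfl
      _ ≤ C₁ * (Real.exp ((ε⁻¹ - Λ) * z) * (2 * ε) + Real.exp ((ε⁻¹ + Λ) * z) * (2 * ε)) := by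
          gcongr
      _ = ε * Real.exp (z / ε) * A := by
          have x1 : Real.exp ((ε⁻¹ - Λ) * z) = Real.exp (z / ε) * Real.exp (-Λ * z) := by
            rw [← Real.exp_add]; congr 1; field_simp; ring
          have x2 : Real.exp ((ε⁻¹ + Λ) * z) = Real.exp (z / ε) * Real.exp (Λ * z) := by
            rw [← Real.exp_add]; congr 1; field_simp
          rw [x1, x2, hA]; ring
  have x3 : Real.exp (y / ε) = Real.exp (z / ε) * Real.exp ((y - z) / ε) := by
    rw [← Real.exp_add]; congr 1; field_simp; ring
  have hneg : ∫ t in Iic d, (q t - G) * Real.exp (t / ε) < 0 := by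
    have k : 0 < ε * Real.exp (z / ε) := by positivity
    have := mul_lt_mul_of_pos_left hεA k
    rw [x3] at b2
    nlinarith
  have h5 : 0 < ε⁻¹ * Real.exp (-d / ε) := by positivity
  have := mul_neg_of_pos_of_neg h5 hneg
  linarith

/-! ## Exponential bounds for the derivatives -/

/-- Markov's inequality: where |t| ≤ T the weight is at least exp(-T/ε∞), so the variation of f''
there is at most exp(T/ε∞) times the convergent integral. -/
lemma SummabilityCondition.exists_expBound {f : ℝ → ℝ} {εinf : ℝ} (hε : 0 < εinf)
    (h : SummabilityCondition f εinf) : ∃ C, ExpBound C (1 / εinf) (deriv (deriv f)) := by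
  obtain ⟨μ, hμ, hint⟩ := h
  set g := deriv (deriv f)
  set J := ∫⁻ t, ENNReal.ofReal (Real.exp (-|t| / εinf)) ∂μ with hJ
  have hJtop : J ≠ ⊤ := by
    have := hint.lintegral_lt_top
    exact this.ne
  have key : ∀ a b T : ℝ, a ≤ b → (∀ t ∈ Ioc a b, |t| ≤ T) →
      |g a - g b| ≤ J.toReal * Real.exp (T / εinf) := by
    intro a b T hab hT
    have h1 : edist (g a) (g b) ≤ μ (Ioc a b) := by
      rw [hμ a b hab]
      exact eVariationOn.edist_le g (left_mem_Icc.2 hab) (right_mem_Icc.2 hab)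
    have h2 : ENNReal.ofReal (Real.exp (-T / εinf)) * μ (Ioc a b) ≤ J := by
      refine le_trans ?_ (mul_meas_ge_le_lintegral (by fun_prop) (ENNReal.ofReal (Real.exp (-T / εinf))))
      gcongr
      intro t ht
      exact ENNReal.ofReal_le_ofReal (Real.exp_le_exp.2 (by
        apply div_le_div_of_nonneg_right _ hε.le; linarith [hT t ht]))
    have h3 : ENNReal.ofReal (Real.exp (-T / εinf)) * edist (g a) (g b) ≤ J :=
      (mul_le_mul_right h1 _).trans h2
    have h4 := ENNReal.toReal_mono hJtop h3
    rw [ENNReal.toReal_mul, ENNReal.toReal_ofReal (Real.exp_pos _).le, edist_dist,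
      ENNReal.toReal_ofReal dist_nonneg, Real.dist_eq] at h4
    have h5 : Real.exp (T / εinf) * Real.exp (-T / εinf) = 1 := by
      rw [← Real.exp_add, neg_div, add_neg_cancel, Real.exp_zero]
    have := mul_le_mul_of_nonneg_left h4 (Real.exp_pos (T / εinf)).le
    rw [← mul_assoc, h5, one_mul] at this
    linarith
  refine ⟨J.toReal + |g 0|, fun t => ?_⟩
  have h1 : |g t - g 0| ≤ J.toReal * Real.exp (|t| / εinf) := by
    rcases le_total 0 t with ht | ht
    · rw [abs_sub_comm]
      refine key 0 t |t| ht fun s hs => ?_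
      rw [abs_of_pos hs.1, abs_of_nonneg ht]; exact hs.2
    · refine key t 0 |t| ht fun s hs => ?_
      rw [abs_of_nonpos hs.2, abs_of_nonpos ht]; linarith [hs.1]
  have h2 : 1 ≤ Real.exp (1 / εinf * |t|) := Real.one_le_exp (by positivity)
  have h3 : |t| / εinf = 1 / εinf * |t| := by ring
  rw [h3] at h1
  have h4 : |g t| ≤ |g t - g 0| + |g 0| := by
    have := abs_add_le (g t - g 0) (g 0); rwa [sub_add_cancel] at this
  rw [add_mul]
  nlinarith [mul_le_mul_of_nonneg_left h2 (abs_nonneg (g 0))]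

lemma ExpBound.mono {C Λ Λ' : ℝ} {q : ℝ → ℝ} (h : ExpBound C Λ q) (hΛ : Λ ≤ Λ') :
    ExpBound C Λ' q := fun t =>
  (h t).trans (mul_le_mul_of_nonneg_left (Real.exp_le_exp.2
    (mul_le_mul_of_nonneg_right hΛ (abs_nonneg t))) h.nonneg)

/-- The mean value inequality produces an extra factor |t| ≤ exp(Λ|t|)/Λ, which is paid for by
doubling the rate. -/
lemma ExpBound.of_deriv {C Λ : ℝ} (hΛ : 0 < Λ) {F F' : ℝ → ℝ} (hF : ∀ t, HasDerivAt F (F' t) t)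
    (h : ExpBound C Λ F') : ∃ C', ExpBound C' (2 * Λ) F := by
  have hC := h.nonneg
  refine ⟨|F 0| + C / Λ, fun t => ?_⟩
  have h1 : ‖F t - F 0‖ ≤ C * Real.exp (Λ * |t|) * ‖t - 0‖ := by
    refine Convex.norm_image_sub_le_of_norm_hasDerivWithin_le (s := Icc (-|t|) |t|)
      (fun x _ => (hF x).hasDerivWithinAt) (fun x hx => ?_) (convex_Icc _ _)
      ⟨by simp, by simp⟩ ⟨neg_abs_le t, le_abs_self t⟩
    refine (h x).trans ?_
    have : |x| ≤ |t| := abs_le.2 hx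
    gcongr
  rw [sub_zero, Real.norm_eq_abs, Real.norm_eq_abs] at h1
  have h2 : |t| ≤ Real.exp (Λ * |t|) / Λ := by
    rw [le_div_iff₀ hΛ]
    linarith [Real.add_one_le_exp (Λ * |t|)]
  have h3 : C * Real.exp (Λ * |t|) * |t| ≤ C * Real.exp (Λ * |t|) * (Real.exp (Λ * |t|) / Λ) :=
    mul_le_mul_of_nonneg_left h2 (by positivity)
  have h4 : Real.exp (Λ * |t|) * Real.exp (Λ * |t|) = Real.exp (2 * Λ * |t|) := by
    rw [← Real.exp_add]; ring_nf
  have h5 : C * Real.exp (Λ * |t|) * (Real.exp (Λ * |t|) / Λ) = C / Λ * Real.exp (2 * Λ * |t|) := by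
    rw [← h4]; ring
  have h6 : |F t| ≤ |F t - F 0| + |F 0| := by
    have := abs_add_le (F t - F 0) (F 0); rwa [sub_add_cancel] at this
  have h7 : 1 ≤ Real.exp (2 * Λ * |t|) := Real.one_le_exp (by positivity)
  rw [add_mul]
  nlinarith [mul_le_mul_of_nonneg_left h7 (abs_nonneg (F 0))]

/-! ## The cup equation -/

/-- The cup equation is `cupFun F F' a b = 0`. -/
def cupFun (F F1 : ℝ → ℝ) (a b : ℝ) : ℝ := (b - a) * (F1 a + F1 b) / 2 - (F b - F a)

/-- The mean value over `[a, b]` of the derivative of `F1`. -/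
def slopeOn (F1 : ℝ → ℝ) (a b : ℝ) : ℝ := (F1 b - F1 a) / (b - a)

/-- `F` is of class `C²` and `F''` has a strict maximum at `p`, with monotonicity on both sides. -/
structure CupData (F F1 F2 : ℝ → ℝ) (p δ : ℝ) : Prop where
  deriv0 : ∀ t, HasDerivAt F (F1 t) t
  deriv1 : ∀ t, HasDerivAt F1 (F2 t) t
  cont : Continuous F2
  mono : ∀ x y, p - δ ≤ x → x ≤ y → y ≤ p → F2 x ≤ F2 y
  anti : ∀ x y, p ≤ x → x ≤ y → y ≤ p + δ → F2 y ≤ F2 x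
  lt_left : ∀ x, p - δ ≤ x → x < p → F2 x < F2 p
  lt_right : ∀ x, p < x → x ≤ p + δ → F2 x < F2 p

lemma hasDerivAt_comp_neg_apply {F : ℝ → ℝ} {d t : ℝ} (h : HasDerivAt F d (-t)) :
    HasDerivAt (fun t => F (-t)) (-d) t := by
  have := h.comp t (hasDerivAt_neg t)
  simpa [Function.comp_def] using this

lemma slopeOn_neg (F1 : ℝ → ℝ) (a b : ℝ) :
    slopeOn (fun t => -F1 (-t)) (-b) (-a) = slopeOn F1 a b := by
  simp only [slopeOn, neg_neg]; congr 1 <;> ring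

lemma cupFun_neg (F F1 : ℝ → ℝ) (a b : ℝ) :
    cupFun (fun t => F (-t)) (fun t => -F1 (-t)) (-b) (-a) = -cupFun F F1 a b := by
  simp only [cupFun, neg_neg]; ring

/-- A differentiable function with negative derivatives at its zeros has at most one zero. -/
lemma zero_unique_of_deriv_neg {φ φ' : ℝ → ℝ} {s t : ℝ} (hst : s < t)
    (hd : ∀ x ∈ Icc s t, HasDerivAt φ (φ' x) x) (hs : φ s = 0) (ht : φ t = 0)
    (hneg : ∀ x ∈ Icc s t, φ x = 0 → φ' x < 0) : False := by
  have hc : ContinuousOn φ (Icc s t) := fun x hx => (hd x hx).continuousAt.continuousWithinAt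
  have aux : ∀ x ∈ Icc s t, φ x = 0 → (∀ᶠ y in 𝓝[>] x, φ y < 0) ∧ ∀ᶠ y in 𝓝[<] x, 0 < φ y := by
    intro x hx h0
    have h1 := hasDerivAt_iff_tendsto_slope.1 (hd x hx)
    have h2 := h1.eventually (gt_mem_nhds (hneg x hx h0))
    constructor
    · have := h2.filter_mono (nhdsWithin_mono x (fun y (hy : y ∈ Ioi x) => ne_of_gt hy))
      filter_upwards [this, self_mem_nhdsWithin] with y hy hxy
      rw [slope_def_field, h0, sub_zero, div_lt_iff₀ (sub_pos.2 hxy), zero_mul] at hy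
      exact hy
    · have := h2.filter_mono (nhdsWithin_mono x (fun y (hy : y ∈ Iio x) => ne_of_lt hy))
      filter_upwards [this, self_mem_nhdsWithin] with y hy hxy
      rw [slope_def_field, h0, sub_zero, div_lt_iff_of_neg (sub_neg.2 hxy), zero_mul] at hy
      exact hy
  set Z : Set ℝ := Icc s t ∩ φ ⁻¹' {0} with hZ
  have hZc : IsClosed Z := hc.preimage_isClosed_of_isClosed isClosed_Icc isClosed_singleton
  obtain ⟨r, hr1, hr2⟩ : ∃ r ∈ Ioc s t, ∀ y ∈ Ioo s r, φ y < 0 := by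
    obtain ⟨r, hr, h⟩ := (mem_nhdsGT_iff_exists_Ioo_subset' hst).1
      (aux s ⟨le_rfl, hst.le⟩ hs).1
    refine ⟨min r t, ⟨lt_min hr hst, min_le_right _ _⟩, fun y hy => h ⟨hy.1, ?_⟩⟩
    exact hy.2.trans_le (min_le_left _ _)
  have hZ' : IsCompact (Z ∩ Ici r) :=
    (isCompact_Icc (a := s) (b := t)).of_isClosed_subset (hZc.inter isClosed_Ici)
      (fun x hx => hx.1.1)
  -- The first zero after s. The function is negative on (s, x), whereas a negative derivative at
  -- the zero x requires positive values just before x.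
  obtain ⟨x, ⟨⟨hx1, hx2⟩, hx3⟩, hmin⟩ := hZ'.exists_isLeast ⟨t, ⟨⟨hst.le, le_rfl⟩, ht⟩, hr1.2⟩
  have hx4 : s < x := hr1.1.trans_le hx3
  have hneg' : ∀ y ∈ Ioo s x, φ y < 0 := by
    intro y hy
    by_contra! hcon
    have hry : r ≤ y := by
      by_contra! hyr
      exact absurd (hr2 y ⟨hy.1, hyr⟩) hcon.not_gt
    set y₀ := (s + r) / 2 with hy₀
    have h1 : φ y₀ < 0 := hr2 _ ⟨by linarith [hr1.1], by linarith [hr1.1]⟩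
    have hy₀y : y₀ ≤ y := by linarith [hr1.1]
    have hsub : Icc y₀ y ⊆ Icc s t := Icc_subset_Icc (by linarith [hr1.1]) (hy.2.le.trans hx1.2)
    obtain ⟨z, hz, hz0⟩ := intermediate_value_Icc hy₀y (hc.mono hsub) ⟨h1.le, hcon⟩
    have hrz : r ≤ z := by
      by_contra! hzr
      have := hr2 z ⟨by linarith [hr1.1, hz.1], hzr⟩
      linarith
    have := hmin ⟨⟨hsub hz, hz0⟩, hrz⟩
    linarith [hz.2, hy.2]
  have h5 := (aux x hx1 hx2).2
  have h6 : ∀ᶠ y in 𝓝[<] x, y ∈ Ioo s x := Ioo_mem_nhdsLT hx4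
  obtain ⟨y, hy1, hy2⟩ := (h5.and h6).exists
  exact absurd (hneg' y hy2) hy1.not_gt

/-! ### Chords of a cup: signs of the differentials, existence, uniqueness and smooth dependence on
the length. -/

namespace CupData

variable {F F1 F2 : ℝ → ℝ} {p δ : ℝ} (h : CupData F F1 F2 p δ)

include h

lemma reflect : CupData (fun t => F (-t)) (fun t => -F1 (-t)) (fun t => F2 (-t)) (-p) δ where
  deriv0 t := hasDerivAt_comp_neg_apply (h.deriv0 (-t))
  deriv1 t := by
    have := (hasDerivAt_comp_neg_apply (h.deriv1 (-t))).neg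
    rw [neg_neg] at this
    exact this
  cont := h.cont.comp continuous_neg
  mono x y h1 h2 h3 := h.anti (-y) (-x) (by linarith) (by linarith) (by linarith)
  anti x y h1 h2 h3 := h.mono (-y) (-x) (by linarith) (by linarith) (by linarith)
  lt_left x h1 h2 := by simpa using h.lt_right (-x) (by linarith) (by linarith)
  lt_right x h1 h2 := by simpa using h.lt_left (-x) (by linarith) (by linarith)

lemma integral_eq (a b : ℝ) : ∫ t in a..b, F2 t = F1 b - F1 a :=
  intervalIntegral.integral_eq_sub_of_hasDerivAt (fun t _ => h.deriv1 t)
    (h.cont.intervalIntegrable _ _)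

lemma lt_slopeOn {b : ℝ} (h1 : p < b) (h2 : b ≤ p + δ) : F2 b < slopeOn F1 p b := by
  have := intervalIntegral.integral_lt_integral_of_continuousOn_of_le_of_exists_lt h1
    (continuousOn_const (c := F2 b)) h.cont.continuousOn
    (fun t ht => h.anti t b ht.1.le ht.2 h2) ⟨p, ⟨le_rfl, h1.le⟩, h.lt_right b h1 h2⟩
  rw [h.integral_eq, intervalIntegral.integral_const, smul_eq_mul] at this
  rw [slopeOn, lt_div_iff₀ (by linarith)]; linarith

lemma hasDerivAt_cupFun_right (a b : ℝ) (hab : a ≠ b) :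
    HasDerivAt (fun b => cupFun F F1 a b) ((b - a) / 2 * (F2 b - slopeOn F1 a b)) b := by
  have := ((((hasDerivAt_id b).sub_const a).mul ((h.deriv1 b).const_add (F1 a))).div_const 2).sub
    ((h.deriv0 b).sub_const (F a))
  refine this.congr_deriv ?_
  have : b - a ≠ 0 := sub_ne_zero.2 hab.symm
  simp only [slopeOn, id]
  field_simp
  ring

/-- The defect vanishes for the degenerate chord at p and strictly decreases in b, since on the
descending side the value of F2 at the end is below its mean. -/
lemma cupFun_neg_right {b : ℝ} (h1 : p < b) (h2 : b ≤ p + δ) : cupFun F F1 p b < 0 := by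
  have hc0 : Continuous F := continuous_iff_continuousAt.2 fun t => (h.deriv0 t).continuousAt
  have hc1 : Continuous F1 := continuous_iff_continuousAt.2 fun t => (h.deriv1 t).continuousAt
  have hanti : StrictAntiOn (fun b => cupFun F F1 p b) (Icc p b) := by
    refine strictAntiOn_of_deriv_neg (convex_Icc _ _) ?_ fun x hx => ?_
    · unfold cupFun; fun_prop
    · rw [interior_Icc] at hx
      rw [(h.hasDerivAt_cupFun_right p x hx.1.ne).deriv]
      have := h.lt_slopeOn hx.1 (hx.2.le.trans h2)
      exact mul_neg_of_pos_of_neg (by linarith [hx.1]) (by linarith)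
  have := hanti (left_mem_Icc.2 h1.le) (right_mem_Icc.2 h1.le) h1
  simpa [cupFun] using this

lemma cupFun_pos_left {a : ℝ} (h1 : a < p) (h2 : p - δ ≤ a) : 0 < cupFun F F1 a p := by
  have := h.reflect.cupFun_neg_right (b := -a) (by linarith) (by linarith)
  rw [cupFun_neg] at this
  linarith

/-- The left differential of a chord satisfying the cup equation is negative. -/
lemma diff_left_neg {a b : ℝ} (ha : p - δ ≤ a) (hap : a < p) (hpb : p < b) (hb : b ≤ p + δ)
    (h0 : cupFun F F1 a b = 0) : F2 a < slopeOn F1 a b := by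
  by_contra! hcon
  set κ := slopeOn F1 a b with hκ
  have hκ' : κ * (b - a) = F1 b - F1 a := by
    rw [hκ, slopeOn, div_mul_cancel₀]; linarith
  set D' : ℝ → ℝ := fun t => F1 t - F1 a - κ * (t - a) with hD'
  -- The remainder of F after subtracting the quadratic polynomial with the same value and slope at
  -- a and with second derivative κ. The cup equation means that D vanishes at b as well, together
  -- with D'.
  set D : ℝ → ℝ := fun t => F t - F a - F1 a * (t - a) - κ * (t - a) ^ 2 / 2 with hD
  have hd : ∀ t, HasDerivAt D (D' t) t := by
    intro t
    have := (((h.deriv0 t).sub_const (F a)).sub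
      (((hasDerivAt_id t).sub_const a).const_mul (F1 a))).sub
      (((((hasDerivAt_id t).sub_const a).pow 2).const_mul κ).div_const 2)
    refine this.congr_deriv ?_
    simp only [hD', id]; ring
  have hd' : ∀ t, HasDerivAt D' (F2 t - κ) t := by
    intro t
    have := ((h.deriv1 t).sub_const (F1 a)).sub (((hasDerivAt_id t).sub_const a).const_mul κ)
    refine this.congr_deriv ?_
    ring
  have hcD : Continuous D := continuous_iff_continuousAt.2 fun t => (hd t).continuousAt
  have hcD' : Continuous D' := continuous_iff_continuousAt.2 fun t => (hd' t).continuousAt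
  have hD'a : D' a = 0 := by simp [hD']
  have hD'b : D' b = 0 := by simp only [hD']; linarith
  have hDa : D a = 0 := by simp [hD]
  have hDb : D b = 0 := by
    unfold cupFun at h0
    simp only [hD]
    linear_combination -h0 - (b - a) / 2 * hκ'
  -- If F2 t ≥ κ then unimodality gives F2 ≥ κ on all of [a, t], and D' has grown from 0; otherwise
  -- t is beyond p, F2 < κ from t on, and D' still has to fall to 0 at b.
  have hpos : ∀ t ∈ Icc a b, 0 ≤ D' t := by
    intro t ht
    rcases le_or_gt κ (F2 t) with hge | hlt
    · have : MonotoneOn D' (Icc a t) := by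
        refine monotoneOn_of_deriv_nonneg (convex_Icc _ _) hcD'.continuousOn
          (fun s _ => (hd' s).differentiableAt.differentiableWithinAt) fun s hs => ?_
        rw [interior_Icc] at hs
        rw [(hd' s).deriv, sub_nonneg]
        rcases le_total s p with hsp | hsp
        · exact hcon.trans (h.mono a s ha hs.1.le hsp)
        · exact hge.trans (h.anti s t hsp hs.2.le (ht.2.trans hb))
      have := this (left_mem_Icc.2 ht.1) (right_mem_Icc.2 ht.1) ht.1
      rwa [hD'a] at this
    · have hpt : p < t := by
        by_contra! htp
        exact absurd (hcon.trans (h.mono a t ha ht.1 htp)) hlt.not_ge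
      have : AntitoneOn D' (Icc t b) := by
        refine antitoneOn_of_deriv_nonpos (convex_Icc _ _) hcD'.continuousOn
          (fun s _ => (hd' s).differentiableAt.differentiableWithinAt) fun s hs => ?_
        rw [interior_Icc] at hs
        rw [(hd' s).deriv, sub_nonpos]
        exact (h.anti t s hpt.le hs.1.le (hs.2.le.trans hb)).trans hlt.le
      have := this (left_mem_Icc.2 ht.2) (right_mem_Icc.2 ht.2) ht.2
      rwa [hD'b] at this
  have hmono : MonotoneOn D (Icc a b) := by
    refine monotoneOn_of_deriv_nonneg (convex_Icc _ _) hcD.continuousOn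
      (fun s _ => (hd s).differentiableAt.differentiableWithinAt) fun s hs => ?_
    rw [(hd s).deriv]; exact hpos s (interior_subset hs)
  have hab : a ≤ b := by linarith
  have hzero : ∀ t ∈ Icc a b, D t = 0 := fun t ht =>
    le_antisymm (hDb ▸ hmono ht (right_mem_Icc.2 hab) ht.2) (hDa ▸ hmono (left_mem_Icc.2 hab) ht ht.1)
  have hzero' : ∀ t ∈ Ioo a b, D' t = 0 := by
    intro t ht
    have : D =ᶠ[𝓝 t] fun _ => 0 := by
      filter_upwards [Icc_mem_nhds ht.1 ht.2] with s hs using hzero s hs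
    exact (hd t).unique ((hasDerivAt_const t (0 : ℝ)).congr_of_eventuallyEq this)
  have hzero'' : ∀ t ∈ Ioo a b, F2 t = κ := by
    intro t ht
    have : D' =ᶠ[𝓝 t] fun _ => 0 := by
      filter_upwards [Ioo_mem_nhds ht.1 ht.2] with s hs using hzero' s hs
    have := (hd' t).unique ((hasDerivAt_const t (0 : ℝ)).congr_of_eventuallyEq this)
    linarith
  -- D is monotone with equal end values, hence zero, so F2 is constant inside; this contradicts the
  -- strict maximum at p.
  have e1 := hzero'' p ⟨hap, hpb⟩
  have e2 := hzero'' ((p + b) / 2) ⟨by linarith, by linarith⟩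
  have e3 := h.lt_right ((p + b) / 2) (by linarith) (by linarith)
  linarith

lemma diff_right_neg {a b : ℝ} (ha : p - δ ≤ a) (hap : a < p) (hpb : p < b) (hb : b ≤ p + δ)
    (h0 : cupFun F F1 a b = 0) : F2 b < slopeOn F1 a b := by
  have := h.reflect.diff_left_neg (a := -b) (b := -a) (by linarith) (by linarith) (by linarith)
    (by linarith) (by rw [cupFun_neg, h0, neg_zero])
  rwa [slopeOn_neg, neg_neg] at this

/-- Sliding a chord of fixed length changes the defect at a rate proportional to the sum of the two
differentials. This sum is negative at admissible zeros, which gives both uniqueness and the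
hypothesis of the implicit function theorem. -/
lemma hasDerivAt_cupFun_shift (l a : ℝ) (hl : l ≠ 0) :
    HasDerivAt (fun a => cupFun F F1 a (a + l))
      (l / 2 * ((F2 a - slopeOn F1 a (a + l)) + (F2 (a + l) - slopeOn F1 a (a + l)))) a := by
  have e1 : HasDerivAt (fun a => F1 (a + l)) (F2 (a + l)) a := (h.deriv1 (a + l)).comp_add_const a l
  have e0 : HasDerivAt (fun a => F (a + l)) (F1 (a + l)) a := (h.deriv0 (a + l)).comp_add_const a l
  have := ((((h.deriv1 a).add e1).const_mul l).div_const 2).sub (e0.sub (h.deriv0 a))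
  have e : (fun a => cupFun F F1 a (a + l)) = fun a => l * (F1 a + F1 (a + l)) / 2 - (F (a + l) - F a) := by
    funext a; simp [cupFun]
  rw [e]
  refine this.congr_deriv ?_
  simp only [slopeOn, add_sub_cancel_left]
  field_simp
  ring

lemma cup_unique {l a a' : ℝ} (hl : 0 < l) (hlδ : l < δ) (ha : p - l < a) (hap : a < p)
    (ha' : p - l < a') (hap' : a' < p) (h0 : cupFun F F1 a (a + l) = 0)
    (h0' : cupFun F F1 a' (a' + l) = 0) : a = a' := by
  wlog hlt : a < a' generalizing a a'
  · rcases lt_trichotomy a a' with hh | hh | hh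
    · exact absurd hh hlt
    · exact hh
    · exact (this ha' hap' ha hap h0' h0 hh).symm
  exfalso
  refine zero_unique_of_deriv_neg hlt (fun x _ => h.hasDerivAt_cupFun_shift l x hl.ne') h0 h0' ?_
  intro x hx hx0
  have e1 := h.diff_left_neg (a := x) (b := x + l) (by linarith [hx.1]) (by linarith [hx.2])
    (by linarith [hx.1]) (by linarith [hx.2]) hx0
  have e2 := h.diff_right_neg (a := x) (b := x + l) (by linarith [hx.1]) (by linarith [hx.2])
    (by linarith [hx.1]) (by linarith [hx.2]) hx0
  exact mul_neg_of_pos_of_neg (by linarith) (by linarith)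

/-- The defect is positive for [p - l, p] and negative for [p, p + l], so it vanishes at an
intermediate position. -/
lemma cup_exists {l : ℝ} (hl : 0 < l) (hlδ : l < δ) :
    ∃ a, p - l < a ∧ a < p ∧ cupFun F F1 a (a + l) = 0 := by
  have hc : ContinuousOn (fun a => cupFun F F1 a (a + l)) (Icc (p - l) p) := fun x _ =>
    (h.hasDerivAt_cupFun_shift l x hl.ne').continuousAt.continuousWithinAt
  have h1 := h.cupFun_pos_left (a := p - l) (by linarith) (by linarith)
  have h2 := h.cupFun_neg_right (b := p + l) (by linarith) (by linarith)
  obtain ⟨a, ha, h0⟩ := intermediate_value_Ioo' (by linarith) hc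
    (show (0 : ℝ) ∈ Ioo _ _ from ⟨h2, by rw [sub_add_cancel]; exact h1⟩)
  exact ⟨a, ha.1, ha.2, h0⟩

omit h in
open Classical in
/-- The left end of the chord of length `l` with the origin of the cup at `p`. -/
def left (_ : CupData F F1 F2 p δ) (l : ℝ) : ℝ :=
  if hl : ∃ a, p - l < a ∧ a < p ∧ cupFun F F1 a (a + l) = 0 then hl.choose else p

lemma left_spec {l : ℝ} (hl : 0 < l) (hlδ : l < δ) :
    p - l < h.left l ∧ h.left l < p ∧ cupFun F F1 (h.left l) (h.left l + l) = 0 := by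
  have hex := h.cup_exists hl hlδ
  rw [left, dif_pos hex]
  exact hex.choose_spec

/-- No point satisfies p < a < p, so the default value in `left` supplies the origin. -/
lemma left_zero : h.left 0 = p := by
  rw [left, dif_neg]
  rintro ⟨a, h1, h2, -⟩
  linarith

/-- The left and right differentials of the chord of length `l`. -/
lemma diffs_neg {l : ℝ} (hl : 0 < l) (hlδ : l < δ) :
    F2 (h.left l) < slopeOn F1 (h.left l) (h.left l + l) ∧
      F2 (h.left l + l) < slopeOn F1 (h.left l) (h.left l + l) := by
  obtain ⟨h1, h2, h3⟩ := h.left_spec hl hlδ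
  exact ⟨h.diff_left_neg (by linarith) h2 (by linarith) (by linarith) h3,
    h.diff_right_neg (by linarith) h2 (by linarith) (by linarith) h3⟩

/-- The implicit function theorem applies to the defect as a function of the length and the left
end; uniqueness of the cup chord identifies `left` with the implicit function near l. -/
lemma hasDerivAt_left {l : ℝ} (hl : 0 < l) (hlδ : l < δ) :
    HasDerivAt h.left (-(F2 (h.left l + l) - slopeOn F1 (h.left l) (h.left l + l)) /
      ((F2 (h.left l) - slopeOn F1 (h.left l) (h.left l + l)) +
        (F2 (h.left l + l) - slopeOn F1 (h.left l) (h.left l + l)))) l := by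
  obtain ⟨h1, h2, h3⟩ := h.left_spec hl hlδ
  obtain ⟨d1, d2⟩ := h.diffs_neg hl hlδ
  set a := h.left l with ha
  set κ := slopeOn F1 a (a + l) with hκ
  set φ : ℝ × ℝ → ℝ := fun v => v.1 * (F1 v.2 + F1 (v.2 + v.1)) / 2 - (F (v.2 + v.1) - F v.2) with hφ
  have s0 : ∀ t, HasStrictDerivAt F (F1 t) t := fun t =>
    hasStrictDerivAt_of_hasDerivAt_of_continuousAt (Eventually.of_forall h.deriv0)
      (h.deriv1 t).continuousAt
  have s1 : ∀ t, HasStrictDerivAt F1 (F2 t) t := fun t =>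
    hasStrictDerivAt_of_hasDerivAt_of_continuousAt (Eventually.of_forall h.deriv1)
      h.cont.continuousAt
  have hfst : HasStrictFDerivAt (fun v : ℝ × ℝ => v.1) (ContinuousLinearMap.fst ℝ ℝ ℝ) (l, a) :=
    hasStrictFDerivAt_fst
  have hsnd : HasStrictFDerivAt (fun v : ℝ × ℝ => v.2) (ContinuousLinearMap.snd ℝ ℝ ℝ) (l, a) :=
    hasStrictFDerivAt_snd
  have hsum := hsnd.add hfst
  have g1 : HasStrictFDerivAt (fun v : ℝ × ℝ => F1 v.2) _ (l, a) :=
    (s1 a).comp_hasStrictFDerivAt (l, a) hsnd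
  have g2 : HasStrictFDerivAt (fun v : ℝ × ℝ => F1 (v.2 + v.1)) _ (l, a) :=
    (s1 (a + l)).comp_hasStrictFDerivAt (l, a) hsum
  have g3 : HasStrictFDerivAt (fun v : ℝ × ℝ => F v.2) _ (l, a) :=
    (s0 a).comp_hasStrictFDerivAt (l, a) hsnd
  have g4 : HasStrictFDerivAt (fun v : ℝ × ℝ => F (v.2 + v.1)) _ (l, a) :=
    (s0 (a + l)).comp_hasStrictFDerivAt (l, a) hsum
  have hst := ((hfst.mul (g1.add g2)).mul_const (1 / 2)).sub (g4.sub g3)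
  have hst' : HasStrictFDerivAt φ
      ((l / 2 * (F2 (a + l) - κ)) • ContinuousLinearMap.fst ℝ ℝ ℝ +
        (l / 2 * ((F2 a - κ) + (F2 (a + l) - κ))) • ContinuousLinearMap.snd ℝ ℝ ℝ) (l, a) := by
    have hκl : κ * l = F1 (a + l) - F1 a := by
      rw [hκ, slopeOn, add_sub_cancel_left, div_mul_cancel₀ _ hl.ne']
    refine (hst.congr_of_eventuallyEq (Eventually.of_forall fun v => ?_)).congr_fderiv ?_
    · simp only [hφ, Pi.sub_apply, Pi.mul_apply, Pi.add_apply]; ring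
    · ext
      · simp
        linear_combination (1 / 2) * hκl
      · simp
        linear_combination hκl
  set c := l / 2 * ((F2 a - κ) + (F2 (a + l) - κ)) with hc
  have hcneg : c < 0 := mul_neg_of_pos_of_neg (by linarith) (by linarith)
  have hinv : (((l / 2 * (F2 (a + l) - κ)) • ContinuousLinearMap.fst ℝ ℝ ℝ +
        c • ContinuousLinearMap.snd ℝ ℝ ℝ) ∘L .inr ℝ ℝ ℝ).IsInvertible := by
    refine ⟨ContinuousLinearEquiv.unitsEquivAut ℝ (Units.mk0 c hcneg.ne), ?_⟩
    ext; simp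
  have hψ1 := hst'.hasStrictFDerivAt_implicitFunctionOfProdDomain hinv
  have hψ2 := hst'.eventually_apply_implicitFunctionOfProdDomain hinv
  have hψ3 := hst'.tendsto_implicitFunctionOfProdDomain hinv
  set ψ := hst'.implicitFunctionOfProdDomain hinv with hψ
  have hφ0 : φ (l, a) = 0 := by
    simp only [hφ]; unfold cupFun at h3; rw [add_sub_cancel_left] at h3; exact h3
  have heq : h.left =ᶠ[𝓝 l] ψ := by
    have t1 : ∀ᶠ x in 𝓝 l, ψ x < p := hψ3.eventually (gt_mem_nhds h2)
    have t2 : ∀ᶠ x in 𝓝 l, p < ψ x + x :=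
      (hψ3.add tendsto_id).eventually (lt_mem_nhds (by simp only; linarith))
    filter_upwards [hψ2, t1, t2, Ioo_mem_nhds hl hlδ] with x e1 e2 e3 e4
    obtain ⟨k1, k2, k3⟩ := h.left_spec e4.1 e4.2
    refine h.cup_unique e4.1 e4.2 k1 k2 (by linarith) e2 k3 ?_
    rw [hφ0] at e1
    simpa [hφ, cupFun] using e1
  have hψd := hψ1.hasFDerivAt.hasDerivAt
  set d := (-(((l / 2 * (F2 (a + l) - κ)) • ContinuousLinearMap.fst ℝ ℝ ℝ +
        c • ContinuousLinearMap.snd ℝ ℝ ℝ) ∘L .inr ℝ ℝ ℝ).inverse ∘L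
        (((l / 2 * (F2 (a + l) - κ)) • ContinuousLinearMap.fst ℝ ℝ ℝ +
        c • ContinuousLinearMap.snd ℝ ℝ ℝ) ∘L .inl ℝ ℝ ℝ)) 1 with hd
  have hψl : ψ l = a := heq.symm.eq_of_nhds
  -- The value of the derivative is read off from the identity φ(x, ψ x) = 0, which avoids
  -- evaluating the inverse operator in the implicit function theorem.
  have hcomp : HasDerivAt (fun x => φ (x, ψ x)) (l / 2 * (F2 (a + l) - κ) + c * d) l := by
    have hφd := hst'.hasFDerivAt
    have hpair : HasDerivAt (fun x => (x, ψ x)) (1, d) l := (hasDerivAt_id l).prodMk hψd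
    have hφd' : HasFDerivAt φ ((l / 2 * (F2 (a + l) - κ)) • ContinuousLinearMap.fst ℝ ℝ ℝ +
        c • ContinuousLinearMap.snd ℝ ℝ ℝ) ((fun x => (x, ψ x)) l) := by
      dsimp only; rw [hψl]; exact hφd
    have := hφd'.comp_hasDerivAt l hpair
    refine this.congr_deriv ?_
    simp
  have hzero : HasDerivAt (fun x => φ (x, ψ x)) 0 l :=
    (hasDerivAt_const l (0 : ℝ)).congr_of_eventuallyEq (by
      filter_upwards [hψ2] with x hx; rw [hx, hφ0])
  have hd0 := hcomp.unique hzero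
  refine (hψd.congr_of_eventuallyEq heq).congr_deriv ?_
  have hne : (F2 a - κ) + (F2 (a + l) - κ) ≠ 0 := by intro hh; rw [hc, hh, mul_zero] at hcneg; exact lt_irrefl _ hcneg
  rw [eq_div_iff hne]
  have hl2 : l / 2 ≠ 0 := by positivity
  apply mul_left_cancel₀ hl2
  rw [hc] at hd0
  linear_combination hd0

end CupData

/-! ## Coordinates on the parabolic strip -/

/-- The distance between the abscissas of `x` and of the points where the tangents through `x`
touch the free boundary. -/
def rad (ε : ℝ) (x : ℝ × ℝ) : ℝ := √(x.1 ^ 2 + ε ^ 2 - x.2)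

def uR (ε : ℝ) (x : ℝ × ℝ) : ℝ := foot ε .R x

def uL (ε : ℝ) (x : ℝ × ℝ) : ℝ := foot ε .L x

lemma uR_eq (ε : ℝ) (x : ℝ × ℝ) : uR ε x = x.1 + ε - rad ε x := by
  simp [uR, foot, Orient.sign, rad]; ring

lemma uL_eq (ε : ℝ) (x : ℝ × ℝ) : uL ε x = x.1 - ε + rad ε x := by
  simp [uL, foot, Orient.sign, rad]; ring

lemma continuous_rad (ε : ℝ) : Continuous (rad ε) := by unfold rad; fun_prop

lemma continuous_uR (ε : ℝ) : Continuous (uR ε) := by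
  have := continuous_rad ε
  simp only [funext (uR_eq ε)]; fun_prop

lemma continuous_uL (ε : ℝ) : Continuous (uL ε) := by
  have := continuous_rad ε
  simp only [funext (uL_eq ε)]; fun_prop

section coordinates

variable {ε : ℝ} {x y : ℝ × ℝ}

lemma rad_nonneg : 0 ≤ rad ε x := Real.sqrt_nonneg _

lemma rad_sq (hx : x ∈ strip ε) : rad ε x ^ 2 = x.1 ^ 2 + ε ^ 2 - x.2 :=
  Real.sq_sqrt (by have := hx.2; linarith)

lemma rad_le (hε : 0 < ε) (hx : x ∈ strip ε) : rad ε x ≤ ε := by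
  have h := rad_sq hx
  have := hx.1
  nlinarith [rad_nonneg (ε := ε) (x := x)]

lemma uL_le_uR (hε : 0 < ε) (hx : x ∈ strip ε) : uL ε x ≤ uR ε x := by
  rw [uR_eq, uL_eq]; linarith [rad_le hε hx]

lemma uR_le_uL : uR ε x ≤ uL ε x + 2 * ε := by
  rw [uR_eq, uL_eq]; linarith [rad_nonneg (ε := ε) (x := x)]

lemma uL_add_uR : uL ε x + uR ε x = 2 * x.1 := by
  rw [uR_eq, uL_eq]; ring

/-- The line containing the right tangent at `v`. -/
lemma right_tangent_factor (hx : x ∈ strip ε) (v : ℝ) :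
    x.2 - 2 * (v - ε) * x.1 + v ^ 2 - 2 * ε * v = (uR ε x - v) * (uL ε x + 2 * ε - v) := by
  have h := rad_sq hx
  rw [uR_eq, uL_eq]; linear_combination h

lemma left_tangent_factor (hx : x ∈ strip ε) (v : ℝ) :
    x.2 - 2 * (v + ε) * x.1 + v ^ 2 + 2 * ε * v = (uR ε x - 2 * ε - v) * (uL ε x - v) := by
  have h := rad_sq hx
  rw [uR_eq, uL_eq]; linear_combination h

/-- Otherwise there is a right tangent line with both x and y strictly above it and on opposite
sides of its point of tangency with the free boundary. The segment then passes strictly above that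
point and leaves the strip. -/
lemma uR_le_of_segment (hx : x ∈ strip ε) (hy : y ∈ strip ε)
    (h : segment ℝ x y ⊆ strip ε) : uR ε x ≤ uL ε y + 2 * ε := by
  by_contra! hlt
  obtain ⟨v, hv1, hv2⟩ := exists_between hlt
  have hxL := uR_le_uL (ε := ε) (x := x)
  have hyL := uR_le_uL (ε := ε) (x := y)
  have hx1 := uL_add_uR (ε := ε) (x := x)
  have hy1 := uL_add_uR (ε := ε) (x := y)
  have hFx := right_tangent_factor hx v
  have hFy := right_tangent_factor hy v
  have hFx' : 0 < (uR ε x - v) * (uL ε x + 2 * ε - v) := mul_pos (by linarith) (by linarith)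
  have hFy' : 0 < (uR ε y - v) * (uL ε y + 2 * ε - v) :=
    mul_pos_of_neg_of_neg (by linarith) (by linarith)
  rw [← hFx] at hFx'
  rw [← hFy] at hFy'
  have hxq : 0 < x.1 - (v - ε) := by linarith
  have hyq : 0 < (v - ε) - y.1 := by linarith
  have hD : 0 < x.1 - y.1 := by linarith
  set s := ((v - ε) - y.1) / (x.1 - y.1) with hs
  have hsD : s * (x.1 - y.1) = (v - ε) - y.1 := by rw [hs]; field_simp
  have hs0 : 0 < s := div_pos hyq hD
  have hs1 : s < 1 := by rw [hs, div_lt_one hD]; linarith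
  have hz : s • x + (1 - s) • y ∈ segment ℝ x y :=
    ⟨s, 1 - s, hs0.le, by linarith, by ring, rfl⟩
  have hz2 := (h hz).2
  simp only [Prod.fst_add, Prod.snd_add, Prod.smul_fst, Prod.smul_snd, smul_eq_mul] at hz2
  have e1 : s * x.1 + (1 - s) * y.1 = v - ε := by linear_combination hsD
  rw [e1] at hz2
  have := add_pos (mul_pos hs0 hFx') (mul_pos (sub_pos.2 hs1) hFy')
  have e2 : s * (x.2 - 2 * (v - ε) * x.1 + v ^ 2 - 2 * ε * v) +
      (1 - s) * (y.2 - 2 * (v - ε) * y.1 + v ^ 2 - 2 * ε * v) =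
      s * x.2 + (1 - s) * y.2 - (v - ε) ^ 2 - ε ^ 2 - 2 * (v - ε) * (s * x.1 + (1 - s) * y.1 - (v - ε)) := by
    ring
  rw [e2, e1] at this
  nlinarith

end coordinates

lemma isClosed_strip (ε : ℝ) : IsClosed (strip ε) := by
  have h1 : IsClosed {x : ℝ × ℝ | x.1 ^ 2 ≤ x.2} := isClosed_le (by fun_prop) (by fun_prop)
  have h2 : IsClosed {x : ℝ × ℝ | x.2 ≤ x.1 ^ 2 + ε ^ 2} := isClosed_le (by fun_prop) (by fun_prop)
  exact h1.inter h2

/-! ## Affine functions -/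

/-- The coefficients of an affine function on the plane. -/
abbrev Plane := ℝ × ℝ × ℝ

def Plane.ev (P : Plane) (x : ℝ × ℝ) : ℝ := P.1 + P.2.1 * x.1 + P.2.2 * x.2

def Plane.grad (P : Plane) : ℝ × ℝ →L[ℝ] ℝ :=
  P.2.1 • ContinuousLinearMap.fst ℝ ℝ ℝ + P.2.2 • ContinuousLinearMap.snd ℝ ℝ ℝ

lemma Plane.grad_apply (P : Plane) (x : ℝ × ℝ) : P.grad x = P.2.1 * x.1 + P.2.2 * x.2 := by
  simp [Plane.grad]

lemma Plane.ev_sub (P : Plane) (x y : ℝ × ℝ) : P.ev y - P.ev x = P.grad (y - x) := by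
  rw [Plane.grad_apply]; simp [Plane.ev]; ring

lemma Plane.continuous_grad : Continuous Plane.grad := by
  unfold Plane.grad; fun_prop

/-! ## Functions with locally supporting affine functions -/

/-- A continuous function on an interval with local supporting lines from above is concave. -/
lemma le_of_local_support {φ : ℝ → ℝ} (hc : ContinuousOn φ (Icc 0 1))
    (hs : ∀ t ∈ Icc (0 : ℝ) 1, ∃ p δ : ℝ, 0 < δ ∧ ∀ s ∈ Icc (0 : ℝ) 1, |s - t| < δ →
      φ s ≤ φ t + p * (s - t)) :
    ∀ t ∈ Icc (0 : ℝ) 1, (1 - t) * φ 0 + t * φ 1 ≤ φ t := by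
  set ψ : ℝ → ℝ := fun t => φ t - ((1 - t) * φ 0 + t * φ 1) with hψ
  have hψc : ContinuousOn ψ (Icc 0 1) := by
    apply hc.sub; fun_prop
  obtain ⟨t₀, ht₀, hmin⟩ := isCompact_Icc.exists_isMinOn (nonempty_Icc.2 zero_le_one) hψc
  by_contra! hcon
  obtain ⟨t₁, ht₁, hlt⟩ := hcon
  have hneg : ψ t₀ < 0 := lt_of_le_of_lt (hmin ht₁) (by simp only [hψ]; linarith)
  have hψ1 : ψ 1 = 0 := by simp [hψ]
  have hψ0 : ψ 0 = 0 := by simp [hψ]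
  -- The last minimum of the deviation from the chord. A line supporting from above at an interior
  -- minimum is horizontal, so the minimum persists a little further to the right, which is a
  -- contradiction.
  set M : Set ℝ := Icc 0 1 ∩ ψ ⁻¹' {ψ t₀} with hM
  have hMc : IsCompact M := by
    apply isCompact_Icc.of_isClosed_subset _ inter_subset_left
    exact hψc.preimage_isClosed_of_isClosed isClosed_Icc isClosed_singleton
  obtain ⟨t, ⟨ht, hteq⟩, htmax⟩ := hMc.exists_isGreatest ⟨t₀, ht₀, rfl⟩
  rw [mem_preimage, mem_singleton_iff] at hteq
  have ht1 : t < 1 := lt_of_le_of_ne ht.2 (by rintro rfl; linarith)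
  have ht0 : 0 < t := lt_of_le_of_ne ht.1 (by rintro rfl; linarith)
  obtain ⟨p, δ, hδ, hsup⟩ := hs t ht
  set q := p + φ 0 - φ 1 with hq
  have hsup' : ∀ s ∈ Icc (0 : ℝ) 1, |s - t| < δ → ψ s ≤ ψ t + q * (s - t) := by
    intro s hs hst
    have := hsup s hs hst
    simp only [hψ, hq]; nlinarith
  set η := min (δ / 2) (min t (1 - t)) with hη
  have hη0 : 0 < η := by simp [hη, hδ, ht0, ht1]
  have hη1 : η ≤ δ / 2 := min_le_left _ _
  have hη2 : η ≤ t := (min_le_right _ _).trans (min_le_left _ _)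
  have hη3 : η ≤ 1 - t := (min_le_right _ _).trans (min_le_right _ _)
  have m1 : t - η ∈ Icc (0 : ℝ) 1 := ⟨by linarith, by linarith⟩
  have m2 : t + η ∈ Icc (0 : ℝ) 1 := ⟨by linarith, by linarith⟩
  have h1 := hsup' _ m1 (by rw [sub_sub_cancel_left, abs_neg, abs_of_pos hη0]; linarith)
  have h2 := hsup' _ m2 (by rw [add_sub_cancel_left, abs_of_pos hη0]; linarith)
  have g1 := hmin m1
  have g2 := hmin m2
  simp only [mem_ofPred_eq] at g1 g2
  have hq0 : q = 0 := by
    have a1 : q * η ≤ 0 := by linarith [show q * (t - η - t) = - (q * η) by ring]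
    have a2 : 0 ≤ q * η := by linarith [show q * (t + η - t) = q * η by ring]
    have : q * η = 0 := le_antisymm a1 a2
    rcases mul_eq_zero.1 this with h | h
    · exact h
    · exact absurd h hη0.ne'
  have : t + η ≤ t := htmax ⟨m2, by
    rw [mem_preimage, mem_singleton_iff]
    rw [hq0] at h2
    linarith⟩
  linarith

/-- A function on the strip with locally supporting affine functions along segments. -/
def LocallySupported (ε : ℝ) (PB : ℝ × ℝ → Plane) : Prop :=
  ∀ z ∈ strip ε, ∃ N ∈ 𝓝 z, ∀ x ∈ N ∩ strip ε, ∀ y ∈ N ∩ strip ε,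
    segment ℝ x y ⊆ strip ε → (PB y).ev y ≤ (PB x).ev y

/-- Restricted to a segment, the plane at a point is a local supporting line with slope equal to its
gradient along the segment; the one-dimensional criterion applies. -/
lemma LocallySupported.locallyConcaveOn {ε : ℝ} {PB : ℝ × ℝ → Plane}
    (hc : ContinuousOn PB (strip ε)) (h : LocallySupported ε PB) :
    LocallyConcaveOn (strip ε) (fun x => (PB x).ev x) := by
  intro C hC hCs
  refine ⟨hC, fun x hx y hy s t hs ht hst => ?_⟩
  obtain rfl : s = 1 - t := by linarith
  have hxy : ∀ τ ∈ Icc (0 : ℝ) 1, (1 - τ) • x + τ • y ∈ C := fun τ hτ =>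
    hC hx hy (by linarith [hτ.2]) hτ.1 (by ring)
  have hline : Continuous fun τ : ℝ => (1 - τ) • x + τ • y := by fun_prop
  have hev : ContinuousOn (fun z => (PB z).ev z) (strip ε) := by
    unfold Plane.ev
    have h1 : ContinuousOn (fun z => (PB z).1) (strip ε) := continuous_fst.comp_continuousOn hc
    have h2 : ContinuousOn (fun z => (PB z).2.1) (strip ε) :=
      (continuous_fst.comp continuous_snd).comp_continuousOn hc
    have h3 : ContinuousOn (fun z => (PB z).2.2) (strip ε) :=
      (continuous_snd.comp continuous_snd).comp_continuousOn hc
    fun_prop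
  have := le_of_local_support (φ := fun τ => (PB ((1 - τ) • x + τ • y)).ev ((1 - τ) • x + τ • y))
    (hev.comp hline.continuousOn fun τ hτ => hCs (hxy τ hτ)) ?_ t ⟨ht, by linarith⟩
  · simpa using this
  · intro τ hτ
    set z := (1 - τ) • x + τ • y with hz
    obtain ⟨N, hN, hsup⟩ := h z (hCs (hxy τ hτ))
    have : ∀ᶠ σ in 𝓝 τ, (1 - σ) • x + σ • y ∈ N := hline.continuousAt.eventually hN
    obtain ⟨δ, hδ, hball⟩ := Metric.eventually_nhds_iff.1 this
    refine ⟨(PB z).grad (y - x), δ, hδ, fun σ hσ hd => ?_⟩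
    have hσN := hball (y := σ) (by simpa [Real.dist_eq] using hd)
    have hseg : segment ℝ z ((1 - σ) • x + σ • y) ⊆ strip ε :=
      (hC.segment_subset (hxy τ hτ) (hxy σ hσ)).trans hCs
    have h1 := hsup z ⟨mem_of_mem_nhds hN, hCs (hxy τ hτ)⟩ _ ⟨hσN, hCs (hxy σ hσ)⟩ hseg
    have h2 := (PB z).ev_sub z ((1 - σ) • x + σ • y)
    have h3 : (1 - σ) • x + σ • y - z = (σ - τ) • (y - x) := by rw [hz]; module
    rw [h3, map_smul, smul_eq_mul] at h2
    linarith

/-- Two points of the strip can be joined by two segments in the strip. -/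
lemma exists_intermediate {ε : ℝ} (hε : 0 < ε) {x y : ℝ × ℝ} (hx : x ∈ strip ε) (hy : y ∈ strip ε)
    (hd : (x.1 - y.1) ^ 2 ≤ ε ^ 2) :
    ∃ z ∈ strip ε, segment ℝ x z ⊆ strip ε ∧ segment ℝ z y ⊆ strip ε ∧
      z.1 = y.1 ∧ |z.2 - x.2| ≤ |y.1 ^ 2 - x.1 ^ 2| + (x.1 - y.1) ^ 2 := by
  set η := x.2 - x.1 ^ 2 with hη
  have hη0 : 0 ≤ η := by have := hx.1; linarith
  have hη1 : η ≤ ε ^ 2 := by have := hx.2; linarith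
  set Δ := (x.1 - y.1) ^ 2 with hΔ
  have hΔ0 : 0 ≤ Δ := sq_nonneg _
  have hε2 : 0 < ε ^ 2 := by positivity
  -- The intermediate point lies above y.1 with the height over the parabola reduced by the factor 1
  -- - κ. This reduction compensates the bulge t(1 - t)Δ that a segment gains over the parabola, so
  -- the free boundary is not crossed.
  set κ := Δ / ε ^ 2 with hκ
  have hκ0 : 0 ≤ κ := by positivity
  have hκ1 : κ ≤ 1 := by rw [hκ, div_le_one hε2]; exact hd
  have hκε : κ * ε ^ 2 = Δ := by rw [hκ]; field_simp
  have hκη : κ * η ≤ Δ := by rw [← hκε]; exact mul_le_mul_of_nonneg_left hη1 hκ0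
  set z : ℝ × ℝ := (y.1, y.1 ^ 2 + η * (1 - κ)) with hz
  have hη' : 0 ≤ η * (1 - κ) := mul_nonneg hη0 (by linarith)
  have hη'' : η * (1 - κ) ≤ ε ^ 2 := by nlinarith
  refine ⟨z, ⟨by simp [hz]; linarith, by simp [hz]; linarith⟩, ?_, ?_, rfl, ?_⟩
  · rintro _ ⟨s, t, hs, ht, hst, rfl⟩
    obtain rfl : s = 1 - t := by linarith
    have e : (1 - t) * x.2 + t * (y.1 ^ 2 + η * (1 - κ)) - ((1 - t) * x.1 + t * y.1) ^ 2 =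
        η * (1 - t * κ) + t * (1 - t) * Δ := by rw [hη, hΔ]; ring
    have htκ : t * κ ≤ 1 := by nlinarith
    constructor
    · simp only [hz, Prod.fst_add, Prod.snd_add, Prod.smul_fst, Prod.smul_snd, smul_eq_mul]
      have := mul_nonneg hη0 (sub_nonneg.2 htκ)
      have := mul_nonneg (mul_nonneg ht hs) hΔ0
      linarith
    · simp only [hz, Prod.fst_add, Prod.snd_add, Prod.smul_fst, Prod.smul_snd, smul_eq_mul]
      have h1 : η * (1 - t * κ) ≤ ε ^ 2 * (1 - t * κ) :=
        mul_le_mul_of_nonneg_right hη1 (by linarith)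
      have h2 : ε ^ 2 * (1 - t * κ) = ε ^ 2 - t * Δ := by rw [← hκε]; ring
      have h3 : 0 ≤ t * t * Δ := by positivity
      nlinarith
  · rintro _ ⟨s, t, hs, ht, hst, rfl⟩
    have e : s * y.1 + t * y.1 = y.1 := by rw [← add_mul, hst, one_mul]
    have hy1 := hy.1
    have hy2 := hy.2
    constructor
    · simp only [hz, Prod.fst_add, Prod.snd_add, Prod.smul_fst, Prod.smul_snd, smul_eq_mul, e]
      nlinarith [mul_nonneg hs hη', mul_le_mul_of_nonneg_left hy1 ht]
    · simp only [hz, Prod.fst_add, Prod.snd_add, Prod.smul_fst, Prod.smul_snd, smul_eq_mul, e]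
      nlinarith [mul_le_mul_of_nonneg_left hη'' hs, mul_le_mul_of_nonneg_left hy2 ht]
  · have : z.2 - x.2 = (y.1 ^ 2 - x.1 ^ 2) - κ * η := by simp only [hz]; rw [hη]; ring
    rw [this]
    calc |(y.1 ^ 2 - x.1 ^ 2) - κ * η| ≤ |y.1 ^ 2 - x.1 ^ 2| + |κ * η| := abs_sub _ _
      _ ≤ _ := by rw [abs_of_nonneg (mul_nonneg hκ0 hη0)]; linarith

/-- Supports in both directions along a segment bound the mismatch of two planes by the difference
of their gradients times the length, which is of smaller order by continuity. Near the free boundary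
the segment from x to y may leave the strip, so the estimate goes through an intermediate point. -/
lemma LocallySupported.hasFDerivWithinAt {ε : ℝ} (hε : 0 < ε) {PB : ℝ × ℝ → Plane}
    (hc : ContinuousOn PB (strip ε)) (h : LocallySupported ε PB) {x : ℝ × ℝ} (hx : x ∈ strip ε) :
    HasFDerivWithinAt (fun x => (PB x).ev x) (PB x).grad (strip ε) x := by
  obtain ⟨N, hN, hsup⟩ := h x hx
  have hxN := mem_of_mem_nhds hN
  have key : ∀ p ∈ N ∩ strip ε, ∀ q ∈ N ∩ strip ε, segment ℝ p q ⊆ strip ε →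
      |(PB q).ev q - (PB p).ev q| ≤ ‖(PB q).grad - (PB p).grad‖ * ‖q - p‖ := by
    intro p hp q hq hpq
    have h1 := hsup p hp q hq hpq
    have h2 := hsup q hq p hp (by rwa [segment_symm])
    have h3 := (PB p).ev_sub p q
    have h4 := (PB q).ev_sub p q
    have h5 := ((PB q).grad - (PB p).grad).le_opNorm (q - p)
    rw [Real.norm_eq_abs, sub_apply] at h5
    rw [abs_le]
    have h6 := neg_le_of_abs_le h5
    constructor <;> [linarith; linarith [(abs_nonneg _).trans h5]]
  -- The detour is comparable with the direct distance: C bounds ‖z - x‖ / ‖y - x‖ for the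
  -- intermediate point z.
  set C : ℝ := 2 * (|x.1| + 1) + 4 with hC
  have hC0 : 0 < C := by positivity
  rw [hasFDerivWithinAt_iff_isLittleO, Asymptotics.isLittleO_iff]
  intro c hcpos
  have hgc : ContinuousWithinAt (fun y => (PB y).grad) (strip ε) x :=
    (Plane.continuous_grad.continuousAt).comp_continuousWithinAt (hc x hx)
  -- The three error terms add up to at most κ(C + 2(C + 1) + (C + 1))‖y - x‖.
  set κ := c / (4 * C + 4) with hκ
  have hκ0 : 0 < κ := by positivity
  have hκc : κ * (4 * C + 4) = c := by rw [hκ]; field_simp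
  obtain ⟨δ₁, hδ₁, hgrad⟩ := Metric.continuousWithinAt_iff.1 hgc κ hκ0
  obtain ⟨δ₂, hδ₂, hNball⟩ := Metric.mem_nhds_iff.1 hN
  set δ := min (min δ₁ δ₂ / (C + 1)) (min ε 1) with hδ
  have hm : 0 < min δ₁ δ₂ := lt_min hδ₁ hδ₂
  have hδ0 : 0 < δ := by
    apply lt_min (by positivity); exact lt_min hε one_pos
  have hδC : δ * (C + 1) ≤ min δ₁ δ₂ := by
    have : δ ≤ min δ₁ δ₂ / (C + 1) := min_le_left _ _
    rwa [le_div_iff₀ (by positivity)] at this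
  have hδε : δ ≤ ε := (min_le_right _ _).trans (min_le_left _ _)
  have hδ1 : δ ≤ 1 := (min_le_right _ _).trans (min_le_right _ _)
  have hev : ∀ᶠ y in 𝓝[strip ε] x, dist y x < δ ∧ y ∈ strip ε :=
    Filter.Eventually.and (nhdsWithin_le_nhds (Metric.ball_mem_nhds x hδ0)) self_mem_nhdsWithin
  filter_upwards [hev] with y ⟨hyd, hy⟩
  rw [dist_eq_norm] at hyd
  have hn1 : |y.1 - x.1| ≤ ‖y - x‖ := by
    simpa using norm_fst_le (y - x)
  have hn2 : |y.2 - x.2| ≤ ‖y - x‖ := by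
    simpa using norm_snd_le (y - x)
  have hsq : (x.1 - y.1) ^ 2 ≤ ε ^ 2 := by
    rw [← sq_abs, abs_sub_comm]
    exact pow_le_pow_left₀ (abs_nonneg _) (by linarith) 2
  obtain ⟨z, hz, hxz, hzy, hz1, hz2⟩ := exists_intermediate hε hx hy hsq
  have hzx : ‖z - x‖ ≤ C * ‖y - x‖ := by
    have hnn := norm_nonneg (y - x)
    rw [Prod.norm_def, max_le_iff]
    constructor
    · simp only [Prod.fst_sub, hz1, Real.norm_eq_abs]
      refine hn1.trans ?_
      have : 1 ≤ C := by rw [hC]; linarith [abs_nonneg x.1]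
      nlinarith
    · simp only [Prod.snd_sub, Real.norm_eq_abs]
      refine hz2.trans ?_
      have e1 : |y.1 ^ 2 - x.1 ^ 2| = |y.1 - x.1| * |y.1 + x.1| := by
        rw [← abs_mul]; ring_nf
      have e2 : |y.1 + x.1| ≤ 2 * |x.1| + 1 := by
        calc |y.1 + x.1| = |(y.1 - x.1) + 2 * x.1| := by ring_nf
          _ ≤ |y.1 - x.1| + |2 * x.1| := abs_add_le _ _
          _ ≤ _ := by rw [abs_mul, abs_two]; linarith
      have e3 : (x.1 - y.1) ^ 2 ≤ ‖y - x‖ * 1 := by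
        rw [← sq_abs, abs_sub_comm, sq]
        exact mul_le_mul hn1 (by linarith) (abs_nonneg _) hnn
      have e4 : |y.1 - x.1| * |y.1 + x.1| ≤ ‖y - x‖ * (2 * |x.1| + 1) :=
        mul_le_mul hn1 e2 (abs_nonneg _) hnn
      rw [e1, hC]; nlinarith
  have hyz : ‖y - z‖ ≤ (C + 1) * ‖y - x‖ := by
    calc ‖y - z‖ = ‖(y - x) - (z - x)‖ := by congr 1; abel
      _ ≤ ‖y - x‖ + ‖z - x‖ := norm_sub_le _ _
      _ ≤ _ := by linarith
  have hzlt : ‖z - x‖ < min δ₁ δ₂ := by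
    have : C * ‖y - x‖ < δ * (C + 1) := by nlinarith [norm_nonneg (y - x)]
    linarith
  have hylt : ‖y - x‖ < min δ₁ δ₂ := by nlinarith [norm_nonneg (y - x)]
  have hzN : z ∈ N := hNball (by rw [Metric.mem_ball, dist_eq_norm]; exact hzlt.trans_le (min_le_right _ _))
  have hyN : y ∈ N := hNball (by rw [Metric.mem_ball, dist_eq_norm]; exact hylt.trans_le (min_le_right _ _))
  have gz := hgrad hz (by rw [dist_eq_norm]; exact hzlt.trans_le (min_le_left _ _))
  have gy := hgrad hy (by rw [dist_eq_norm]; exact hylt.trans_le (min_le_left _ _))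
  rw [dist_eq_norm] at gz gy
  have k1 := key x ⟨hxN, hx⟩ z ⟨hzN, hz⟩ hxz
  have k2 := key z ⟨hzN, hz⟩ y ⟨hyN, hy⟩ hzy
  have gyz : ‖(PB y).grad - (PB z).grad‖ ≤ 2 * κ := by
    calc ‖(PB y).grad - (PB z).grad‖ = ‖((PB y).grad - (PB x).grad) - ((PB z).grad - (PB x).grad)‖ := by
          congr 1; abel
      _ ≤ _ := norm_sub_le _ _
      _ ≤ _ := by linarith
  have k3 : |((PB z).grad - (PB x).grad) (y - z)| ≤ κ * ‖y - z‖ := by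
    refine (((PB z).grad - (PB x).grad).le_opNorm (y - z)).trans ?_
    exact mul_le_mul_of_nonneg_right gz.le (norm_nonneg _)
  have e : (PB y).ev y - (PB x).ev x - (PB x).grad (y - x) =
      ((PB y).ev y - (PB z).ev y) + ((PB z).ev z - (PB x).ev z) +
        ((PB z).grad - (PB x).grad) (y - z) := by
    have h1 := (PB x).ev_sub x y
    have h2 := (PB z).ev_sub z y
    have h3 := (PB x).ev_sub z y
    rw [sub_apply]; linarith
  rw [Real.norm_eq_abs, e]
  have k1' : |(PB z).ev z - (PB x).ev z| ≤ κ * (C * ‖y - x‖) :=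
    k1.trans (mul_le_mul gz.le hzx (norm_nonneg _) hκ0.le)
  have k2' : |(PB y).ev y - (PB z).ev y| ≤ 2 * κ * ((C + 1) * ‖y - x‖) :=
    k2.trans (mul_le_mul gyz hyz (norm_nonneg _) (by linarith))
  have k3' : κ * ‖y - z‖ ≤ κ * ((C + 1) * ‖y - x‖) := mul_le_mul_of_nonneg_left hyz hκ0.le
  calc _ ≤ |(PB y).ev y - (PB z).ev y| + |(PB z).ev z - (PB x).ev z| +
        |((PB z).grad - (PB x).grad) (y - z)| := abs_add_three _ _ _
    _ ≤ κ * (4 * C + 4) * ‖y - x‖ := by nlinarith [mul_nonneg hκ0.le (norm_nonneg (y - x))]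
    _ = c * ‖y - x‖ := by rw [hκc]

lemma LocallySupported.contDiffOn {ε : ℝ} (hε : 0 < ε) {PB : ℝ × ℝ → Plane}
    (hc : ContinuousOn PB (strip ε)) (h : LocallySupported ε PB) :
    ContDiffOn ℝ 1 (fun x => (PB x).ev x) (strip ε) := by
  have : (1 : WithTop ℕ∞) = 0 + 1 := by simp
  rw [this]
  intro x hx
  rw [contDiffWithinAt_succ_iff_hasFDerivWithinAt (by simp)]
  refine ⟨strip ε, by rw [insert_eq_of_mem hx]; exact self_mem_nhdsWithin, by simp,
    fun y => (PB y).grad, fun y hy => h.hasFDerivWithinAt hε hc hy, ?_⟩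
  have : ContDiffOn ℝ 0 (fun y => (PB y).grad) (strip ε) :=
    contDiffOn_zero.2 (Plane.continuous_grad.comp_continuousOn hc)
  exact this x hx

/-! ## Gluing alternating tangent domains, angles and cups -/

/-- The combinatorial and monotonicity data of a picture without long paths. The `i`-th peak (a cup
or a multicup) has its ends at `a i` and `b i`, and `w k` is the vertex of the `k`-th angle. The
plane `Rp i u` belongs to the right tangent at `u`, and it does not change for `u` beyond the next
angle; similarly for `Lp i u`. -/
structure PlaneFoliation (ε : ℝ) (n : ℕ) where
  a : Fin (n + 1) → EReal
  b : Fin (n + 1) → EReal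
  w : Fin n → ℝ
  Rp : Fin (n + 1) → ℝ → Plane
  Lp : Fin (n + 1) → ℝ → Plane
  Pk : Fin (n + 1) → Set (ℝ × ℝ)
  Kp : Fin (n + 1) → ℝ × ℝ → Plane
  a_le_b : ∀ i, a i ≤ b i
  sep : ∀ i, ∀ s t : ℝ, (s : EReal) ≤ a i → b i ≤ t → s + 2 * ε ≤ t
  b_lt_w : ∀ k : Fin n, b k.castSucc < w k
  w_lt_a : ∀ k : Fin n, (w k : EReal) < a k.succ
  R_anti : ∀ i, ∀ u u' : ℝ, ∀ y ∈ strip ε, b i ≤ u → u ≤ u' → u' ≤ uR ε y →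
    (Rp i u').ev y ≤ (Rp i u).ev y
  R_mono : ∀ i, ∀ u u' : ℝ, ∀ y ∈ strip ε, b i ≤ u → u ≤ u' → uR ε y ≤ u → u' ≤ uL ε y + 2 * ε →
    (Rp i u).ev y ≤ (Rp i u').ev y
  L_mono : ∀ i, ∀ u u' : ℝ, ∀ y ∈ strip ε, u' ≤ a i → u ≤ u' → uL ε y ≤ u →
    (Lp i u).ev y ≤ (Lp i u').ev y
  L_anti : ∀ i, ∀ u u' : ℝ, ∀ y ∈ strip ε, u' ≤ a i → u ≤ u' → uR ε y ≤ u + 2 * ε → u' ≤ uL ε y →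
    (Lp i u').ev y ≤ (Lp i u).ev y
  R_const : ∀ k : Fin n, ∀ u, w k ≤ u → Rp k.castSucc u = Rp k.castSucc (w k)
  L_const : ∀ k : Fin n, ∀ u, u ≤ w k → Lp k.succ u = Lp k.succ (w k)
  R_eq_L : ∀ k : Fin n, Rp k.castSucc (w k) = Lp k.succ (w k)
  R_cont : ∀ i, ContinuousOn (Rp i) {u : ℝ | b i ≤ u}
  L_cont : ∀ i, ContinuousOn (Lp i) {u : ℝ | u ≤ a i}
  Pk_sub : ∀ i, ∀ x ∈ Pk i, x ∈ strip ε ∧ a i ≤ uL ε x ∧ uR ε x ≤ b i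
  Pk_closed : ∀ i, IsClosed (Pk i)
  mem_Pk : ∀ i, ∀ x ∈ strip ε, a i < uL ε x → uR ε x < b i → x ∈ Pk i
  K_cont : ∀ i, ContinuousOn (Kp i) (Pk i)
  K_eq_R : ∀ i, ∀ x ∈ Pk i, b i = uR ε x → Kp i x = Rp i (uR ε x)
  K_eq_L : ∀ i, ∀ x ∈ Pk i, a i = uL ε x → Kp i x = Lp i (uL ε x)
  K_ge_R : ∀ i, ∀ x ∈ Pk i, ∀ y ∈ strip ε, ∀ u : ℝ, b i = u → u ≤ uR ε y →
    (Rp i u).ev y ≤ (Kp i x).ev y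
  K_ge_L : ∀ i, ∀ x ∈ Pk i, ∀ y ∈ strip ε, ∀ u : ℝ, a i = u → uL ε y ≤ u →
    (Lp i u).ev y ≤ (Kp i x).ev y
  K_le_R : ∀ i, ∀ y ∈ Pk i, ∀ u : ℝ, b i = u → (Kp i y).ev y ≤ (Rp i u).ev y
  K_le_L : ∀ i, ∀ y ∈ Pk i, ∀ u : ℝ, a i = u → (Kp i y).ev y ≤ (Lp i u).ev y
  K_le : ∀ i, ∀ x ∈ Pk i, ∀ y ∈ Pk i, (Kp i y).ev y ≤ (Kp i x).ev y
  L_eq_R : ∀ i, ∀ s t : ℝ, a i = s → b i = t → t = s + 2 * ε → Lp i s = Rp i t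

lemma Fin.exists_castSucc_succ_of_lt {n : ℕ} {i k : Fin (n + 1)} (h : i < k) :
    ∃ j j' : Fin n, i = j.castSucc ∧ k = j'.succ ∧ j ≤ j' := by
  have hk : k ≠ 0 := by rintro rfl; exact absurd h (Fin.not_lt_zero _)
  have hi : i ≠ Fin.last n := by rintro rfl; exact absurd h (Fin.le_last k).not_gt
  obtain ⟨j', rfl⟩ := Fin.exists_succ_eq.2 hk
  obtain ⟨j, rfl⟩ := Fin.exists_castSucc_eq.2 hi
  refine ⟨j, j', rfl, rfl, ?_⟩
  simp only [Fin.lt_def, Fin.val_castSucc, Fin.val_succ] at h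
  exact Fin.le_def.2 (by omega)

namespace PlaneFoliation

variable {ε : ℝ} {n : ℕ} (Φ : PlaneFoliation ε n)

def wl : Fin (n + 1) → EReal := Fin.cons (α := fun _ => EReal) ⊥ fun k => (Φ.w k : EReal)

def wr : Fin (n + 1) → EReal := Fin.snoc (α := fun _ => EReal) (fun k => (Φ.w k : EReal)) ⊤

@[simp] lemma wl_zero : Φ.wl 0 = ⊥ := rfl
@[simp] lemma wl_succ (k : Fin n) : Φ.wl k.succ = Φ.w k := by simp [wl]
@[simp] lemma wr_last : Φ.wr (Fin.last n) = ⊤ := by simp [wr]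
@[simp] lemma wr_castSucc (k : Fin n) : Φ.wr k.castSucc = Φ.w k := by simp [wr]

lemma a_strictMono : StrictMono Φ.a := by
  rw [Fin.strictMono_iff_lt_succ]
  exact fun k => (Φ.a_le_b _).trans_lt ((Φ.b_lt_w k).trans (Φ.w_lt_a k))

lemma b_strictMono : StrictMono Φ.b := by
  rw [Fin.strictMono_iff_lt_succ]
  exact fun k => (Φ.b_lt_w k).trans ((Φ.w_lt_a k).trans_le (Φ.a_le_b _))

lemma w_strictMono : StrictMono Φ.w := by
  intro j j' h
  have h1 : j.succ ≤ j'.castSucc := by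
    simp only [Fin.le_def, Fin.val_succ, Fin.val_castSucc]; exact h
  have h2 : (Φ.w j : EReal) < Φ.w j' :=
    (Φ.w_lt_a j).trans_le ((Φ.a_strictMono.monotone h1).trans ((Φ.a_le_b _).trans (Φ.b_lt_w j').le))
  exact_mod_cast h2

lemma wl_le_wr {i k : Fin (n + 1)} (h : i < k) : Φ.wr i ≤ Φ.wl k := by
  obtain ⟨j, j', rfl, rfl, hj⟩ := Fin.exists_castSucc_succ_of_lt h
  simpa using Φ.w_strictMono.monotone hj

lemma wr_lt_a {i k : Fin (n + 1)} (h : i < k) : Φ.wr i < Φ.a k := by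
  obtain ⟨j, j', rfl, rfl, hj⟩ := Fin.exists_castSucc_succ_of_lt h
  rw [wr_castSucc]
  exact (Φ.w_lt_a j).trans_le (Φ.a_strictMono.monotone (Fin.succ_le_succ_iff.2 hj))

lemma b_lt_wl {i k : Fin (n + 1)} (h : i < k) : Φ.b i < Φ.wl k := by
  obtain ⟨j, j', rfl, rfl, hj⟩ := Fin.exists_castSucc_succ_of_lt h
  rw [wl_succ]
  exact (Φ.b_strictMono.monotone (Fin.castSucc_le_castSucc_iff.2 hj)).trans_lt (Φ.b_lt_w j')

lemma b_lt_a {i k : Fin (n + 1)} (h : i < k) : Φ.b i < Φ.a k := by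
  obtain ⟨j, j', rfl, rfl, hj⟩ := Fin.exists_castSucc_succ_of_lt h
  have h1 : Φ.wl j'.succ = Φ.w j' := Φ.wl_succ j'
  exact ((h1 ▸ Φ.b_lt_wl h).trans (Φ.w_lt_a j'))

lemma sep_lt_left {i : Fin (n + 1)} {s t : ℝ} (hs : (s : EReal) < Φ.a i) (ht : Φ.b i ≤ t) :
    s + 2 * ε < t := by
  obtain ⟨s', h1, h2⟩ := EReal.lt_iff_exists_real_btwn.1 hs
  have := Φ.sep i s' t h2.le ht
  have : s < s' := by exact_mod_cast h1
  linarith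

lemma sep_lt_right {i : Fin (n + 1)} {s t : ℝ} (hs : (s : EReal) ≤ Φ.a i) (ht : Φ.b i < t) :
    s + 2 * ε < t := by
  obtain ⟨t', h1, h2⟩ := EReal.lt_iff_exists_real_btwn.1 ht
  have := Φ.sep i s t' hs h1.le
  have : t' < t := by exact_mod_cast h2
  linarith

/-- The right tangents of the `i`-th peak together with the next angle. -/
def FR (i : Fin (n + 1)) : Set (ℝ × ℝ) := {x | x ∈ strip ε ∧ Φ.b i ≤ uR ε x ∧ uL ε x ≤ Φ.wr i}

/-- The left tangents of the `i`-th peak together with the previous angle. -/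
def FL (i : Fin (n + 1)) : Set (ℝ × ℝ) := {x | x ∈ strip ε ∧ Φ.wl i ≤ uR ε x ∧ uL ε x ≤ Φ.a i}

/-- `P` is the plane attached to `x` in one of the figures of the `i`-th peak. -/
def SelAt (i : Fin (n + 1)) (x : ℝ × ℝ) (P : Plane) : Prop :=
  (x ∈ Φ.FR i ∧ P = Φ.Rp i (uR ε x)) ∨ (x ∈ Φ.FL i ∧ P = Φ.Lp i (uL ε x)) ∨
    (x ∈ Φ.Pk i ∧ P = Φ.Kp i x)

/-- The open region around the `i`-th peak. -/
def peakRegion (i : Fin (n + 1)) : Set (ℝ × ℝ) :=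
  {x | Φ.wl i < uL ε x ∧ uR ε x < Φ.wr i}

/-- The open region around the `k`-th angle. -/
def angleRegion (k : Fin n) : Set (ℝ × ℝ) :=
  {x | Φ.b k.castSucc < uR ε x ∧ uL ε x < Φ.a k.succ}

lemma isOpen_peakRegion (i : Fin (n + 1)) : IsOpen (Φ.peakRegion i) := by
  have h1 : Continuous fun x => (uL ε x : EReal) := continuous_coe_real_ereal.comp (continuous_uL ε)
  have h2 : Continuous fun x => (uR ε x : EReal) := continuous_coe_real_ereal.comp (continuous_uR ε)
  exact (isOpen_lt continuous_const h1).inter (isOpen_lt h2 continuous_const)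

lemma isOpen_angleRegion (k : Fin n) : IsOpen (Φ.angleRegion k) := by
  have h1 : Continuous fun x => (uL ε x : EReal) := continuous_coe_real_ereal.comp (continuous_uL ε)
  have h2 : Continuous fun x => (uR ε x : EReal) := continuous_coe_real_ereal.comp (continuous_uR ε)
  exact (isOpen_lt continuous_const h2).inter (isOpen_lt h1 continuous_const)

variable (hε : 0 < ε)

lemma mem_region (x : ℝ × ℝ) :
    (∃ i, x ∈ Φ.peakRegion i) ∨ ∃ k, x ∈ Φ.angleRegion k := by
  classical
  have h0 : (0 : Fin (n + 1)) ∈ Finset.univ.filter fun i => Φ.wl i < uL ε x := by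
    simp [EReal.bot_lt_coe]
  -- The last peak whose preceding angle vertex lies to the left of uL x. If x is not in its region,
  -- then x has reached the following angle, and maximality keeps uL x below the next peak.
  set i := (Finset.univ.filter fun i => Φ.wl i < uL ε x).max' ⟨0, h0⟩ with hi
  have hmem := Finset.max'_mem _ ⟨0, h0⟩
  rw [← hi, Finset.mem_filter] at hmem
  by_cases hR : uR ε x < Φ.wr i
  · exact Or.inl ⟨i, hmem.2, hR⟩
  · right
    have hil : i ≠ Fin.last n := by
      intro h; rw [h, wr_last] at hR; exact hR (EReal.coe_lt_top _)
    obtain ⟨k, hk⟩ := Fin.exists_castSucc_eq.2 hil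
    refine ⟨k, ?_, ?_⟩
    · rw [← hk, wr_castSucc, not_lt] at hR
      exact (Φ.b_lt_w k).trans_le hR
    · by_contra! hcon
      have : k.succ ≤ i := by
        apply Finset.le_max'
        simp only [Finset.mem_filter, Finset.mem_univ, true_and, wl_succ]
        exact (Φ.w_lt_a k).trans_le hcon
      rw [← hk] at this
      exact absurd this (by simp [Fin.le_def])

include hε

lemma selAt_of_peakRegion {i : Fin (n + 1)} {x : ℝ × ℝ} (hx : x ∈ strip ε)
    (h : x ∈ Φ.peakRegion i) : ∃ P, Φ.SelAt i x P := by
  have hLR : (uL ε x : EReal) ≤ uR ε x := by exact_mod_cast uL_le_uR hε hx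
  by_cases h1 : Φ.b i ≤ uR ε x
  · exact ⟨_, Or.inl ⟨⟨hx, h1, hLR.trans h.2.le⟩, rfl⟩⟩
  by_cases h2 : uL ε x ≤ Φ.a i
  · exact ⟨_, Or.inr (Or.inl ⟨⟨hx, h.1.le.trans hLR, h2⟩, rfl⟩)⟩
  · exact ⟨_, Or.inr (Or.inr ⟨Φ.mem_Pk i x hx (not_le.1 h2) (not_le.1 h1), rfl⟩)⟩

lemma mem_angleRegion {k : Fin n} {x : ℝ × ℝ} (hx : x ∈ strip ε) (h : x ∈ Φ.angleRegion k) :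
    x ∈ Φ.FR k.castSucc ∨ x ∈ Φ.FL k.succ := by
  have hLR := uL_le_uR hε hx
  by_cases h1 : uL ε x ≤ Φ.w k
  · exact Or.inl ⟨hx, h.1.le, by simpa using h1⟩
  · refine Or.inr ⟨hx, ?_, h.2.le⟩
    rw [wl_succ]
    exact_mod_cast (not_le.1 h1).le.trans hLR

lemma exists_selAt {x : ℝ × ℝ} (hx : x ∈ strip ε) : ∃ i P, Φ.SelAt i x P := by
  rcases Φ.mem_region x with ⟨i, hi⟩ | ⟨k, hk⟩
  · exact ⟨i, Φ.selAt_of_peakRegion hε hx hi⟩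
  · rcases Φ.mem_angleRegion hε hx hk with h | h
    · exact ⟨_, _, Or.inl ⟨h, rfl⟩⟩
    · exact ⟨_, _, Or.inr (Or.inl ⟨h, rfl⟩)⟩

omit hε in
lemma Rp_eq_Lp_of_angle {k : Fin n} {x : ℝ × ℝ} (h1 : Φ.w k ≤ uR ε x) (h2 : uL ε x ≤ Φ.w k) :
    Φ.Rp k.castSucc (uR ε x) = Φ.Lp k.succ (uL ε x) := by
  rw [Φ.R_const k _ h1, Φ.L_const k _ h2, Φ.R_eq_L]

/-- The figures of two different peaks can share points only in the angle between neighbours, where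
both planes equal the plane of the vertex. Any other overlap contradicts the order of the ends or
forces uR x - uL x > 2ε. -/
lemma selAt_unique_of_lt {i k : Fin (n + 1)} (hik : i < k) {x : ℝ × ℝ} {P Q : Plane}
    (hP : Φ.SelAt i x P) (hQ : Φ.SelAt k x Q) : P = Q := by
  have hd := uR_le_uL (ε := ε) (x := x)
  have h1 := Φ.wr_lt_a hik
  have h2 := Φ.b_lt_wl hik
  have h3 := Φ.b_lt_a hik
  have h5 := Φ.a_le_b k
  rcases hP with ⟨⟨hx, hb, hw⟩, rfl⟩ | ⟨⟨hx, hw, ha⟩, rfl⟩ | ⟨hx, rfl⟩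
  · rcases hQ with ⟨⟨-, hb', hw'⟩, rfl⟩ | ⟨⟨-, hw', ha'⟩, rfl⟩ | ⟨hx', rfl⟩
    · exact absurd (Φ.sep_lt_left (hw.trans_lt h1) hb') hd.not_gt
    · obtain ⟨j, j', rfl, rfl, hj⟩ := Fin.exists_castSucc_succ_of_lt hik
      rw [wr_castSucc] at hw
      rw [wl_succ] at hw'
      rcases hj.eq_or_lt with rfl | hj
      · exact Φ.Rp_eq_Lp_of_angle (by exact_mod_cast hw') (by exact_mod_cast hw)
      · have e1 : (uL ε x : EReal) < Φ.a j.succ := hw.trans_lt (Φ.w_lt_a j)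
        have e2 : Φ.b j.succ ≤ uR ε x := by
          have : Φ.b j.succ < Φ.wl j'.succ := Φ.b_lt_wl (Fin.succ_lt_succ_iff.2 hj)
          rw [wl_succ] at this
          exact this.le.trans hw'
        exact absurd (Φ.sep_lt_left e1 e2) hd.not_gt
    · obtain ⟨-, e1, -⟩ := Φ.Pk_sub k x hx'
      exact absurd (hw.trans_lt (h1.trans_le e1)) (lt_irrefl _)
  · rcases hQ with ⟨⟨-, hb', hw'⟩, rfl⟩ | ⟨⟨-, hw', ha'⟩, rfl⟩ | ⟨hx', rfl⟩
    · exact absurd (Φ.sep_lt_right ha ((h3.trans_le h5).trans_le hb')) hd.not_gt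
    · exact absurd (Φ.sep_lt_right ha (h2.trans_le hw')) hd.not_gt
    · obtain ⟨-, e1, -⟩ := Φ.Pk_sub k x hx'
      exact absurd ((Φ.a_strictMono hik).trans_le (e1.trans ha)) (lt_irrefl _)
  · obtain ⟨hs, e1, e2⟩ := Φ.Pk_sub i x hx
    have hLR : (uL ε x : EReal) ≤ uR ε x := by exact_mod_cast uL_le_uR hε hs
    rcases hQ with ⟨⟨-, hb', hw'⟩, rfl⟩ | ⟨⟨-, hw', ha'⟩, rfl⟩ | ⟨hx', rfl⟩
    · exact absurd ((Φ.b_strictMono hik).trans_le (hb'.trans e2)) (lt_irrefl _)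
    · exact absurd (h2.trans_le (hw'.trans e2)) (lt_irrefl _)
    · obtain ⟨-, e1', -⟩ := Φ.Pk_sub k x hx'
      exact absurd (h3.trans_le (e1'.trans (hLR.trans e2))) (lt_irrefl _)

omit hε in
-- Left and right tangents of one peak can meet only if the peak has width exactly 2ε, and then only
-- along its two bounding tangents.
lemma Lp_eq_Rp_of_mem {i : Fin (n + 1)} {s t : ℝ} (hs : (s : EReal) ≤ Φ.a i) (ht : Φ.b i ≤ t)
    (hst : t ≤ s + 2 * ε) : Φ.Lp i s = Φ.Rp i t := by
  have h1 : t = s + 2 * ε := le_antisymm hst (Φ.sep i s t hs ht)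
  have h2 : Φ.a i = s := by
    refine le_antisymm (le_of_not_gt fun h => ?_) hs
    exact absurd (Φ.sep_lt_left h ht) hst.not_gt
  have h3 : Φ.b i = t := by
    refine le_antisymm ht (le_of_not_gt fun h => ?_)
    exact absurd (Φ.sep_lt_right hs h) hst.not_gt
  exact Φ.L_eq_R i s t h2 h3 h1

omit hε in
lemma selAt_unique_same {i : Fin (n + 1)} {x : ℝ × ℝ} {P Q : Plane}
    (hP : Φ.SelAt i x P) (hQ : Φ.SelAt i x Q) : P = Q := by
  have hd := uR_le_uL (ε := ε) (x := x)
  have hRK : x ∈ Φ.FR i → x ∈ Φ.Pk i → Φ.Rp i (uR ε x) = Φ.Kp i x := fun h1 h2 =>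
    (Φ.K_eq_R i x h2 (le_antisymm h1.2.1 (Φ.Pk_sub i x h2).2.2)).symm
  have hLK : x ∈ Φ.FL i → x ∈ Φ.Pk i → Φ.Lp i (uL ε x) = Φ.Kp i x := fun h1 h2 =>
    (Φ.K_eq_L i x h2 (le_antisymm (Φ.Pk_sub i x h2).2.1 h1.2.2)).symm
  have hLR : x ∈ Φ.FL i → x ∈ Φ.FR i → Φ.Lp i (uL ε x) = Φ.Rp i (uR ε x) := fun h1 h2 =>
    Φ.Lp_eq_Rp_of_mem h1.2.2 h2.2.1 hd
  rcases hP with ⟨h1, rfl⟩ | ⟨h1, rfl⟩ | ⟨h1, rfl⟩ <;>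
  rcases hQ with ⟨h2, rfl⟩ | ⟨h2, rfl⟩ | ⟨h2, rfl⟩
  · rfl
  · exact (hLR h2 h1).symm
  · exact hRK h1 h2
  · exact hLR h1 h2
  · rfl
  · exact hLK h1 h2
  · exact (hRK h2 h1).symm
  · exact (hLK h2 h1).symm
  · rfl

lemma selAt_unique {i k : Fin (n + 1)} {x : ℝ × ℝ} {P Q : Plane}
    (hP : Φ.SelAt i x P) (hQ : Φ.SelAt k x Q) : P = Q := by
  rcases lt_trichotomy i k with h | rfl | h
  · exact Φ.selAt_unique_of_lt hε h hP hQ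
  · exact Φ.selAt_unique_same hP hQ
  · exact (Φ.selAt_unique_of_lt hε h hQ hP).symm

omit hε in
open Classical in
/-- The plane attached to a point of the strip. -/
def plane (x : ℝ × ℝ) : Plane :=
  if h : ∃ P, ∃ i, Φ.SelAt i x P then h.choose else 0

lemma plane_eq {i : Fin (n + 1)} {x : ℝ × ℝ} {P : Plane} (h : Φ.SelAt i x P) : Φ.plane x = P := by
  have hex : ∃ P, ∃ i, Φ.SelAt i x P := ⟨P, i, h⟩
  obtain ⟨k, hk⟩ := hex.choose_spec
  rw [plane, dif_pos hex]
  exact Φ.selAt_unique hε hk h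

lemma plane_of_FR {i : Fin (n + 1)} {x : ℝ × ℝ} (h : x ∈ Φ.FR i) :
    Φ.plane x = Φ.Rp i (uR ε x) := Φ.plane_eq hε (Or.inl ⟨h, rfl⟩)

lemma plane_of_FL {i : Fin (n + 1)} {x : ℝ × ℝ} (h : x ∈ Φ.FL i) :
    Φ.plane x = Φ.Lp i (uL ε x) := Φ.plane_eq hε (Or.inr (Or.inl ⟨h, rfl⟩))

lemma plane_of_Pk {i : Fin (n + 1)} {x : ℝ × ℝ} (h : x ∈ Φ.Pk i) :
    Φ.plane x = Φ.Kp i x := Φ.plane_eq hε (Or.inr (Or.inr ⟨h, rfl⟩))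

omit hε in
lemma isClosed_FR (i : Fin (n + 1)) : IsClosed (Φ.FR i) := by
  have h1 : Continuous fun x => (uL ε x : EReal) := continuous_coe_real_ereal.comp (continuous_uL ε)
  have h2 : Continuous fun x => (uR ε x : EReal) := continuous_coe_real_ereal.comp (continuous_uR ε)
  exact (isClosed_strip ε).inter
    ((isClosed_le continuous_const h2).inter (isClosed_le h1 continuous_const))

omit hε in
lemma isClosed_FL (i : Fin (n + 1)) : IsClosed (Φ.FL i) := by
  have h1 : Continuous fun x => (uL ε x : EReal) := continuous_coe_real_ereal.comp (continuous_uL ε)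
  have h2 : Continuous fun x => (uR ε x : EReal) := continuous_coe_real_ereal.comp (continuous_uR ε)
  exact (isClosed_strip ε).inter
    ((isClosed_le continuous_const h2).inter (isClosed_le h1 continuous_const))

lemma continuousOn_plane : ContinuousOn Φ.plane (strip ε) := by
  set D : Fin (n + 1) × Fin 3 → Set (ℝ × ℝ) := fun p => ![Φ.FR p.1, Φ.FL p.1, Φ.Pk p.1] p.2 with hD
  have hcov : strip ε ⊆ ⋃ p, D p := by
    intro x hx
    obtain ⟨i, P, h⟩ := Φ.exists_selAt hε hx
    rw [mem_iUnion]
    rcases h with ⟨h, -⟩ | ⟨h, -⟩ | ⟨h, -⟩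
    · exact ⟨(i, 0), h⟩
    · exact ⟨(i, 1), h⟩
    · exact ⟨(i, 2), h⟩
  refine ContinuousOn.mono ?_ hcov
  refine (locallyFinite_of_finite D).continuousOn_iUnion ?_ ?_
  · rintro ⟨i, j⟩
    fin_cases j
    · exact Φ.isClosed_FR i
    · exact Φ.isClosed_FL i
    · exact Φ.Pk_closed i
  · rintro ⟨i, j⟩
    fin_cases j
    · refine ContinuousOn.congr ?_ fun x hx => Φ.plane_of_FR hε hx
      exact (Φ.R_cont i).comp (continuous_uR ε).continuousOn fun x hx => hx.2.1
    · refine ContinuousOn.congr ?_ fun x hx => Φ.plane_of_FL hε hx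
      exact (Φ.L_cont i).comp (continuous_uL ε).continuousOn fun x hx => hx.2.2
    · exact (Φ.K_cont i).congr fun x hx => Φ.plane_of_Pk hε hx

omit hε in
lemma support_RR {i : Fin (n + 1)} {x y : ℝ × ℝ} (hy : y ∈ strip ε) (hxb : Φ.b i ≤ uR ε x)
    (hyb : Φ.b i ≤ uR ε y) (hxy : uR ε x ≤ uL ε y + 2 * ε) :
    (Φ.Rp i (uR ε y)).ev y ≤ (Φ.Rp i (uR ε x)).ev y := by
  rcases le_total (uR ε x) (uR ε y) with h | h
  · exact Φ.R_anti i _ _ y hy hxb h le_rfl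
  · exact Φ.R_mono i _ _ y hy hyb h le_rfl hxy

omit hε in
lemma support_LL {i : Fin (n + 1)} {x y : ℝ × ℝ} (hy : y ∈ strip ε) (hxa : uL ε x ≤ Φ.a i)
    (hya : uL ε y ≤ Φ.a i) (hyx : uR ε y ≤ uL ε x + 2 * ε) :
    (Φ.Lp i (uL ε y)).ev y ≤ (Φ.Lp i (uL ε x)).ev y := by
  rcases le_total (uL ε x) (uL ε y) with h | h
  · exact Φ.L_anti i _ _ y hy hya h hyx le_rfl
  · exact Φ.L_mono i _ _ y hy hxa h le_rfl

omit hε in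
lemma exists_b_eq {i : Fin (n + 1)} {x : ℝ × ℝ} {t : ℝ} (hx : x ∈ Φ.Pk i) (ht : Φ.b i ≤ t) :
    ∃ u : ℝ, Φ.b i = u := by
  have h1 := (Φ.Pk_sub i x hx).2.2
  have : Φ.b i ≠ ⊤ := fun h => by rw [h] at ht; exact absurd ht (EReal.coe_lt_top t).not_ge
  have : Φ.b i ≠ ⊥ := fun h => by rw [h] at h1; exact absurd h1 (EReal.bot_lt_coe _).not_ge
  exact ⟨(Φ.b i).toReal, (EReal.coe_toReal ‹_› ‹_›).symm⟩

omit hε in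
lemma exists_a_eq {i : Fin (n + 1)} {x : ℝ × ℝ} {t : ℝ} (hx : x ∈ Φ.Pk i) (ht : t ≤ Φ.a i) :
    ∃ u : ℝ, Φ.a i = u := by
  have h1 := (Φ.Pk_sub i x hx).2.1
  have : Φ.a i ≠ ⊤ := fun h => by rw [h] at h1; exact absurd h1 (EReal.coe_lt_top _).not_ge
  have : Φ.a i ≠ ⊥ := fun h => by rw [h] at ht; exact absurd ht (EReal.bot_lt_coe t).not_ge
  exact ⟨(Φ.a i).toReal, (EReal.coe_toReal ‹_› ‹_›).symm⟩

omit hε in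
-- The plane of y is moved to that of x through the plane at the end of the peak when they lie in
-- different figures; each stage can only raise the value at y.
lemma support_peak {i : Fin (n + 1)} {x y : ℝ × ℝ} {P Q : Plane} (hP : Φ.SelAt i x P)
    (hQ : Φ.SelAt i y Q) (hxy : uR ε x ≤ uL ε y + 2 * ε) (hyx : uR ε y ≤ uL ε x + 2 * ε) :
    Q.ev y ≤ P.ev y := by
  rcases hP with ⟨h1, rfl⟩ | ⟨h1, rfl⟩ | ⟨h1, rfl⟩ <;>
  rcases hQ with ⟨h2, rfl⟩ | ⟨h2, rfl⟩ | ⟨h2, rfl⟩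
  · exact Φ.support_RR h2.1 h1.2.1 h2.2.1 hxy
  · rw [Φ.Lp_eq_Rp_of_mem h2.2.2 h1.2.1 hxy]
  · obtain ⟨u, hu⟩ := Φ.exists_b_eq h2 h1.2.1
    have h3 := h1.2.1
    have h4 := (Φ.Pk_sub i y h2)
    refine (Φ.K_le_R i y h2 u hu).trans ?_
    rw [hu] at h3 h4
    exact Φ.R_mono i _ _ y h4.1 hu.le (by exact_mod_cast h3) (by exact_mod_cast h4.2.2) hxy
  · rw [Φ.Lp_eq_Rp_of_mem h1.2.2 h2.2.1 hyx]
  · exact Φ.support_LL h2.1 h1.2.2 h2.2.2 hyx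
  · obtain ⟨u, hu⟩ := Φ.exists_a_eq h2 h1.2.2
    have h3 := h1.2.2
    have h4 := (Φ.Pk_sub i y h2)
    refine (Φ.K_le_L i y h2 u hu).trans ?_
    rw [hu] at h3 h4
    exact Φ.L_anti i _ _ y h4.1 hu.ge (by exact_mod_cast h3) hyx (by exact_mod_cast h4.2.1)
  · obtain ⟨u, hu⟩ := Φ.exists_b_eq h1 h2.2.1
    have h3 := h2.2.1
    rw [hu] at h3
    have h3' : u ≤ uR ε y := by exact_mod_cast h3
    exact (Φ.R_anti i u _ y h2.1 hu.le h3' le_rfl).trans (Φ.K_ge_R i x h1 y h2.1 u hu h3')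
  · obtain ⟨u, hu⟩ := Φ.exists_a_eq h1 h2.2.2
    have h3 := h2.2.2
    rw [hu] at h3
    have h3' : uL ε y ≤ u := by exact_mod_cast h3
    exact (Φ.L_mono i _ u y h2.1 hu.ge h3' le_rfl).trans (Φ.K_ge_L i x h1 y h2.1 u hu h3')
  · exact Φ.K_le i x h1 y h2

/-- As for a peak, with the plane of the angle vertex as the intermediate stage. -/
lemma support_angle {k : Fin n} {x y : ℝ × ℝ} (hx : x ∈ strip ε) (hy : y ∈ strip ε)
    (hx' : x ∈ Φ.angleRegion k) (hy' : y ∈ Φ.angleRegion k)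
    (hxy : uR ε x ≤ uL ε y + 2 * ε) (hyx : uR ε y ≤ uL ε x + 2 * ε) :
    (Φ.plane y).ev y ≤ (Φ.plane x).ev y := by
  have hw1 := Φ.b_lt_w k
  have hw2 := Φ.w_lt_a k
  rcases Φ.mem_angleRegion hε hx hx' with h1 | h1 <;>
  rcases Φ.mem_angleRegion hε hy hy' with h2 | h2
  · rw [Φ.plane_of_FR hε h1, Φ.plane_of_FR hε h2]
    exact Φ.support_RR h2.1 h1.2.1 h2.2.1 hxy
  · rw [Φ.plane_of_FR hε h1, Φ.plane_of_FL hε h2]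
    have hx3 : uL ε x ≤ Φ.w k := by have := h1.2.2; rw [wr_castSucc] at this; exact_mod_cast this
    have hy3 : Φ.w k ≤ uR ε y := by have := h2.2.1; rw [wl_succ] at this; exact_mod_cast this
    rcases le_total (uL ε y) (Φ.w k) with h | h
    · rw [← Φ.Rp_eq_Lp_of_angle hy3 h]
      exact Φ.support_RR h2.1 h1.2.1 hy'.1.le hxy
    refine (Φ.L_anti k.succ (Φ.w k) _ y hy h2.2.2 h (by linarith) le_rfl).trans ?_
    rw [← Φ.R_eq_L]
    rcases le_total (Φ.w k) (uR ε x) with h' | h'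
    · rw [Φ.R_const k _ h']
    · exact Φ.R_anti k.castSucc _ _ y hy h1.2.1 h' hy3
  · rw [Φ.plane_of_FL hε h1, Φ.plane_of_FR hε h2]
    have hx3 : Φ.w k ≤ uR ε x := by have := h1.2.1; rw [wl_succ] at this; exact_mod_cast this
    have hy3 : uL ε y ≤ Φ.w k := by have := h2.2.2; rw [wr_castSucc] at this; exact_mod_cast this
    rcases le_total (Φ.w k) (uR ε y) with h | h
    · rw [Φ.Rp_eq_Lp_of_angle h hy3]
      exact Φ.support_LL h2.1 h1.2.2 hy'.2.le hyx
    refine (Φ.R_mono k.castSucc _ (Φ.w k) y hy h2.2.1 h le_rfl (by linarith)).trans ?_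
    rw [Φ.R_eq_L]
    rcases le_total (uL ε x) (Φ.w k) with h' | h'
    · rw [Φ.L_const k _ h']
    · exact Φ.L_mono k.succ _ _ y hy h1.2.2 h' hy3
  · rw [Φ.plane_of_FL hε h1, Φ.plane_of_FL hε h2]
    exact Φ.support_LL h2.1 h1.2.2 h2.2.2 hyx

lemma locallySupported : LocallySupported ε Φ.plane := by
  intro z hz
  rcases Φ.mem_region z with ⟨i, hi⟩ | ⟨k, hk⟩
  · refine ⟨_, (Φ.isOpen_peakRegion i).mem_nhds hi, fun x hx y hy hxy => ?_⟩
    obtain ⟨P, hP⟩ := Φ.selAt_of_peakRegion hε hx.2 hx.1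
    obtain ⟨Q, hQ⟩ := Φ.selAt_of_peakRegion hε hy.2 hy.1
    rw [Φ.plane_eq hε hP, Φ.plane_eq hε hQ]
    exact Φ.support_peak hP hQ (uR_le_of_segment hx.2 hy.2 hxy)
      (uR_le_of_segment hy.2 hx.2 (by rwa [segment_symm]))
  · refine ⟨_, (Φ.isOpen_angleRegion k).mem_nhds hk, fun x hx y hy hxy => ?_⟩
    exact Φ.support_angle hε hx.2 hy.2 hx.1 hy.1 (uR_le_of_segment hx.2 hy.2 hxy)
      (uR_le_of_segment hy.2 hx.2 (by rwa [segment_symm]))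

end PlaneFoliation

/-! ## Planes tangent to the boundary curve -/

/-- The plane that is tangent to the curve `(t, t², F(t))` at `t = u` and has the coefficient `β` at
the second coordinate. -/
def tp (F F1 : ℝ → ℝ) (u β : ℝ) : Plane := (F u - u * F1 u + β * u ^ 2, F1 u - 2 * u * β, β)

lemma tp_ev (F F1 : ℝ → ℝ) (u β : ℝ) (y : ℝ × ℝ) :
    (tp F F1 u β).ev y = F u + F1 u * (y.1 - u) + β * (y.2 - 2 * u * y.1 + u ^ 2) := by
  simp only [tp, Plane.ev]; ring

/-- The cup equation says exactly that the plane tangent at a whose second coefficient is half the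
mean of the second derivative is tangent at b too. -/
lemma tp_chord {F F1 : ℝ → ℝ} {a b : ℝ} (hab : a ≠ b) (h : cupFun F F1 a b = 0) :
    tp F F1 a (slopeOn F1 a b / 2) = tp F F1 b (slopeOn F1 a b / 2) := by
  have h1 : slopeOn F1 a b * (b - a) = F1 b - F1 a := by
    rw [slopeOn, div_mul_cancel₀]; exact sub_ne_zero.2 hab.symm
  unfold cupFun at h
  simp only [tp, Prod.mk.injEq, and_true]
  constructor
  · linear_combination h + (-a - b) / 2 * h1
  · linear_combination h1

/-! ### Monotonicity of the planes along families of tangents. -/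

section branches

variable {F F1 F2 : ℝ → ℝ} (h0 : ∀ t, HasDerivAt F (F1 t) t) (h1 : ∀ t, HasDerivAt F1 (F2 t) t)

include h0 h1

/-- The first-order terms cancel by tangency, so the motion is seen only through the second
derivative of F and the change of the coefficient β. -/
lemma hasDerivAt_tp_ev {U β : ℝ → ℝ} {U' β' s : ℝ} (hU : HasDerivAt U U' s)
    (hβ : HasDerivAt β β' s) (y : ℝ × ℝ) :
    HasDerivAt (fun s => (tp F F1 (U s) (β s)).ev y)
      (U' * (y.1 - U s) * (F2 (U s) - 2 * β s) + β' * (y.2 - 2 * U s * y.1 + U s ^ 2)) s := by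
  simp only [tp_ev]
  have e0 := (h0 (U s)).comp s hU
  have e1 := ((h1 (U s)).comp s hU).mul (hU.const_sub y.1)
  have e2 := hβ.mul ((((hU.const_mul 2).mul_const y.1).const_sub y.2).add (hU.pow 2))
  refine ((e0.add e1).add e2).congr_deriv ?_
  simp only [Function.comp, Pi.add_apply, Pi.pow_apply]
  push_cast
  ring

lemma continuous_tp : Continuous fun q : ℝ × ℝ => tp F F1 q.1 q.2 := by
  have hc0 : Continuous F := continuous_iff_continuousAt.2 fun t => (h0 t).continuousAt
  have hc1 : Continuous F1 := continuous_iff_continuousAt.2 fun t => (h1 t).continuousAt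
  unfold tp
  fun_prop

lemma continuousOn_tp_ev {U β : ℝ → ℝ} {s : Set ℝ} (hU : ContinuousOn U s) (hβ : ContinuousOn β s)
    (y : ℝ × ℝ) : ContinuousOn (fun t => (tp F F1 (U t) (β t)).ev y) s := by
  have hc : Continuous fun P : Plane => P.ev y := by unfold Plane.ev; fun_prop
  exact (hc.comp (continuous_tp h0 h1)).comp_continuousOn (hU.prodMk hβ)

variable {ε : ℝ} (hε : 0 < ε) {M : ℝ → ℝ} {u u' : ℝ} (huu' : u ≤ u')
  (hMc : ContinuousOn M (Icc u u'))
include hε huu' hMc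

omit hε in
lemma antitone_tp {M' : ℝ → ℝ} (hM : ∀ v ∈ Ioo u u', HasDerivAt M (M' v) v) (y : ℝ × ℝ)
    (hs : ∀ v ∈ Ioo u u', (y.1 - v) * (F2 v - M v) +
      M' v / 2 * (y.2 - 2 * v * y.1 + v ^ 2) ≤ 0) :
    (tp F F1 u' (M u' / 2)).ev y ≤ (tp F F1 u (M u / 2)).ev y := by
  have hd : ∀ v ∈ Ioo u u', HasDerivAt (fun v => (tp F F1 v (M v / 2)).ev y)
      ((y.1 - v) * (F2 v - M v) + M' v / 2 * (y.2 - 2 * v * y.1 + v ^ 2)) v := fun v hv => by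
    refine (hasDerivAt_tp_ev h0 h1 (hasDerivAt_id v) ((hM v hv).div_const 2) y).congr_deriv ?_
    simp only [id]; ring
  have : AntitoneOn (fun v => (tp F F1 v (M v / 2)).ev y) (Icc u u') := by
    refine antitoneOn_of_deriv_nonpos (convex_Icc _ _)
      (continuousOn_tp_ev h0 h1 continuousOn_id (hMc.div_const 2) y) ?_ ?_ <;>
    rw [interior_Icc]
    · exact fun v hv => (hd v hv).differentiableAt.differentiableWithinAt
    · intro v hv; rw [(hd v hv).deriv]; exact hs v hv
  exact this (left_mem_Icc.2 huu') (right_mem_Icc.2 huu') huu'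

omit hε in
lemma monotone_tp {M' : ℝ → ℝ} (hM : ∀ v ∈ Ioo u u', HasDerivAt M (M' v) v) (y : ℝ × ℝ)
    (hs : ∀ v ∈ Ioo u u', 0 ≤ (y.1 - v) * (F2 v - M v) +
      M' v / 2 * (y.2 - 2 * v * y.1 + v ^ 2)) :
    (tp F F1 u (M u / 2)).ev y ≤ (tp F F1 u' (M u' / 2)).ev y := by
  have hd : ∀ v ∈ Ioo u u', HasDerivAt (fun v => (tp F F1 v (M v / 2)).ev y)
      ((y.1 - v) * (F2 v - M v) + M' v / 2 * (y.2 - 2 * v * y.1 + v ^ 2)) v := fun v hv => by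
    refine (hasDerivAt_tp_ev h0 h1 (hasDerivAt_id v) ((hM v hv).div_const 2) y).congr_deriv ?_
    simp only [id]; ring
  have : MonotoneOn (fun v => (tp F F1 v (M v / 2)).ev y) (Icc u u') := by
    refine monotoneOn_of_deriv_nonneg (convex_Icc _ _)
      (continuousOn_tp_ev h0 h1 continuousOn_id (hMc.div_const 2) y) ?_ ?_ <;>
    rw [interior_Icc]
    · exact fun v hv => (hd v hv).differentiableAt.differentiableWithinAt
    · intro v hv; rw [(hd v hv).deriv]; exact hs v hv
  exact this (left_mem_Icc.2 huu') (right_mem_Icc.2 huu') huu'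

/-- By the equation εM' + M = F2 the derivative in v is -(M - F2)/(2ε) times (uR y - v)(uL y + 2ε -
v), and both factors are non-negative as long as v ≤ uR y. In `right_branch_mono` the point v has
passed uR y but not uL y + 2ε, so only the first factor changes its sign. -/
lemma right_branch_anti (hM : ∀ v ∈ Ioo u u', HasDerivAt M ((F2 v - M v) / ε) v)
    (hpos : ∀ v ∈ Ioo u u', F2 v ≤ M v) {y : ℝ × ℝ} (hy : y ∈ strip ε) (hu : u' ≤ uR ε y) :
    (tp F F1 u' (M u' / 2)).ev y ≤ (tp F F1 u (M u / 2)).ev y := by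
  refine antitone_tp h0 h1 huu' hMc hM y fun v hv => ?_
  have e := right_tangent_factor hy v
  have hd := uR_le_uL (ε := ε) (x := y)
  have e1 : (y.1 - v) * (F2 v - M v) + (F2 v - M v) / ε / 2 * (y.2 - 2 * v * y.1 + v ^ 2) =
      -((M v - F2 v) / ε / 2 * ((uR ε y - v) * (uL ε y + 2 * ε - v))) := by
    rw [← e]; field_simp; ring
  rw [e1, neg_nonpos]
  have := hpos v hv
  have a1 : 0 ≤ (M v - F2 v) / ε / 2 := by
    have : 0 ≤ M v - F2 v := by linarith
    positivity
  exact mul_nonneg a1 (mul_nonneg (by linarith [hv.2]) (by linarith [hv.2]))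

lemma right_branch_mono (hM : ∀ v ∈ Ioo u u', HasDerivAt M ((F2 v - M v) / ε) v)
    (hpos : ∀ v ∈ Ioo u u', F2 v ≤ M v) {y : ℝ × ℝ} (hy : y ∈ strip ε) (hu : uR ε y ≤ u)
    (hu' : u' ≤ uL ε y + 2 * ε) :
    (tp F F1 u (M u / 2)).ev y ≤ (tp F F1 u' (M u' / 2)).ev y := by
  refine monotone_tp h0 h1 huu' hMc hM y fun v hv => ?_
  have e := right_tangent_factor hy v
  have e1 : (y.1 - v) * (F2 v - M v) + (F2 v - M v) / ε / 2 * (y.2 - 2 * v * y.1 + v ^ 2) =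
      (M v - F2 v) / ε / 2 * ((v - uR ε y) * (uL ε y + 2 * ε - v)) := by
    have : (v - uR ε y) * (uL ε y + 2 * ε - v) = -((uR ε y - v) * (uL ε y + 2 * ε - v)) := by ring
    rw [this, ← e]; field_simp; ring
  rw [e1]
  have := hpos v hv
  have a1 : 0 ≤ (M v - F2 v) / ε / 2 := by
    have : 0 ≤ M v - F2 v := by linarith
    positivity
  exact mul_nonneg a1 (mul_nonneg (by linarith [hv.1]) (by linarith [hv.2]))

/-- Mirror image of the right branch: the derivative is (M - F2)/(2ε) times (v + 2ε - uR y)(v - uL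
y). -/
lemma left_branch_mono (hM : ∀ v ∈ Ioo u u', HasDerivAt M ((M v - F2 v) / ε) v)
    (hpos : ∀ v ∈ Ioo u u', F2 v ≤ M v) {y : ℝ × ℝ} (hy : y ∈ strip ε) (hu : uL ε y ≤ u) :
    (tp F F1 u (M u / 2)).ev y ≤ (tp F F1 u' (M u' / 2)).ev y := by
  refine monotone_tp h0 h1 huu' hMc hM y fun v hv => ?_
  have e := left_tangent_factor hy v
  have hd := uR_le_uL (ε := ε) (x := y)
  have e1 : (y.1 - v) * (F2 v - M v) + (M v - F2 v) / ε / 2 * (y.2 - 2 * v * y.1 + v ^ 2) =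
      (M v - F2 v) / ε / 2 * ((v + 2 * ε - uR ε y) * (v - uL ε y)) := by
    have : (v + 2 * ε - uR ε y) * (v - uL ε y) = (uR ε y - 2 * ε - v) * (uL ε y - v) := by ring
    rw [this, ← e]; field_simp; ring
  rw [e1]
  have := hpos v hv
  have a1 : 0 ≤ (M v - F2 v) / ε / 2 := by
    have : 0 ≤ M v - F2 v := by linarith
    positivity
  exact mul_nonneg a1 (mul_nonneg (by linarith [hv.1]) (by linarith [hv.1]))

lemma left_branch_anti (hM : ∀ v ∈ Ioo u u', HasDerivAt M ((M v - F2 v) / ε) v)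
    (hpos : ∀ v ∈ Ioo u u', F2 v ≤ M v) {y : ℝ × ℝ} (hy : y ∈ strip ε) (hu : uR ε y ≤ u + 2 * ε)
    (hu' : u' ≤ uL ε y) :
    (tp F F1 u' (M u' / 2)).ev y ≤ (tp F F1 u (M u / 2)).ev y := by
  refine antitone_tp h0 h1 huu' hMc hM y fun v hv => ?_
  have e := left_tangent_factor hy v
  have e1 : (y.1 - v) * (F2 v - M v) + (M v - F2 v) / ε / 2 * (y.2 - 2 * v * y.1 + v ^ 2) =
      -((M v - F2 v) / ε / 2 * ((v + 2 * ε - uR ε y) * (uL ε y - v))) := by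
    have : (v + 2 * ε - uR ε y) * (uL ε y - v) = -((uR ε y - 2 * ε - v) * (uL ε y - v)) := by ring
    rw [this, ← e]; field_simp; ring
  rw [e1, neg_nonpos]
  have := hpos v hv
  have a1 : 0 ≤ (M v - F2 v) / ε / 2 := by
    have : 0 ≤ M v - F2 v := by linarith
    positivity
  exact mul_nonneg a1 (mul_nonneg (by linarith [hv.1]) (by linarith [hv.2]))

end branches

/-! ## Full cups -/

namespace CupData

variable {F F1 F2 : ℝ → ℝ} {p δ : ℝ} (h : CupData F F1 F2 p δ)

/-- The right end of the chord of length `l`. -/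
def right (l : ℝ) : ℝ := h.left l + l

/-- Negative (positive) below (above) the chord of length `l`. -/
def chordFun (l : ℝ) (y : ℝ × ℝ) : ℝ := y.2 - (h.left l + h.right l) * y.1 + h.left l * h.right l

/-- The value at l = 0 is the limit of the mean over the shrinking chord, so the planes extend
continuously to the origin. -/
def chordSlope (l : ℝ) : ℝ := if l = 0 then F2 p else slopeOn F1 (h.left l) (h.right l)

/-- The plane attached to the chord of length `l`. -/
def chordPlane (l : ℝ) : Plane := tp F F1 (h.left l) (h.chordSlope l / 2)

lemma chordFun_eq (l : ℝ) (y : ℝ × ℝ) :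
    h.chordFun l y = (y.1 - h.left l) * (y.1 - h.right l) + (y.2 - y.1 ^ 2) := by
  simp only [chordFun]; ring

lemma deriv_left_neg {l : ℝ} (hl : 0 < l) (hlδ : l < δ) :
    deriv h.left l < 0 ∧ 0 < deriv h.left l + 1 := by
  obtain ⟨d1, d2⟩ := h.diffs_neg hl hlδ
  rw [(h.hasDerivAt_left hl hlδ).deriv]
  set x := F2 (h.left l) - slopeOn F1 (h.left l) (h.left l + l) with hx
  set y := F2 (h.left l + l) - slopeOn F1 (h.left l) (h.left l + l) with hy
  have hx0 : x < 0 := by linarith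
  have hy0 : y < 0 := by linarith
  have hne : x + y ≠ 0 := by linarith
  constructor
  · exact div_neg_of_pos_of_neg (by linarith) (by linarith)
  · have : -y / (x + y) + 1 = x / (x + y) := by field_simp; ring
    rw [this]
    exact div_pos_of_neg_of_neg hx0 (by linarith)

lemma continuousOn_left : ContinuousOn h.left (Ico 0 δ) := by
  intro l hl
  rcases hl.1.eq_or_lt with rfl | h0
  · have hz := h.left_zero
    rw [Metric.continuousWithinAt_iff]
    intro η hη
    refine ⟨η, hη, fun x hx hxd => ?_⟩
    rw [hz, Real.dist_eq]
    rw [Real.dist_eq, sub_zero, abs_of_nonneg hx.1] at hxd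
    rcases hx.1.eq_or_lt with rfl | hx0
    · rw [hz]; simpa using hη
    · obtain ⟨k1, k2, -⟩ := h.left_spec hx0 hx.2
      rw [abs_lt]; constructor <;> linarith
  · exact (h.hasDerivAt_left h0 hl.2).continuousAt.continuousWithinAt

lemma continuousOn_right : ContinuousOn h.right (Ico 0 δ) :=
  h.continuousOn_left.add continuousOn_id

lemma strictAntiOn_left : StrictAntiOn h.left (Ico 0 δ) := by
  refine strictAntiOn_of_deriv_neg (convex_Ico _ _) h.continuousOn_left fun l hl => ?_
  rw [interior_Ico] at hl
  exact (h.deriv_left_neg hl.1 hl.2).1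

lemma deriv_right {l : ℝ} (hl : 0 < l) (hlδ : l < δ) :
    HasDerivAt h.right (deriv h.left l + 1) l :=
  (h.hasDerivAt_left hl hlδ).differentiableAt.hasDerivAt.add (hasDerivAt_id l)

lemma strictMonoOn_right : StrictMonoOn h.right (Ico 0 δ) := by
  refine strictMonoOn_of_deriv_pos (convex_Ico _ _) h.continuousOn_right fun l hl => ?_
  rw [interior_Ico] at hl
  rw [(h.deriv_right hl.1 hl.2).deriv]
  exact (h.deriv_left_neg hl.1 hl.2).2

/-- With the differentials x, y of the chord the derivative equals 2xy/((x + y)l), which is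
negative. The last relation couples the motions of the end and of the slope; it makes the plane turn
about its chord in `hasDerivAt_chordPlane_ev`. -/
lemma hasDerivAt_chordSlope {l : ℝ} (hl : 0 < l) (hlδ : l < δ) : ∃ d < 0,
    HasDerivAt h.chordSlope d l ∧
      deriv h.left l * (F2 (h.left l) - h.chordSlope l) = -(d / 2) * l := by
  obtain ⟨d1, d2⟩ := h.diffs_neg hl hlδ
  have hd := h.hasDerivAt_left hl hlδ
  set a' := -(F2 (h.left l + l) - slopeOn F1 (h.left l) (h.left l + l)) /
      ((F2 (h.left l) - slopeOn F1 (h.left l) (h.left l + l)) +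
        (F2 (h.left l + l) - slopeOn F1 (h.left l) (h.left l + l))) with ha'
  have hs : h.chordSlope l = slopeOn F1 (h.left l) (h.left l + l) := by
    rw [chordSlope, if_neg hl.ne']; rfl
  set κ := slopeOn F1 (h.left l) (h.left l + l) with hκ
  have hκl : κ * l = F1 (h.left l + l) - F1 (h.left l) := by
    rw [hκ, slopeOn, add_sub_cancel_left, div_mul_cancel₀ _ hl.ne']
  set x := F2 (h.left l) - κ with hx
  set y := F2 (h.left l + l) - κ with hy
  have hx0 : x < 0 := by linarith
  have hy0 : y < 0 := by linarith
  have hne : x + y ≠ 0 := by linarith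
  have ha2 : a' * (x + y) = -y := by rw [ha', div_mul_cancel₀ _ hne]
  refine ⟨2 * (x * y / (x + y)) / l, ?_, ?_, ?_⟩
  · apply div_neg_of_neg_of_pos _ hl
    have : x * y / (x + y) < 0 := div_neg_of_pos_of_neg (mul_pos_of_neg_of_neg hx0 hy0) (by linarith)
    linarith
  · have e : h.chordSlope =ᶠ[𝓝 l] fun l => (F1 (h.left l + l) - F1 (h.left l)) / l := by
      filter_upwards [lt_mem_nhds hl] with t ht
      rw [chordSlope, if_neg ht.ne', slopeOn, right, add_sub_cancel_left]
    have hid : HasDerivAt (fun l => h.left l + l) (a' + 1) l := hd.add (hasDerivAt_id l)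
    have g1 := HasDerivAt.comp (h₂ := F1) (h := fun l => h.left l + l) l (h.deriv1 (h.left l + l)) hid
    have g2 := (h.deriv1 (h.left l)).comp l hd
    have := (g1.sub g2).div (hasDerivAt_id l) hl.ne'
    refine (this.congr_of_eventuallyEq e).congr_deriv ?_
    simp only [Pi.sub_apply, Function.comp, id, mul_one]
    rw [← hκl]
    have hz : x * y / (x + y) = -(a' * x) := by
      rw [div_eq_iff hne]; linear_combination x * ha2
    have : F2 (h.left l + l) = y + κ := by rw [hy]; ring
    have : F2 (h.left l) = x + κ := by rw [hx]; ring
    rw [hz, ‹F2 (h.left l + l) = _›, ‹F2 (h.left l) = _›]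
    field_simp
    linear_combination ha2
  · rw [hd.deriv, hs]
    have hz : x * y / (x + y) = -(a' * x) := by
      rw [div_eq_iff hne]; linear_combination x * ha2
    rw [hz, ← hx]; field_simp

lemma continuousOn_chordSlope : ContinuousOn h.chordSlope (Ico 0 δ) := by
  intro l hl
  rcases hl.1.eq_or_lt with rfl | h0
  · have hz : h.chordSlope 0 = F2 p := by simp [chordSlope]
    rw [Metric.continuousWithinAt_iff]
    intro η hη
    obtain ⟨r, hr, hball⟩ := Metric.continuous_iff.1 h.cont p η hη
    refine ⟨r, hr, fun x hx hxd => ?_⟩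
    rw [Real.dist_eq, sub_zero, abs_of_nonneg hx.1] at hxd
    rw [hz]
    rcases hx.1.eq_or_lt with rfl | hx0
    · rw [hz]; simpa using hη
    · obtain ⟨k1, k2, -⟩ := h.left_spec hx0 hx.2
      obtain ⟨ξ, hξ, hξ'⟩ := exists_hasDerivAt_eq_slope F1 F2 (show h.left x < h.right x by
        unfold right; linarith) (fun t _ => (h.deriv1 t).continuousAt.continuousWithinAt)
        fun t _ => h.deriv1 t
      rw [chordSlope, if_neg hx0.ne', slopeOn, ← hξ']
      refine hball ξ ?_
      unfold right at hξ
      rw [Real.dist_eq, abs_lt]; constructor <;> linarith [hξ.1, hξ.2]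
  · obtain ⟨d, -, hd, -⟩ := h.hasDerivAt_chordSlope h0 hl.2
    exact hd.continuousAt.continuousWithinAt

lemma continuousOn_chordPlane : ContinuousOn h.chordPlane (Ico 0 δ) :=
  (continuous_tp h.deriv0 h.deriv1).comp_continuousOn
    (h.continuousOn_left.prodMk (h.continuousOn_chordSlope.div_const 2))

/-- The derivative vanishes on the chord itself: as the length grows the plane turns about its
chord, rising below it and sinking above it. -/
lemma hasDerivAt_chordPlane_ev {l : ℝ} (hl : 0 < l) (hlδ : l < δ) (y : ℝ × ℝ) :
    ∃ d < 0, HasDerivAt (fun l => (h.chordPlane l).ev y) (d * h.chordFun l y) l := by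
  obtain ⟨d, hd0, hd, he⟩ := h.hasDerivAt_chordSlope hl hlδ
  refine ⟨d / 2, by linarith, ?_⟩
  refine (hasDerivAt_tp_ev h.deriv0 h.deriv1
    (h.hasDerivAt_left hl hlδ).differentiableAt.hasDerivAt (hd.div_const 2) y).congr_deriv ?_
  simp only [chordFun, right]
  linear_combination (y.1 - h.left l) * he

lemma chordPlane_anti {l l' : ℝ} (hl : 0 ≤ l) (hll' : l ≤ l') (hl' : l' < δ) (y : ℝ × ℝ)
    (hs : ∀ m ∈ Ioo l l', 0 ≤ h.chordFun m y) : (h.chordPlane l').ev y ≤ (h.chordPlane l).ev y := by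
  have hev : Continuous fun P : Plane => P.ev y := by unfold Plane.ev; fun_prop
  have : AntitoneOn (fun l => (h.chordPlane l).ev y) (Icc l l') := by
    refine antitoneOn_of_deriv_nonpos (convex_Icc _ _)
      (hev.comp_continuousOn (h.continuousOn_chordPlane.mono fun t ht =>
        ⟨hl.trans ht.1, ht.2.trans_lt hl'⟩)) ?_ ?_ <;>
    rw [interior_Icc] <;> intro m hm <;>
    obtain ⟨d, hd0, hd⟩ := h.hasDerivAt_chordPlane_ev (hl.trans_lt hm.1) (hm.2.trans hl') y
    · exact hd.differentiableAt.differentiableWithinAt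
    · rw [hd.deriv]; exact mul_nonpos_of_nonpos_of_nonneg hd0.le (hs m hm)
  exact this (left_mem_Icc.2 hll') (right_mem_Icc.2 hll') hll'

lemma chordPlane_mono {l l' : ℝ} (hl : 0 ≤ l) (hll' : l ≤ l') (hl' : l' < δ) (y : ℝ × ℝ)
    (hs : ∀ m ∈ Ioo l l', h.chordFun m y ≤ 0) : (h.chordPlane l).ev y ≤ (h.chordPlane l').ev y := by
  have hev : Continuous fun P : Plane => P.ev y := by unfold Plane.ev; fun_prop
  have : MonotoneOn (fun l => (h.chordPlane l).ev y) (Icc l l') := by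
    refine monotoneOn_of_deriv_nonneg (convex_Icc _ _)
      (hev.comp_continuousOn (h.continuousOn_chordPlane.mono fun t ht =>
        ⟨hl.trans ht.1, ht.2.trans_lt hl'⟩)) ?_ ?_ <;>
    rw [interior_Icc] <;> intro m hm <;>
    obtain ⟨d, hd0, hd⟩ := h.hasDerivAt_chordPlane_ev (hl.trans_lt hm.1) (hm.2.trans hl') y
    · exact hd.differentiableAt.differentiableWithinAt
    · rw [hd.deriv]; exact mul_nonneg_of_nonpos_of_nonpos hd0.le (hs m hm)
  exact this (left_mem_Icc.2 hll') (right_mem_Icc.2 hll') hll'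

/-- Points below a chord are strictly below all longer chords. -/
lemma chordFun_neg_of_lt {l l' : ℝ} (hl : 0 ≤ l) (hll' : l < l') (hl' : l' < δ) {y : ℝ × ℝ}
    (hy : y.1 ^ 2 ≤ y.2) (h0 : h.chordFun l y ≤ 0) : h.chordFun l' y < 0 := by
  have e1 := h.strictAntiOn_left ⟨hl, hll'.trans hl'⟩ ⟨hl.trans hll'.le, hl'⟩ hll'
  have e2 := h.strictMonoOn_right ⟨hl, hll'.trans hl'⟩ ⟨hl.trans hll'.le, hl'⟩ hll'
  rw [chordFun_eq] at h0 ⊢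
  have hlr : h.left l ≤ h.right l := by unfold right; linarith
  have h1 : (y.1 - h.left l) * (y.1 - h.right l) ≤ 0 := by linarith
  have h2 : h.left l ≤ y.1 := by
    by_contra! hc
    have := mul_pos_of_neg_of_neg (show y.1 - h.left l < 0 by linarith)
      (show y.1 - h.right l < 0 by linarith)
    linarith
  have h3 : y.1 ≤ h.right l := by
    by_contra! hc
    have := mul_pos (show 0 < y.1 - h.left l by linarith) (show 0 < y.1 - h.right l by linarith)
    linarith
  nlinarith [mul_nonneg (sub_nonneg.2 h2) (sub_nonneg.2 h3),
    mul_pos (sub_pos.2 e1) (sub_pos.2 e2), mul_nonneg (sub_nonneg.2 h2) (sub_pos.2 e2).le,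
    mul_nonneg (sub_nonneg.2 h3) (sub_pos.2 e1).le]

/-- Such a point lies on or above the tangent to the parabola at the origin, the degenerate chord,
and on or below the chord of length L; the chords vary continuously. -/
lemma exists_level {L : ℝ} (hL : 0 ≤ L) (hLδ : L < δ) {y : ℝ × ℝ} (hy : y.1 ^ 2 ≤ y.2)
    (h0 : h.chordFun L y ≤ 0) : ∃ l ∈ Icc 0 L, h.chordFun l y = 0 := by
  have hsub : Icc 0 L ⊆ Ico 0 δ := fun t ht => ⟨ht.1, ht.2.trans_lt hLδ⟩
  have hc : ContinuousOn (fun l => h.chordFun l y) (Icc 0 L) := by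
    have h1 := h.continuousOn_left.mono hsub
    have h2 := h.continuousOn_right.mono hsub
    unfold chordFun; fun_prop
  have h1 : 0 ≤ h.chordFun 0 y := by
    rw [chordFun_eq, right, h.left_zero, add_zero]
    nlinarith [sq_nonneg (y.1 - p)]
  obtain ⟨l, hl, hl0⟩ := intermediate_value_Icc' hL hc ⟨h0, h1⟩
  exact ⟨l, hl, hl0⟩

open Classical in
/-- The length of the chord through `y`. -/
def level (L : ℝ) (y : ℝ × ℝ) : ℝ :=
  if hy : ∃ l ∈ Icc 0 L, h.chordFun l y = 0 then hy.choose else 0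

section level

variable {L : ℝ} (hL : 0 ≤ L) (hLδ : L < δ) {y : ℝ × ℝ} (hy : y.1 ^ 2 ≤ y.2)
  (h0 : h.chordFun L y ≤ 0)
include hL hLδ hy h0

lemma level_spec : h.level L y ∈ Icc 0 L ∧ h.chordFun (h.level L y) y = 0 := by
  have hex := h.exists_level hL hLδ hy h0
  rw [level, dif_pos hex]
  exact hex.choose_spec

lemma chordFun_pos_of_lt_level {m : ℝ} (hm : 0 ≤ m) (hml : m < h.level L y) :
    0 < h.chordFun m y := by
  obtain ⟨h1, h2⟩ := h.level_spec hL hLδ hy h0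
  by_contra! hc
  have := h.chordFun_neg_of_lt hm hml (h1.2.trans_lt hLδ) hy hc
  linarith

lemma chordFun_neg_of_level_lt {m : ℝ} (hm : m ≤ L) (hml : h.level L y < m) :
    h.chordFun m y < 0 := by
  obtain ⟨h1, h2⟩ := h.level_spec hL hLδ hy h0
  exact h.chordFun_neg_of_lt h1.1 hml (hm.trans_lt hLδ) hy h2.le

lemma level_unique {l : ℝ} (hl : l ∈ Icc 0 L) (hl0 : h.chordFun l y = 0) : h.level L y = l := by
  rcases lt_trichotomy (h.level L y) l with hlt | heq | hlt
  · have := h.chordFun_neg_of_level_lt hL hLδ hy h0 hl.2 hlt; linarith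
  · exact heq
  · have := h.chordFun_pos_of_lt_level hL hLδ hy h0 hl.1 hlt; linarith

end level

/-- Lying strictly above or strictly below a given chord is an open condition, and it decides on
which side of that length the level falls. -/
lemma continuousOn_level {L : ℝ} (hL : 0 ≤ L) (hLδ : L < δ) :
    ContinuousOn (h.level L) {y | y.1 ^ 2 ≤ y.2 ∧ h.chordFun L y ≤ 0} := by
  have hc : ∀ m, Continuous (h.chordFun m) := fun m => by unfold chordFun; fun_prop
  intro y ⟨hy, h0⟩
  obtain ⟨h1, h2⟩ := h.level_spec hL hLδ hy h0
  refine tendsto_order.2 ⟨fun m hm => ?_, fun m hm => ?_⟩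
  · rcases lt_or_ge m 0 with hneg | hm0
    · filter_upwards [self_mem_nhdsWithin] with z hz
      exact hneg.trans_le (h.level_spec hL hLδ hz.1 hz.2).1.1
    · have e := h.chordFun_pos_of_lt_level hL hLδ hy h0 hm0 hm
      have e' : ∀ᶠ z in 𝓝 y, 0 < h.chordFun m z := (hc m).continuousAt.eventually (lt_mem_nhds e)
      filter_upwards [self_mem_nhdsWithin, e'.filter_mono nhdsWithin_le_nhds] with z hz hz'
      by_contra! hcon
      obtain ⟨k1, k2⟩ := h.level_spec hL hLδ hz.1 hz.2
      rcases hcon.eq_or_lt with heq | hlt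
      · rw [heq] at k2; linarith
      · have := h.chordFun_neg_of_level_lt hL hLδ hz.1 hz.2 (hm.le.trans h1.2) hlt
        linarith
  · rcases lt_or_ge L m with hLm | hmL
    · filter_upwards [self_mem_nhdsWithin] with z hz
      exact (h.level_spec hL hLδ hz.1 hz.2).1.2.trans_lt hLm
    · have e := h.chordFun_neg_of_level_lt hL hLδ hy h0 hmL hm
      have e' : ∀ᶠ z in 𝓝 y, h.chordFun m z < 0 := (hc m).continuousAt.eventually (gt_mem_nhds e)
      filter_upwards [self_mem_nhdsWithin, e'.filter_mono nhdsWithin_le_nhds] with z hz hz'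
      by_contra! hcon
      obtain ⟨k1, k2⟩ := h.level_spec hL hLδ hz.1 hz.2
      rcases hcon.eq_or_lt with heq | hlt
      · rw [← heq] at k2; linarith
      · have := h.chordFun_pos_of_lt_level hL hLδ hz.1 hz.2 (h1.1.trans hm.le) hlt
        linarith

section full

variable {ε : ℝ}

/-- A chord of length 2ε touches the free boundary at its midpoint: it is the union of the left
tangent at its left end and the right tangent at its right end. Its equation therefore factors in
the coordinates uL, uR. -/
lemma chordFun_full {y : ℝ × ℝ} (hy : y ∈ strip ε) : h.chordFun (2 * ε) y =
    (uR ε y - h.right (2 * ε)) * (uL ε y - h.left (2 * ε)) := by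
  have := right_tangent_factor hy (h.right (2 * ε))
  simp only [right, chordFun] at this ⊢
  linear_combination this

lemma chordFun_full_nonpos_iff {y : ℝ × ℝ} (hy : y ∈ strip ε) :
    h.chordFun (2 * ε) y ≤ 0 ↔ h.left (2 * ε) ≤ uL ε y ∧ uR ε y ≤ h.right (2 * ε) := by
  rw [h.chordFun_full hy]
  have hd := uR_le_uL (ε := ε) (x := y)
  have hr : h.right (2 * ε) = h.left (2 * ε) + 2 * ε := rfl
  constructor
  · intro hle
    constructor
    · by_contra! hc
      have := mul_pos_of_neg_of_neg (show uR ε y - h.right (2 * ε) < 0 by linarith)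
        (show uL ε y - h.left (2 * ε) < 0 by linarith)
      linarith
    · by_contra! hc
      have := mul_pos (show 0 < uR ε y - h.right (2 * ε) by linarith)
        (show 0 < uL ε y - h.left (2 * ε) by linarith)
      linarith
  · rintro ⟨h1, h2⟩
    exact mul_nonpos_of_nonpos_of_nonneg (by linarith) (by linarith)

end full

end CupData

/-! ## Layouts: the data of a picture without long paths -/

/-- Cups and flat peaks with ends `a i`, `b i`, the vertices `w k` of the angles, and the derivatives
`MR i`, `ML i` of the slopes of the standard candidates on the tangent domains adjacent to the
`i`-th peak. -/
structure Layout (F F1 F2 : ℝ → ℝ) (ε : ℝ) (n : ℕ) where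
  a : Fin (n + 1) → EReal
  b : Fin (n + 1) → EReal
  w : Fin n → ℝ
  MR : Fin (n + 1) → ℝ → ℝ
  ML : Fin (n + 1) → ℝ → ℝ
  K : Fin (n + 1) → ℝ
  p : Fin (n + 1) → ℝ
  δ : Fin (n + 1) → ℝ
  isCup : Fin (n + 1) → Prop
  pos : 0 < ε
  deriv0 : ∀ t, HasDerivAt F (F1 t) t
  deriv1 : ∀ t, HasDerivAt F1 (F2 t) t
  cont : Continuous F2
  cup : ∀ i, isCup i → CupData F F1 F2 (p i) (δ i)
  cup_lt : ∀ i, isCup i → 2 * ε < δ i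
  cup_a : ∀ i (hi : isCup i), a i = ((cup i hi).left (2 * ε) : ℝ)
  cup_b : ∀ i (hi : isCup i), b i = ((cup i hi).right (2 * ε) : ℝ)
  cup_K : ∀ i (hi : isCup i), K i = (cup i hi).chordSlope (2 * ε)
  flat_le : ∀ i, ¬ isCup i → a i ≤ b i
  flat_sep : ∀ i, ¬ isCup i → ∀ s t : ℝ, (s : EReal) ≤ a i → b i ≤ t → s + 2 * ε ≤ t
  flat_eq : ∀ i, ¬ isCup i → a i = b i → a i = ⊥ ∨ a i = ⊤
  flat : ∀ i, ¬ isCup i → ∀ t : ℝ, a i ≤ t → t ≤ b i → F2 t = K i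
  b_lt_w : ∀ k : Fin n, b k.castSucc < w k
  w_lt_a : ∀ k : Fin n, (w k : EReal) < a k.succ
  MR_cont : ∀ i, Continuous (MR i)
  ML_cont : ∀ i, Continuous (ML i)
  MR_const : ∀ i, ∀ u : ℝ, u ≤ b i → MR i u = K i
  ML_const : ∀ i, ∀ u : ℝ, a i ≤ u → ML i u = K i
  MR_deriv : ∀ i, ∀ u : ℝ, b i < u → HasDerivAt (MR i) ((F2 u - MR i u) / ε) u
  ML_deriv : ∀ i, ∀ u : ℝ, u < a i → HasDerivAt (ML i) ((ML i u - F2 u) / ε) u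
  MR_gt : ∀ i, ∀ u : ℝ, b i < u →
    u < (Fin.snoc (α := fun _ => EReal) (fun k => (w k : EReal)) ⊤ : Fin (n + 1) → EReal) i →
    F2 u < MR i u
  ML_gt : ∀ i, ∀ u : ℝ, u < a i →
    (Fin.cons (α := fun _ => EReal) ⊥ (fun k => (w k : EReal)) : Fin (n + 1) → EReal) i < u →
    F2 u < ML i u
  M_eq : ∀ k : Fin n, MR k.castSucc (w k) = ML k.succ (w k)

namespace Layout

variable {F F1 F2 : ℝ → ℝ} {ε : ℝ} {n : ℕ} (Λ : Layout F F1 F2 ε n)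

/-- Right tangents beyond the next angle are replaced by the one at its vertex. -/
def capR (i : Fin (n + 1)) (u : ℝ) : ℝ :=
  (Fin.snoc (α := fun _ => ℝ) (fun k => min u (Λ.w k)) u : Fin (n + 1) → ℝ) i

def capL (i : Fin (n + 1)) (u : ℝ) : ℝ :=
  (Fin.cons (α := fun _ => ℝ) u (fun k => max u (Λ.w k)) : Fin (n + 1) → ℝ) i

@[simp] lemma capR_castSucc (k : Fin n) (u : ℝ) : Λ.capR k.castSucc u = min u (Λ.w k) := by
  simp [capR]
@[simp] lemma capR_last (u : ℝ) : Λ.capR (Fin.last n) u = u := by simp [capR]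
@[simp] lemma capL_succ (k : Fin n) (u : ℝ) : Λ.capL k.succ u = max u (Λ.w k) := by
  simp [capL]
@[simp] lemma capL_zero (u : ℝ) : Λ.capL 0 u = u := rfl

def wl : Fin (n + 1) → EReal := Fin.cons (α := fun _ => EReal) ⊥ fun k => (Λ.w k : EReal)

def wr : Fin (n + 1) → EReal := Fin.snoc (α := fun _ => EReal) (fun k => (Λ.w k : EReal)) ⊤

lemma capR_cases (i : Fin (n + 1)) (u : ℝ) :
    (Λ.capR i u = u ∧ (u : EReal) ≤ Λ.wr i) ∨
      ∃ k : Fin n, i = k.castSucc ∧ Λ.w k < u ∧ Λ.capR i u = Λ.w k := by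
  refine Fin.lastCases (by simp [wr]) (fun k => ?_) i
  rcases le_or_gt u (Λ.w k) with h | h
  · left; simp [wr, h]
  · right; exact ⟨k, rfl, h, by simp [h.le]⟩

lemma capL_cases (i : Fin (n + 1)) (u : ℝ) :
    (Λ.capL i u = u ∧ Λ.wl i ≤ u) ∨
      ∃ k : Fin n, i = k.succ ∧ u < Λ.w k ∧ Λ.capL i u = Λ.w k := by
  refine Fin.cases (by simp [wl]) (fun k => ?_) i
  rcases le_or_gt (Λ.w k) u with h | h
  · left; simp [wl, h]
  · right; exact ⟨k, rfl, h, by simp [h.le]⟩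

lemma capR_mono (i : Fin (n + 1)) : Monotone (Λ.capR i) := by
  refine Fin.lastCases ?_ (fun k => ?_) i
  · intro u v h; simpa
  · intro u v h; simp only [capR_castSucc]; exact min_le_min_right _ h

lemma capL_mono (i : Fin (n + 1)) : Monotone (Λ.capL i) := by
  refine Fin.cases ?_ (fun k => ?_) i
  · intro u v h; simpa
  · intro u v h; simp only [capL_succ]; exact max_le_max_right _ h

lemma continuous_capR (i : Fin (n + 1)) : Continuous (Λ.capR i) := by
  refine Fin.lastCases ?_ (fun k => ?_) i
  · have : Λ.capR (Fin.last n) = id := by funext u; simp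
    rw [this]; exact continuous_id
  · have : Λ.capR k.castSucc = fun u => min u (Λ.w k) := by funext u; simp
    rw [this]; fun_prop

lemma continuous_capL (i : Fin (n + 1)) : Continuous (Λ.capL i) := by
  refine Fin.cases ?_ (fun k => ?_) i
  · have : Λ.capL 0 = id := by funext u; simp
    rw [this]; exact continuous_id
  · have : Λ.capL k.succ = fun u => max u (Λ.w k) := by funext u; simp
    rw [this]; fun_prop

lemma capR_le (i : Fin (n + 1)) (u : ℝ) : Λ.capR i u ≤ u := by
  rcases Λ.capR_cases i u with h | ⟨k, -, h, e⟩
  · exact h.1.le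
  · rw [e]; exact h.le

lemma le_capL (i : Fin (n + 1)) (u : ℝ) : u ≤ Λ.capL i u := by
  rcases Λ.capL_cases i u with h | ⟨k, -, h, e⟩
  · exact h.1.ge
  · rw [e]; exact h.le

lemma capR_le_wr (i : Fin (n + 1)) (u : ℝ) : (Λ.capR i u : EReal) ≤ Λ.wr i := by
  rcases Λ.capR_cases i u with h | ⟨k, rfl, h, e⟩
  · rw [h.1]; exact h.2
  · rw [e]; simp [wr]

lemma wl_le_capL (i : Fin (n + 1)) (u : ℝ) : Λ.wl i ≤ Λ.capL i u := by
  rcases Λ.capL_cases i u with h | ⟨k, rfl, h, e⟩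
  · rw [h.1]; exact h.2
  · rw [e]; simp [wl]

lemma b_le_capR {i : Fin (n + 1)} {u : ℝ} (h : Λ.b i ≤ u) : Λ.b i ≤ Λ.capR i u := by
  rcases Λ.capR_cases i u with h' | ⟨k, rfl, h', e⟩
  · rwa [h'.1]
  · rw [e]; exact (Λ.b_lt_w k).le

lemma capL_le_a {i : Fin (n + 1)} {u : ℝ} (h : u ≤ Λ.a i) : Λ.capL i u ≤ Λ.a i := by
  rcases Λ.capL_cases i u with h' | ⟨k, rfl, h', e⟩
  · rwa [h'.1]
  · rw [e]; exact (Λ.w_lt_a k).le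

lemma b_le_wr (i : Fin (n + 1)) : Λ.b i ≤ Λ.wr i := by
  refine Fin.lastCases (by simp [wr]) (fun k => ?_) i
  simpa [wr] using (Λ.b_lt_w k).le

lemma wl_le_a (i : Fin (n + 1)) : Λ.wl i ≤ Λ.a i := by
  refine Fin.cases (by simp [wl]) (fun k => ?_) i
  simpa [wl] using (Λ.w_lt_a k).le

lemma capR_eq {i : Fin (n + 1)} {u : ℝ} (h : u ≤ Λ.wr i) : Λ.capR i u = u := by
  rcases Λ.capR_cases i u with h' | ⟨k, rfl, h', e⟩
  · exact h'.1
  · simp only [wr, Fin.snoc_castSucc, EReal.coe_le_coe_iff] at h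
    exact absurd h h'.not_ge

lemma capL_eq {i : Fin (n + 1)} {u : ℝ} (h : Λ.wl i ≤ u) : Λ.capL i u = u := by
  rcases Λ.capL_cases i u with h' | ⟨k, rfl, h', e⟩
  · exact h'.1
  · simp only [wl, Fin.cons_succ, EReal.coe_le_coe_iff] at h
    exact absurd h h'.not_ge

def Rp (i : Fin (n + 1)) (u : ℝ) : Plane := tp F F1 (Λ.capR i u) (Λ.MR i (Λ.capR i u) / 2)

def Lp (i : Fin (n + 1)) (u : ℝ) : Plane := tp F F1 (Λ.capL i u) (Λ.ML i (Λ.capL i u) / 2)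

lemma Rp_b {i : Fin (n + 1)} {u : ℝ} (h : Λ.b i = u) : Λ.Rp i u = tp F F1 u (Λ.K i / 2) := by
  rw [Rp, Λ.capR_eq (h ▸ Λ.b_le_wr i), Λ.MR_const i u h.ge]

lemma Lp_a {i : Fin (n + 1)} {u : ℝ} (h : Λ.a i = u) : Λ.Lp i u = tp F F1 u (Λ.K i / 2) := by
  rw [Lp, Λ.capL_eq (h ▸ Λ.wl_le_a i), Λ.ML_const i u h.le]

/-- A plane tangent to the curve at a point of a flat peak is tangent to it on the whole peak. -/
lemma flat_plane {i : Fin (n + 1)} (hi : ¬ Λ.isCup i) {s t : ℝ} (hs : Λ.a i ≤ s)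
    (hs' : s ≤ Λ.b i) (ht : Λ.a i ≤ t) (ht' : t ≤ Λ.b i) :
    tp F F1 s (Λ.K i / 2) = tp F F1 t (Λ.K i / 2) := by
  wlog hst : s ≤ t generalizing s t
  · exact (this ht ht' hs hs' (le_of_not_ge hst)).symm
  have hK : ∀ x ∈ Icc s t, F2 x = Λ.K i := fun x hx => Λ.flat i hi x
    (hs.trans (EReal.coe_le_coe_iff.2 hx.1)) (le_trans (EReal.coe_le_coe_iff.2 hx.2) ht')
  have key : ∀ (φ φ' : ℝ → ℝ), (∀ x, HasDerivAt φ (φ' x) x) → (∀ x ∈ Icc s t, φ' x = 0) →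
      φ s = φ t := fun φ φ' hd h0 =>
    (constant_of_has_deriv_right_zero (a := s) (b := t)
      (fun x _ => (hd x).continuousAt.continuousWithinAt)
      (fun x hx => by
        have := (hd x).hasDerivWithinAt (s := Ici x)
        rwa [h0 x (Ico_subset_Icc_self hx)] at this) t (right_mem_Icc.2 hst)).symm
  simp only [tp, Prod.mk.injEq, and_true]
  constructor
  · refine key (fun u => F u - u * F1 u + Λ.K i / 2 * u ^ 2) (fun u => u * (Λ.K i - F2 u))
      (fun x => ?_) fun x hx => by rw [hK x hx, sub_self, mul_zero]
    refine (((Λ.deriv0 x).sub ((hasDerivAt_id x).mul (Λ.deriv1 x))).add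
      (((hasDerivAt_id x).pow 2).const_mul (Λ.K i / 2))).congr_deriv ?_
    simp only [id]; push_cast; ring
  · refine key (fun u => F1 u - 2 * u * (Λ.K i / 2)) (fun u => F2 u - Λ.K i)
      (fun x => ?_) fun x hx => by rw [hK x hx, sub_self]
    refine ((Λ.deriv1 x).sub (((hasDerivAt_id x).const_mul 2).mul_const (Λ.K i / 2))).congr_deriv ?_
    ring

/-- The closed region of the `i`-th peak. -/
def Pk (i : Fin (n + 1)) : Set (ℝ × ℝ) := {x | x ∈ strip ε ∧ Λ.a i ≤ uL ε x ∧ uR ε x ≤ Λ.b i}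

open Classical in
-- On a flat peak every tangency point in [a i, b i] gives the same plane. The choice uL x lies in
-- that interval for x in the peak and avoids naming an end, which may be infinite.
def Kp (i : Fin (n + 1)) (x : ℝ × ℝ) : Plane :=
  if hi : Λ.isCup i then (Λ.cup i hi).chordPlane ((Λ.cup i hi).level (2 * ε) x)
  else tp F F1 (uL ε x) (Λ.K i / 2)

include Λ in
lemma two_eps_pos : 0 < 2 * ε := by linarith [Λ.pos]

section cup

variable {i : Fin (n + 1)} (hi : Λ.isCup i)

lemma mem_Pk_iff {x : ℝ × ℝ} : x ∈ Λ.Pk i ↔ x ∈ strip ε ∧ (Λ.cup i hi).chordFun (2 * ε) x ≤ 0 := by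
  rw [Pk, mem_ofPred_eq, Λ.cup_a i hi, Λ.cup_b i hi, EReal.coe_le_coe_iff, EReal.coe_le_coe_iff]
  exact and_congr_right fun hx => ((Λ.cup i hi).chordFun_full_nonpos_iff hx).symm

lemma Kp_cup (x : ℝ × ℝ) :
    Λ.Kp i x = (Λ.cup i hi).chordPlane ((Λ.cup i hi).level (2 * ε) x) := by rw [Kp, dif_pos hi]

lemma Lp_cup : Λ.Lp i ((Λ.cup i hi).left (2 * ε)) = (Λ.cup i hi).chordPlane (2 * ε) := by
  rw [Λ.Lp_a (Λ.cup_a i hi), Λ.cup_K i hi]; rfl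

lemma Rp_cup : Λ.Rp i ((Λ.cup i hi).right (2 * ε)) = (Λ.cup i hi).chordPlane (2 * ε) := by
  have h2 := Λ.two_eps_pos
  obtain ⟨-, -, h3⟩ := (Λ.cup i hi).left_spec h2 (Λ.cup_lt i hi)
  have hne : (Λ.cup i hi).left (2 * ε) ≠ (Λ.cup i hi).left (2 * ε) + 2 * ε := by linarith
  rw [Λ.Rp_b (Λ.cup_b i hi), Λ.cup_K i hi, CupData.chordPlane, CupData.chordSlope, if_neg h2.ne']
  exact (tp_chord hne h3).symm

/-- A point on or above the long chord is on or above all shorter ones, so the planes decrease at it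
as the chord grows. -/
lemma Kp_anti {x y : ℝ × ℝ} (hx : x ∈ Λ.Pk i) (hy : y ∈ strip ε)
    (h0 : 0 ≤ (Λ.cup i hi).chordFun (2 * ε) y) :
    ((Λ.cup i hi).chordPlane (2 * ε)).ev y ≤ (Λ.Kp i x).ev y := by
  rw [Λ.Kp_cup hi]
  rw [Λ.mem_Pk_iff hi] at hx
  obtain ⟨h1, -⟩ := (Λ.cup i hi).level_spec Λ.two_eps_pos.le (Λ.cup_lt i hi) hx.1.1 hx.2
  refine (Λ.cup i hi).chordPlane_anti h1.1 h1.2 (Λ.cup_lt i hi) y fun m hm => ?_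
  by_contra! hc
  have := (Λ.cup i hi).chordFun_neg_of_lt (h1.1.trans hm.1.le) hm.2 (Λ.cup_lt i hi) hy.1 hc.le
  linarith

lemma Kp_le_chord {y : ℝ × ℝ} (hy : y ∈ Λ.Pk i) :
    (Λ.Kp i y).ev y ≤ ((Λ.cup i hi).chordPlane (2 * ε)).ev y := by
  rw [Λ.Kp_cup hi]
  rw [Λ.mem_Pk_iff hi] at hy
  obtain ⟨h1, -⟩ := (Λ.cup i hi).level_spec Λ.two_eps_pos.le (Λ.cup_lt i hi) hy.1.1 hy.2
  exact (Λ.cup i hi).chordPlane_mono h1.1 h1.2 (Λ.cup_lt i hi) y fun m hm =>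
    ((Λ.cup i hi).chordFun_neg_of_level_lt Λ.two_eps_pos.le (Λ.cup_lt i hi) hy.1.1 hy.2 hm.2.le
      hm.1).le

end cup

section flat

variable {i : Fin (n + 1)} (hi : ¬ Λ.isCup i)
include hi

lemma Kp_flat {x : ℝ × ℝ} (hx : x ∈ Λ.Pk i) {t : ℝ} (ht : Λ.a i ≤ t) (ht' : t ≤ Λ.b i) :
    Λ.Kp i x = tp F F1 t (Λ.K i / 2) := by
  rw [Kp, dif_neg hi]
  exact Λ.flat_plane hi hx.2.1
    (le_trans (EReal.coe_le_coe_iff.2 (uL_le_uR Λ.pos hx.1)) hx.2.2) ht ht'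

lemma Kp_flat_R {x : ℝ × ℝ} (hx : x ∈ Λ.Pk i) {u : ℝ} (hu : Λ.b i = u) : Λ.Kp i x = Λ.Rp i u := by
  rw [Λ.Rp_b hu, Λ.Kp_flat hi hx (hu ▸ Λ.flat_le i hi) hu.ge]

lemma Kp_flat_L {x : ℝ × ℝ} (hx : x ∈ Λ.Pk i) {u : ℝ} (hu : Λ.a i = u) : Λ.Kp i x = Λ.Lp i u := by
  rw [Λ.Lp_a hu, Λ.Kp_flat hi hx hu.le (hu ▸ Λ.flat_le i hi)]

end flat

lemma Pk_closed (i : Fin (n + 1)) : IsClosed (Λ.Pk i) := by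
  have h1 : Continuous fun x => (uL ε x : EReal) := continuous_coe_real_ereal.comp (continuous_uL ε)
  have h2 : Continuous fun x => (uR ε x : EReal) := continuous_coe_real_ereal.comp (continuous_uR ε)
  exact (isClosed_strip ε).inter ((isClosed_le continuous_const h1).inter
    (isClosed_le h2 continuous_const))

lemma Kp_cont (i : Fin (n + 1)) : ContinuousOn (Λ.Kp i) (Λ.Pk i) := by
  by_cases hi : Λ.isCup i
  · have h2 := Λ.two_eps_pos.le
    have e1 := (Λ.cup i hi).continuousOn_chordPlane
    have e2 := (Λ.cup i hi).continuousOn_level h2 (Λ.cup_lt i hi)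
    have hsub : ∀ x ∈ Λ.Pk i, x.1 ^ 2 ≤ x.2 ∧ (Λ.cup i hi).chordFun (2 * ε) x ≤ 0 := fun x hx => by
      rw [Λ.mem_Pk_iff hi] at hx; exact ⟨hx.1.1, hx.2⟩
    refine ((e1.comp (e2.mono hsub)) fun x hx => ?_).congr fun x _ => Λ.Kp_cup hi x
    obtain ⟨h3, -⟩ := (Λ.cup i hi).level_spec h2 (Λ.cup_lt i hi) (hsub x hx).1 (hsub x hx).2
    exact ⟨h3.1, h3.2.trans_lt (Λ.cup_lt i hi)⟩
  · refine ContinuousOn.congr (f := fun x => tp F F1 (uL ε x) (Λ.K i / 2)) ?_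
      fun x _ => by rw [Kp, dif_neg hi]
    exact ((continuous_tp Λ.deriv0 Λ.deriv1).comp
      ((continuous_uL ε).prodMk continuous_const)).continuousOn

lemma R_anti (i : Fin (n + 1)) (u u' : ℝ) (y : ℝ × ℝ) (hy : y ∈ strip ε) (hb : Λ.b i ≤ u)
    (huu' : u ≤ u') (hu' : u' ≤ uR ε y) : (Λ.Rp i u').ev y ≤ (Λ.Rp i u).ev y :=
  right_branch_anti Λ.deriv0 Λ.deriv1 Λ.pos (Λ.capR_mono i huu') (Λ.MR_cont i).continuousOn
    (fun v hv => Λ.MR_deriv i v ((Λ.b_le_capR hb).trans_lt (EReal.coe_lt_coe_iff.2 hv.1)))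
    (fun v hv => (Λ.MR_gt i v ((Λ.b_le_capR hb).trans_lt (EReal.coe_lt_coe_iff.2 hv.1))
      ((EReal.coe_lt_coe_iff.2 hv.2).trans_le (Λ.capR_le_wr i u'))).le) hy
    ((Λ.capR_le i u').trans hu')

lemma R_mono (i : Fin (n + 1)) (u u' : ℝ) (y : ℝ × ℝ) (hy : y ∈ strip ε) (hb : Λ.b i ≤ u)
    (huu' : u ≤ u') (hu : uR ε y ≤ u) (hu' : u' ≤ uL ε y + 2 * ε) :
    (Λ.Rp i u).ev y ≤ (Λ.Rp i u').ev y := by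
  rcases Λ.capR_cases i u with h | ⟨k, rfl, h, e⟩
  · refine right_branch_mono Λ.deriv0 Λ.deriv1 Λ.pos (Λ.capR_mono i huu') (Λ.MR_cont i).continuousOn
      (fun v hv => Λ.MR_deriv i v ((Λ.b_le_capR hb).trans_lt (EReal.coe_lt_coe_iff.2 hv.1)))
      (fun v hv => (Λ.MR_gt i v ((Λ.b_le_capR hb).trans_lt (EReal.coe_lt_coe_iff.2 hv.1))
        ((EReal.coe_lt_coe_iff.2 hv.2).trans_le (Λ.capR_le_wr i u'))).le) hy ?_
      ((Λ.capR_le i u').trans hu')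
    rw [h.1]; exact hu
  · rw [Rp, Rp, e, Λ.capR_castSucc, min_eq_right (h.le.trans huu')]

lemma L_mono (i : Fin (n + 1)) (u u' : ℝ) (y : ℝ × ℝ) (hy : y ∈ strip ε) (ha : u' ≤ Λ.a i)
    (huu' : u ≤ u') (hu : uL ε y ≤ u) : (Λ.Lp i u).ev y ≤ (Λ.Lp i u').ev y :=
  left_branch_mono Λ.deriv0 Λ.deriv1 Λ.pos (Λ.capL_mono i huu') (Λ.ML_cont i).continuousOn
    (fun v hv => Λ.ML_deriv i v ((EReal.coe_lt_coe_iff.2 hv.2).trans_le (Λ.capL_le_a ha)))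
    (fun v hv => (Λ.ML_gt i v ((EReal.coe_lt_coe_iff.2 hv.2).trans_le (Λ.capL_le_a ha))
      ((Λ.wl_le_capL i u).trans_lt (EReal.coe_lt_coe_iff.2 hv.1))).le) hy
    (hu.trans (Λ.le_capL i u))

lemma L_anti (i : Fin (n + 1)) (u u' : ℝ) (y : ℝ × ℝ) (hy : y ∈ strip ε) (ha : u' ≤ Λ.a i)
    (huu' : u ≤ u') (hu : uR ε y ≤ u + 2 * ε) (hu' : u' ≤ uL ε y) :
    (Λ.Lp i u').ev y ≤ (Λ.Lp i u).ev y := by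
  rcases Λ.capL_cases i u' with h | ⟨k, rfl, h, e⟩
  · refine left_branch_anti Λ.deriv0 Λ.deriv1 Λ.pos (Λ.capL_mono i huu') (Λ.ML_cont i).continuousOn
      (fun v hv => Λ.ML_deriv i v ((EReal.coe_lt_coe_iff.2 hv.2).trans_le (Λ.capL_le_a ha)))
      (fun v hv => (Λ.ML_gt i v ((EReal.coe_lt_coe_iff.2 hv.2).trans_le (Λ.capL_le_a ha))
        ((Λ.wl_le_capL i u).trans_lt (EReal.coe_lt_coe_iff.2 hv.1))).le) hy
      (hu.trans (by linarith [Λ.le_capL i u])) ?_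
    rw [h.1]; exact hu'
  · rw [Lp, Lp, e, Λ.capL_succ, max_eq_right (huu'.trans h.le)]

def foliation : PlaneFoliation ε n where
  a := Λ.a
  b := Λ.b
  w := Λ.w
  Rp := Λ.Rp
  Lp := Λ.Lp
  Pk := Λ.Pk
  Kp := Λ.Kp
  a_le_b i := by
    by_cases hi : Λ.isCup i
    · rw [Λ.cup_a i hi, Λ.cup_b i hi, EReal.coe_le_coe_iff, CupData.right]
      linarith [Λ.two_eps_pos]
    · exact Λ.flat_le i hi
  sep i s t hs ht := by
    by_cases hi : Λ.isCup i
    · rw [Λ.cup_a i hi, EReal.coe_le_coe_iff] at hs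
      rw [Λ.cup_b i hi, EReal.coe_le_coe_iff, CupData.right] at ht
      linarith
    · exact Λ.flat_sep i hi s t hs ht
  b_lt_w := Λ.b_lt_w
  w_lt_a := Λ.w_lt_a
  R_anti := Λ.R_anti
  R_mono := Λ.R_mono
  L_mono := Λ.L_mono
  L_anti := Λ.L_anti
  R_const k u hu := by simp [Rp, hu]
  L_const k u hu := by simp [Lp, hu]
  R_eq_L k := by simp [Rp, Lp, Λ.M_eq]
  R_cont i := by
    have h1 := Λ.continuous_capR i
    have h2 := (Λ.MR_cont i).comp h1
    exact ((continuous_tp Λ.deriv0 Λ.deriv1).comp (h1.prodMk (h2.div_const 2))).continuousOn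
  L_cont i := by
    have h1 := Λ.continuous_capL i
    have h2 := (Λ.ML_cont i).comp h1
    exact ((continuous_tp Λ.deriv0 Λ.deriv1).comp (h1.prodMk (h2.div_const 2))).continuousOn
  Pk_sub i x hx := hx
  Pk_closed := Λ.Pk_closed
  mem_Pk i x hx ha hb := ⟨hx, ha.le, hb.le⟩
  K_cont := Λ.Kp_cont
  K_eq_R i x hx hu := by
    by_cases hi : Λ.isCup i
    · have h2 := Λ.two_eps_pos.le
      rw [Λ.cup_b i hi, EReal.coe_eq_coe_iff] at hu
      have hx' := (Λ.mem_Pk_iff hi).1 hx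
      rw [← hu, Λ.Rp_cup hi, Λ.Kp_cup hi, (Λ.cup i hi).level_unique h2 (Λ.cup_lt i hi) hx'.1.1 hx'.2
        (right_mem_Icc.2 h2)]
      rw [(Λ.cup i hi).chordFun_full hx.1, ← hu, sub_self, zero_mul]
    · exact Λ.Kp_flat_R hi hx hu
  K_eq_L i x hx hu := by
    by_cases hi : Λ.isCup i
    · have h2 := Λ.two_eps_pos.le
      rw [Λ.cup_a i hi, EReal.coe_eq_coe_iff] at hu
      have hx' := (Λ.mem_Pk_iff hi).1 hx
      rw [← hu, Λ.Lp_cup hi, Λ.Kp_cup hi, (Λ.cup i hi).level_unique h2 (Λ.cup_lt i hi) hx'.1.1 hx'.2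
        (right_mem_Icc.2 h2)]
      rw [(Λ.cup i hi).chordFun_full hx.1, ← hu, sub_self, mul_zero]
    · exact Λ.Kp_flat_L hi hx hu
  K_ge_R i x hx y hy u hu huy := by
    by_cases hi : Λ.isCup i
    · rw [Λ.cup_b i hi, EReal.coe_eq_coe_iff] at hu
      rw [← hu] at huy ⊢
      rw [Λ.Rp_cup hi]
      refine Λ.Kp_anti hi hx hy ?_
      rw [(Λ.cup i hi).chordFun_full hy]
      have := uR_le_uL (ε := ε) (x := y)
      rw [CupData.right] at huy ⊢
      exact mul_nonneg (by linarith) (by linarith)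
    · rw [Λ.Kp_flat_R hi hx hu]
  K_ge_L i x hx y hy u hu huy := by
    by_cases hi : Λ.isCup i
    · rw [Λ.cup_a i hi, EReal.coe_eq_coe_iff] at hu
      rw [← hu] at huy ⊢
      rw [Λ.Lp_cup hi]
      refine Λ.Kp_anti hi hx hy ?_
      rw [(Λ.cup i hi).chordFun_full hy]
      have := uR_le_uL (ε := ε) (x := y)
      rw [CupData.right]
      exact mul_nonneg_of_nonpos_of_nonpos (by linarith) (by linarith)
    · rw [Λ.Kp_flat_L hi hx hu]
  K_le_R i y hy u hu := by
    by_cases hi : Λ.isCup i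
    · rw [Λ.cup_b i hi, EReal.coe_eq_coe_iff] at hu
      rw [← hu, Λ.Rp_cup hi]
      exact Λ.Kp_le_chord hi hy
    · rw [Λ.Kp_flat_R hi hy hu]
  K_le_L i y hy u hu := by
    by_cases hi : Λ.isCup i
    · rw [Λ.cup_a i hi, EReal.coe_eq_coe_iff] at hu
      rw [← hu, Λ.Lp_cup hi]
      exact Λ.Kp_le_chord hi hy
    · rw [Λ.Kp_flat_L hi hy hu]
  K_le i x hx y hy := by
    by_cases hi : Λ.isCup i
    · have h2 := Λ.two_eps_pos.le
      have hx' := (Λ.mem_Pk_iff hi).1 hx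
      have hy' := (Λ.mem_Pk_iff hi).1 hy
      obtain ⟨hx1, -⟩ := (Λ.cup i hi).level_spec h2 (Λ.cup_lt i hi) hx'.1.1 hx'.2
      obtain ⟨hy1, -⟩ := (Λ.cup i hi).level_spec h2 (Λ.cup_lt i hi) hy'.1.1 hy'.2
      rw [Λ.Kp_cup hi, Λ.Kp_cup hi]
      rcases le_total ((Λ.cup i hi).level (2 * ε) y) ((Λ.cup i hi).level (2 * ε) x) with hle | hle
      · exact (Λ.cup i hi).chordPlane_mono hy1.1 hle (hx1.2.trans_lt (Λ.cup_lt i hi)) y fun m hm =>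
          ((Λ.cup i hi).chordFun_neg_of_level_lt h2 (Λ.cup_lt i hi) hy'.1.1 hy'.2
            (hm.2.le.trans hx1.2) hm.1).le
      · exact (Λ.cup i hi).chordPlane_anti hx1.1 hle (hy1.2.trans_lt (Λ.cup_lt i hi)) y fun m hm =>
          ((Λ.cup i hi).chordFun_pos_of_lt_level h2 (Λ.cup_lt i hi) hy'.1.1 hy'.2
            (hx1.1.trans hm.1.le) hm.2).le
    · rw [Λ.Kp_flat hi hx hy.2.1 (le_trans (EReal.coe_le_coe_iff.2 (uL_le_uR Λ.pos hy.1)) hy.2.2),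
        Λ.Kp_flat hi hy hy.2.1 (le_trans (EReal.coe_le_coe_iff.2 (uL_le_uR Λ.pos hy.1)) hy.2.2)]
  L_eq_R i s t hs ht _ := by
    by_cases hi : Λ.isCup i
    · rw [Λ.cup_a i hi, EReal.coe_eq_coe_iff] at hs
      rw [Λ.cup_b i hi, EReal.coe_eq_coe_iff] at ht
      rw [← hs, ← ht, Λ.Lp_cup hi, Λ.Rp_cup hi]
    · have hle := Λ.flat_le i hi
      rw [Λ.Lp_a hs, Λ.Rp_b ht, Λ.flat_plane hi hs.le (hs ▸ hle) (ht ▸ hle) ht.ge]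

end Layout

/-! ## One side of a peak -/

/-- `g` with the values on `(-∞, b]` replaced by `K`. -/
def flatten (g : ℝ → ℝ) (b : EReal) (K : ℝ) (t : ℝ) : ℝ := if (t : EReal) ≤ b then K else g t

lemma flatten_of_le {g : ℝ → ℝ} {b : EReal} {K t : ℝ} (h : t ≤ b) : flatten g b K t = K := if_pos h

lemma flatten_of_lt {g : ℝ → ℝ} {b : EReal} {K t : ℝ} (h : b < t) : flatten g b K t = g t :=
  if_neg h.not_ge

lemma flatten_bot (g : ℝ → ℝ) (K : ℝ) : flatten g ⊥ K = g := by
  funext t; exact flatten_of_lt (EReal.bot_lt_coe t)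

lemma measurable_flatten {g : ℝ → ℝ} (hg : Measurable g) (b : EReal) (K : ℝ) :
    Measurable (flatten g b K) := by
  refine Measurable.ite ?_ measurable_const hg
  exact measurableSet_le measurable_coe_real_ereal measurable_const

lemma ExpBound.const {C Λ K : ℝ} {g : ℝ → ℝ} (hΛ : 0 ≤ Λ) (h : ExpBound C Λ g) (t : ℝ) :
    |K| ≤ (C + |K|) * Real.exp (Λ * |t|) := by
  have h1 : 1 ≤ Real.exp (Λ * |t|) := Real.one_le_exp (by positivity)
  nlinarith [mul_le_mul_of_nonneg_left h1 (abs_nonneg K), h.nonneg, abs_nonneg K,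
    mul_nonneg h.nonneg (Real.exp_pos (Λ * |t|)).le]

lemma ExpBound.le_add {C Λ K : ℝ} {g : ℝ → ℝ} (h : ExpBound C Λ g) (t : ℝ) :
    |g t| ≤ (C + |K|) * Real.exp (Λ * |t|) := by
  have := h t
  nlinarith [mul_nonneg (abs_nonneg K) (Real.exp_pos (Λ * |t|)).le]

lemma ExpBound.flatten {C Λ : ℝ} {g : ℝ → ℝ} (hΛ : 0 ≤ Λ) (h : ExpBound C Λ g) (b : EReal) (K : ℝ) :
    ExpBound (C + |K|) Λ (flatten g b K) := fun t => by
  unfold Bellman.flatten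
  split_ifs
  · exact h.const hΛ t
  · exact h.le_add t

/-- `g` is non-increasing on `[c, e]`, and not constant near `c`. -/
structure Descends (g : ℝ → ℝ) (c e : EReal) : Prop where
  anti : ∀ x y : ℝ, c ≤ x → x ≤ y → y ≤ e → g y ≤ g x
  strict : ∀ x : ℝ, c < x → x ≤ e → ∃ y : ℝ, c < y ∧ y < x ∧ g x < g y

/-- `g` is non-decreasing on `[e, c]`, and not constant near `e`. -/
structure Ascends (g : ℝ → ℝ) (e : ℝ) (c : EReal) : Prop where
  mono : ∀ x y : ℝ, e ≤ x → x ≤ y → y ≤ c → g x ≤ g y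
  strict : ∀ x : ℝ, e < x → x < c → ∃ y : ℝ, e < y ∧ y < x ∧ g y < g x

/-- The slope of a tangent domain that begins at `b` with the value `K`. -/
def branch (ε : ℝ) (g : ℝ → ℝ) (b : EReal) (K : ℝ) : ℝ → ℝ := avR ε (flatten g b K)

section branch

variable {ε C Λ K : ℝ} {g : ℝ → ℝ} {b c e : EReal} (hε : 0 < ε) (hΛ : 0 ≤ Λ) (hεΛ : Λ * ε < 1)
  (hg : Continuous g) (hb : ExpBound C Λ g)

include hε in
lemma branch_const {u : ℝ} (hu : u ≤ b) : branch ε g b K u = K :=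
  avR_eq_of_const hε fun _ ht => flatten_of_le (le_trans (EReal.coe_le_coe_iff.2 ht) hu)

include hε hΛ hεΛ hg hb

lemma continuous_branch (b : EReal) (K : ℝ) : Continuous (branch ε g b K) :=
  continuous_avR hε hΛ hεΛ (measurable_flatten hg.measurable b K) (hb.flatten hΛ b K)

lemma hasDerivAt_branch {u : ℝ} (hu : b < u) :
    HasDerivAt (branch ε g b K) ((g u - branch ε g b K u) / ε) u := by
  have he : flatten g b K =ᶠ[𝓝 u] g := by
    have : ∀ᶠ t : ℝ in 𝓝 u, b < t :=
      continuous_coe_real_ereal.continuousAt.eventually (lt_mem_nhds hu)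
    filter_upwards [this] with t ht using flatten_of_lt ht
  have := hasDerivAt_avR hε hΛ hεΛ (measurable_flatten hg.measurable b K) (hb.flatten hΛ b K)
    (hg.continuousAt.congr he.symm)
  rwa [flatten_of_lt hu] at this

/-- All the averaged values are at least g u. Strictness on a half-line comes from K > g u to the
left of a finite b, and from the strict descent of g when b = -∞. -/
lemma lt_branch (hd : Descends g c e) (hcb : c ≤ b)
    (hK : ∀ u : ℝ, b < u → u ≤ e → b ≠ ⊥ → g u < K) {u : ℝ} (hbu : b < u) (hue : u ≤ e) :
    g u < branch ε g b K u := by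
  have h1 : ∀ t ≤ u, g u ≤ flatten g b K t := fun t ht => by
    rcases le_or_gt (t : EReal) b with h | h
    · rw [flatten_of_le h]
      exact (hK u hbu hue fun hb0 => by simp [hb0] at h).le
    · rw [flatten_of_lt h]
      exact hd.anti t u (hcb.trans h.le) ht hue
  obtain ⟨y, hyu, hy⟩ : ∃ y ≤ u, ∀ t ≤ y, g u < flatten g b K t := by
    by_cases hb0 : b = ⊥
    · obtain ⟨y, hy1, hy2, hy3⟩ := hd.strict u (hcb.trans_lt hbu) hue
      refine ⟨y, hy2.le, fun t ht => ?_⟩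
      have hc : c = ⊥ := le_bot_iff.1 (hb0 ▸ hcb)
      rw [hb0, flatten_bot]
      exact hy3.trans_le (hd.anti t y (by simp [hc]) ht
        (le_trans (EReal.coe_le_coe_iff.2 hy2.le) hue))
    · lift b to ℝ using ⟨fun h => by simp [h] at hbu, hb0⟩
      refine ⟨b, (EReal.coe_lt_coe_iff.1 hbu).le, fun t ht => ?_⟩
      rw [flatten_of_le (EReal.coe_le_coe_iff.2 ht)]
      exact hK u hbu hue hb0
  exact lt_avR hε hΛ hεΛ (measurable_flatten hg.measurable b K) (hb.flatten hΛ b K) hyu h1 hy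

/-- On an interval where `g` increases, the branch has been above `g` if it ends above `g`. -/
lemma lt_branch_of_lt {v : ℝ} (ha : Ascends g v c) {u w : ℝ} (hbu : b < u) (hvu : v ≤ u)
    (huw : u ≤ w) (hwc : w ≤ c) (hw : g w < branch ε g b K w) : g u < branch ε g b K u := by
  by_contra! hcon
  -- A branch that is at most g at u cannot rise above g w by the time w, because the values
  -- averaged in between do not exceed g w.
  refine absurd hw (not_lt.2 ?_)
  refine avR_le_of_le hε hΛ hεΛ (measurable_flatten hg.measurable b K) (hb.flatten hΛ b K) huw
    (hcon.trans (ha.mono u w hvu huw hwc)) fun t h1 h2 => ?_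
  rw [flatten_of_lt (hbu.trans (EReal.coe_lt_coe_iff.2 h1))]
  exact ha.mono t w (hvu.trans h1.le) h2 hwc

end branch

/-- As ε → 0 the average at d forgets what lies beyond v, and g is smaller than g d by a fixed
amount on an interval right after v. The bound is uniform in b and K because the ends and slopes of
cups depend on ε. -/
lemma eventually_branch_lt {C Λ K₀ v d : ℝ} {g : ℝ → ℝ} {c : EReal} (hΛ : 0 ≤ Λ)
    (hg : Continuous g) (hb : ExpBound C Λ g) (ha : Ascends g v c) (hvd : v < d) (hdc : d < c) :
    ∀ᶠ ε in 𝓝[>] (0 : ℝ), ∀ (b : EReal) (K : ℝ), b ≤ v → K ≤ K₀ → branch ε g b K d < g d := by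
  obtain ⟨y, hy1, hy2, hy3⟩ := ha.strict d hvd hdc
  filter_upwards [eventually_avR_lt (C := C + |K₀|) (G := g d) hΛ hy1 hy2.le (sub_pos.2 hy3)]
    with ε hε b K hbv hK
  refine hε _ (measurable_flatten hg.measurable b K) ⟨_, hb.flatten hΛ b K⟩ (fun t _ => ?_)
    (fun t h1 h2 => ?_) (fun t h1 h2 => ?_)
  · unfold flatten
    split_ifs
    · exact (hK.trans (le_abs_self K₀)).trans (hb.const hΛ t)
    · exact (le_abs_self _).trans (hb.le_add t)
  · rw [flatten_of_lt (hbv.trans_lt (EReal.coe_lt_coe_iff.2 h1)), sub_sub_cancel]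
    exact ha.mono t y h1.le h2 ((EReal.coe_lt_coe_iff.2 hy2).trans hdc).le
  · rw [flatten_of_lt (hbv.trans_lt (EReal.coe_lt_coe_iff.2 (hy1.trans h1)))]
    exact ha.mono t d (hy1.trans h1).le h2 hdc.le

/-! ## The vertex of an angle -/

/-- `f''` between two neighbouring peaks. -/
structure Valley (g : ℝ → ℝ) (c : EReal) (vl vr : ℝ) (c' : EReal) : Prop where
  left_lt : c < vl
  le : vl ≤ vr
  lt_right : vr < c'
  descR : Descends g c vr
  ascR : Ascends g vr c'
  descL : Descends (fun t => g (-t)) (-c') ((-vl : ℝ) : EReal)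
  ascL : Ascends (fun t => g (-t)) (-vl) (-c)

/-- `w` is the vertex of an angle between the right branch that begins at `b` and the left branch
that begins at `a`. -/
structure IsAngleVertex (ε : ℝ) (g : ℝ → ℝ) (b a : EReal) (K K' w : ℝ) : Prop where
  left_lt : b < w
  lt_right : w < a
  eq : branch ε g b K w = branch ε (fun t => g (-t)) (-a) K' (-w)
  gt_R : ∀ u : ℝ, b < u → u < w → g u < branch ε g b K u
  gt_L : ∀ u : ℝ, w < u → u < a → g u < branch ε (fun t => g (-t)) (-a) K' (-u)

/-- At d the right branch is above g and the left branch below it; at d' the roles are exchanged.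
The branches therefore take a common value in between. -/
lemma Valley.exists_isAngleVertex {ε C Λ K K' vl vr d d' : ℝ} {g : ℝ → ℝ} {c c' b a : EReal}
    (hε : 0 < ε) (hΛ : 0 ≤ Λ) (hεΛ : Λ * ε < 1) (hg : Continuous g) (hb : ExpBound C Λ g)
    (hv : Valley g c vl vr c') (hcb : c ≤ b) (hac : a ≤ c')
    (hK : ∀ u : ℝ, b < u → (u : EReal) ≤ vr → b ≠ ⊥ → g u < K)
    (hK' : ∀ u : ℝ, u < a → (vl : EReal) ≤ u → a ≠ ⊤ → g u < K')
    (hbd : b < d) (hdv : d < vl) (hvd' : vr < d') (hd'a : d' < a)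
    (h1 : branch ε (fun t => g (-t)) (-a) K' (-d) < g d) (h2 : branch ε g b K d' < g d') :
    ∃ w, d < w ∧ w < d' ∧ IsAngleVertex ε g b a K K' w := by
  have hgn : Continuous fun t => g (-t) := by fun_prop
  have hbn := hb.comp_neg
  have hvv := hv.le
  have nearR : ∀ u : ℝ, b < u → u ≤ vr → g u < branch ε g b K u := fun u h h' =>
    lt_branch hε hΛ hεΛ hg hb hv.descR hcb hK h (EReal.coe_le_coe_iff.2 h')
  have nearL : ∀ u : ℝ, u < a → vl ≤ u → g u < branch ε (fun t => g (-t)) (-a) K' (-u) := by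
    intro u h h'
    have := lt_branch (K := K') (b := -a) (u := -u) hε hΛ hεΛ hgn hbn hv.descL
      (EReal.neg_le_neg_iff.2 hac) (fun x hx hx' hx'' => ?_) ?_ ?_
    · rwa [neg_neg] at this
    · refine hK' (-x) ?_ (EReal.coe_le_coe_iff.2 ?_) (fun h => hx'' (by simp [h]))
      · rw [EReal.coe_neg]; exact EReal.neg_lt_comm.1 hx
      · have := EReal.coe_le_coe_iff.1 hx'; linarith
    · rw [EReal.coe_neg]; exact EReal.neg_lt_neg_iff.2 h
    · exact EReal.coe_le_coe_iff.2 (by linarith)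
  have hc : Continuous fun u => branch ε g b K u - branch ε (fun t => g (-t)) (-a) K' (-u) :=
    (continuous_branch hε hΛ hεΛ hg hb b K).sub
      ((continuous_branch hε hΛ hεΛ hgn hbn (-a) K').comp continuous_neg)
  have e1 := nearR d hbd (by linarith)
  have e2 := nearL d' hd'a (by linarith)
  obtain ⟨w, hw, hw0⟩ := intermediate_value_Ioo' (a := d) (b := d') (by linarith) hc.continuousOn
    (show (0 : ℝ) ∈ _ from ⟨by linarith, by linarith⟩)
  have hbw : b < w := hbd.trans (EReal.coe_lt_coe_iff.2 hw.1)
  have hwa : w < a := (EReal.coe_lt_coe_iff.2 hw.2).trans hd'a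
  have hweq : branch ε g b K w = branch ε (fun t => g (-t)) (-a) K' (-w) := sub_eq_zero.1 hw0
  refine ⟨w, hw.1, hw.2, hbw, hwa, hweq, fun u hbu huw => ?_, fun u hwu hua => ?_⟩
  · rcases le_or_gt u vr with h | h
    · exact nearR u hbu h
    -- Here u, hence w, is beyond the root, where g ascends. At w the right branch equals the left
    -- one, which is above g there, and this inequality propagates back to u.
    · refine lt_branch_of_lt hε hΛ hεΛ hg hb hv.ascR hbu h.le huw.le (hwa.le.trans hac) ?_
      rw [hweq]; exact nearL w hwa (by linarith)
  · rcases le_or_gt vl u with h | h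
    · exact nearL u hua h
    · have := lt_branch_of_lt (K := K') (b := -a) (u := -u) (w := -w) hε hΛ hεΛ hgn hbn hv.ascL
        ?_ (by linarith) (by linarith) ?_ ?_
      · rwa [neg_neg] at this
      · rw [EReal.coe_neg]; exact EReal.neg_lt_neg_iff.2 hua
      · rw [EReal.coe_neg]; exact EReal.neg_le_neg_iff.2 (hcb.trans hbw.le)
      · rw [neg_neg, ← hweq]; exact nearR w hbw (by linarith)

/-- The vertices of the angles cannot stay away from the root of `f'''`. -/
lemma Valley.eventually_vertex_le {C Λ K₀ vl vr d : ℝ} {g : ℝ → ℝ} {c c' : EReal} (hΛ : 0 ≤ Λ)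
    (hg : Continuous g) (hb : ExpBound C Λ g) (hv : Valley g c vl vr c') (hd : vr < d) :
    ∀ᶠ ε in 𝓝[>] (0 : ℝ), ∀ (b a : EReal) (K K' w : ℝ), b ≤ vr → a ≤ c' → K ≤ K₀ →
      IsAngleVertex ε g b a K K' w → w < d := by
  obtain ⟨x, hx1, hx2⟩ := EReal.lt_iff_exists_real_btwn.1 hv.lt_right
  rw [EReal.coe_lt_coe_iff] at hx1
  have h1 : vr < min x d := lt_min hx1 hd
  -- At a point y between the root and d the right branch is eventually below g, while a vertex at
  -- or beyond d would need it above g at y.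
  obtain ⟨y, hy1, hy2⟩ := exists_between h1
  have h2 : (y : EReal) < c' := (EReal.coe_lt_coe_iff.2 (hy2.trans_le (min_le_left _ _))).trans hx2
  filter_upwards [eventually_branch_lt (K₀ := K₀) hΛ hg hb hv.ascR hy1 h2]
    with ε hε b a K K' w hbv hac hK hw
  by_contra! hcon
  have h3 := hw.gt_R y (hbv.trans_lt (EReal.coe_lt_coe_iff.2 hy1))
    ((hy2.trans_le (min_le_right _ _)).trans_le hcon)
  exact lt_asymm h3 (hε b K hbv hK)

lemma Valley.eventually_lt_vertex {C Λ K₀ vl vr d : ℝ} {g : ℝ → ℝ} {c c' : EReal} (hΛ : 0 ≤ Λ)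
    (hg : Continuous g) (hb : ExpBound C Λ g) (hv : Valley g c vl vr c') (hd : d < vl) :
    ∀ᶠ ε in 𝓝[>] (0 : ℝ), ∀ (b a : EReal) (K K' w : ℝ), (vl : EReal) ≤ a → K' ≤ K₀ →
      IsAngleVertex ε g b a K K' w → d < w := by
  obtain ⟨x, hx1, hx2⟩ := EReal.lt_iff_exists_real_btwn.1 hv.left_lt
  rw [EReal.coe_lt_coe_iff] at hx2
  obtain ⟨y, hy1, hy2⟩ := exists_between (max_lt hx2 hd)
  have h2 : c < (y : EReal) := hx1.trans (EReal.coe_lt_coe_iff.2 ((le_max_left _ _).trans_lt hy1))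
  have hgn : Continuous fun t => g (-t) := by fun_prop
  have h3 : ((-y : ℝ) : EReal) < -c := by rw [EReal.coe_neg]; exact EReal.neg_lt_neg_iff.2 h2
  filter_upwards [eventually_branch_lt (K₀ := K₀) hΛ hgn hb.comp_neg hv.ascL (neg_lt_neg hy2) h3]
    with ε hε b a K K' w hbv hK hw
  by_contra! hcon
  have h3 := hw.gt_L y (hcon.trans_lt ((le_max_right _ _).trans_lt hy1))
    ((EReal.coe_lt_coe_iff.2 hy2).trans_le hbv)
  have h4 := hε (-a) K' (by rw [EReal.coe_neg]; exact EReal.neg_le_neg_iff.2 hbv) hK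
  rw [neg_neg] at h4
  exact lt_asymm h3 h4

/-! ## The layout that belongs to a system of essential roots -/

namespace EssentialRoots

variable {f : ℝ → ℝ} (ρ : EssentialRoots f)

/-- The root `c i` is a single finite point. -/
def IsPt (i : Fin (ρ.n + 1)) : Prop := ρ.cl i = ρ.cr i ∧ ρ.cl i ≠ ⊥ ∧ ρ.cl i ≠ ⊤

def pt (i : Fin (ρ.n + 1)) : ℝ := (ρ.cl i).toReal

open Classical in
/-- The value of `f''` on the root `c i`. -/
def top (i : Fin (ρ.n + 1)) : ℝ :=
  if ρ.cl i = ⊥ then deriv (deriv f) (ρ.cr i).toReal else deriv (deriv f) (ρ.cl i).toReal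

/-- Descents are continued through the flat interval of the neighbouring root v to its far end: vr
on the right side of a peak, vl on the left side. -/
def nextV : Fin (ρ.n + 1) → EReal := Fin.snoc (α := fun _ => EReal) (fun k => (ρ.vr k : EReal)) ⊤

def prevV : Fin (ρ.n + 1) → EReal := Fin.cons (α := fun _ => EReal) ⊥ fun k => (ρ.vl k : EReal)

variable {ρ}

lemma IsPt.cl_eq {i : Fin (ρ.n + 1)} (h : ρ.IsPt i) : ρ.cl i = ρ.pt i :=
  (EReal.coe_toReal h.2.2 h.2.1).symm

lemma IsPt.cr_eq {i : Fin (ρ.n + 1)} (h : ρ.IsPt i) : ρ.cr i = ρ.pt i := h.1.symm.trans h.cl_eq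

lemma IsPt.top_eq {i : Fin (ρ.n + 1)} (h : ρ.IsPt i) : ρ.top i = deriv (deriv f) (ρ.pt i) := by
  rw [top, if_neg h.2.1]; rfl

lemma top_eq {i : Fin (ρ.n + 1)} {t : ℝ} (h1 : ρ.cl i ≤ t) (h2 : t ≤ ρ.cr i) :
    ρ.top i = deriv (deriv f) t := by
  have hle := ρ.cl_le_cr i
  rw [top]
  split_ifs with h
  · induction hr : ρ.cr i with
    | bot => rw [hr] at h2; exact absurd h2 (EReal.bot_lt_coe t).not_ge
    | top => exact ρ.const_c i _ _ (by simp [h]) (by simp [hr]) h1 h2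
    | coe r => exact ρ.const_c i _ _ (by simp [h]) (by simp [hr]) h1 h2
  · have h3 : ρ.cl i ≠ ⊤ := fun hh => by rw [hh] at h1; exact absurd h1 (EReal.coe_lt_top t).not_ge
    have h4 : ρ.cl i = (ρ.cl i).toReal := (EReal.coe_toReal h3 h).symm
    exact ρ.const_c i _ _ h4.le (h4 ▸ hle) h1 h2

/-- The descent reaches vl and stays constant up to vr. Strict descent needs to be known only near
the peak: a point before both x and vl provides it, and antitonicity carries it to x. -/
lemma descends_right (i : Fin (ρ.n + 1)) :
    Descends (deriv (deriv f)) (ρ.cr i) (ρ.nextV i) := by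
  refine Fin.lastCases ?_ (fun k => ?_) i
  · have ha := ρ.antitone_after_c (Fin.last _)
    have hs := ρ.neg_after_c (Fin.last _)
    simp only [Fin.snoc_last, nextV] at ha hs ⊢
    exact ⟨ha, fun x h1 _ => hs x h1 (EReal.coe_lt_top x)⟩
  · have ha := ρ.antitone_after_c k.castSucc
    have hs := ρ.neg_after_c k.castSucc
    simp only [Fin.snoc_castSucc, nextV] at ha hs ⊢
    have anti : ∀ x y : ℝ, ρ.cr k.castSucc ≤ x → x ≤ y → (y : EReal) ≤ ρ.vr k →
        deriv (deriv f) y ≤ deriv (deriv f) x := by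
      intro x y hx hxy hy
      rw [EReal.coe_le_coe_iff] at hy
      rcases le_or_gt y (ρ.vl k) with h | h
      · exact ha x y hx hxy (EReal.coe_le_coe_iff.2 h)
      rcases le_or_gt x (ρ.vl k) with h' | h'
      · rw [ρ.const_v k y (ρ.vl k) ⟨h.le, hy⟩ ⟨le_rfl, ρ.vl_le_vr k⟩]
        exact ha x _ hx h' le_rfl
      · exact (ρ.const_v k y x ⟨h.le, hy⟩ ⟨h'.le, hxy.trans hy⟩).le
    refine ⟨anti, fun x h1 h2 => ?_⟩
    obtain ⟨z, hz1, hz2⟩ := EReal.lt_iff_exists_real_btwn.1 (lt_min h1 (ρ.cr_lt_vl k))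
    obtain ⟨y, hy1, hy2, hy3⟩ := hs z hz1 (hz2.trans_le (min_le_right _ _))
    have hzx : z < x := EReal.coe_lt_coe_iff.1 (hz2.trans_le (min_le_left _ _))
    exact ⟨y, hy1, hy2.trans hzx, (anti z x hz1.le hzx.le h2).trans_lt hy3⟩

lemma descends_left (i : Fin (ρ.n + 1)) :
    Descends (fun t => deriv (deriv f) (-t)) (-ρ.cl i) (-ρ.prevV i) := by
  have neg1 : ∀ {c : EReal} {x : ℝ}, -c ≤ x ↔ ((-x : ℝ) : EReal) ≤ c := fun {c x} => by
    rw [EReal.coe_neg]; exact EReal.neg_le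
  have neg2 : ∀ {c : EReal} {x : ℝ}, x ≤ -c ↔ c ≤ ((-x : ℝ) : EReal) := fun {c x} => by
    rw [EReal.coe_neg]; exact EReal.le_neg
  have neg3 : ∀ {c : EReal} {x : ℝ}, -c < x ↔ ((-x : ℝ) : EReal) < c := fun {c x} => by
    rw [EReal.coe_neg]; exact EReal.neg_lt_comm
  suffices h : (∀ x y : ℝ, ρ.prevV i ≤ x → x ≤ y → y ≤ ρ.cl i →
      deriv (deriv f) x ≤ deriv (deriv f) y) ∧ ∀ x : ℝ, ρ.prevV i ≤ x → x < ρ.cl i →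
      ∃ y : ℝ, x < y ∧ y < ρ.cl i ∧ deriv (deriv f) x < deriv (deriv f) y by
    refine ⟨fun x y hx hxy hy => h.1 (-y) (-x) (neg2.1 hy) (neg_le_neg hxy) (neg1.1 hx),
      fun x h1 h2 => ?_⟩
    obtain ⟨y, hy1, hy2, hy3⟩ := h.2 (-x) (neg2.1 h2) (neg3.1 h1)
    exact ⟨-y, neg3.2 (by rwa [neg_neg]), by linarith, by simpa using hy3⟩
  refine Fin.cases ?_ (fun k => ?_) i
  · have ha := ρ.monotone_before_c 0
    have hs := ρ.pos_before_c 0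
    simp only [Fin.cons_zero, prevV] at ha hs ⊢
    exact ⟨ha, fun x _ h1 => hs x (EReal.bot_lt_coe x) h1⟩
  · have ha := ρ.monotone_before_c k.succ
    have hs := ρ.pos_before_c k.succ
    simp only [Fin.cons_succ, prevV] at ha hs ⊢
    have mono : ∀ x y : ℝ, (ρ.vl k : EReal) ≤ x → x ≤ y → y ≤ ρ.cl k.succ →
        deriv (deriv f) x ≤ deriv (deriv f) y := by
      intro x y hx hxy hy
      rw [EReal.coe_le_coe_iff] at hx
      rcases le_or_gt (ρ.vr k) x with h | h
      · exact ha x y (EReal.coe_le_coe_iff.2 h) hxy hy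
      rcases le_or_gt (ρ.vr k) y with h' | h'
      · rw [ρ.const_v k x (ρ.vr k) ⟨hx, h.le⟩ ⟨ρ.vl_le_vr k, le_rfl⟩]
        exact ha _ y le_rfl h' hy
      · exact (ρ.const_v k x y ⟨hx, h.le⟩ ⟨hx.trans hxy, h'.le⟩).le
    refine ⟨mono, fun x h1 h2 => ?_⟩
    obtain ⟨z, hz1, hz2⟩ := EReal.lt_iff_exists_real_btwn.1 (max_lt h2 (ρ.vr_lt_cl k))
    obtain ⟨y, hy1, hy2, hy3⟩ := hs z ((le_max_right _ _).trans_lt hz1) hz2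
    have hxz : x < z := EReal.coe_lt_coe_iff.1 ((le_max_left _ _).trans_lt hz1)
    exact ⟨y, hxz.trans hy1, hy2, (mono x z h1 hxz.le hz2.le).trans_lt hy3⟩

lemma valley (k : Fin ρ.n) : Valley (deriv (deriv f)) (ρ.cr k.castSucc) (ρ.vl k) (ρ.vr k)
    (ρ.cl k.succ) := by
  refine ⟨ρ.cr_lt_vl k, ρ.vl_le_vr k, ρ.vr_lt_cl k, ?_, ?_, ?_, ?_⟩
  · simpa [nextV] using ρ.descends_right k.castSucc
  · have ha := ρ.monotone_before_c k.succ
    simp only [Fin.cons_succ] at ha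
    exact ⟨fun x y h => ha x y (EReal.coe_le_coe_iff.2 h),
      fun x h => ρ.pos_after_v k x h⟩
  · simpa [prevV] using ρ.descends_left k.succ
  · have ha := ρ.antitone_after_c k.castSucc
    simp only [Fin.snoc_castSucc] at ha
    refine ⟨fun x y h1 h2 h3 => ha (-y) (-x) ?_ (neg_le_neg h2)
      (EReal.coe_le_coe_iff.2 (by linarith)), fun x h1 h2 => ?_⟩
    · rw [EReal.coe_neg]; exact EReal.le_neg.1 h3
    · obtain ⟨y, hy1, hy2, hy3⟩ := ρ.neg_before_v k (-x)
        (by rw [EReal.coe_neg]; exact EReal.lt_neg_comm.1 h2) (by linarith)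
      exact ⟨-y, by linarith, by linarith, by simpa using hy3⟩

lemma exists_cupData (hreg : Regular f) : ∃ δ : Fin (ρ.n + 1) → ℝ, ∀ i, ρ.IsPt i →
    0 < δ i ∧ CupData f (deriv f) (deriv (deriv f)) (ρ.pt i) (δ i) := by
  have hd := hreg.1
  have h0 : ∀ t, HasDerivAt f (deriv f t) t := fun t =>
    (hd.differentiable (by norm_num)).differentiableAt.hasDerivAt
  have hd1 : ContDiff ℝ 1 (deriv f) := by
    have : ContDiff ℝ (1 + 1) f := by norm_num; exact hd
    exact (contDiff_succ_iff_deriv.1 this).2.2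
  have h1 : ∀ t, HasDerivAt (deriv f) (deriv (deriv f) t) t := fun t =>
    (hd1.differentiable (by norm_num)).differentiableAt.hasDerivAt
  have h2 : Continuous (deriv (deriv f)) := hd1.continuous_deriv (by norm_num)
  have key : ∀ i, ∃ δ : ℝ, ρ.IsPt i →
      0 < δ ∧ CupData f (deriv f) (deriv (deriv f)) (ρ.pt i) δ := by
    intro i
    by_cases hi : ρ.IsPt i
    · have e1 : ρ.prevV i < ρ.pt i := by
        rw [← hi.cl_eq]
        refine Fin.cases ?_ (fun k => ?_) i (motive := fun i => ρ.IsPt i → ρ.prevV i < ρ.cl i) hi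
        · intro h; rw [h.cl_eq]; simp [prevV]
        · intro _; simp only [prevV, Fin.cons_succ]
          exact (EReal.coe_le_coe_iff.2 (ρ.vl_le_vr k)).trans_lt (ρ.vr_lt_cl k)
      have e2 : ρ.pt i < ρ.nextV i := by
        rw [← hi.cr_eq]
        refine Fin.lastCases ?_ (fun k => ?_) i (motive := fun i => ρ.IsPt i → ρ.cr i < ρ.nextV i) hi
        · intro h; rw [h.cr_eq]; simp [nextV]
        · intro _; simp only [nextV, Fin.snoc_castSucc]
          exact (ρ.cr_lt_vl k).trans_le (EReal.coe_le_coe_iff.2 (ρ.vl_le_vr k))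
      obtain ⟨x, hx1, hx2⟩ := EReal.lt_iff_exists_real_btwn.1 e1
      obtain ⟨y, hy1, hy2⟩ := EReal.lt_iff_exists_real_btwn.1 e2
      rw [EReal.coe_lt_coe_iff] at hx2 hy1
      have hR := ρ.descends_right i
      have hL := ρ.descends_left i
      rw [hi.cr_eq] at hR
      rw [hi.cl_eq] at hL
      have hm1 := min_le_left (ρ.pt i - x) (y - ρ.pt i)
      have hm2 := min_le_right (ρ.pt i - x) (y - ρ.pt i)
      have hx' : ∀ t : ℝ, ρ.pt i - min (ρ.pt i - x) (y - ρ.pt i) ≤ t →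
          ((-t : ℝ) : EReal) ≤ -ρ.prevV i := fun t ht => by
        rw [EReal.coe_neg]
        exact EReal.neg_le_neg_iff.2 (hx1.le.trans (EReal.coe_le_coe_iff.2 (by linarith)))
      have hy' : ∀ t : ℝ, t ≤ ρ.pt i + min (ρ.pt i - x) (y - ρ.pt i) →
          (t : EReal) ≤ ρ.nextV i := fun t ht =>
        le_trans (EReal.coe_le_coe_iff.2 (by linarith)) hy2.le
      have mono : ∀ s t, ρ.pt i - min (ρ.pt i - x) (y - ρ.pt i) ≤ s → s ≤ t → t ≤ ρ.pt i →
          deriv (deriv f) s ≤ deriv (deriv f) t := fun s t h3 h4 h5 => by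
        have := hL.anti (-t) (-s) (by rw [← EReal.coe_neg, EReal.coe_le_coe_iff]; linarith)
          (by linarith) (hx' s h3)
        simpa using this
      have anti : ∀ s t, ρ.pt i ≤ s → s ≤ t → t ≤ ρ.pt i + min (ρ.pt i - x) (y - ρ.pt i) →
          deriv (deriv f) t ≤ deriv (deriv f) s := fun s t h3 h4 h5 =>
        hR.anti s t (EReal.coe_le_coe_iff.2 h3) h4 (hy' t h5)
      -- The radius keeps the interval around the root strictly inside the neighbouring roots v.
      refine ⟨min (ρ.pt i - x) (y - ρ.pt i), fun _ => ⟨lt_min (by linarith) (by linarith),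
        h0, h1, h2, mono, anti, fun s h3 h4 => ?_, fun s h3 h4 => ?_⟩⟩
      · obtain ⟨z, hz1, hz2, hz3⟩ := hL.strict (-s)
          (by rw [← EReal.coe_neg, EReal.coe_lt_coe_iff]; linarith) (hx' s h3)
        rw [← EReal.coe_neg, EReal.coe_lt_coe_iff] at hz1
        rw [neg_neg] at hz3
        exact hz3.trans_le (mono _ _ (by linarith) (by linarith) le_rfl)
      · obtain ⟨z, hz1, hz2, hz3⟩ := hR.strict s (EReal.coe_lt_coe_iff.2 h3) (hy' s h4)
        rw [EReal.coe_lt_coe_iff] at hz1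
        exact hz3.trans_le (anti _ _ le_rfl hz1.le (by linarith))
    · exact ⟨0, fun h => absurd h hi⟩
  choose δ hδ using key
  exact ⟨δ, hδ⟩

/-- `Λ` is a layout with cups and flat peaks at the roots `c i`. -/
structure Adapted (ρ : EssentialRoots f) {ε : ℝ}
    (Λ : Layout f (deriv f) (deriv (deriv f)) ε ρ.n) : Prop where
  isCup_iff : ∀ i, Λ.isCup i ↔ ρ.IsPt i
  p_eq : ∀ i, Λ.p i = ρ.pt i
  a_eq : ∀ i, ¬ Λ.isCup i → Λ.a i = ρ.cl i
  b_eq : ∀ i, ¬ Λ.isCup i → Λ.b i = ρ.cr i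
  a_le : ∀ i, Λ.a i ≤ ρ.cl i
  le_b : ∀ i, ρ.cr i ≤ Λ.b i
  b_le : ∀ k : Fin ρ.n, Λ.b k.castSucc ≤ ρ.vl k
  le_a : ∀ k : Fin ρ.n, ρ.vr k ≤ Λ.a k.succ
  K_le : ∀ i, Λ.K i ≤ ρ.top i
  MR_eq : ∀ i, Λ.MR i = branch ε (deriv (deriv f)) (Λ.b i) (Λ.K i)
  ML_eq : ∀ i u, Λ.ML i u = branch ε (fun t => deriv (deriv f) (-t)) (-Λ.a i) (Λ.K i) (-u)

/-! ### Ends and initial slopes of the peaks. -/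

section ends

variable (ρ) (δ : Fin (ρ.n + 1) → ℝ) (ε : ℝ) (i : Fin (ρ.n + 1))

/-- The proof of `CupData` is bundled into the case distinction so that the ends of the chord can be
written down for arbitrary δ and ε; for the radii of `exists_cupData` the condition is just `IsPt`.
-/
def HasCup : Prop := ρ.IsPt i ∧ CupData f (deriv f) (deriv (deriv f)) (ρ.pt i) (δ i)

open Classical in
def leftEnd : EReal := if h : ρ.HasCup δ i then (h.2.left (2 * ε) : ℝ) else ρ.cl i

open Classical in
def rightEnd : EReal := if h : ρ.HasCup δ i then (h.2.right (2 * ε) : ℝ) else ρ.cr i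

open Classical in
def slope : ℝ := if h : ρ.HasCup δ i then h.2.chordSlope (2 * ε) else ρ.top i

end ends

section small

variable {δ : Fin (ρ.n + 1) → ℝ} {ε : ℝ} {i : Fin (ρ.n + 1)}

lemma leftEnd_cup (h : ρ.HasCup δ i) : ρ.leftEnd δ ε i = (h.2.left (2 * ε) : ℝ) := dif_pos h
lemma rightEnd_cup (h : ρ.HasCup δ i) : ρ.rightEnd δ ε i = (h.2.right (2 * ε) : ℝ) := dif_pos h
lemma slope_cup (h : ρ.HasCup δ i) : ρ.slope δ ε i = h.2.chordSlope (2 * ε) := dif_pos h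
lemma leftEnd_flat (h : ¬ ρ.HasCup δ i) : ρ.leftEnd δ ε i = ρ.cl i := dif_neg h
lemma rightEnd_flat (h : ¬ ρ.HasCup δ i) : ρ.rightEnd δ ε i = ρ.cr i := dif_neg h
lemma slope_flat (h : ¬ ρ.HasCup δ i) : ρ.slope δ ε i = ρ.top i := dif_neg h

variable (hε : 0 < ε) (hδ : ∀ i, ρ.IsPt i → 2 * ε < δ i)
include hε hδ

lemma cup_bounds (h : ρ.HasCup δ i) : ρ.pt i - 2 * ε < h.2.left (2 * ε) ∧
    h.2.left (2 * ε) < ρ.pt i ∧ ρ.pt i < h.2.right (2 * ε) ∧ h.2.right (2 * ε) < ρ.pt i + 2 * ε := by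
  obtain ⟨h1, h2, -⟩ := h.2.left_spec (by linarith) (hδ i h.1)
  rw [CupData.right]
  refine ⟨h1, h2, ?_, ?_⟩ <;> linarith

lemma leftEnd_le : ρ.leftEnd δ ε i ≤ ρ.cl i := by
  by_cases h : ρ.HasCup δ i
  · rw [leftEnd_cup h, h.1.cl_eq, EReal.coe_le_coe_iff]
    exact (cup_bounds hε hδ h).2.1.le
  · rw [leftEnd_flat h]

lemma le_rightEnd : ρ.cr i ≤ ρ.rightEnd δ ε i := by
  by_cases h : ρ.HasCup δ i
  · rw [rightEnd_cup h, h.1.cr_eq, EReal.coe_le_coe_iff]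
    exact (cup_bounds hε hδ h).2.2.1.le
  · rw [rightEnd_flat h]

lemma rightEnd_lt {d : ℝ} (h1 : ρ.cr i < d) (h2 : ρ.IsPt i → ρ.pt i + 2 * ε < d) :
    ρ.rightEnd δ ε i < d := by
  by_cases h : ρ.HasCup δ i
  · rw [rightEnd_cup h, EReal.coe_lt_coe_iff]
    linarith [cup_bounds hε hδ h, h2 h.1]
  · rwa [rightEnd_flat h]

lemma lt_leftEnd {d : ℝ} (h1 : d < ρ.cl i) (h2 : ρ.IsPt i → d < ρ.pt i - 2 * ε) :
    d < ρ.leftEnd δ ε i := by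
  by_cases h : ρ.HasCup δ i
  · rw [leftEnd_cup h, EReal.coe_lt_coe_iff]
    linarith [cup_bounds hε hδ h, h2 h.1]
  · rwa [leftEnd_flat h]

lemma slope_le : ρ.slope δ ε i ≤ ρ.top i := by
  by_cases h : ρ.HasCup δ i
  · have hb := cup_bounds hε hδ h
    have h2 := hδ i h.1
    have hs : h.2.right (2 * ε) = h.2.left (2 * ε) + 2 * ε := rfl
    rw [slope_cup h, h.1.top_eq, CupData.chordSlope, if_neg (by linarith), slopeOn,
      div_le_iff₀ (by linarith)]
    have hc : ContinuousOn (deriv f) (Icc (h.2.left (2 * ε)) (h.2.right (2 * ε))) := fun t _ =>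
      (h.2.deriv1 t).continuousAt.continuousWithinAt
    obtain ⟨ξ, hξ, he⟩ := exists_hasDerivAt_eq_slope (deriv f) (deriv (deriv f))
      (show h.2.left (2 * ε) < h.2.right (2 * ε) by linarith) hc fun t _ => h.2.deriv1 t
    rw [eq_div_iff (by linarith)] at he
    rw [← he]
    refine mul_le_mul_of_nonneg_right ?_ (by linarith)
    rcases le_total ξ (ρ.pt i) with hle | hle
    · exact h.2.mono _ _ (by linarith [hξ.1]) hle le_rfl
    · exact h.2.anti _ _ le_rfl hle (by linarith [hξ.2])
  · rw [slope_flat h]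

/-- The constant with which a branch begins exceeds f'' beyond the peak: for a cup since the right
differential of the long chord is negative, for a flat peak by strict descent. This is the input
that `lt_branch` needs. -/
lemma lt_slope_right {u : ℝ} (h1 : ρ.rightEnd δ ε i < u) (h2 : u ≤ ρ.nextV i)
    (h3 : ρ.rightEnd δ ε i ≠ ⊥) : deriv (deriv f) u < ρ.slope δ ε i := by
  have hd := ρ.descends_right i
  by_cases h : ρ.HasCup δ i
  · have hb := cup_bounds hε hδ h
    rw [rightEnd_cup h] at h1
    have hlt := (h.2.diffs_neg (by linarith) (hδ i h.1)).2
    rw [slope_cup h, CupData.chordSlope, if_neg (by linarith)]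
    refine lt_of_le_of_lt ?_ hlt
    refine hd.anti _ _ ?_ (EReal.coe_lt_coe_iff.1 h1).le h2
    rw [h.1.cr_eq]; exact EReal.coe_le_coe_iff.2 hb.2.2.1.le
  · rw [rightEnd_flat h] at h1 h3
    obtain ⟨y, hy1, hy2, hy3⟩ := hd.strict u h1 h2
    have h4 : ρ.cr i ≠ ⊤ := fun hh => by simp [hh] at h1
    have h5 : ((ρ.cr i).toReal : EReal) = ρ.cr i := EReal.coe_toReal h4 h3
    rw [slope_flat h, top_eq (t := (ρ.cr i).toReal) (h5.symm ▸ ρ.cl_le_cr i) h5.le]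
    refine hy3.trans_le (hd.anti _ _ h5.ge ?_ (le_trans (EReal.coe_le_coe_iff.2 hy2.le) h2))
    rw [← h5] at hy1
    exact (EReal.coe_lt_coe_iff.1 hy1).le

lemma lt_slope_left {u : ℝ} (h1 : u < ρ.leftEnd δ ε i) (h2 : ρ.prevV i ≤ u)
    (h3 : ρ.leftEnd δ ε i ≠ ⊤) : deriv (deriv f) u < ρ.slope δ ε i := by
  have hd := ρ.descends_left i
  have h2' : ((-u : ℝ) : EReal) ≤ -ρ.prevV i := by
    rw [EReal.coe_neg]; exact EReal.neg_le_neg_iff.2 h2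
  by_cases h : ρ.HasCup δ i
  · have hb := cup_bounds hε hδ h
    rw [leftEnd_cup h, EReal.coe_lt_coe_iff] at h1
    have hlt := (h.2.diffs_neg (by linarith) (hδ i h.1)).1
    rw [slope_cup h, CupData.chordSlope, if_neg (by linarith)]
    refine lt_of_le_of_lt ?_ hlt
    have := hd.anti (-h.2.left (2 * ε)) (-u) ?_ (by linarith) h2'
    · simpa using this
    · rw [h.1.cl_eq, ← EReal.coe_neg, EReal.coe_le_coe_iff]; linarith
  · rw [leftEnd_flat h] at h1 h3
    obtain ⟨y, hy1, hy2, hy3⟩ := hd.strict (-u)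
      (by rw [EReal.coe_neg]; exact EReal.neg_lt_neg_iff.2 h1) h2'
    have h4 : ρ.cl i ≠ ⊥ := fun hh => by simp [hh] at h1
    have h5 : ((ρ.cl i).toReal : EReal) = ρ.cl i := EReal.coe_toReal h3 h4
    rw [slope_flat h, top_eq (t := (ρ.cl i).toReal) h5.ge (h5.symm ▸ ρ.cl_le_cr i)]
    rw [neg_neg] at hy3
    rw [← h5, ← EReal.coe_neg, EReal.coe_lt_coe_iff] at hy1
    refine hy3.trans_le ?_
    have := hd.anti (-(ρ.cl i).toReal) y ?_ hy1.le (le_trans (EReal.coe_le_coe_iff.2 hy2.le) h2')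
    · simpa using this
    · rw [EReal.coe_neg, h5]

end small

end EssentialRoots

/-! ### Layouts for small ε and the limits of the vertices. -/

lemma eventually_mul_lt {c r : ℝ} (hr : 0 < r) : ∀ᶠ ε in 𝓝[>] (0 : ℝ), c * ε < r := by
  have : Tendsto (fun ε : ℝ => c * ε) (𝓝[>] 0) (𝓝 (c * 0)) :=
    (tendsto_id.const_mul c).mono_left nhdsWithin_le_nhds
  rw [mul_zero] at this
  exact this.eventually (gt_mem_nhds hr)

namespace EssentialRoots

variable {f : ℝ → ℝ} {ρ : EssentialRoots f}

/-- There are finitely many peaks and valleys, so finitely many smallness conditions on ε can be met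
at once; under them every valley provides a vertex, and the branches provide the tangent domains. -/
theorem eventually_exists_layout {C Λ₀ : ℝ} (hreg : Regular f) (hΛ : 0 ≤ Λ₀)
    (hb : ExpBound C Λ₀ (deriv (deriv f))) : ∀ᶠ ε in 𝓝[>] (0 : ℝ),
    ∃ Λ : Layout f (deriv f) (deriv (deriv f)) ε ρ.n, ρ.Adapted Λ := by
  obtain ⟨δ, hδ⟩ := ρ.exists_cupData hreg
  have hd := hreg.1
  have h0 : ∀ t, HasDerivAt f (deriv f t) t := fun t =>
    (hd.differentiable (by norm_num)).differentiableAt.hasDerivAt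
  have hd1 : ContDiff ℝ 1 (deriv f) := by
    have : ContDiff ℝ (1 + 1) f := by norm_num; exact hd
    exact (contDiff_succ_iff_deriv.1 this).2.2
  have h1 : ∀ t, HasDerivAt (deriv f) (deriv (deriv f) t) t := fun t =>
    (hd1.differentiable (by norm_num)).differentiableAt.hasDerivAt
  have hg : Continuous (deriv (deriv f)) := hd1.continuous_deriv (by norm_num)
  have hgn : Continuous fun t => deriv (deriv f) (-t) := by fun_prop
  have hcup : ∀ i, ρ.HasCup δ i ↔ ρ.IsPt i := fun i => ⟨fun h => h.1, fun h => ⟨h, (hδ i h).2⟩⟩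
  -- The points d k and d' k separate v k from the adjacent peaks independently of ε; the two
  -- branches are compared with f'' there.
  choose d hd1 hd2 using fun k => EReal.lt_iff_exists_real_btwn.1 (ρ.cr_lt_vl k)
  choose d' hd1' hd2' using fun k => EReal.lt_iff_exists_real_btwn.1 (ρ.vr_lt_cl k)
  simp only [EReal.coe_lt_coe_iff] at hd2 hd1'
  have E3 : ∀ᶠ ε in 𝓝[>] (0 : ℝ), ∀ i, ρ.IsPt i → 2 * ε < δ i := by
    refine eventually_all.2 fun i => ?_
    by_cases hi : ρ.IsPt i
    · filter_upwards [eventually_mul_lt (c := 2) (hδ i hi).1] with ε h _ using h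
    · exact Eventually.of_forall fun ε h => absurd h hi
  have E4 : ∀ᶠ ε in 𝓝[>] (0 : ℝ), ∀ k : Fin ρ.n, ρ.IsPt k.castSucc →
      ρ.pt k.castSucc + 2 * ε < d k := by
    refine eventually_all.2 fun k => ?_
    by_cases hi : ρ.IsPt k.castSucc
    · have h := hd1 k
      rw [hi.cr_eq, EReal.coe_lt_coe_iff] at h
      filter_upwards [eventually_mul_lt (c := 2) (sub_pos.2 h)] with ε h _ using by linarith
    · exact Eventually.of_forall fun ε h => absurd h hi
  have E5 : ∀ᶠ ε in 𝓝[>] (0 : ℝ), ∀ k : Fin ρ.n, ρ.IsPt k.succ → d' k < ρ.pt k.succ - 2 * ε := by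
    refine eventually_all.2 fun k => ?_
    by_cases hi : ρ.IsPt k.succ
    · have h := hd2' k
      rw [hi.cl_eq, EReal.coe_lt_coe_iff] at h
      filter_upwards [eventually_mul_lt (c := 2) (sub_pos.2 h)] with ε h _ using by linarith
    · exact Eventually.of_forall fun ε h => absurd h hi
  -- A bounded non-degenerate root must be long enough for a multicup.
  have E6 : ∀ᶠ ε in 𝓝[>] (0 : ℝ), ∀ i, ∀ x y : ℝ, ρ.cl i = x → ρ.cr i = y → x < y →
      x + 2 * ε ≤ y := by
    refine eventually_all.2 fun i => ?_
    by_cases hi : ∃ x y : ℝ, ρ.cl i = x ∧ ρ.cr i = y ∧ x < y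
    · obtain ⟨x, y, hx, hy, hxy⟩ := hi
      filter_upwards [eventually_mul_lt (c := 2) (sub_pos.2 hxy)] with ε h x' y' hx' hy' _
      rw [hx, EReal.coe_eq_coe_iff] at hx'
      rw [hy, EReal.coe_eq_coe_iff] at hy'
      linarith
    · exact Eventually.of_forall fun ε x y hx hy hxy => absurd ⟨x, y, hx, hy, hxy⟩ hi
  -- Quantified over all b and K: the actual end and slope of the peak are only known to satisfy
  -- these bounds.
  have E7 : ∀ᶠ ε in 𝓝[>] (0 : ℝ), ∀ k : Fin ρ.n, ∀ (b : EReal) (K : ℝ), b ≤ ρ.vr k →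
      K ≤ ρ.top k.castSucc → branch ε (deriv (deriv f)) b K (d' k) < deriv (deriv f) (d' k) :=
    eventually_all.2 fun k => eventually_branch_lt hΛ hg hb (ρ.valley k).ascR (hd1' k) (hd2' k)
  have E8 : ∀ᶠ ε in 𝓝[>] (0 : ℝ), ∀ k : Fin ρ.n, ∀ (b : EReal) (K : ℝ), b ≤ ((-ρ.vl k : ℝ) : EReal) →
      K ≤ ρ.top k.succ → branch ε (fun t => deriv (deriv f) (-t)) b K (-d k) <
        deriv (deriv f) (d k) := by
    refine eventually_all.2 fun k => ?_
    have := eventually_branch_lt (K₀ := ρ.top k.succ) (d := -d k) hΛ hgn hb.comp_neg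
      (ρ.valley k).ascL (neg_lt_neg (hd2 k))
      (by rw [EReal.coe_neg]; exact EReal.neg_lt_neg_iff.2 (hd1 k))
    simpa only [neg_neg] using this
  filter_upwards [self_mem_nhdsWithin, eventually_mul_lt (c := Λ₀) one_pos, E3, E4, E5, E6, E7, E8]
    with ε hε hεΛ e3 e4 e5 e6 e7 e8
  replace hε : 0 < ε := hε
  have hbd : ∀ k : Fin ρ.n, ρ.rightEnd δ ε k.castSucc < d k := fun k =>
    rightEnd_lt hε e3 (hd1 k) (e4 k)
  have hda : ∀ k : Fin ρ.n, d' k < ρ.leftEnd δ ε k.succ := fun k =>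
    lt_leftEnd hε e3 (hd2' k) (e5 k)
  have hbv : ∀ k : Fin ρ.n, ρ.rightEnd δ ε k.castSucc ≤ ρ.vl k := fun k =>
    ((hbd k).trans (EReal.coe_lt_coe_iff.2 (hd2 k))).le
  have hva : ∀ k : Fin ρ.n, ρ.vr k ≤ ρ.leftEnd δ ε k.succ := fun k =>
    ((EReal.coe_lt_coe_iff.2 (hd1' k)).trans (hda k)).le
  have hw : ∀ k : Fin ρ.n, ∃ w, IsAngleVertex ε (deriv (deriv f)) (ρ.rightEnd δ ε k.castSucc)
      (ρ.leftEnd δ ε k.succ) (ρ.slope δ ε k.castSucc) (ρ.slope δ ε k.succ) w := fun k => by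
    have hvv : (ρ.vl k : EReal) ≤ ρ.vr k := EReal.coe_le_coe_iff.2 (ρ.vl_le_vr k)
    obtain ⟨w, -, -, hw⟩ := (ρ.valley k).exists_isAngleVertex hε hΛ hεΛ hg hb
      (le_rightEnd hε e3) (leftEnd_le hε e3)
      (fun u h h' h'' => lt_slope_right hε e3 h (by simpa [nextV] using h') h'')
      (fun u h h' h'' => lt_slope_left hε e3 h (by simpa [prevV] using h') h'')
      (hbd k) (hd2 k) (hd1' k) (hda k)
      (e8 k _ _ (by rw [EReal.coe_neg]; exact EReal.neg_le_neg_iff.2 (hvv.trans (hva k)))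
        (slope_le hε e3)) (e7 k _ _ ((hbv k).trans hvv) (slope_le hε e3))
    exact ⟨w, hw⟩
  choose w hw using hw
  have nonpt : ∀ {i}, ¬ ρ.HasCup δ i → ρ.cl i = ρ.cr i → ρ.cl i = ⊥ ∨ ρ.cl i = ⊤ := by
    intro i hi he
    by_contra! hcon
    exact hi ((hcup i).2 ⟨he, hcon.1, hcon.2⟩)
  let Λ : Layout f (deriv f) (deriv (deriv f)) ε ρ.n :=
    { a := ρ.leftEnd δ ε
      b := ρ.rightEnd δ ε
      w := w
      MR := fun i => branch ε (deriv (deriv f)) (ρ.rightEnd δ ε i) (ρ.slope δ ε i)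
      ML := fun i u => branch ε (fun t => deriv (deriv f) (-t)) (-ρ.leftEnd δ ε i)
        (ρ.slope δ ε i) (-u)
      K := ρ.slope δ ε
      p := ρ.pt
      δ := δ
      isCup := ρ.HasCup δ
      pos := hε
      deriv0 := h0
      deriv1 := h1
      cont := hg
      cup := fun i hi => hi.2
      cup_lt := fun i hi => e3 i hi.1
      cup_a := fun i hi => leftEnd_cup hi
      cup_b := fun i hi => rightEnd_cup hi
      cup_K := fun i hi => slope_cup hi
      flat_le := fun i hi => by rw [leftEnd_flat hi, rightEnd_flat hi]; exact ρ.cl_le_cr i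
      flat_sep := fun i hi s t hs ht => by
        rw [leftEnd_flat hi] at hs
        rw [rightEnd_flat hi] at ht
        have hle := ρ.cl_le_cr i
        have hne := nonpt hi
        induction hl : ρ.cl i with
        | bot => simp [hl] at hs
        | top =>
          rw [hl, top_le_iff] at hle
          simp [hle] at ht
        | coe x =>
          induction hr : ρ.cr i with
          | bot => simp [hl, hr] at hle
          | top => simp [hr] at ht
          | coe y =>
            rw [hl, EReal.coe_le_coe_iff] at hs
            rw [hr, EReal.coe_le_coe_iff] at ht
            rw [hl, hr, EReal.coe_le_coe_iff] at hle
            rcases hle.eq_or_lt with heq | hlt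
            · have := hne (by rw [hl, hr, heq])
              simp [hl] at this
            · linarith [e6 i x y hl hr hlt]
      flat_eq := fun i hi he => by
        rw [leftEnd_flat hi, rightEnd_flat hi] at he
        rw [leftEnd_flat hi]
        exact nonpt hi he
      flat := fun i hi t h1 h2 => by
        rw [leftEnd_flat hi] at h1
        rw [rightEnd_flat hi] at h2
        rw [slope_flat hi, top_eq h1 h2]
      b_lt_w := fun k => (hw k).left_lt
      w_lt_a := fun k => (hw k).lt_right
      MR_cont := fun i => continuous_branch hε hΛ hεΛ hg hb _ _
      ML_cont := fun i => (continuous_branch hε hΛ hεΛ hgn hb.comp_neg _ _).comp continuous_neg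
      MR_const := fun i u hu => branch_const hε hu
      ML_const := fun i u hu => branch_const hε (by
        rw [EReal.coe_neg]; exact EReal.neg_le_neg_iff.2 hu)
      MR_deriv := fun i u hu => hasDerivAt_branch hε hΛ hεΛ hg hb hu
      ML_deriv := fun i u hu => by
        have := hasDerivAt_branch (K := ρ.slope δ ε i) (b := -ρ.leftEnd δ ε i) (u := -u) hε hΛ hεΛ hgn
          hb.comp_neg (by rw [EReal.coe_neg]; exact EReal.neg_lt_neg_iff.2 hu)
        refine (hasDerivAt_comp_neg_apply this).congr_deriv ?_
        rw [neg_neg]; ring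
      MR_gt := fun i u h1 h2 => by
        revert h1 h2
        refine Fin.lastCases (fun h1 _ => ?_) (fun k h1 h2 => ?_) i
        · exact lt_branch hε hΛ hεΛ hg hb (ρ.descends_right _) (le_rightEnd hε e3)
            (fun v h h' h'' => lt_slope_right hε e3 h h' h'') h1 (by simp [nextV])
        · rw [Fin.snoc_castSucc, EReal.coe_lt_coe_iff] at h2
          exact (hw k).gt_R u h1 h2
      ML_gt := fun i u h1 h2 => by
        revert h1 h2
        refine Fin.cases (fun h1 _ => ?_) (fun k h1 h2 => ?_) i
        · have := lt_branch (K := ρ.slope δ ε 0) (b := -ρ.leftEnd δ ε 0) (u := -u) hε hΛ hεΛ hgn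
            hb.comp_neg (ρ.descends_left 0) (EReal.neg_le_neg_iff.2 (leftEnd_le hε e3))
            (fun v h h' h'' => lt_slope_left hε e3
              (by rw [EReal.coe_neg]; exact EReal.neg_lt_comm.1 h) (by simp [prevV])
              (fun hh => h'' (by simp [hh])))
            (by rw [EReal.coe_neg]; exact EReal.neg_lt_neg_iff.2 h1) (by simp [prevV])
          rwa [neg_neg] at this
        · rw [Fin.cons_succ, EReal.coe_lt_coe_iff] at h2
          exact (hw k).gt_L u h2 h1
      M_eq := fun k => (hw k).eq }
  exact ⟨Λ, hcup, fun _ => rfl, fun i hi => leftEnd_flat hi, fun i hi => rightEnd_flat hi,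
    fun i => leftEnd_le hε e3, fun i => le_rightEnd hε e3, hbv, hva, fun i => slope_le hε e3,
    fun _ => rfl, fun _ _ => rfl⟩

lemma Adapted.isAngleVertex {ε : ℝ} {Λ : Layout f (deriv f) (deriv (deriv f)) ε ρ.n}
    (h : ρ.Adapted Λ) (k : Fin ρ.n) : IsAngleVertex ε (deriv (deriv f)) (Λ.b k.castSucc)
      (Λ.a k.succ) (Λ.K k.castSucc) (Λ.K k.succ) (Λ.w k) := by
  refine ⟨Λ.b_lt_w k, Λ.w_lt_a k, ?_, fun u h1 h2 => ?_, fun u h1 h2 => ?_⟩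
  · rw [← h.MR_eq, Λ.M_eq, h.ML_eq]
  · rw [← h.MR_eq]
    exact Λ.MR_gt _ u h1 (by simpa using h2)
  · rw [← h.ML_eq]
    exact Λ.ML_gt _ u h2 (by simpa using h1)

lemma Adapted.between {ε : ℝ} {Λ : Layout f (deriv f) (deriv (deriv f)) ε ρ.n}
    (h : ρ.Adapted Λ) (k : Fin ρ.n) :
    ρ.cr k.castSucc < Λ.w k ∧ (Λ.w k : EReal) < ρ.cl k.succ :=
  ⟨(h.le_b _).trans_lt (Λ.b_lt_w k), (Λ.w_lt_a k).trans_le (h.a_le _)⟩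

/-- The vertices of the angles tend to the roots `v k`. -/
theorem tendsto_vertex {C Λ₀ : ℝ} (hreg : Regular f) (hΛ : 0 ≤ Λ₀)
    (hb : ExpBound C Λ₀ (deriv (deriv f))) {w : ℝ → Fin ρ.n → ℝ}
    (hw : ∀ᶠ ε in 𝓝[>] (0 : ℝ), ∃ Λ : Layout f (deriv f) (deriv (deriv f)) ε ρ.n,
      ρ.Adapted Λ ∧ Λ.w = w ε) (k : Fin ρ.n) :
    Tendsto (fun ε => w ε k) (𝓝[>] 0) (𝓝ˢ (Icc (ρ.vl k) (ρ.vr k))) := by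
  have hg : Continuous (deriv (deriv f)) := by
    have : ContDiff ℝ (1 + 1) f := by norm_num; exact hreg.1
    exact (contDiff_succ_iff_deriv.1 this).2.2.continuous_deriv (by norm_num)
  intro U hU
  rw [mem_nhdsSet_iff_exists] at hU
  obtain ⟨V, hV, hVs, hVU⟩ := hU
  have hvv := ρ.vl_le_vr k
  obtain ⟨x, hx1, hx2⟩ : ∃ x < ρ.vl k, Ioc x (ρ.vl k) ⊆ V :=
    (exists_Ioc_subset_of_mem_nhds (hV.mem_nhds (hVs (left_mem_Icc.2 hvv))) ⟨ρ.vl k - 1, by linarith⟩)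
  obtain ⟨y, hy1, hy2⟩ : ∃ y > ρ.vr k, Ico (ρ.vr k) y ⊆ V :=
    (exists_Ico_subset_of_mem_nhds (hV.mem_nhds (hVs (right_mem_Icc.2 hvv))) ⟨ρ.vr k + 1, by linarith⟩)
  rw [mem_map]
  filter_upwards [hw, (ρ.valley k).eventually_vertex_le (K₀ := ρ.top k.castSucc) hΛ hg hb hy1,
    (ρ.valley k).eventually_lt_vertex (K₀ := ρ.top k.succ) hΛ hg hb hx1] with ε ⟨Λ, h, hΛw⟩ h1 h2
  have hvv' : (ρ.vl k : EReal) ≤ ρ.vr k := EReal.coe_le_coe_iff.2 hvv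
  have e1 := h1 _ _ _ _ _ ((h.b_le k).trans hvv') (h.a_le _) (h.K_le _) (h.isAngleVertex k)
  have e2 := h2 _ _ _ _ _ (hvv'.trans (h.le_a k)) (h.K_le _) (h.isAngleVertex k)
  rw [hΛw] at e1 e2
  apply hVU
  rcases le_or_gt (w ε k) (ρ.vl k) with h3 | h3
  · exact hx2 ⟨e2, h3⟩
  rcases le_or_gt (ρ.vr k) (w ε k) with h4 | h4
  · exact hy2 ⟨h4, e1⟩
  · exact hVs ⟨h3.le, h4.le⟩

end EssentialRoots

/-! ## Figures in the coordinates `uL`, `uR` -/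

/-- The point of the strip with `uL = p` and `uR = q`. -/
def stripPoint (ε : ℝ) (z : ℝ × ℝ) : ℝ × ℝ :=
  ((z.1 + z.2) / 2, ((z.1 + z.2) / 2) ^ 2 + ε ^ 2 - (ε - (z.2 - z.1) / 2) ^ 2)

section coordinates

variable {ε : ℝ} {x z : ℝ × ℝ}

lemma continuous_stripPoint (ε : ℝ) : Continuous (stripPoint ε) := by
  unfold stripPoint; fun_prop

lemma rad_stripPoint (h : z.2 ≤ z.1 + 2 * ε) : rad ε (stripPoint ε z) = ε - (z.2 - z.1) / 2 := by
  have : ((z.1 + z.2) / 2) ^ 2 + ε ^ 2 - (((z.1 + z.2) / 2) ^ 2 + ε ^ 2 - (ε - (z.2 - z.1) / 2) ^ 2) =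
      (ε - (z.2 - z.1) / 2) ^ 2 := by ring
  rw [rad, stripPoint, this, Real.sqrt_sq (by linarith)]

lemma uL_stripPoint (h : z.2 ≤ z.1 + 2 * ε) : uL ε (stripPoint ε z) = z.1 := by
  rw [uL_eq, rad_stripPoint h, stripPoint]; ring

lemma uR_stripPoint (h : z.2 ≤ z.1 + 2 * ε) : uR ε (stripPoint ε z) = z.2 := by
  rw [uR_eq, rad_stripPoint h, stripPoint]; ring

lemma stripPoint_mem (h1 : z.1 ≤ z.2) (h2 : z.2 ≤ z.1 + 2 * ε) : stripPoint ε z ∈ strip ε := by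
  simp only [strip, stripPoint, mem_ofPred_eq]
  constructor
  · nlinarith
  · nlinarith [sq_nonneg (ε - (z.2 - z.1) / 2)]

lemma stripPoint_uL_uR (hx : x ∈ strip ε) : stripPoint ε (uL ε x, uR ε x) = x := by
  have h := rad_sq hx
  ext
  · simp only [stripPoint]; linarith [uL_add_uR (ε := ε) (x := x)]
  · simp only [stripPoint, uL_eq, uR_eq]; linear_combination -h

/-- A figure bounded by tangents. -/
def box (ε : ℝ) (l₁ h₁ l₂ h₂ : EReal) : Set (ℝ × ℝ) :=
  {x | x ∈ strip ε ∧ (l₁ ≤ uL ε x ∧ uL ε x ≤ h₁) ∧ l₂ ≤ uR ε x ∧ uR ε x ≤ h₂}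

variable {l₁ h₁ l₂ h₂ : EReal}

/-- In the coordinates (uL, uR) a box is convex, being a rectangle cut by p ≤ q ≤ p + 2ε. A convex
set with non-empty interior lies in the closure of that interior, which is connected, and both facts
are carried over by `stripPoint`. -/
lemma isPlanarDomain_box (hε : 0 < ε) (hz : z.1 < z.2) (hz' : z.2 < z.1 + 2 * ε) (a1 : l₁ < z.1)
    (a2 : z.1 < h₁) (a3 : l₂ < z.2) (a4 : z.2 < h₂) : IsPlanarDomain (box ε l₁ h₁ l₂ h₂) := by
  set I₁ : Set ℝ := {t | l₁ ≤ t ∧ t ≤ h₁} with hI₁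
  set I₂ : Set ℝ := {t | l₂ ≤ t ∧ t ≤ h₂} with hI₂
  have cI : ∀ l h : EReal, Convex ℝ {t : ℝ | l ≤ t ∧ t ≤ h} := fun l h => by
    apply Set.OrdConnected.convex
    exact ⟨fun x hx y hy t ht => ⟨hx.1.trans (EReal.coe_le_coe_iff.2 ht.1),
      le_trans (EReal.coe_le_coe_iff.2 ht.2) hy.2⟩⟩
  set S : Set (ℝ × ℝ) := {y | y.2 ≤ y.1 + 2 * ε} with hS
  set C : Set (ℝ × ℝ) := (I₁ ×ˢ I₂) ∩ {y | y.1 ≤ y.2} ∩ S with hC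
  have cC : Convex ℝ C := by
    refine (((cI l₁ h₁).prod (cI l₂ h₂)).inter ?_).inter ?_
    · have := convex_halfSpace_le (𝕜 := ℝ) (E := ℝ × ℝ)
        (LinearMap.fst ℝ ℝ ℝ - LinearMap.snd ℝ ℝ ℝ).isLinear 0
      simpa using this
    · have := convex_halfSpace_le (𝕜 := ℝ) (E := ℝ × ℝ)
        (LinearMap.snd ℝ ℝ ℝ - LinearMap.fst ℝ ℝ ℝ).isLinear (2 * ε)
      simpa [hS, sub_le_iff_le_add, add_comm] using this
  have ne : (interior C).Nonempty := by
    refine ⟨z, mem_interior_iff_mem_nhds.2 ?_⟩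
    have k1 : Continuous fun y : ℝ × ℝ => (y.1 : EReal) := continuous_coe_real_ereal.comp continuous_fst
    have k2 : Continuous fun y : ℝ × ℝ => (y.2 : EReal) := continuous_coe_real_ereal.comp continuous_snd
    have e5 : ∀ᶠ y : ℝ × ℝ in 𝓝 z, y.1 < y.2 :=
      (isOpen_lt continuous_fst continuous_snd).mem_nhds hz
    have e6 : ∀ᶠ y : ℝ × ℝ in 𝓝 z, y.2 < y.1 + 2 * ε :=
      (isOpen_lt continuous_snd (by fun_prop)).mem_nhds hz'
    filter_upwards [k1.continuousAt.eventually (lt_mem_nhds a1),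
      k1.continuousAt.eventually (gt_mem_nhds a2), k2.continuousAt.eventually (lt_mem_nhds a3),
      k2.continuousAt.eventually (gt_mem_nhds a4), e5, e6] with y b1 b2 b3 b4 b5 b6
    exact ⟨⟨⟨⟨b1.le, b2.le⟩, b3.le, b4.le⟩, b5.le⟩, b6.le⟩
  -- Interior points avoid the line q = p + 2ε, which represents the free boundary and along which
  -- `stripPoint` folds.
  have hint : ∀ y ∈ interior C, y.2 < y.1 + 2 * ε := by
    intro y hy
    have hev : ∀ᶠ t : ℝ in 𝓝 0, (y.1, y.2 + t) ∈ C := by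
      have hc : Continuous fun t : ℝ => (y.1, y.2 + t) := by fun_prop
      have := hc.tendsto 0
      simp only [add_zero] at this
      exact this.eventually (mem_interior_iff_mem_nhds.1 hy)
    obtain ⟨t, ht, ht0⟩ := ((hev.filter_mono nhdsWithin_le_nhds).and
      (self_mem_nhdsWithin (s := Ioi 0))).exists
    have h1 : y.2 + t ≤ y.1 + 2 * ε := ht.2
    have h2 : 0 < t := ht0
    linarith
  set ψ : ℝ × ℝ → ℝ × ℝ := fun x => (uL ε x, uR ε x) with hψ
  have cψ : Continuous ψ := (continuous_uL ε).prodMk (continuous_uR ε)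
  have hsub : interior C ⊆ C := interior_subset
  -- Openness is read off from a preimage. The restriction to points below the free boundary is
  -- needed because the square root in uL and uR takes its default value 0 beyond it.
  have himg : stripPoint ε '' interior C =
      ψ ⁻¹' interior C ∩ {x | x.2 < x.1 ^ 2 + ε ^ 2} := by
    ext x; constructor
    · rintro ⟨y, hy, rfl⟩
      have h1 : y.2 ≤ y.1 + 2 * ε := (hsub hy).2
      refine ⟨?_, ?_⟩
      · simp only [hψ, mem_preimage, uL_stripPoint h1, uR_stripPoint h1]; exact hy
      · have := hint y hy
        have : 0 < (ε - (y.2 - y.1) / 2) ^ 2 := pow_pos (by linarith) 2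
        simp only [stripPoint, mem_ofPred_eq]; linarith
    · rintro ⟨h1, h2⟩
      refine ⟨ψ x, h1, ?_⟩
      have h3 : uL ε x ≤ uR ε x := (hsub h1).1.2
      have h4 : rad ε x ^ 2 = x.1 ^ 2 + ε ^ 2 - x.2 :=
        Real.sq_sqrt (by have : x.2 < x.1 ^ 2 + ε ^ 2 := h2; linarith)
      ext
      · simp only [hψ, stripPoint]; linarith [uL_add_uR (ε := ε) (x := x)]
      · simp only [hψ, stripPoint, uL_eq, uR_eq]; linear_combination -h4
  refine ⟨stripPoint ε '' interior C, ?_, ?_, ?_, ?_⟩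
  · rw [himg]
    exact (isOpen_interior.preimage cψ).inter (isOpen_lt continuous_snd (by fun_prop))
  · exact ⟨ne.image _, cC.interior.isPreconnected.image _ (continuous_stripPoint ε).continuousOn⟩
  · rintro _ ⟨y, hy, rfl⟩
    obtain ⟨⟨⟨h1, h2⟩, h3⟩, h4⟩ := hsub hy
    refine ⟨stripPoint_mem h3 h4, ?_, ?_⟩
    · rw [uL_stripPoint h4]; exact h1
    · rw [uR_stripPoint h4]; exact h2
  · intro x hx
    have h1 : ψ x ∈ C := ⟨⟨⟨hx.2.1, hx.2.2⟩, uL_le_uR hε hx.1⟩, uR_le_uL⟩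
    have h2 : ψ x ∈ closure (interior C) := by
      rw [cC.closure_interior_eq_closure_of_nonempty_interior ne]; exact subset_closure h1
    rw [← stripPoint_uL_uR hx.1]
    exact image_closure_subset_closure_image (continuous_stripPoint ε) (mem_image_of_mem _ h2)

/-- Interior points of figures satisfy strict inequalities. -/
lemma interior_box_subset (h : x ∈ interior (box ε l₁ h₁ l₂ h₂)) :
    x ∈ strip ε ∧ l₁ < uL ε x ∧ uL ε x < h₁ ∧ l₂ < uR ε x ∧ uR ε x < h₂ := by
  have hx := interior_subset h
  have hn := mem_interior_iff_mem_nhds.1 h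
  have hrad : uR ε x < uL ε x + 2 * ε := by
    have hev : ∀ᶠ t : ℝ in 𝓝 0, (x.1, x.2 + t) ∈ box ε l₁ h₁ l₂ h₂ := by
      have hc : Continuous fun t : ℝ => (x.1, x.2 + t) := by fun_prop
      have := hc.tendsto 0
      simp only [add_zero] at this
      exact this.eventually hn
    obtain ⟨t, ht, ht0⟩ := ((hev.filter_mono nhdsWithin_le_nhds).and
      (self_mem_nhdsWithin (s := Ioi 0))).exists
    have h1 : x.2 + t ≤ x.1 ^ 2 + ε ^ 2 := ht.1.2
    have h2 : 0 < t := ht0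
    have h3 : 0 < rad ε x := Real.sqrt_pos.2 (by linarith)
    rw [uR_eq, uL_eq]; linarith
  have key : ∀ s₁ s₂ : ℝ, ∃ t > 0, (l₁ ≤ ((uL ε x + s₁ * t : ℝ) : EReal) ∧
      ((uL ε x + s₁ * t : ℝ) : EReal) ≤ h₁) ∧ l₂ ≤ ((uR ε x + s₂ * t : ℝ) : EReal) ∧
      ((uR ε x + s₂ * t : ℝ) : EReal) ≤ h₂ := by
    -- Off the free boundary both coordinates of an interior point may be moved a little in either
    -- direction inside the box, so none of its bounds is attained.
    intro s₁ s₂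
    have hc : Continuous fun t : ℝ => stripPoint ε (uL ε x + s₁ * t, uR ε x + s₂ * t) :=
      (continuous_stripPoint ε).comp (by fun_prop)
    have e1 := hc.tendsto 0
    simp only [mul_zero, add_zero, stripPoint_uL_uR hx.1] at e1
    have e2 : ∀ᶠ t : ℝ in 𝓝 0, uR ε x + s₂ * t < uL ε x + s₁ * t + 2 * ε := by
      have hc1 : Continuous fun t : ℝ => uR ε x + s₂ * t := by fun_prop
      have hc2 : Continuous fun t : ℝ => uL ε x + s₁ * t + 2 * ε := by fun_prop
      exact (isOpen_lt hc1 hc2).mem_nhds (by simpa using hrad)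
    obtain ⟨t, ⟨ht, ht'⟩, ht0⟩ := ((((e1.eventually hn).and e2).filter_mono nhdsWithin_le_nhds).and
      (self_mem_nhdsWithin (s := Ioi 0))).exists
    have := ht.2
    rw [uL_stripPoint ht'.le, uR_stripPoint ht'.le] at this
    exact ⟨t, ht0, this⟩
  obtain ⟨t, ht0, ⟨b1, -⟩, b2, -⟩ := key (-1) (-1)
  obtain ⟨s, hs0, ⟨-, b3⟩, -, b4⟩ := key 1 1
  exact ⟨hx.1, b1.trans_lt (EReal.coe_lt_coe_iff.2 (by linarith)),
    (EReal.coe_lt_coe_iff.2 (by linarith)).trans_le b3,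
    b2.trans_lt (EReal.coe_lt_coe_iff.2 (by linarith)),
    (EReal.coe_lt_coe_iff.2 (by linarith)).trans_le b4⟩

end coordinates

/-! ## Extremals -/

section extremals

variable {ε : ℝ} (hε : 0 < ε)

lemma mem_segment_prod {P Q x : ℝ × ℝ} : x ∈ segment ℝ P Q ↔
    ∃ s ∈ Icc (0 : ℝ) 1, x.1 = P.1 + s * (Q.1 - P.1) ∧ x.2 = P.2 + s * (Q.2 - P.2) := by
  rw [segment_eq_image']
  constructor
  · rintro ⟨s, hs, rfl⟩; exact ⟨s, hs, by simp, by simp⟩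
  · rintro ⟨s, hs, h1, h2⟩; exact ⟨s, hs, by ext <;> simp [h1, h2]⟩

include hε

/-- The right tangent at `u` consists of the points with `uR = u`. -/
lemma mem_rightTangent {u : ℝ} {x : ℝ × ℝ} :
    x ∈ segment ℝ (u, u ^ 2) (u - ε, (u - ε) ^ 2 + ε ^ 2) ↔ x ∈ strip ε ∧ uR ε x = u := by
  rw [mem_segment_prod]
  constructor
  · rintro ⟨s, hs, h1, h2⟩
    have e : x = stripPoint ε (u - 2 * s * ε, u) := by
      ext
      · rw [h1, stripPoint]; ring
      · rw [h2, stripPoint]; ring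
    have h3 : u ≤ u - 2 * s * ε + 2 * ε := by nlinarith [hs.2]
    rw [e]
    exact ⟨stripPoint_mem (by simp only; nlinarith [hs.1]) h3, uR_stripPoint h3⟩
  · rintro ⟨hx, hu⟩
    have hr := rad_le hε hx
    have hr0 := rad_nonneg (ε := ε) (x := x)
    have hsq := rad_sq hx
    have e1 : x.1 = u - ε + rad ε x := by rw [uR_eq] at hu; linarith
    have e2 : rad ε x = rad ε x / ε * ε := by field_simp
    refine ⟨1 - rad ε x / ε, ⟨?_, ?_⟩, ?_, ?_⟩
    · rw [sub_nonneg, div_le_one hε]; exact hr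
    · have : 0 ≤ rad ε x / ε := by positivity
      linarith
    · simp only; linear_combination e1 + e2
    · simp only
      have e3 : x.2 = x.1 ^ 2 + ε ^ 2 - rad ε x ^ 2 := by linarith
      rw [e3, e1]
      linear_combination (2 * u - 2 * ε) * e2

lemma mem_leftTangent {u : ℝ} {x : ℝ × ℝ} :
    x ∈ segment ℝ (u, u ^ 2) (u + ε, (u + ε) ^ 2 + ε ^ 2) ↔ x ∈ strip ε ∧ uL ε x = u := by
  rw [mem_segment_prod]
  constructor
  · rintro ⟨s, hs, h1, h2⟩
    have e : x = stripPoint ε (u, u + 2 * s * ε) := by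
      ext
      · rw [h1, stripPoint]; ring
      · rw [h2, stripPoint]; ring
    have h3 : u + 2 * s * ε ≤ u + 2 * ε := by nlinarith [hs.2]
    rw [e]
    exact ⟨stripPoint_mem (by simp only; nlinarith [hs.1]) h3, uL_stripPoint h3⟩
  · rintro ⟨hx, hu⟩
    have hr := rad_le hε hx
    have hr0 := rad_nonneg (ε := ε) (x := x)
    have hsq := rad_sq hx
    have e1 : x.1 = u + ε - rad ε x := by rw [uL_eq] at hu; linarith
    have e2 : rad ε x = rad ε x / ε * ε := by field_simp
    refine ⟨1 - rad ε x / ε, ⟨?_, ?_⟩, ?_, ?_⟩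
    · rw [sub_nonneg, div_le_one hε]; exact hr
    · have : 0 ≤ rad ε x / ε := by positivity
      linarith
    · simp only; linear_combination e1 - e2
    · simp only
      have e3 : x.2 = x.1 ^ 2 + ε ^ 2 - rad ε x ^ 2 := by linarith
      rw [e3, e1]
      linear_combination (-2 * u - 2 * ε) * e2

lemma isExtremal_rightTangent (u : ℝ) :
    IsExtremalSegment ε (u, u ^ 2) (u - ε, (u - ε) ^ 2 + ε ^ 2) := by
  refine ⟨fun h => ?_, rfl, fun x hx => ((mem_rightTangent hε).1 hx).1, Or.inr ⟨rfl, ?_⟩⟩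
  · have := congrArg Prod.fst h; simp only at this; linarith
  · simp only; ring

lemma isExtremal_leftTangent (u : ℝ) :
    IsExtremalSegment ε (u, u ^ 2) (u + ε, (u + ε) ^ 2 + ε ^ 2) := by
  refine ⟨fun h => ?_, rfl, fun x hx => ((mem_leftTangent hε).1 hx).1, Or.inr ⟨rfl, ?_⟩⟩
  · have := congrArg Prod.fst h; simp only at this; linarith
  · simp only; ring

omit hε in
lemma mem_chord {a b : ℝ} (hab : a < b) {x : ℝ × ℝ} :
    x ∈ segment ℝ (a, a ^ 2) (b, b ^ 2) ↔ x.1 ^ 2 ≤ x.2 ∧ x.2 - (a + b) * x.1 + a * b = 0 := by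
  rw [mem_segment_prod]
  have hba : 0 < b - a := by linarith
  constructor
  · rintro ⟨s, hs, h1, h2⟩
    simp only at h1 h2
    refine ⟨?_, by rw [h1, h2]; ring⟩
    have : x.2 - x.1 ^ 2 = s * (1 - s) * (b - a) ^ 2 := by rw [h1, h2]; ring
    have : 0 ≤ s * (1 - s) * (b - a) ^ 2 :=
      mul_nonneg (mul_nonneg hs.1 (sub_nonneg.2 hs.2)) (sq_nonneg _)
    linarith
  · rintro ⟨h1, h2⟩
    have h3 : (x.1 - a) * (x.1 - b) ≤ 0 := by nlinarith
    have e : (x.1 - a) / (b - a) * (b - a) = x.1 - a := div_mul_cancel₀ _ hba.ne'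
    refine ⟨(x.1 - a) / (b - a), ⟨?_, ?_⟩, ?_, ?_⟩
    · apply div_nonneg _ hba.le
      by_contra! hc
      have := mul_pos_of_neg_of_neg hc (show x.1 - b < 0 by linarith); linarith
    · rw [div_le_one hba]
      by_contra! hc
      have := mul_pos (show 0 < x.1 - a by linarith) (show 0 < x.1 - b by linarith); linarith
    · simp only; linarith
    · simp only; linear_combination h2 - (b + a) * e

omit hε in
lemma chord_subset_strip {a b : ℝ} (hab : a < b) (h : b - a ≤ 2 * ε) :
    segment ℝ (a, a ^ 2) (b, b ^ 2) ⊆ strip ε := by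
  intro x hx
  obtain ⟨h1, h2⟩ := (mem_chord hab).1 hx
  refine ⟨h1, ?_⟩
  nlinarith [sq_nonneg (x.1 - (a + b) / 2), mul_self_le_mul_self (show 0 ≤ b - a by linarith) h]

end extremals

namespace Layout

/-! ## The function constructed from a layout -/

variable {f : ℝ → ℝ} {ε : ℝ} {n : ℕ} (Λ : Layout f (deriv f) (deriv (deriv f)) ε n)

def B (x : ℝ × ℝ) : ℝ := (Λ.foliation.plane x).ev x

def dB (x : ℝ × ℝ) : ℝ × ℝ →L[ℝ] ℝ := (Λ.foliation.plane x).grad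

section planes

variable {i : Fin (n + 1)} {x : ℝ × ℝ}

lemma plane_R (hx : x ∈ strip ε) (h1 : Λ.b i ≤ uR ε x) (h2 : uR ε x ≤ Λ.wr i) :
    Λ.foliation.plane x = tp f (deriv f) (uR ε x) (Λ.MR i (uR ε x) / 2) := by
  have h3 : (uL ε x : EReal) ≤ Λ.wr i :=
    le_trans (EReal.coe_le_coe_iff.2 (uL_le_uR Λ.pos hx)) h2
  have : Λ.foliation.plane x = Λ.Rp i (uR ε x) :=
    Λ.foliation.plane_of_FR Λ.pos (i := i) ⟨hx, h1, h3⟩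
  rw [this, Rp, Λ.capR_eq h2]

lemma plane_L (hx : x ∈ strip ε) (h1 : Λ.wl i ≤ uL ε x) (h2 : uL ε x ≤ Λ.a i) :
    Λ.foliation.plane x = tp f (deriv f) (uL ε x) (Λ.ML i (uL ε x) / 2) := by
  have h3 : Λ.wl i ≤ uR ε x := h1.trans (EReal.coe_le_coe_iff.2 (uL_le_uR Λ.pos hx))
  have : Λ.foliation.plane x = Λ.Lp i (uL ε x) :=
    Λ.foliation.plane_of_FL Λ.pos (i := i) ⟨hx, h3, h2⟩
  rw [this, Lp, Λ.capL_eq h1]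

lemma plane_angle {k : Fin n} (hx : x ∈ strip ε) (h1 : Λ.w k ≤ uR ε x) (h2 : uL ε x ≤ Λ.w k) :
    Λ.foliation.plane x = tp f (deriv f) (Λ.w k) (Λ.MR k.castSucc (Λ.w k) / 2) := by
  have h3 : (uL ε x : EReal) ≤ Λ.wr k.castSucc := by simpa [wr] using h2
  have h4 : Λ.b k.castSucc ≤ uR ε x := (Λ.b_lt_w k).le.trans (EReal.coe_le_coe_iff.2 h1)
  have : Λ.foliation.plane x = Λ.Rp k.castSucc (uR ε x) :=
    Λ.foliation.plane_of_FR Λ.pos (i := k.castSucc) ⟨hx, h4, h3⟩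
  rw [this, Rp, Λ.capR_castSucc, min_eq_right h1]

lemma plane_Pk (hx : x ∈ Λ.Pk i) : Λ.foliation.plane x = Λ.Kp i x :=
  Λ.foliation.plane_of_Pk Λ.pos hx

/-- The figures cover the strip. -/
lemma exists_figure (hx : x ∈ strip ε) :
    (∃ i, Λ.b i ≤ uR ε x ∧ uR ε x ≤ Λ.wr i) ∨ (∃ i, Λ.wl i ≤ uL ε x ∧ uL ε x ≤ Λ.a i) ∨
      (∃ k, Λ.w k ≤ uR ε x ∧ uL ε x ≤ Λ.w k) ∨ ∃ i, x ∈ Λ.Pk i := by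
  obtain ⟨i, P, h | h | h⟩ := Λ.foliation.exists_selAt Λ.pos hx
  · obtain ⟨⟨-, h1, h2⟩, -⟩ := h
    replace h1 : Λ.b i ≤ uR ε x := h1
    replace h2 : uL ε x ≤ Λ.wr i := h2
    rcases Λ.capR_cases i (uR ε x) with h3 | ⟨k, rfl, h3, -⟩
    · exact Or.inl ⟨i, h1, h3.2⟩
    · exact Or.inr (Or.inr (Or.inl ⟨k, h3.le, by simpa [wr] using h2⟩))
  · obtain ⟨⟨-, h1, h2⟩, -⟩ := h
    replace h1 : Λ.wl i ≤ uR ε x := h1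
    replace h2 : uL ε x ≤ Λ.a i := h2
    rcases Λ.capL_cases i (uL ε x) with h3 | ⟨k, rfl, h3, -⟩
    · exact Or.inr (Or.inl ⟨i, h3.2, h2⟩)
    · exact Or.inr (Or.inr (Or.inl ⟨k, by simpa [wl] using h1, h3.le⟩))
  · exact Or.inr (Or.inr (Or.inr ⟨i, h.1⟩))

lemma continuousOn_dB : ContinuousOn Λ.dB (strip ε) :=
  Plane.continuous_grad.comp_continuousOn (Λ.foliation.continuousOn_plane Λ.pos)

lemma hasFDerivWithinAt_B (hx : x ∈ strip ε) : HasFDerivWithinAt Λ.B (Λ.dB x) (strip ε) x :=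
  (Λ.foliation.locallySupported Λ.pos).hasFDerivWithinAt Λ.pos
    (Λ.foliation.continuousOn_plane Λ.pos) hx

lemma continuousOn_B : ContinuousOn Λ.B (strip ε) := fun _ hx =>
  (Λ.hasFDerivWithinAt_B hx).continuousWithinAt

lemma contDiffOn_B : ContDiffOn ℝ 1 Λ.B (strip ε) :=
  (Λ.foliation.locallySupported Λ.pos).contDiffOn Λ.pos (Λ.foliation.continuousOn_plane Λ.pos)

lemma locallyConcaveOn_B : LocallyConcaveOn (strip ε) Λ.B :=
  (Λ.foliation.locallySupported Λ.pos).locallyConcaveOn (Λ.foliation.continuousOn_plane Λ.pos)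

lemma isC1DifferentialOn {D : Set (ℝ × ℝ)} (hD : D ⊆ strip ε) : IsC1DifferentialOn Λ.B Λ.dB D :=
  ⟨Λ.continuousOn_dB.mono hD, fun _ hx => (Λ.hasFDerivWithinAt_B (hD hx)).mono hD⟩

lemma linear_of_plane_eq {x y : ℝ × ℝ} (h : Λ.foliation.plane x = Λ.foliation.plane y) :
    Λ.dB x = Λ.dB y ∧ Λ.B x = Λ.B y + Λ.dB y (x - y) := by
  refine ⟨by rw [dB, h, dB], ?_⟩
  rw [B, B, dB, h, ← Plane.ev_sub]; ring

end planes

section cup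

variable {i : Fin (n + 1)} (hi : Λ.isCup i) {l : ℝ} (hl0 : 0 ≤ l) (hl : l ≤ 2 * ε) {x : ℝ × ℝ}
include hl0 hl

lemma mem_Pk_of_chord (hx : x.1 ^ 2 ≤ x.2) (h0 : (Λ.cup i hi).chordFun l x = 0) :
    x ∈ Λ.Pk i ∧ (Λ.cup i hi).level (2 * ε) x = l := by
  have h2 := Λ.two_eps_pos
  have hle : (Λ.cup i hi).chordFun (2 * ε) x ≤ 0 := by
    rcases hl.eq_or_lt with rfl | hlt
    · exact h0.le
    · exact ((Λ.cup i hi).chordFun_neg_of_lt hl0 hlt (Λ.cup_lt i hi) hx h0.le).le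
  have hs : x ∈ strip ε := by
    refine ⟨hx, ?_⟩
    simp only [CupData.chordFun, CupData.right] at hle
    nlinarith [sq_nonneg (x.1 - (Λ.cup i hi).left (2 * ε) - ε)]
  exact ⟨(Λ.mem_Pk_iff hi).2 ⟨hs, hle⟩,
    (Λ.cup i hi).level_unique h2.le (Λ.cup_lt i hi) hx hle ⟨hl0, hl⟩ h0⟩

lemma plane_chord (hx : x.1 ^ 2 ≤ x.2) (h0 : (Λ.cup i hi).chordFun l x = 0) :
    Λ.foliation.plane x = (Λ.cup i hi).chordPlane l := by
  obtain ⟨h1, h2⟩ := Λ.mem_Pk_of_chord hi hl0 hl hx h0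
  rw [Λ.plane_Pk h1, Λ.Kp_cup hi, h2]

end cup

section cup

variable {i : Fin (n + 1)} (hi : Λ.isCup i) {l : ℝ} (hl0 : 0 < l) (hl : l ≤ 2 * ε)
include hl0 hl

lemma chordPlane_right : (Λ.cup i hi).chordPlane l =
    tp f (deriv f) ((Λ.cup i hi).right l) ((Λ.cup i hi).chordSlope l / 2) := by
  obtain ⟨-, -, h3⟩ := (Λ.cup i hi).left_spec hl0 (hl.trans_lt (Λ.cup_lt i hi))
  have hne : (Λ.cup i hi).left l ≠ (Λ.cup i hi).left l + l := by linarith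
  rw [CupData.chordPlane, CupData.chordSlope, if_neg hl0.ne']
  exact tp_chord hne h3

lemma chordPlane_ev {x : ℝ × ℝ} (h0 : (Λ.cup i hi).chordFun l x = 0) :
    ((Λ.cup i hi).chordPlane l).ev x =
      (f ((Λ.cup i hi).right l) - f ((Λ.cup i hi).left l)) /
        ((Λ.cup i hi).right l - (Λ.cup i hi).left l) * x.1 +
      ((Λ.cup i hi).right l * f ((Λ.cup i hi).left l) -
        (Λ.cup i hi).left l * f ((Λ.cup i hi).right l)) /
        ((Λ.cup i hi).right l - (Λ.cup i hi).left l) := by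
  have e1 : ((Λ.cup i hi).chordPlane l).ev ((Λ.cup i hi).left l, (Λ.cup i hi).left l ^ 2) =
      f ((Λ.cup i hi).left l) := by rw [CupData.chordPlane, tp_ev]; simp only; ring
  have e2 : ((Λ.cup i hi).chordPlane l).ev ((Λ.cup i hi).right l, (Λ.cup i hi).right l ^ 2) =
      f ((Λ.cup i hi).right l) := by rw [Λ.chordPlane_right hi hl0 hl, tp_ev]; simp only; ring
  have hba : (Λ.cup i hi).right l - (Λ.cup i hi).left l = l := by rw [CupData.right]; ring
  set a := (Λ.cup i hi).left l
  set b := (Λ.cup i hi).right l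
  have h0' : x.2 - (a + b) * x.1 + a * b = 0 := h0
  rw [← e1, ← e2]
  simp only [Plane.ev]
  have hba' : b - a ≠ 0 := by rw [hba]; exact hl0.ne'
  field_simp
  linear_combination ((Λ.cup i hi).chordPlane l).2.2 * (b - a) * h0'

end cup

lemma B_boundary (u : ℝ) : Λ.B (u, u ^ 2) = f u := by
  have hs : ((u, u ^ 2) : ℝ × ℝ) ∈ strip ε := ⟨le_rfl, by simp only; nlinarith [Λ.pos]⟩
  have hr : rad ε (u, u ^ 2) = ε := by
    rw [rad]; simp only
    rw [add_sub_cancel_left, Real.sqrt_sq Λ.pos.le]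
  have hR : uR ε (u, u ^ 2) = u := by rw [uR_eq, hr]; simp
  have hL : uL ε (u, u ^ 2) = u := by rw [uL_eq, hr]; simp
  have ev : ∀ β, (tp f (deriv f) u β).ev (u, u ^ 2) = f u := fun β => by
    rw [tp_ev]; simp only; ring
  rcases Λ.exists_figure hs with ⟨i, h1, h2⟩ | ⟨i, h1, h2⟩ | ⟨k, h1, h2⟩ | ⟨i, hi⟩
  · rw [B, Λ.plane_R hs h1 h2, hR, ev]
  · rw [B, Λ.plane_L hs h1 h2, hL, ev]
  · rw [hR] at h1
    rw [hL] at h2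
    rw [B, Λ.plane_angle (k := k) hs (by rwa [hR]) (by rwa [hL]), le_antisymm h1 h2, ev]
  · by_cases hc : Λ.isCup i
    · have hi' := (Λ.mem_Pk_iff hc).1 hi
      obtain ⟨h1, h2⟩ := (Λ.cup i hc).level_spec Λ.two_eps_pos.le (Λ.cup_lt i hc) hs.1 hi'.2
      rw [B, Λ.plane_Pk hi, Λ.Kp_cup hc]
      -- A point of the parabola that lies on a chord is one of the ends of the chord, and the plane
      -- is tangent to the curve at both.
      have h3 : (u - (Λ.cup i hc).left ((Λ.cup i hc).level (2 * ε) (u, u ^ 2))) *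
          (u - (Λ.cup i hc).right ((Λ.cup i hc).level (2 * ε) (u, u ^ 2))) = 0 := by
        rw [CupData.chordFun_eq] at h2; simpa using h2
      rcases mul_eq_zero.1 h3 with h4 | h4
      · rw [CupData.chordPlane, ← sub_eq_zero.1 h4, ev]
      · rcases h1.1.eq_or_lt with h5 | h5
        · rw [← h5, CupData.right, add_zero] at h4
          rw [← h5, CupData.chordPlane, ← sub_eq_zero.1 h4, ev]
        · rw [Λ.chordPlane_right hc h5 h1.2, ← sub_eq_zero.1 h4, ev]
    · rw [B, Λ.plane_Pk hi, Λ.Kp_flat hc hi (t := u) (by simpa [hL] using hi.2.1)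
        (by simpa [hR] using hi.2.2), ev]

/-! ## Standard candidates -/

lemma isStandard_angle (k : Fin n) : (Vertex.angle (Λ.w k)).IsStandard f ε Λ.B := by
  set P := tp f (deriv f) (Λ.w k) (Λ.MR k.castSucc (Λ.w k) / 2) with hP
  refine ⟨P.1, P.2.1, P.2.2, fun x hx => ?_, fun p hp t h1 h2 => ?_, trivial⟩
  · obtain ⟨hs, h1, h2, -⟩ := hx
    simp only [Vertex.arcs, leftEnd, rightEnd, List.head?_cons, List.getLast?_singleton,
      Option.map_some, Option.getD_some, EReal.coe_le_coe_iff] at h1 h2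
    rw [B, Λ.plane_angle (k := k) hs h1 h2]; rfl
  · simp only [Vertex.arcs, List.mem_singleton] at hp
    subst hp
    rw [EReal.coe_le_coe_iff] at h1 h2
    obtain rfl := le_antisymm h2 h1
    simp only [hP, tp]
    constructor <;> ring

lemma tp_tangent (u β : ℝ) :
    f u = (tp f (deriv f) u β).1 + (tp f (deriv f) u β).2.1 * u + (tp f (deriv f) u β).2.2 * u ^ 2 ∧
      deriv f u = (tp f (deriv f) u β).2.1 + 2 * (tp f (deriv f) u β).2.2 * u := by
  simp only [tp]; constructor <;> ring

lemma isStandard_multicup {i : Fin (n + 1)} (hi : ¬ Λ.isCup i) (hab : Λ.a i < Λ.b i) :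
    (Vertex.multicup [(Λ.a i, Λ.b i)]).IsStandard f ε Λ.B := by
  obtain ⟨t, ht1, ht2⟩ := EReal.lt_iff_exists_real_btwn.1 hab
  refine ⟨(tp f (deriv f) t (Λ.K i / 2)).1, (tp f (deriv f) t (Λ.K i / 2)).2.1,
    (tp f (deriv f) t (Λ.K i / 2)).2.2, fun x hx => ?_, fun p hp s h1 h2 => ?_, trivial⟩
  · obtain ⟨hs, h1, h2, -⟩ := hx
    simp only [Vertex.arcs, leftEnd, rightEnd, List.head?_cons, List.getLast?_singleton,
      Option.map_some, Option.getD_some] at h1 h2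
    have hP : x ∈ Λ.Pk i := ⟨hs, h1, h2⟩
    rw [B, Λ.plane_Pk hP, Λ.Kp_flat hi hP ht1.le ht2.le]; rfl
  · simp only [Vertex.arcs, List.mem_singleton] at hp
    subst hp
    rw [Λ.flat_plane hi ht1.le ht2.le h1 h2]
    exact tp_tangent s _

lemma average_deriv {F F' : ℝ → ℝ} (h : ∀ t, HasDerivAt F (F' t) t) (hc : Continuous F') (a b : ℝ) :
    average F' a b = (F b - F a) / (b - a) := by
  rw [average, intervalIntegral.integral_eq_sub_of_hasDerivAt (fun t _ => h t)
    (hc.intervalIntegrable a b)]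

lemma diffs_cup {i : Fin (n + 1)} (hi : Λ.isCup i) {l : ℝ} (hl0 : 0 < l) (hl : l ≤ 2 * ε) :
    diffL f ((Λ.cup i hi).left l) ((Λ.cup i hi).right l) < 0 ∧
      diffR f ((Λ.cup i hi).left l) ((Λ.cup i hi).right l) < 0 := by
  have := (Λ.cup i hi).diffs_neg hl0 (hl.trans_lt (Λ.cup_lt i hi))
  rw [diffL, diffR, average_deriv Λ.deriv1 Λ.cont]
  exact ⟨sub_neg.2 this.1, sub_neg.2 this.2⟩

lemma isStandard_longChord {i : Fin (n + 1)} (hi : Λ.isCup i) :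
    (Vertex.longChord ((Λ.cup i hi).left (2 * ε)) ((Λ.cup i hi).right (2 * ε))).IsStandard
      f ε Λ.B := by
  have h2 := Λ.two_eps_pos
  set P := (Λ.cup i hi).chordPlane (2 * ε) with hP
  refine ⟨P.1, P.2.1, P.2.2, fun x hx => ?_, fun p hp s h1 h2 => ?_,
    (Λ.diffs_cup hi h2 le_rfl).1.ne, (Λ.diffs_cup hi h2 le_rfl).2.ne⟩
  · obtain ⟨hs, h3, h4, h5⟩ := hx
    simp only [Vertex.arcs, leftEnd, rightEnd, List.head?_cons, List.getLast?_cons_cons,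
      List.getLast?_singleton, Option.map_some, Option.getD_some, EReal.coe_le_coe_iff] at h3 h4
    have h6 := h5 (((Λ.cup i hi).left (2 * ε) : EReal), ((Λ.cup i hi).right (2 * ε) : EReal))
      (by simp [Vertex.arcs, gaps])
    simp only [EReal.toReal_coe, AboveChord] at h6
    have h7 := ((Λ.cup i hi).chordFun_full_nonpos_iff hs).2 ⟨h3, h4⟩
    have h8 : (Λ.cup i hi).chordFun (2 * ε) x = 0 := le_antisymm h7 (by
      rw [CupData.chordFun]; linarith)
    rw [B, Λ.plane_chord hi h2.le le_rfl hs.1 h8]; rfl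
  · simp only [Vertex.arcs, List.mem_cons, List.not_mem_nil, or_false] at hp
    rcases hp with rfl | rfl <;> rw [EReal.coe_le_coe_iff] at h1 h2 <;>
      obtain rfl := le_antisymm h2 h1
    · exact tp_tangent _ _
    · rw [hP, Λ.chordPlane_right hi Λ.two_eps_pos le_rfl]; exact tp_tangent _ _

/-- The domain of an origin is the single point (p, p²), so the second coefficient of the plane is
arbitrary; zero is taken. -/
lemma isStandard_origin (p : ℝ) : (Vertex.origin p).IsStandard f ε Λ.B := by
  refine ⟨(tp f (deriv f) p 0).1, (tp f (deriv f) p 0).2.1, (tp f (deriv f) p 0).2.2,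
    fun x hx => ?_, fun q hq s h1 h2 => ?_, trivial⟩
  · obtain ⟨hs, h1, -⟩ := hx
    simp only [Vertex.arcs, leftEnd, rightEnd, List.head?_cons, List.getLast?_singleton,
      Option.map_some, Option.getD_some, EReal.toReal_coe, BelowChord] at h1
    have h2 := hs.1
    have h3 : x.1 = p := by nlinarith [sq_nonneg (x.1 - p)]
    have h4 : x = (p, p ^ 2) := by
      ext
      · exact h3
      · simp only; rw [h3] at h1 h2; linarith
    rw [h4, Λ.B_boundary]; exact (tp_tangent p 0).1
  · simp only [Vertex.arcs, List.mem_singleton] at hq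
    subst hq
    rw [EReal.coe_le_coe_iff] at h1 h2
    obtain rfl := le_antisymm h2 h1
    exact tp_tangent _ _

lemma isStandard_infinity (o : Orient) : (Vertex.negInfinity o).IsStandard f ε Λ.B ∧
    (Vertex.posInfinity o).IsStandard f ε Λ.B :=
  ⟨⟨0, 0, 0, fun x hx => absurd hx (notMem_empty x), fun _ hp => absurd hp (List.not_mem_nil),
    trivial⟩, ⟨0, 0, 0, fun x hx => absurd hx (notMem_empty x),
    fun _ hp => absurd hp (List.not_mem_nil), trivial⟩⟩

lemma standardChords {i : Fin (n + 1)} (hi : Λ.isCup i) :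
    StandardChords f 0 (2 * ε) (Λ.cup i hi).left (Λ.cup i hi).right Λ.B := by
  have hsub : Icc 0 (2 * ε) ⊆ Ico 0 (Λ.δ i) := fun t ht => ⟨ht.1, ht.2.trans_lt (Λ.cup_lt i hi)⟩
  refine ⟨(Λ.cup i hi).continuousOn_left.mono hsub, (Λ.cup i hi).continuousOn_right.mono hsub,
    fun l hl => ?_, fun l hl hl0 => ?_⟩
  · have hlδ := hl.2.trans (Λ.cup_lt i hi)
    have hd := (Λ.cup i hi).deriv_right hl.1 hlδ
    obtain ⟨h1, h2⟩ := (Λ.cup i hi).deriv_left_neg hl.1 hlδ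
    exact ⟨((Λ.cup i hi).hasDerivAt_left hl.1 hlδ).differentiableAt, hd.differentiableAt, h1,
      by rwa [hd.deriv], Λ.diffs_cup hi hl.1 hl.2.le⟩
  · obtain ⟨-, -, h3⟩ := (Λ.cup i hi).left_spec hl0 (hl.2.trans_lt (Λ.cup_lt i hi))
    have hab : (Λ.cup i hi).left l < (Λ.cup i hi).right l := by rw [CupData.right]; linarith
    have hc : Continuous (deriv f) := continuous_iff_continuousAt.2 fun t => (Λ.deriv1 t).continuousAt
    refine ⟨?_, fun x hx => ?_⟩
    · rw [CupEquation, average_deriv Λ.deriv0 hc]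
      rw [div_eq_iff (by linarith)]
      unfold cupFun at h3
      rw [CupData.right]; linarith
    · obtain ⟨h4, h5⟩ := (mem_chord hab).1 hx
      rw [B, Λ.plane_chord hi hl.1 hl.2 h4 h5, Λ.chordPlane_ev hi hl0 hl.2 h5]

/-- The slopes of the standard candidate on right tangents. -/
def mR (i : Fin (n + 1)) (u : ℝ) : ℝ := deriv f u - ε * Λ.MR i u

def mL (i : Fin (n + 1)) (u : ℝ) : ℝ := deriv f u + ε * Λ.ML i u

/-- Thus M = m', and the equation for M gives m'' = (f'' - M)/ε: the inequality M > f'' is the sign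
condition of a standard candidate. -/
lemma hasDerivAt_mR {i : Fin (n + 1)} {u : ℝ} (hu : Λ.b i < u) :
    HasDerivAt (Λ.mR i) (Λ.MR i u) u := by
  have hε := Λ.pos.ne'
  refine ((Λ.deriv1 u).sub ((Λ.MR_deriv i u hu).const_mul ε)).congr_deriv ?_
  field_simp; ring

lemma hasDerivAt_mL {i : Fin (n + 1)} {u : ℝ} (hu : u < Λ.a i) :
    HasDerivAt (Λ.mL i) (Λ.ML i u) u := by
  have hε := Λ.pos.ne'
  refine ((Λ.deriv1 u).add ((Λ.ML_deriv i u hu).const_mul ε)).congr_deriv ?_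
  field_simp; ring

lemma standardTangents_R (i : Fin (n + 1)) (hinf : Λ.b i = ⊥ → ∀ u : ℝ,
      IntegrableOn (fun t => deriv f t * Real.exp (t / ε)) (Iic u) ∧
      Λ.mR i u = avR ε (deriv f) u) :
    StandardTangents f ε .R (Λ.b i) (Λ.wr i) Λ.B := by
  have hε := Λ.pos.ne'
  have hc : Continuous (deriv f) := continuous_iff_continuousAt.2 fun t => (Λ.deriv1 t).continuousAt
  refine ⟨Λ.mR i, fun x hx => ?_, ?_, fun u h1 h2 => ?_, fun hb u _ => hinf hb u⟩
  · obtain ⟨hs, h1, h2⟩ := hx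
    change Λ.b i ≤ uR ε x at h1
    change uR ε x ≤ Λ.wr i at h2
    change Λ.B x = Λ.mR i (uR ε x) * (x.1 - uR ε x) + f (uR ε x)
    rw [B, Λ.plane_R hs h1 h2, tp_ev, mR]
    have := right_tangent_factor hs (uR ε x)
    linear_combination Λ.MR i (uR ε x) / 2 * this
  · exact (hc.sub (continuous_const.mul (Λ.MR_cont i))).continuousOn
  · refine ⟨(Λ.hasDerivAt_mR h1).congr_deriv ?_, ?_⟩
    · simp only [Orient.sign, mR]; field_simp; ring
    · have hev : deriv (Λ.mR i) =ᶠ[𝓝 u] Λ.MR i := by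
        have : ∀ᶠ t : ℝ in 𝓝 u, Λ.b i < t :=
          continuous_coe_real_ereal.continuousAt.eventually (lt_mem_nhds h1)
        filter_upwards [this] with t ht using (Λ.hasDerivAt_mR ht).deriv
      rw [hev.deriv_eq, (Λ.MR_deriv i u h1).deriv]
      simp only [Orient.sign, one_mul]
      exact div_neg_of_neg_of_pos (sub_neg.2 (Λ.MR_gt i u h1 h2)) Λ.pos

lemma standardTangents_L (i : Fin (n + 1)) (hinf : Λ.a i = ⊤ → ∀ u : ℝ,
      IntegrableOn (fun t => deriv f t * Real.exp (-t / ε)) (Ici u) ∧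
      Λ.mL i u = avL ε (deriv f) u) :
    StandardTangents f ε .L (Λ.wl i) (Λ.a i) Λ.B := by
  have hε := Λ.pos.ne'
  have hc : Continuous (deriv f) := continuous_iff_continuousAt.2 fun t => (Λ.deriv1 t).continuousAt
  refine ⟨Λ.mL i, fun x hx => ?_, ?_, fun u h1 h2 => ?_, fun hb u _ => hinf hb u⟩
  · obtain ⟨hs, h1, h2⟩ := hx
    change Λ.wl i ≤ uL ε x at h1
    change uL ε x ≤ Λ.a i at h2
    change Λ.B x = Λ.mL i (uL ε x) * (x.1 - uL ε x) + f (uL ε x)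
    rw [B, Λ.plane_L hs h1 h2, tp_ev, mL]
    have := left_tangent_factor hs (uL ε x)
    linear_combination Λ.ML i (uL ε x) / 2 * this
  · exact (hc.add (continuous_const.mul (Λ.ML_cont i))).continuousOn
  · refine ⟨(Λ.hasDerivAt_mL h2).congr_deriv ?_, ?_⟩
    · simp only [Orient.sign, mL]; field_simp; ring
    · have hev : deriv (Λ.mL i) =ᶠ[𝓝 u] Λ.ML i := by
        have : ∀ᶠ t : ℝ in 𝓝 u, t < Λ.a i :=
          continuous_coe_real_ereal.continuousAt.eventually (gt_mem_nhds h2)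
        filter_upwards [this] with t ht using (Λ.hasDerivAt_mL ht).deriv
      rw [hev.deriv_eq, (Λ.ML_deriv i u h2).deriv]
      simp only [Orient.sign, neg_one_mul, neg_lt_zero]
      exact div_pos (sub_pos.2 (Λ.ML_gt i u h2 h1)) Λ.pos

/-! ## The Bellman candidate -/

/-- The figures of a layout as domains of the plane. -/
def figure : Fin (n + 1) ⊕ Fin (n + 1) ⊕ Fin (n + 1) ⊕ Fin n → Set (ℝ × ℝ)
  | .inl i => box ε ⊥ ⊤ (Λ.b i) (Λ.wr i)
  | .inr (.inl i) => box ε (Λ.wl i) (Λ.a i) ⊥ ⊤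
  | .inr (.inr (.inl i)) => box ε (Λ.a i) ⊤ ⊥ (Λ.b i)
  | .inr (.inr (.inr k)) => box ε ⊥ (Λ.w k) (Λ.w k) ⊤

lemma b_lt_wr {i : Fin (n + 1)} (h : Λ.b i ≠ ⊤) : Λ.b i < Λ.wr i := by
  revert h
  refine Fin.lastCases (fun h => ?_) (fun k _ => ?_) i
  · simpa [wr] using lt_top_iff_ne_top.2 h
  · simpa [wr] using Λ.b_lt_w k

lemma wl_lt_a {i : Fin (n + 1)} (h : Λ.a i ≠ ⊥) : Λ.wl i < Λ.a i := by
  revert h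
  refine Fin.cases (fun h => ?_) (fun k _ => ?_) i
  · simpa [wl] using bot_lt_iff_ne_bot.2 h
  · simpa [wl] using Λ.w_lt_a k

/-- A flat peak with coinciding ends is a point at infinity, so its region contains no points of the
strip; a cup has ends 2ε apart. -/
lemma a_lt_b {i : Fin (n + 1)} (h : (Λ.Pk i).Nonempty) : Λ.a i < Λ.b i := by
  obtain ⟨x, hs, h1, h2⟩ := h
  have h3 : (uL ε x : EReal) ≤ uR ε x := EReal.coe_le_coe_iff.2 (uL_le_uR Λ.pos hs)
  refine lt_of_le_of_ne (h1.trans (h3.trans h2)) fun he => ?_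
  by_cases hi : Λ.isCup i
  · rw [Λ.cup_a i hi, Λ.cup_b i hi, EReal.coe_eq_coe_iff, CupData.right] at he
    linarith [Λ.two_eps_pos]
  · rcases Λ.flat_eq i hi he with h | h
    · rw [← he, h] at h2; exact absurd h2 (EReal.bot_lt_coe _).not_ge
    · rw [h] at h1; exact absurd h1 (EReal.coe_lt_top _).not_ge

lemma isPlanarDomain_figure {j} (h : (Λ.figure j).Nonempty) : IsPlanarDomain (Λ.figure j) := by
  have hε := Λ.pos
  rcases j with i | i | i | k
  · obtain ⟨x, -, -, h1, -⟩ := h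
    have hb : Λ.b i ≠ ⊤ := fun hh => by rw [hh] at h1; exact absurd h1 (EReal.coe_lt_top _).not_ge
    obtain ⟨t, h3, h4⟩ := EReal.lt_iff_exists_real_btwn.1 (Λ.b_lt_wr hb)
    exact isPlanarDomain_box (z := (t - ε, t)) hε (by simp only; linarith) (by simp only; linarith)
      (EReal.bot_lt_coe _) (EReal.coe_lt_top _) h3 h4
  · obtain ⟨x, -, ⟨-, h1⟩, -⟩ := h
    have hb : Λ.a i ≠ ⊥ := fun hh => by rw [hh] at h1; exact absurd h1 (EReal.bot_lt_coe _).not_ge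
    obtain ⟨t, h3, h4⟩ := EReal.lt_iff_exists_real_btwn.1 (Λ.wl_lt_a hb)
    exact isPlanarDomain_box (z := (t, t + ε)) hε (by simp only; linarith) (by simp only; linarith)
      h3 h4 (EReal.bot_lt_coe _) (EReal.coe_lt_top _)
  · have hab : Λ.a i < Λ.b i := Λ.a_lt_b (by
      obtain ⟨x, hs, h1, h2⟩ := h; exact ⟨x, hs, h1.1, h2.2⟩)
    obtain ⟨s, h1, h2⟩ := EReal.lt_iff_exists_real_btwn.1 hab
    obtain ⟨t, h3, h4⟩ := EReal.lt_iff_exists_real_btwn.1 h2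
    rw [EReal.coe_lt_coe_iff] at h3
    have m1 := min_le_left (t - s) ε
    have m2 := min_le_right (t - s) ε
    have m3 : 0 < min (t - s) ε := lt_min (by linarith) hε
    exact isPlanarDomain_box (z := (s, s + min (t - s) ε)) hε (by simp only; linarith)
      (by simp only; linarith) h1 (EReal.coe_lt_top _) (EReal.bot_lt_coe _)
      ((EReal.coe_le_coe_iff.2 (by linarith)).trans_lt h4)
  · exact isPlanarDomain_box (z := (Λ.w k - ε / 2, Λ.w k + ε / 2)) hε (by simp only; linarith)
      (by simp only; linarith) (EReal.bot_lt_coe _) (EReal.coe_lt_coe_iff.2 (by linarith))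
      (EReal.coe_lt_coe_iff.2 (by linarith)) (EReal.coe_lt_top _)

lemma figure_subset (j) : Λ.figure j ⊆ strip ε := by
  rcases j with i | i | i | k <;> exact fun x hx => hx.1

lemma iUnion_figure : strip ε = ⋃ j, Λ.figure j := by
  refine Subset.antisymm (fun x hx => mem_iUnion.2 ?_) (iUnion_subset Λ.figure_subset)
  rcases Λ.exists_figure hx with ⟨i, h1, h2⟩ | ⟨i, h1, h2⟩ | ⟨k, h1, h2⟩ | ⟨i, -, h1, h2⟩
  · exact ⟨.inl i, hx, ⟨bot_le, le_top⟩, h1, h2⟩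
  · exact ⟨.inr (.inl i), hx, ⟨h1, h2⟩, bot_le, le_top⟩
  · exact ⟨.inr (.inr (.inr k)), hx, ⟨bot_le, EReal.coe_le_coe_iff.2 h2⟩,
      EReal.coe_le_coe_iff.2 h1, le_top⟩
  · exact ⟨.inr (.inr (.inl i)), hx, ⟨h1, le_top⟩, bot_le, h2⟩

lemma foliated_R (i : Fin (n + 1)) :
    FoliatedByExtremals ε (box ε ⊥ ⊤ (Λ.b i) (Λ.wr i)) Λ.B Λ.dB := by
  have hε := Λ.pos
  refine ⟨{e | ∃ u : ℝ, Λ.b i ≤ u ∧ u ≤ Λ.wr i ∧ e = ((u, u ^ 2), (u - ε, (u - ε) ^ 2 + ε ^ 2))},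
    ?_, fun x hx _ => ?_⟩
  · rintro e ⟨u, h1, h2, rfl⟩
    have hsub : ∀ x ∈ segment ℝ ((u, u ^ 2) : ℝ × ℝ) (u - ε, (u - ε) ^ 2 + ε ^ 2),
        Λ.foliation.plane x = tp f (deriv f) u (Λ.MR i u / 2) := fun x hx => by
      obtain ⟨hs, hu⟩ := (mem_rightTangent hε).1 hx
      rw [Λ.plane_R (i := i) hs (by rwa [hu]) (by rwa [hu]), hu]
    refine ⟨isExtremal_rightTangent hε u, fun x hx => ?_, fun x hx => ?_⟩
    · obtain ⟨hs, hu⟩ := (mem_rightTangent hε).1 hx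
      exact ⟨hs, ⟨bot_le, le_top⟩, by rwa [hu], by rwa [hu]⟩
    · exact Λ.linear_of_plane_eq ((hsub x hx).trans (hsub _ (left_mem_segment ℝ _ _)).symm)
  · obtain ⟨hs, -, h1, h2⟩ := hx
    refine ⟨_, ⟨⟨uR ε x, h1, h2, rfl⟩, (mem_rightTangent hε).2 ⟨hs, rfl⟩⟩, ?_⟩
    rintro e ⟨⟨u, -, -, rfl⟩, he⟩
    rw [((mem_rightTangent hε).1 he).2]

lemma foliated_L (i : Fin (n + 1)) :
    FoliatedByExtremals ε (box ε (Λ.wl i) (Λ.a i) ⊥ ⊤) Λ.B Λ.dB := by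
  have hε := Λ.pos
  refine ⟨{e | ∃ u : ℝ, Λ.wl i ≤ u ∧ u ≤ Λ.a i ∧ e = ((u, u ^ 2), (u + ε, (u + ε) ^ 2 + ε ^ 2))},
    ?_, fun x hx _ => ?_⟩
  · rintro e ⟨u, h1, h2, rfl⟩
    have hsub : ∀ x ∈ segment ℝ ((u, u ^ 2) : ℝ × ℝ) (u + ε, (u + ε) ^ 2 + ε ^ 2),
        Λ.foliation.plane x = tp f (deriv f) u (Λ.ML i u / 2) := fun x hx => by
      obtain ⟨hs, hu⟩ := (mem_leftTangent hε).1 hx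
      rw [Λ.plane_L (i := i) hs (by rwa [hu]) (by rwa [hu]), hu]
    refine ⟨isExtremal_leftTangent hε u, fun x hx => ?_, fun x hx => ?_⟩
    · obtain ⟨hs, hu⟩ := (mem_leftTangent hε).1 hx
      exact ⟨hs, ⟨by rwa [hu], by rwa [hu]⟩, bot_le, le_top⟩
    · exact Λ.linear_of_plane_eq ((hsub x hx).trans (hsub _ (left_mem_segment ℝ _ _)).symm)
  · obtain ⟨hs, ⟨h1, h2⟩, -⟩ := hx
    refine ⟨_, ⟨⟨uL ε x, h1, h2, rfl⟩, (mem_leftTangent hε).2 ⟨hs, rfl⟩⟩, ?_⟩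
    rintro e ⟨⟨u, -, -, rfl⟩, he⟩
    rw [((mem_leftTangent hε).1 he).2]

lemma foliated_cup {i : Fin (n + 1)} (hi : Λ.isCup i) :
    FoliatedByExtremals ε (box ε (Λ.a i) ⊤ ⊥ (Λ.b i)) Λ.B Λ.dB := by
  have h2 := Λ.two_eps_pos
  set h := Λ.cup i hi with hh
  have hlt : ∀ l, 0 < l → h.left l < h.right l := fun l hl => by rw [CupData.right]; linarith
  refine ⟨{e | ∃ l : ℝ, 0 < l ∧ l ≤ 2 * ε ∧ e = ((h.left l, h.left l ^ 2),
    (h.right l, h.right l ^ 2))}, ?_, fun x hx hxb => ?_⟩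
  · rintro e ⟨l, h3, h4, rfl⟩
    have hsub := fun x hx => Λ.plane_chord hi h3.le h4 ((mem_chord (hlt l h3)).1 hx).1
      ((mem_chord (hlt l h3)).1 hx).2 (x := x)
    refine ⟨⟨fun he => ?_, rfl, ?_, Or.inl rfl⟩, fun x hx => ?_, fun x hx => ?_⟩
    · exact (hlt l h3).ne (congrArg Prod.fst he)
    · exact chord_subset_strip (hlt l h3) (by rw [CupData.right]; linarith)
    · obtain ⟨⟨hs, h5, h6⟩, -⟩ := Λ.mem_Pk_of_chord hi h3.le h4 ((mem_chord (hlt l h3)).1 hx).1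
        ((mem_chord (hlt l h3)).1 hx).2
      exact ⟨hs, ⟨h5, le_top⟩, bot_le, h6⟩
    · exact Λ.linear_of_plane_eq ((hsub x hx).trans (hsub _ (left_mem_segment ℝ _ _)).symm)
  · obtain ⟨hs, ⟨h3, -⟩, -, h4⟩ := hx
    have hP := (Λ.mem_Pk_iff hi).1 ⟨hs, h3, h4⟩
    obtain ⟨h5, h6⟩ := h.level_spec h2.le (Λ.cup_lt i hi) hs.1 hP.2
    -- The degenerate chord of level 0 meets the region above the parabola only at the origin, which
    -- is on the fixed boundary and thus excluded.
    have h7 : 0 < h.level (2 * ε) x := by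
      refine lt_of_le_of_ne h5.1 fun he => hxb ?_
      rw [← he, CupData.chordFun_eq, CupData.right, add_zero] at h6
      have := hs.1
      show x.2 = x.1 ^ 2
      nlinarith [mul_self_nonneg (x.1 - h.left 0)]
    refine ⟨_, ⟨⟨h.level (2 * ε) x, h7, h5.2, rfl⟩, (mem_chord (hlt _ h7)).2 ⟨hs.1, h6⟩⟩, ?_⟩
    rintro e ⟨⟨l, h8, h9, rfl⟩, he⟩
    rw [(Λ.mem_Pk_of_chord hi h8.le h9 hs.1 ((mem_chord (hlt l h8)).1 he).2).2]

lemma figure_spec (j) : LinearOn (Λ.figure j) Λ.B ∨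
    FoliatedByExtremals ε (Λ.figure j) Λ.B Λ.dB := by
  rcases j with i | i | i | k
  · exact Or.inr (Λ.foliated_R i)
  · exact Or.inr (Λ.foliated_L i)
  · by_cases hi : Λ.isCup i
    · exact Or.inr (Λ.foliated_cup hi)
    · left
      rcases (Λ.Pk i).eq_empty_or_nonempty with he | hne
      · refine ⟨0, 0, 0, fun x hx => ?_⟩
        have : x ∈ Λ.Pk i := ⟨hx.1, hx.2.1.1, hx.2.2.2⟩
        rw [he] at this; exact absurd this (notMem_empty x)
      · obtain ⟨t, ht1, ht2⟩ := EReal.lt_iff_exists_real_btwn.1 (Λ.a_lt_b hne)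
        set P := tp f (deriv f) t (Λ.K i / 2)
        refine ⟨P.1, P.2.1, P.2.2, fun x hx => ?_⟩
        have hP : x ∈ Λ.Pk i := ⟨hx.1, hx.2.1.1, hx.2.2.2⟩
        rw [B, Λ.plane_Pk hP, Λ.Kp_flat hi hP ht1.le ht2.le]; rfl
  · left
    set P := tp f (deriv f) (Λ.w k) (Λ.MR k.castSucc (Λ.w k) / 2)
    refine ⟨P.1, P.2.1, P.2.2, fun x hx => ?_⟩
    rw [B, Λ.plane_angle (k := k) hx.1 (EReal.coe_le_coe_iff.1 hx.2.2.1)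
      (EReal.coe_le_coe_iff.1 hx.2.1.2)]; rfl

open Classical in
theorem isBellmanCandidate : IsBellmanCandidate f ε (strip ε) Λ.B := by
  refine ⟨Λ.continuousOn_B, Λ.locallyConcaveOn_B, fun u _ => Λ.B_boundary u, ?_⟩
  -- Peaks at infinity give empty figures, which are not planar domains; only the non-empty figures
  -- are listed.
  let e := Fintype.equivFin {j // (Λ.figure j).Nonempty}
  refine ⟨_, fun m => Λ.figure (e.symm m).1, ?_, fun m =>
    ⟨Λ.isPlanarDomain_figure (e.symm m).2, Λ.dB, Λ.isC1DifferentialOn (Λ.figure_subset _),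
      Λ.figure_spec _⟩⟩
  rw [Λ.iUnion_figure]
  refine Subset.antisymm (iUnion_subset fun j x hx => ?_) (iUnion_subset fun m x hx => ?_)
  · exact mem_iUnion.2 ⟨e ⟨j, x, hx⟩, by simpa using hx⟩
  · exact mem_iUnion.2 ⟨_, hx⟩

end Layout

/-! ## The foliation graph of a layout -/

section ports

variable {ε : ℝ} {q : Port}

lemma mem_ports_angle {w : ℝ} : q ∈ (Vertex.angle w).ports ε ↔
    q = .inTangent .R w ∨ q = .inTangent .L w := by
  simp [Vertex.ports, Vertex.shape, gaps, leftEnd, rightEnd, Vertex.arcs]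
  tauto

lemma mem_ports_origin {p : ℝ} : q ∈ (Vertex.origin p).ports ε ↔ q = .inChord p p := by
  simp [Vertex.ports, Vertex.shape, gaps, leftEnd, rightEnd, Vertex.arcs]

lemma mem_ports_longChord {a b : ℝ} : q ∈ (Vertex.longChord a b).ports ε ↔
    q = .outChord a b ∨ q = .outTangent .L a ∨ q = .outTangent .R b := by
  simp [Vertex.ports, Vertex.shape, gaps, leftEnd, rightEnd, Vertex.arcs]
  tauto

lemma mem_ports_multicup {a b : EReal} : q ∈ (Vertex.multicup [(a, b)]).ports ε ↔
    (a ≠ ⊥ ∧ q = .outTangent .L a) ∨ (b ≠ ⊤ ∧ q = .outTangent .R b) := by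
  simp [Vertex.ports, Vertex.shape, gaps, leftEnd, rightEnd, Vertex.arcs]

end ports

namespace Layout

variable {f : ℝ → ℝ} {ε : ℝ} {n : ℕ} (Λ : Layout f (deriv f) (deriv (deriv f)) ε n)

open Classical in
/-- The vertex of the graph that belongs to the `i`-th peak. -/
def top (i : Fin (n + 1)) : Vertex :=
  if Λ.isCup i then .longChord (Λ.a i).toReal (Λ.b i).toReal
  else if Λ.a i < Λ.b i then .multicup [(Λ.a i, Λ.b i)]
  else if Λ.a i = ⊥ then .negInfinity .R else .posInfinity .L

section top

variable {i : Fin (n + 1)}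

lemma top_cup (hi : Λ.isCup i) :
    Λ.top i = .longChord ((Λ.cup i hi).left (2 * ε)) ((Λ.cup i hi).right (2 * ε)) := by
  rw [top, if_pos hi, Λ.cup_a i hi, Λ.cup_b i hi, EReal.toReal_coe, EReal.toReal_coe]

lemma top_flat (hi : ¬ Λ.isCup i) (h : Λ.a i < Λ.b i) : Λ.top i = .multicup [(Λ.a i, Λ.b i)] := by
  rw [top, if_neg hi, if_pos h]

lemma top_infinity (hi : ¬ Λ.isCup i) (h : ¬ Λ.a i < Λ.b i) :
    (Λ.a i = ⊥ ∧ Λ.b i = ⊥ ∧ Λ.top i = .negInfinity .R) ∨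
      (Λ.a i = ⊤ ∧ Λ.b i = ⊤ ∧ Λ.top i = .posInfinity .L) := by
  have he : Λ.a i = Λ.b i := (Λ.flat_le i hi).eq_of_not_lt h
  rw [top, if_neg hi, if_neg h]
  rcases Λ.flat_eq i hi he with h1 | h1
  · exact Or.inl ⟨h1, he ▸ h1, if_pos h1⟩
  · exact Or.inr ⟨h1, he ▸ h1, if_neg (by simp [h1])⟩

lemma top_cases (i : Fin (n + 1)) :
    (∃ hi : Λ.isCup i,
      Λ.top i = .longChord ((Λ.cup i hi).left (2 * ε)) ((Λ.cup i hi).right (2 * ε))) ∨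
    (¬ Λ.isCup i ∧ Λ.a i < Λ.b i ∧ Λ.top i = .multicup [(Λ.a i, Λ.b i)]) ∨
    (¬ Λ.isCup i ∧ Λ.a i = ⊥ ∧ Λ.b i = ⊥ ∧ Λ.top i = .negInfinity .R) ∨
      (¬ Λ.isCup i ∧ Λ.a i = ⊤ ∧ Λ.b i = ⊤ ∧ Λ.top i = .posInfinity .L) := by
  by_cases hi : Λ.isCup i
  · exact Or.inl ⟨hi, Λ.top_cup hi⟩
  by_cases h : Λ.a i < Λ.b i
  · exact Or.inr (Or.inl ⟨hi, h, Λ.top_flat hi h⟩)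
  · rcases Λ.top_infinity hi h with h | h
    · exact Or.inr (Or.inr (Or.inl ⟨hi, h⟩))
    · exact Or.inr (Or.inr (Or.inr ⟨hi, h⟩))

/-- One formula covers all four kinds of peaks: a root at -∞ acts as a peak whose right tangents
begin at b = -∞, and symmetrically at +∞. -/
lemma mem_ports_top {q : Port} : q ∈ (Λ.top i).ports ε ↔
    (Λ.isCup i ∧ q = .outChord (Λ.a i) (Λ.b i)) ∨ (Λ.a i ≠ ⊥ ∧ q = .outTangent .L (Λ.a i)) ∨
      (Λ.b i ≠ ⊤ ∧ q = .outTangent .R (Λ.b i)) := by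
  rcases Λ.top_cases i with ⟨hi, h⟩ | ⟨hi, -, h⟩ | ⟨hi, h1, h2, h⟩ | ⟨hi, h1, h2, h⟩
  · rw [h, mem_ports_longChord, Λ.cup_a i hi, Λ.cup_b i hi]; simp [hi]
  · rw [h, mem_ports_multicup]; simp [hi]
  · rw [h, h1, h2]; simp [hi, Vertex.ports]
  · rw [h, h1, h2]; simp [hi, Vertex.ports]

lemma a_strictMono : StrictMono Λ.a := Λ.foliation.a_strictMono

lemma b_strictMono : StrictMono Λ.b := Λ.foliation.b_strictMono

lemma w_strictMono : StrictMono Λ.w := Λ.foliation.w_strictMono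

lemma top_injective : Function.Injective Λ.top := by
  intro i j h
  apply Λ.a_strictMono.injective
  rcases Λ.top_cases i with ⟨hi, h'⟩ | ⟨hi, -, h'⟩ | ⟨hi, h1, h2, h'⟩ | ⟨hi, h1, h2, h'⟩ <;>
  rcases Λ.top_cases j with ⟨hj, h''⟩ | ⟨hj, -, h''⟩ | ⟨hj, h3, h4, h''⟩ | ⟨hj, h3, h4, h''⟩ <;>
  rw [h', h''] at h <;>
  first
  | (simp at h; done)
  | skip
  · rw [Vertex.longChord.injEq] at h
    rw [Λ.cup_a i hi, Λ.cup_a j hj, h.1]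
  · simp only [Vertex.multicup.injEq, List.cons.injEq, Prod.mk.injEq, and_true] at h
    exact h.1
  · rw [h1, h3]
  · rw [h1, h3]

end top

/-- Indices of the vertices: peaks, angles, origins, and the infinities at which tangent domains
end. -/
abbrev VIdx := Fin (n + 1) ⊕ Fin n ⊕ {i // Λ.isCup i} ⊕ {_u : Unit // Λ.a 0 ≠ ⊥} ⊕
  {_u : Unit // Λ.b (Fin.last n) ≠ ⊤}

def vertex : Λ.VIdx → Vertex
  | .inl i => Λ.top i
  | .inr (.inl k) => .angle (Λ.w k)
  | .inr (.inr (.inl i)) => .origin (Λ.p i)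
  | .inr (.inr (.inr (.inl _))) => .negInfinity .L
  | .inr (.inr (.inr (.inr _))) => .posInfinity .R

/-- Indices of the edges: chords, right tangents, left tangents. -/
abbrev EIdx := {i // Λ.isCup i} ⊕ {i // Λ.b i ≠ ⊤} ⊕ {i // Λ.a i ≠ ⊥}

def edge : Λ.EIdx → Edge
  | .inl i => .chords 0 (2 * ε) (Λ.cup i i.2).left (Λ.cup i i.2).right
  | .inr (.inl i) => .tangents .R (Λ.b i) (Λ.wr i)
  | .inr (.inr i) => .tangents .L (Λ.wl i) (Λ.a i)

open Classical in
def graph : FoliationGraph where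
  vertices := Finset.univ.image Λ.vertex
  edges := Finset.univ.image Λ.edge

lemma mem_vertices {v : Vertex} : v ∈ Λ.graph.vertices ↔ (∃ i, v = Λ.top i) ∨
    (∃ k, v = .angle (Λ.w k)) ∨ (∃ i, Λ.isCup i ∧ v = .origin (Λ.p i)) ∨
    (Λ.a 0 ≠ ⊥ ∧ v = .negInfinity .L) ∨ (Λ.b (Fin.last n) ≠ ⊤ ∧ v = .posInfinity .R) := by
  simp only [graph, Finset.mem_image, Finset.mem_univ, true_and, Sum.exists, vertex, Subtype.exists,
    exists_prop, exists_const, @eq_comm _ v]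

lemma mem_edges {e : Edge} : e ∈ Λ.graph.edges ↔
    (∃ i, ∃ hi : Λ.isCup i, e = .chords 0 (2 * ε) (Λ.cup i hi).left (Λ.cup i hi).right) ∨
    (∃ i, Λ.b i ≠ ⊤ ∧ e = .tangents .R (Λ.b i) (Λ.wr i)) ∨
    (∃ i, Λ.a i ≠ ⊥ ∧ e = .tangents .L (Λ.wl i) (Λ.a i)) := by
  simp only [graph, Finset.mem_image, Finset.mem_univ, true_and, Sum.exists, edge, Subtype.exists,
    exists_prop, @eq_comm _ e]

lemma cup_ends {i : Fin (n + 1)} (hi : Λ.isCup i) : Λ.a i < Λ.p i ∧ (Λ.p i : EReal) < Λ.b i := by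
  have h2 := Λ.two_eps_pos
  obtain ⟨h3, h4, -⟩ := (Λ.cup i hi).left_spec h2 (Λ.cup_lt i hi)
  rw [Λ.cup_a i hi, Λ.cup_b i hi, EReal.coe_lt_coe_iff, EReal.coe_lt_coe_iff, CupData.right]
  exact ⟨h4, by linarith⟩

lemma p_injective {i j : Fin (n + 1)} (hi : Λ.isCup i) (hj : Λ.isCup j) (h : Λ.p i = Λ.p j) :
    i = j := by
  have e1 := Λ.cup_ends hi
  have e2 := Λ.cup_ends hj
  rw [← h] at e2
  rcases lt_trichotomy i j with hlt | heq | hlt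
  · have : Λ.b i < Λ.a j := Λ.foliation.b_lt_a hlt
    exact absurd (e1.2.trans (this.trans e2.1)) (lt_irrefl _)
  · exact heq
  · have : Λ.b j < Λ.a i := Λ.foliation.b_lt_a hlt
    exact absurd (e2.2.trans (this.trans e1.1)) (lt_irrefl _)

lemma vertex_injective : Function.Injective Λ.vertex := by
  have htop : ∀ i v, Λ.top i = v → (∀ w, v ≠ .angle w) ∧ (∀ p, v ≠ .origin p) ∧
      v ≠ .negInfinity .L ∧ v ≠ .posInfinity .R := by
    rintro i _ rfl
    rcases Λ.top_cases i with ⟨hi, h'⟩ | ⟨hi, -, h'⟩ | ⟨hi, h1, h2, h'⟩ | ⟨hi, h1, h2, h'⟩ <;>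
    rw [h'] <;> simp
  intro x y h
  rcases x with i | k | i | u | u <;> rcases y with j | l | j | u' | u' <;>
    simp only [vertex] at h
  · rw [Λ.top_injective h]
  · exact absurd rfl ((htop _ _ h).1 _)
  · exact absurd rfl ((htop _ _ h).2.1 _)
  · exact absurd rfl (htop _ _ h).2.2.1
  · exact absurd rfl (htop _ _ h).2.2.2
  · exact absurd rfl ((htop _ _ h.symm).1 _)
  · rw [Vertex.angle.injEq] at h; rw [Λ.w_strictMono.injective h]
  · simp at h
  · simp at h
  · simp at h
  · exact absurd rfl ((htop _ _ h.symm).2.1 _)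
  · simp at h
  · rw [Vertex.origin.injEq] at h
    rw [Subtype.ext (Λ.p_injective i.2 j.2 h)]
  · simp at h
  · simp at h
  · exact absurd rfl (htop _ _ h.symm).2.2.1
  · simp at h
  · simp at h
  · rw [Subsingleton.elim u u']
  · simp at h
  · exact absurd rfl (htop _ _ h.symm).2.2.2
  · simp at h
  · simp at h
  · simp at h
  · rw [Subsingleton.elim u u']

lemma edge_injective : Function.Injective Λ.edge := by
  intro x y h
  rcases x with i | i | i <;> rcases y with j | j | j <;>
    simp only [edge, Edge.chords.injEq, Edge.tangents.injEq, reduceCtorEq, true_and, false_and] at h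
  · have : Λ.a i = Λ.a j := by rw [Λ.cup_a i i.2, Λ.cup_a j j.2, h.1]
    rw [Subtype.ext (Λ.a_strictMono.injective this)]
  · rw [Subtype.ext (Λ.b_strictMono.injective h.1)]
  · rw [Subtype.ext (Λ.a_strictMono.injective h.2)]

lemma b_castSucc_ne_top (k : Fin n) : Λ.b k.castSucc ≠ ⊤ :=
  ((Λ.b_lt_w k).trans (EReal.coe_lt_top _)).ne

lemma a_succ_ne_bot (k : Fin n) : Λ.a k.succ ≠ ⊥ :=
  ((EReal.bot_lt_coe _).trans (Λ.w_lt_a k)).ne'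

open Classical in
-- Both counts contain one term per cup and one per infinity at which tangents end. Apart from these
-- there are 2n + 1 vertices, the peaks and angles, and 2n edges, two for each angle.
lemma card_edges_add_one : Λ.graph.edges.card + 1 = Λ.graph.vertices.card := by
  simp only [graph]
  rw [Finset.card_image_of_injective _ Λ.vertex_injective,
    Finset.card_image_of_injective _ Λ.edge_injective, Finset.card_univ, Finset.card_univ]
  have h1 : Fintype.card {i // Λ.b i ≠ ⊤} = n + Fintype.card {_u : Unit // Λ.b (Fin.last n) ≠ ⊤} := by
    rw [Fintype.card_subtype, Fintype.card_subtype, Finset.card_filter, Finset.card_filter,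
      Fin.sum_univ_castSucc]
    simp [Λ.b_castSucc_ne_top]
  have h2 : Fintype.card {i // Λ.a i ≠ ⊥} = n + Fintype.card {_u : Unit // Λ.a 0 ≠ ⊥} := by
    rw [Fintype.card_subtype, Fintype.card_subtype, Finset.card_filter, Finset.card_filter,
      Fin.sum_univ_succ]
    simp [Λ.a_succ_ne_bot, add_comm]
  simp only [Fintype.card_sum, Fintype.card_fin, h1, h2]
  omega

/-! ### Ports -/

lemma sourcePort_chords {i : Fin (n + 1)} (hi : Λ.isCup i) :
    (Edge.chords 0 (2 * ε) (Λ.cup i hi).left (Λ.cup i hi).right).sourcePort =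
      .outChord (Λ.a i) (Λ.b i) := by
  rw [Λ.cup_a i hi, Λ.cup_b i hi]; rfl

lemma targetPort_chords {i : Fin (n + 1)} (hi : Λ.isCup i) :
    (Edge.chords 0 (2 * ε) (Λ.cup i hi).left (Λ.cup i hi).right).targetPort =
      .inChord (Λ.p i) (Λ.p i) := by
  rw [Edge.targetPort, CupData.right, CupData.left_zero, add_zero]

lemma mem_ports {v : Vertex} (hv : v ∈ Λ.graph.vertices) {q : Port} : q ∈ v.ports ε ↔
    (∃ i, v = Λ.top i ∧ Λ.isCup i ∧ q = .outChord (Λ.a i) (Λ.b i)) ∨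
    (∃ i, v = Λ.top i ∧ Λ.a i ≠ ⊥ ∧ q = .outTangent .L (Λ.a i)) ∨
    (∃ i, v = Λ.top i ∧ Λ.b i ≠ ⊤ ∧ q = .outTangent .R (Λ.b i)) ∨
    (∃ k, v = .angle (Λ.w k) ∧ q = .inTangent .R (Λ.w k)) ∨
    (∃ k, v = .angle (Λ.w k) ∧ q = .inTangent .L (Λ.w k)) ∨
    (∃ i, v = .origin (Λ.p i) ∧ Λ.isCup i ∧ q = .inChord (Λ.p i) (Λ.p i)) ∨
    (v = .negInfinity .L ∧ q = .inTangent .L ⊥) ∨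
    (v = .posInfinity .R ∧ q = .inTangent .R ⊤) := by
  constructor
  · intro h
    rcases Λ.mem_vertices.1 hv with ⟨i, rfl⟩ | ⟨k, rfl⟩ | ⟨i, hi, rfl⟩ | ⟨h1, rfl⟩ | ⟨h1, rfl⟩
    · rcases Λ.mem_ports_top.1 h with h | h | h
      · exact Or.inl ⟨i, rfl, h⟩
      · exact Or.inr (Or.inl ⟨i, rfl, h⟩)
      · exact Or.inr (Or.inr (Or.inl ⟨i, rfl, h⟩))
    · rcases mem_ports_angle.1 h with h | h
      · exact Or.inr (Or.inr (Or.inr (Or.inl ⟨k, rfl, h⟩)))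
      · exact Or.inr (Or.inr (Or.inr (Or.inr (Or.inl ⟨k, rfl, h⟩))))
    · exact Or.inr (Or.inr (Or.inr (Or.inr (Or.inr (Or.inl ⟨i, rfl, hi, mem_ports_origin.1 h⟩)))))
    · exact Or.inr (Or.inr (Or.inr (Or.inr (Or.inr (Or.inr (Or.inl ⟨rfl, h⟩))))))
    · exact Or.inr (Or.inr (Or.inr (Or.inr (Or.inr (Or.inr (Or.inr ⟨rfl, h⟩))))))
  · rintro (⟨i, rfl, h⟩ | ⟨i, rfl, h⟩ | ⟨i, rfl, h⟩ | ⟨k, rfl, h⟩ | ⟨k, rfl, h⟩ | ⟨i, rfl, -, h⟩ |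
      ⟨rfl, h⟩ | ⟨rfl, h⟩)
    · exact Λ.mem_ports_top.2 (Or.inl h)
    · exact Λ.mem_ports_top.2 (Or.inr (Or.inl h))
    · exact Λ.mem_ports_top.2 (Or.inr (Or.inr h))
    · exact mem_ports_angle.2 (Or.inl h)
    · exact mem_ports_angle.2 (Or.inr h)
    · exact mem_ports_origin.2 h
    · exact h
    · exact h

lemma top_mem (i : Fin (n + 1)) : Λ.top i ∈ Λ.graph.vertices := Λ.mem_vertices.2 (Or.inl ⟨i, rfl⟩)

lemma angle_mem (k : Fin n) : .angle (Λ.w k) ∈ Λ.graph.vertices :=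
  Λ.mem_vertices.2 (Or.inr (Or.inl ⟨k, rfl⟩))

lemma origin_mem {i : Fin (n + 1)} (hi : Λ.isCup i) : .origin (Λ.p i) ∈ Λ.graph.vertices :=
  Λ.mem_vertices.2 (Or.inr (Or.inr (Or.inl ⟨i, hi, rfl⟩)))

lemma source_unique {i : Fin (n + 1)} {q : Port} (hq : q ∈ (Λ.top i).ports ε) :
    ∃! v, v ∈ Λ.graph.vertices ∧ q ∈ v.ports ε := by
  refine ⟨Λ.top i, ⟨Λ.top_mem i, hq⟩, ?_⟩
  rintro v ⟨hv, hvq⟩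
  rcases (Λ.mem_ports hv).1 hvq with ⟨j, rfl, -, rfl⟩ | ⟨j, rfl, -, rfl⟩ | ⟨j, rfl, -, rfl⟩ |
    ⟨k, rfl, rfl⟩ | ⟨k, rfl, rfl⟩ | ⟨j, rfl, -, rfl⟩ | ⟨rfl, rfl⟩ | ⟨rfl, rfl⟩ <;>
  simp only [mem_ports_top, Port.outChord.injEq, Port.outTangent.injEq, reduceCtorEq, and_false,
    or_false, false_or, true_and, false_and] at hq
  · rw [Λ.a_strictMono.injective hq.2.1]
  · rw [Λ.a_strictMono.injective hq.2]
  · rw [Λ.b_strictMono.injective hq.2]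

/-- The vertex at which the right tangents of the `i`-th peak end. -/
lemma target_R {i : Fin (n + 1)} (hb : Λ.b i ≠ ⊤) :
    (∃ k : Fin n, i = k.castSucc ∧ Λ.wr i = Λ.w k) ∨
      (Λ.wr i = ⊤ ∧ Λ.b (Fin.last n) ≠ ⊤ ∧ i = Fin.last n) := by
  revert hb
  refine Fin.lastCases (fun h => Or.inr ⟨by simp [wr], h, rfl⟩) (fun k _ => ?_) i
  exact Or.inl ⟨k, rfl, by simp [wr]⟩

lemma target_L {i : Fin (n + 1)} (ha : Λ.a i ≠ ⊥) :
    (∃ k : Fin n, i = k.succ ∧ Λ.wl i = Λ.w k) ∨ (Λ.wl i = ⊥ ∧ Λ.a 0 ≠ ⊥ ∧ i = 0) := by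
  revert ha
  refine Fin.cases (fun h => Or.inr ⟨by simp [wl], h, rfl⟩) (fun k _ => ?_) i
  exact Or.inl ⟨k, rfl, by simp [wl]⟩

lemma target_mem_R {i : Fin (n + 1)} (hb : Λ.b i ≠ ⊤) :
    ∃ v ∈ Λ.graph.vertices, .inTangent .R (Λ.wr i) ∈ v.ports ε := by
  rcases Λ.target_R hb with ⟨k, -, hk⟩ | ⟨h1, h2, -⟩
  · exact ⟨_, Λ.angle_mem k, mem_ports_angle.2 (Or.inl (by rw [hk]))⟩
  · refine ⟨.posInfinity .R, Λ.mem_vertices.2 (by simp [h2]), ?_⟩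
    rw [h1]; exact rfl

lemma target_mem_L {i : Fin (n + 1)} (ha : Λ.a i ≠ ⊥) :
    ∃ v ∈ Λ.graph.vertices, .inTangent .L (Λ.wl i) ∈ v.ports ε := by
  rcases Λ.target_L ha with ⟨k, -, hk⟩ | ⟨h1, h2, -⟩
  · exact ⟨_, Λ.angle_mem k, mem_ports_angle.2 (Or.inr (by rw [hk]))⟩
  · refine ⟨.negInfinity .L, Λ.mem_vertices.2 (by simp [h2]), ?_⟩
    rw [h1]; exact rfl

/-- A port of two vertices that ends an edge. -/
lemma target_unique {v v' : Vertex} {q : Port} (hv : v ∈ Λ.graph.vertices)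
    (hv' : v' ∈ Λ.graph.vertices) (hq : q ∈ v.ports ε) (hq' : q ∈ v'.ports ε) : v' = v := by
  rcases (Λ.mem_ports hv).1 hq with ⟨i, rfl, -⟩ | ⟨i, rfl, -⟩ | ⟨i, rfl, -⟩ | ⟨k, rfl, h⟩ |
    ⟨k, rfl, h⟩ | ⟨i, rfl, -, h⟩ | ⟨rfl, h⟩ | ⟨rfl, h⟩
  iterate 3 exact (Λ.source_unique hq).unique ⟨hv', hq'⟩ ⟨hv, hq⟩
  all_goals
    rcases (Λ.mem_ports hv').1 hq' with ⟨j, rfl, -, h'⟩ | ⟨j, rfl, -, h'⟩ | ⟨j, rfl, -, h'⟩ |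
      ⟨l, rfl, h'⟩ | ⟨l, rfl, h'⟩ | ⟨j, rfl, -, h'⟩ | ⟨rfl, h'⟩ | ⟨rfl, h'⟩ <;>
    rw [h] at h' <;> simp at h' <;> simp [h']

lemma edge_ends {e : Edge} (he : e ∈ Λ.graph.edges) :
    (∃ v ∈ Λ.graph.vertices, e.sourcePort ∈ v.ports ε) ∧
      ∃ v ∈ Λ.graph.vertices, e.targetPort ∈ v.ports ε := by
  rcases Λ.mem_edges.1 he with ⟨i, hi, rfl⟩ | ⟨i, hi, rfl⟩ | ⟨i, hi, rfl⟩
  · rw [Λ.sourcePort_chords hi, Λ.targetPort_chords hi]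
    exact ⟨⟨_, Λ.top_mem i, Λ.mem_ports_top.2 (Or.inl ⟨hi, rfl⟩)⟩,
      ⟨_, Λ.origin_mem hi, mem_ports_origin.2 rfl⟩⟩
  · exact ⟨⟨_, Λ.top_mem i, Λ.mem_ports_top.2 (Or.inr (Or.inr ⟨hi, rfl⟩))⟩, Λ.target_mem_R hi⟩
  · exact ⟨⟨_, Λ.top_mem i, Λ.mem_ports_top.2 (Or.inr (Or.inl ⟨hi, rfl⟩))⟩, Λ.target_mem_L hi⟩

lemma edge_eq {e e' : Edge} (he : e ∈ Λ.graph.edges) (he' : e' ∈ Λ.graph.edges) {q : Port}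
    (h : e.sourcePort = q ∨ e.targetPort = q) (h' : e'.sourcePort = q ∨ e'.targetPort = q) :
    e' = e := by
  -- Different peaks send their right tangents to different angles, and only the last one can send
  -- them to infinity, so the end of such an edge determines its peak.
  have wr_inj : ∀ i j, Λ.b i ≠ ⊤ → Λ.b j ≠ ⊤ → Λ.wr j = Λ.wr i → j = i := by
    intro i j hi hj hw
    rcases Λ.target_R hi with ⟨k, rfl, hk⟩ | ⟨h1, -, rfl⟩ <;>
    rcases Λ.target_R hj with ⟨l, rfl, hl⟩ | ⟨h2, -, rfl⟩
    · rw [hk, hl, EReal.coe_eq_coe_iff] at hw; rw [Λ.w_strictMono.injective hw]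
    · rw [hk, h2] at hw; simp at hw
    · rw [h1, hl] at hw; simp at hw
    · rfl
  have wl_inj : ∀ i j, Λ.a i ≠ ⊥ → Λ.a j ≠ ⊥ → Λ.wl j = Λ.wl i → j = i := by
    intro i j hi hj hw
    rcases Λ.target_L hi with ⟨k, rfl, hk⟩ | ⟨h1, -, rfl⟩ <;>
    rcases Λ.target_L hj with ⟨l, rfl, hl⟩ | ⟨h2, -, rfl⟩
    · rw [hk, hl, EReal.coe_eq_coe_iff] at hw; rw [Λ.w_strictMono.injective hw]
    · rw [hk, h2] at hw; simp at hw
    · rw [h1, hl] at hw; simp at hw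
    · rfl
  rcases Λ.mem_edges.1 he with ⟨i, hi, rfl⟩ | ⟨i, hi, rfl⟩ | ⟨i, hi, rfl⟩ <;>
  rcases Λ.mem_edges.1 he' with ⟨j, hj, rfl⟩ | ⟨j, hj, rfl⟩ | ⟨j, hj, rfl⟩ <;>
  (try rw [Λ.sourcePort_chords hi, Λ.targetPort_chords hi] at h) <;>
  (try rw [Λ.sourcePort_chords hj, Λ.targetPort_chords hj] at h') <;>
  (try simp only [Edge.sourcePort, Edge.targetPort] at h h') <;>
  rcases h with rfl | rfl <;>
  simp only [Port.outChord.injEq, Port.inChord.injEq, Port.outTangent.injEq, Port.inTangent.injEq,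
    reduceCtorEq, or_false, false_or, true_and, false_and, and_self, EReal.coe_eq_coe_iff] at h'
  · obtain rfl := Λ.a_strictMono.injective h'.1; rfl
  · obtain rfl := Λ.p_injective hj hi h'; rfl
  · rw [Λ.b_strictMono.injective h']
  · rw [wr_inj i j hi hj h']
  · rw [Λ.a_strictMono.injective h']
  · rw [wl_inj i j hi hj h']

lemma port_edge {v : Vertex} (hv : v ∈ Λ.graph.vertices) {q : Port} (hq : q ∈ v.ports ε) :
    ∃ e ∈ Λ.graph.edges, e.sourcePort = q ∨ e.targetPort = q := by
  rcases (Λ.mem_ports hv).1 hq with ⟨i, rfl, hi, rfl⟩ | ⟨i, rfl, hi, rfl⟩ | ⟨i, rfl, hi, rfl⟩ |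
    ⟨k, rfl, rfl⟩ | ⟨k, rfl, rfl⟩ | ⟨i, rfl, hi, rfl⟩ | ⟨rfl, rfl⟩ | ⟨rfl, rfl⟩
  · exact ⟨_, Λ.mem_edges.2 (Or.inl ⟨i, hi, rfl⟩), Or.inl (Λ.sourcePort_chords hi)⟩
  · exact ⟨_, Λ.mem_edges.2 (Or.inr (Or.inr ⟨i, hi, rfl⟩)), Or.inl rfl⟩
  · exact ⟨_, Λ.mem_edges.2 (Or.inr (Or.inl ⟨i, hi, rfl⟩)), Or.inl rfl⟩
  · exact ⟨_, Λ.mem_edges.2 (Or.inr (Or.inl ⟨k.castSucc, Λ.b_castSucc_ne_top k, rfl⟩)),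
      Or.inr (by simp [Edge.targetPort, wr])⟩
  · exact ⟨_, Λ.mem_edges.2 (Or.inr (Or.inr ⟨k.succ, Λ.a_succ_ne_bot k, rfl⟩)),
      Or.inr (by simp [Edge.targetPort, wl])⟩
  · exact ⟨_, Λ.mem_edges.2 (Or.inl ⟨i, hi, rfl⟩), Or.inr (Λ.targetPort_chords hi)⟩
  · have h0 : Λ.a 0 ≠ ⊥ := by
      rcases Λ.mem_vertices.1 hv with ⟨i, h⟩ | ⟨k, h⟩ | ⟨i, -, h⟩ | ⟨h, -⟩ | ⟨-, h⟩
      · rcases Λ.top_cases i with ⟨_, h'⟩ | ⟨-, -, h'⟩ | ⟨-, -, -, h'⟩ | ⟨-, -, -, h'⟩ <;>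
          rw [h'] at h <;> simp at h
      · simp at h
      · simp at h
      · exact h
      · simp at h
    exact ⟨_, Λ.mem_edges.2 (Or.inr (Or.inr ⟨0, h0, rfl⟩)), Or.inr (by simp [Edge.targetPort, wl])⟩
  · have h0 : Λ.b (Fin.last n) ≠ ⊤ := by
      rcases Λ.mem_vertices.1 hv with ⟨i, h⟩ | ⟨k, h⟩ | ⟨i, -, h⟩ | ⟨-, h⟩ | ⟨h, -⟩
      · rcases Λ.top_cases i with ⟨_, h'⟩ | ⟨-, -, h'⟩ | ⟨-, -, -, h'⟩ | ⟨-, -, -, h'⟩ <;>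
          rw [h'] at h <;> simp at h
      · simp at h
      · simp at h
      · simp at h
      · exact h
    exact ⟨_, Λ.mem_edges.2 (Or.inr (Or.inl ⟨Fin.last n, h0, rfl⟩)),
      Or.inr (by simp [Edge.targetPort, wr])⟩

/-! ### Connectedness -/

lemma adj_of_edge {e : Edge} (he : e ∈ Λ.graph.edges) {v v' : Vertex} (hv : v ∈ Λ.graph.vertices)
    (hv' : v' ∈ Λ.graph.vertices) (h : e.sourcePort ∈ v.ports ε) (h' : e.targetPort ∈ v'.ports ε) :
    Λ.graph.Adj ε v v' := ⟨hv, hv', e, he, h, h'⟩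

lemma adj_angle_right (k : Fin n) : Λ.graph.Adj ε (Λ.top k.castSucc) (.angle (Λ.w k)) :=
  Λ.adj_of_edge (Λ.mem_edges.2 (Or.inr (Or.inl ⟨k.castSucc, Λ.b_castSucc_ne_top k, rfl⟩)))
    (Λ.top_mem _) (Λ.angle_mem k)
    (Λ.mem_ports_top.2 (Or.inr (Or.inr ⟨Λ.b_castSucc_ne_top k, rfl⟩)))
    (mem_ports_angle.2 (Or.inl (by simp [Edge.targetPort, wr])))

lemma adj_angle_left (k : Fin n) : Λ.graph.Adj ε (Λ.top k.succ) (.angle (Λ.w k)) :=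
  Λ.adj_of_edge (Λ.mem_edges.2 (Or.inr (Or.inr ⟨k.succ, Λ.a_succ_ne_bot k, rfl⟩)))
    (Λ.top_mem _) (Λ.angle_mem k)
    (Λ.mem_ports_top.2 (Or.inr (Or.inl ⟨Λ.a_succ_ne_bot k, rfl⟩)))
    (mem_ports_angle.2 (Or.inr (by simp [Edge.targetPort, wl])))

/-- Consecutive peaks are joined through the angle between them. -/
lemma connected_top (i : Fin (n + 1)) :
    Relation.EqvGen (Λ.graph.Adj ε) (Λ.top 0) (Λ.top i) := by
  refine Fin.induction (.refl _) (fun k ih => ?_) i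
  exact ih.trans _ _ _ ((Relation.EqvGen.rel _ _ (Λ.adj_angle_right k)).trans _ _ _
    ((Relation.EqvGen.rel _ _ (Λ.adj_angle_left k)).symm _ _))

lemma connected {v : Vertex} (hv : v ∈ Λ.graph.vertices) :
    Relation.EqvGen (Λ.graph.Adj ε) (Λ.top 0) v := by
  rcases Λ.mem_vertices.1 hv with ⟨i, rfl⟩ | ⟨k, rfl⟩ | ⟨i, hi, rfl⟩ | ⟨h0, rfl⟩ | ⟨h0, rfl⟩
  · exact Λ.connected_top i
  · exact (Λ.connected_top _).trans _ _ _ (.rel _ _ (Λ.adj_angle_right k))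
  · refine (Λ.connected_top i).trans _ _ _ (.rel _ _ (Λ.adj_of_edge
      (Λ.mem_edges.2 (Or.inl ⟨i, hi, rfl⟩)) (Λ.top_mem i) hv ?_ ?_))
    · rw [Λ.sourcePort_chords hi]; exact Λ.mem_ports_top.2 (Or.inl ⟨hi, rfl⟩)
    · rw [Λ.targetPort_chords hi]; exact mem_ports_origin.2 rfl
  · refine .rel _ _ (Λ.adj_of_edge (Λ.mem_edges.2 (Or.inr (Or.inr ⟨0, h0, rfl⟩))) (Λ.top_mem 0) hv
      (Λ.mem_ports_top.2 (Or.inr (Or.inl ⟨h0, rfl⟩))) ?_)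
    exact rfl
  · refine (Λ.connected_top (Fin.last n)).trans _ _ _ (.rel _ _ (Λ.adj_of_edge
      (Λ.mem_edges.2 (Or.inr (Or.inl ⟨Fin.last n, h0, rfl⟩))) (Λ.top_mem _) hv
      (Λ.mem_ports_top.2 (Or.inr (Or.inr ⟨h0, rfl⟩))) ?_))
    simp [Edge.targetPort, wr, Vertex.ports]

/-! ### Simplicity -/

/-- Edges begin only at peaks, and a peak has no incoming port, so no edge can be continued
backwards from its source. -/
lemma isSimple : Λ.graph.IsSimple ε := by
  refine ⟨fun v₁ v₂ v₃ ⟨_, h2, e, he, _, ht⟩ ⟨_, _, e', he', hs, _⟩ => ?_, fun arcs h => ?_⟩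
  · have hout : ∃ i, v₂ = Λ.top i := by
      rcases Λ.mem_edges.1 he' with ⟨i, hi, rfl⟩ | ⟨i, hi, rfl⟩ | ⟨i, hi, rfl⟩ <;>
      (try rw [Λ.sourcePort_chords hi] at hs) <;> (try simp only [Edge.sourcePort] at hs) <;>
      rcases (Λ.mem_ports h2).1 hs with ⟨j, h, -⟩ | ⟨j, h, -⟩ | ⟨j, h, -⟩ | ⟨k, -, h⟩ | ⟨k, -, h⟩ |
        ⟨j, -, -, h⟩ | ⟨-, h⟩ | ⟨-, h⟩ <;>
      first
      | exact ⟨j, h⟩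
      | simp at h
    obtain ⟨i, rfl⟩ := hout
    rcases Λ.mem_edges.1 he with ⟨j, hj, rfl⟩ | ⟨j, hj, rfl⟩ | ⟨j, hj, rfl⟩ <;>
    (try rw [Λ.targetPort_chords hj] at ht) <;> simp [Edge.targetPort, mem_ports_top] at ht
  · rcases Λ.mem_vertices.1 h with ⟨i, h⟩ | ⟨k, h⟩ | ⟨i, -, h⟩ | ⟨-, h⟩ | ⟨-, h⟩
    · rcases Λ.top_cases i with ⟨_, h'⟩ | ⟨-, -, h'⟩ | ⟨-, -, -, h'⟩ | ⟨-, -, -, h'⟩ <;>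
        rw [h'] at h <;> simp at h
    all_goals simp at h

lemma isSimpleFigure {v : Vertex} (hv : v ∈ Λ.graph.vertices) : v.IsSimpleFigure := by
  rcases Λ.mem_vertices.1 hv with ⟨i, rfl⟩ | ⟨k, rfl⟩ | ⟨i, -, rfl⟩ | ⟨-, rfl⟩ | ⟨-, rfl⟩
  · rcases Λ.top_cases i with ⟨_, h'⟩ | ⟨-, -, h'⟩ | ⟨-, -, -, h'⟩ | ⟨-, -, -, h'⟩ <;>
      rw [h'] <;> simp [Vertex.IsSimpleFigure]
  all_goals trivial

/-! ### Numerical restrictions -/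

lemma wellFormed_vertex {v : Vertex} (hv : v ∈ Λ.graph.vertices) : v.WellFormed ε := by
  rcases Λ.mem_vertices.1 hv with ⟨i, rfl⟩ | ⟨k, rfl⟩ | ⟨i, -, rfl⟩ | ⟨-, rfl⟩ | ⟨-, rfl⟩
  · rcases Λ.top_cases i with ⟨_, h'⟩ | ⟨hi, h, h'⟩ | ⟨-, -, -, h'⟩ | ⟨-, -, -, h'⟩ <;> rw [h']
    · simp [Vertex.WellFormed, CupData.right]
    · refine ⟨⟨by simp, fun q hq => ?_, by simp [gaps]⟩, ?_⟩
      · rw [List.mem_singleton] at hq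
        subst hq
        exact ⟨h.le, (h.trans_le le_top).ne, (bot_le.trans_lt h).ne'⟩
      · simp only [leftEnd, rightEnd, List.head?_cons, List.getLast?_singleton, Option.map_some,
          Option.getD_some]
        have hsep := Λ.flat_sep i hi
        generalize Λ.a i = a at *
        generalize Λ.b i = b at *
        induction a with
        | bot => simp
        | top => exact absurd h (not_lt.2 le_top)
        | coe x =>
          induction b with
          | bot => exact absurd h (not_lt.2 bot_le)
          | top => exact le_top
          | coe y =>
            rw [← EReal.coe_add, EReal.coe_le_coe_iff]
            exact hsep x y le_rfl le_rfl
    all_goals trivial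
  all_goals trivial

lemma wellFormed_edge {e : Edge} (he : e ∈ Λ.graph.edges) : e.WellFormed ε := by
  rcases Λ.mem_edges.1 he with ⟨i, hi, rfl⟩ | ⟨i, hi, rfl⟩ | ⟨i, hi, rfl⟩
  · have hsub : Icc 0 (2 * ε) ⊆ Ico 0 (Λ.δ i) := fun t ht => ⟨ht.1, ht.2.trans_lt (Λ.cup_lt i hi)⟩
    exact ⟨le_rfl, Λ.two_eps_pos, le_rfl, fun l _ => by rw [CupData.right]; ring,
      ((Λ.cup i hi).strictAntiOn_left.mono hsub).antitoneOn,
      ((Λ.cup i hi).strictMonoOn_right.mono hsub).monotoneOn⟩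
  · exact ⟨Λ.b_le_wr i, hi, (bot_le.trans_lt (Λ.b_lt_wr hi)).ne'⟩
  · exact ⟨Λ.wl_le_a i, ((Λ.wl_lt_a hi).trans_le le_top).ne, hi⟩

/-! ### The figures of the graph -/

lemma domain_chords {i : Fin (n + 1)} (hi : Λ.isCup i) :
    (Edge.chords 0 (2 * ε) (Λ.cup i hi).left (Λ.cup i hi).right).domain ε = Λ.Pk i := by
  ext x
  rw [Λ.mem_Pk_iff hi]
  simp only [Edge.domain, BelowChord, AboveChord, CupData.chordFun, CupData.right,
    CupData.left_zero, mem_ofPred_eq]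
  constructor
  · rintro ⟨hs, h1, -⟩
    exact ⟨hs, by linarith⟩
  · rintro ⟨hs, h1⟩
    refine ⟨hs, by linarith, ?_⟩
    have := hs.1
    -- The bottom chord of length zero is the tangent to the parabola at the origin, so it does not
    -- restrict points of the strip.
    nlinarith [sq_nonneg (x.1 - Λ.p i)]

lemma domain_multicup {a b : EReal} : (Vertex.multicup [(a, b)]).domain ε = box ε a ⊤ ⊥ b := by
  ext x
  simp [Vertex.domain, Vertex.shape, Vertex.arcs, leftEnd, rightEnd, gaps, box, uL, uR]

lemma domain_angle {w : ℝ} : (Vertex.angle w).domain ε = box ε ⊥ w w ⊤ := by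
  ext x
  simp [Vertex.domain, Vertex.shape, Vertex.arcs, leftEnd, rightEnd, gaps, box, uL, uR]
  tauto

lemma domain_R {u₁ u₂ : EReal} : (Edge.tangents .R u₁ u₂).domain ε = box ε ⊥ ⊤ u₁ u₂ := by
  ext x; simp [Edge.domain, box, uR]

lemma domain_L {u₁ u₂ : EReal} : (Edge.tangents .L u₁ u₂).domain ε = box ε u₁ u₂ ⊥ ⊤ := by
  ext x; simp [Edge.domain, box, uL]

lemma Pk_eq_box (i : Fin (n + 1)) : Λ.Pk i = box ε (Λ.a i) ⊤ ⊥ (Λ.b i) := by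
  ext x; simp [Pk, box]

lemma domain_subset (v : Vertex) : v.domain ε ⊆ strip ε := by
  intro x hx
  unfold Vertex.domain at hx
  split at hx
  · exact hx.1
  · exact hx.1
  · exact absurd hx (notMem_empty x)

lemma edge_domain_subset (e : Edge) : e.domain ε ⊆ strip ε := by
  intro x hx
  cases e <;> exact hx.1

lemma strip_eq_iUnion : strip ε = ⋃ x ∈ Λ.graph.figures, figureDomain ε x := by
  refine Subset.antisymm (fun x hx => ?_) (iUnion₂_subset fun y _ => ?_)
  · have hv : ∀ v ∈ Λ.graph.vertices, x ∈ v.domain ε →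
        x ∈ ⋃ x ∈ Λ.graph.figures, figureDomain ε x := fun v hv hxv =>
      mem_iUnion₂.2 ⟨.inl v, Or.inl ⟨v, hv, rfl⟩, hxv⟩
    have he : ∀ e ∈ Λ.graph.edges, x ∈ e.domain ε →
        x ∈ ⋃ x ∈ Λ.graph.figures, figureDomain ε x := fun e he hxe =>
      mem_iUnion₂.2 ⟨.inr e, Or.inr ⟨e, he, rfl⟩, hxe⟩
    rcases Λ.exists_figure hx with ⟨i, h1, h2⟩ | ⟨i, h1, h2⟩ | ⟨k, h1, h2⟩ | ⟨i, hi⟩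
    · refine he _ (Λ.mem_edges.2 (Or.inr (Or.inl ⟨i, fun hh => ?_, rfl⟩))) ⟨hx, h1, h2⟩
      rw [hh] at h1; exact absurd h1 (EReal.coe_lt_top _).not_ge
    · refine he _ (Λ.mem_edges.2 (Or.inr (Or.inr ⟨i, fun hh => ?_, rfl⟩))) ⟨hx, h1, h2⟩
      rw [hh] at h2; exact absurd h2 (EReal.bot_lt_coe _).not_ge
    · refine hv _ (Λ.angle_mem k) ?_
      rw [domain_angle]
      exact ⟨hx, ⟨bot_le, EReal.coe_le_coe_iff.2 h2⟩, EReal.coe_le_coe_iff.2 h1, le_top⟩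
    · by_cases hc : Λ.isCup i
      · refine he _ (Λ.mem_edges.2 (Or.inl ⟨i, hc, rfl⟩)) ?_
        rwa [Λ.domain_chords hc]
      · refine hv _ (Λ.top_mem i) ?_
        rwa [Λ.top_flat hc (Λ.a_lt_b ⟨x, hi⟩), domain_multicup, ← Λ.Pk_eq_box]
  · rcases y with v | e
    · exact domain_subset v
    · exact edge_domain_subset e

/-- The open zones of the strip; they contain the interiors of the figures. -/
def zone (ε : ℝ) (Λ : Layout f (deriv f) (deriv (deriv f)) ε n) :
    Fin (n + 1) ⊕ Fin (n + 1) ⊕ Fin (n + 1) ⊕ Fin n → Set (ℝ × ℝ)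
  | .inl i => {x | Λ.b i < uR ε x ∧ uR ε x < Λ.wr i}
  | .inr (.inl i) => {x | Λ.wl i < uL ε x ∧ uL ε x < Λ.a i}
  | .inr (.inr (.inl i)) => {x | Λ.a i < uL ε x ∧ uR ε x < Λ.b i}
  | .inr (.inr (.inr k)) => {x | Λ.w k < uR ε x ∧ uL ε x < Λ.w k}

open Classical in
-- Long chords, origins and infinities have no interior points; each remaining figure of the graph
-- belongs to one zone. Thus disjointness of interiors reduces to disjointness of zones.
def zoneFigure : Fin (n + 1) ⊕ Fin (n + 1) ⊕ Fin (n + 1) ⊕ Fin n → Vertex ⊕ Edge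
  | .inl i => .inr (.tangents .R (Λ.b i) (Λ.wr i))
  | .inr (.inl i) => .inr (.tangents .L (Λ.wl i) (Λ.a i))
  | .inr (.inr (.inl i)) => if hi : Λ.isCup i then
      .inr (.chords 0 (2 * ε) (Λ.cup i hi).left (Λ.cup i hi).right) else .inl (Λ.top i)
  | .inr (.inr (.inr k)) => .inl (.angle (Λ.w k))

/-- Overlaps of different zones are excluded by the order of the numbers a, b, w along the line, by
uL ≤ uR, and by uR - uL ≤ 2ε against the separation of the ends of a peak. -/
lemma zone_unique {x : ℝ × ℝ} (hx : x ∈ strip ε) {j j'} (h : x ∈ zone ε Λ j)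
    (h' : x ∈ zone ε Λ j') : j = j' := by
  have hle : (uL ε x : EReal) ≤ uR ε x := EReal.coe_le_coe_iff.2 (uL_le_uR Λ.pos hx)
  have hsep : ∀ i, (uL ε x : EReal) < Λ.a i → Λ.b i < uR ε x → False := fun i h1 h2 =>
    absurd (Λ.foliation.sep_lt_left h1 h2.le) (uR_le_uL (ε := ε) (x := x)).not_gt
  have hwr : ∀ {i k}, i < k → Λ.wr i < Λ.a k := fun h => Λ.foliation.wr_lt_a h
  have hww : ∀ {i k}, i < k → Λ.wr i ≤ Λ.wl k := fun h => Λ.foliation.wl_le_wr h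
  have hbw : ∀ {i k}, i < k → Λ.b i < Λ.wl k := fun h => Λ.foliation.b_lt_wl h
  have hba : ∀ {i k}, i < k → Λ.b i < Λ.a k := fun h => Λ.foliation.b_lt_a h
  have hab : ∀ i, Λ.a i ≤ Λ.b i := Λ.foliation.a_le_b
  have ham := Λ.a_strictMono.monotone
  have hbm := Λ.b_strictMono.monotone
  have hcs : ∀ {i : Fin (n + 1)} {k : Fin n}, i ≤ k.castSucc ∨ k.succ ≤ i := fun {i k} => by
    rcases le_or_gt i k.castSucc with h | h
    · exact Or.inl h
    · exact Or.inr (Fin.castSucc_lt_iff_succ_le.1 h)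
  have hwrk : ∀ {i : Fin (n + 1)} {k : Fin n}, i ≤ k.castSucc → Λ.wr i ≤ Λ.w k := fun {i k} h => by
    have := hww (i := i) (k := k.succ) (h.trans_lt Fin.castSucc_lt_succ)
    simpa [wl] using this
  have hwlk : ∀ {i : Fin (n + 1)} {k : Fin n}, k.succ ≤ i → (Λ.w k : EReal) ≤ Λ.wl i :=
    fun {i k} h => by
    have := hww (i := k.castSucc) (k := i) (Fin.castSucc_lt_succ.trans_le h)
    simpa [wr] using this
  have RL : ∀ i j, x ∈ zone ε Λ (.inl i) → x ∈ zone ε Λ (.inr (.inl j)) → False := by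
    rintro i j ⟨h1, h2⟩ ⟨h3, h4⟩
    rcases lt_or_ge i j with h | h
    · exact absurd (hle.trans_lt (h2.trans_le ((hww h).trans h3.le))) (lt_irrefl _)
    · exact hsep i (h4.trans_le (ham h)) h1
  have RP : ∀ i j, x ∈ zone ε Λ (.inl i) → x ∈ zone ε Λ (.inr (.inr (.inl j))) → False := by
    rintro i j ⟨h1, h2⟩ ⟨h3, h4⟩
    rcases lt_or_ge i j with h | h
    · exact absurd (hle.trans_lt (h2.trans ((hwr h).trans h3))) (lt_irrefl _)
    · exact absurd (h1.trans (h4.trans_le (hbm h))) (lt_irrefl _)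
  have RA : ∀ i j, x ∈ zone ε Λ (.inl i) → x ∈ zone ε Λ (.inr (.inr (.inr j))) → False := by
    rintro i k ⟨h1, h2⟩ ⟨h3, h4⟩
    rcases hcs (i := i) (k := k) with h | h
    · exact absurd ((h2.trans_le (hwrk h)).trans (EReal.coe_lt_coe_iff.2 h3)) (lt_irrefl _)
    · exact hsep i ((EReal.coe_lt_coe_iff.2 h4).trans ((Λ.w_lt_a k).trans_le (ham h))) h1
  have LP : ∀ i j, x ∈ zone ε Λ (.inr (.inl i)) → x ∈ zone ε Λ (.inr (.inr (.inl j))) → False := by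
    rintro i j ⟨h1, h2⟩ ⟨h3, h4⟩
    rcases lt_or_ge j i with h | h
    · exact absurd (hle.trans_lt (h4.trans ((hbw h).trans h1))) (lt_irrefl _)
    · exact absurd (h3.trans (h2.trans_le (ham h))) (lt_irrefl _)
  have LA : ∀ i j, x ∈ zone ε Λ (.inr (.inl i)) → x ∈ zone ε Λ (.inr (.inr (.inr j))) → False := by
    rintro i k ⟨h1, h2⟩ ⟨h3, h4⟩
    rcases hcs (i := i) (k := k) with h | h
    · exact hsep i h2 ((hbm h).trans_lt ((Λ.b_lt_w k).trans (EReal.coe_lt_coe_iff.2 h3)))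
    · exact absurd (((hwlk h).trans_lt h1).trans (EReal.coe_lt_coe_iff.2 h4)) (lt_irrefl _)
  have PA : ∀ i j, x ∈ zone ε Λ (.inr (.inr (.inl i))) → x ∈ zone ε Λ (.inr (.inr (.inr j))) →
      False := by
    rintro i k ⟨h1, h2⟩ ⟨h3, h4⟩
    rcases hcs (i := i) (k := k) with h | h
    · exact absurd ((h2.trans_le (hbm h)).trans ((Λ.b_lt_w k).trans (EReal.coe_lt_coe_iff.2 h3)))
        (lt_irrefl _)
    · exact absurd (((Λ.w_lt_a k).trans_le (ham h)).trans (h1.trans (EReal.coe_lt_coe_iff.2 h4)))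
        (lt_irrefl _)
  have RR : ∀ i j, x ∈ zone ε Λ (.inl i) → x ∈ zone ε Λ (.inl j) → ¬ i < j := by
    rintro i j ⟨h1, h2⟩ ⟨h3, h4⟩ h
    exact absurd (h2.trans ((hwr h).trans_le ((hab j).trans h3.le))) (lt_irrefl _)
  have LL : ∀ i j, x ∈ zone ε Λ (.inr (.inl i)) → x ∈ zone ε Λ (.inr (.inl j)) → ¬ i < j := by
    rintro i j ⟨h1, h2⟩ ⟨h3, h4⟩ h
    exact absurd (h2.trans (((hab i).trans_lt (hbw h)).trans h3)) (lt_irrefl _)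
  have PP : ∀ i j, x ∈ zone ε Λ (.inr (.inr (.inl i))) → x ∈ zone ε Λ (.inr (.inr (.inl j))) →
      ¬ i < j := by
    rintro i j ⟨h1, h2⟩ ⟨h3, h4⟩ h
    exact absurd (hle.trans_lt (h2.trans ((hba h).trans h3))) (lt_irrefl _)
  have AA : ∀ i j, x ∈ zone ε Λ (.inr (.inr (.inr i))) → x ∈ zone ε Λ (.inr (.inr (.inr j))) →
      ¬ i < j := by
    rintro i j ⟨h1, h2⟩ ⟨h3, h4⟩ h
    have hij : i.succ ≤ j.castSucc := by
      simp only [Fin.le_def, Fin.val_succ, Fin.val_castSucc]; exact h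
    exact hsep i.succ ((EReal.coe_lt_coe_iff.2 h2).trans (Λ.w_lt_a i))
      ((hbm hij).trans_lt ((Λ.b_lt_w j).trans (EReal.coe_lt_coe_iff.2 h3)))
  rcases j with i | i | i | i <;> rcases j' with j | j | j | j
  · rw [le_antisymm (not_lt.1 (RR _ _ h' h)) (not_lt.1 (RR _ _ h h'))]
  · exact (RL _ _ h h').elim
  · exact (RP _ _ h h').elim
  · exact (RA _ _ h h').elim
  · exact (RL _ _ h' h).elim
  · rw [le_antisymm (not_lt.1 (LL _ _ h' h)) (not_lt.1 (LL _ _ h h'))]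
  · exact (LP _ _ h h').elim
  · exact (LA _ _ h h').elim
  · exact (RP _ _ h' h).elim
  · exact (LP _ _ h' h).elim
  · rw [le_antisymm (not_lt.1 (PP _ _ h' h)) (not_lt.1 (PP _ _ h h'))]
  · exact (PA _ _ h h').elim
  · exact (RA _ _ h' h).elim
  · exact (LA _ _ h' h).elim
  · exact (PA _ _ h' h).elim
  · rw [le_antisymm (not_lt.1 (AA _ _ h' h)) (not_lt.1 (AA _ _ h h'))]

/-- An interior point would satisfy the tangent bounds strictly and hence, by the factorization of
the chord equation, lie strictly below the chord; the domain requires it to be on or above. -/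
lemma interior_longChord {i : Fin (n + 1)} (hi : Λ.isCup i) :
    interior ((Vertex.longChord ((Λ.cup i hi).left (2 * ε))
      ((Λ.cup i hi).right (2 * ε))).domain ε) = ∅ := by
  rw [eq_empty_iff_forall_notMem]
  intro x hx
  set a := (Λ.cup i hi).left (2 * ε) with ha
  set b := (Λ.cup i hi).right (2 * ε) with hb
  have hsub : (Vertex.longChord a b).domain ε ⊆ box ε a ⊤ ⊥ b := by
    rintro y ⟨hs, h1, h2, -⟩
    exact ⟨hs, ⟨h1, le_top⟩, bot_le, h2⟩
  obtain ⟨hs, h1, -, -, h2⟩ := interior_box_subset (interior_mono hsub hx)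
  rw [EReal.coe_lt_coe_iff] at h1 h2
  obtain ⟨-, -, -, h3⟩ := interior_subset hx
  have h4 := h3 ((a : EReal), (b : EReal)) (by simp [Vertex.arcs, gaps])
  simp only [EReal.toReal_coe, AboveChord] at h4
  have h5 := (Λ.cup i hi).chordFun_full hs
  rw [CupData.chordFun] at h5
  have := mul_neg_of_neg_of_pos (sub_neg.2 h2) (sub_pos.2 h1)
  linarith

lemma interior_origin (p : ℝ) : interior ((Vertex.origin p).domain ε) = ∅ := by
  rw [eq_empty_iff_forall_notMem]
  intro x hx
  have hx' := mem_interior_iff_mem_nhds.1 hx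
  have hev : ∀ᶠ t : ℝ in 𝓝 0, (x.1, x.2 + t) ∈ (Vertex.origin p).domain ε := by
    have hc : Continuous fun t : ℝ => (x.1, x.2 + t) := by fun_prop
    have := hc.tendsto 0
    simp only [add_zero] at this
    exact this.eventually hx'
  obtain ⟨t, ⟨hs, h1, -⟩, ht0⟩ := ((hev.filter_mono nhdsWithin_le_nhds).and
    (self_mem_nhdsWithin (s := Ioi 0))).exists
  simp only [Vertex.arcs, leftEnd, rightEnd, List.head?_cons, List.getLast?_singleton,
    Option.map_some, Option.getD_some, EReal.toReal_coe, BelowChord] at h1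
  have h2 : x.1 ^ 2 ≤ x.2 := (interior_subset hx).1.1
  have h3 : 0 < t := ht0
  nlinarith [sq_nonneg (x.1 - p)]

lemma exists_zone {y : Vertex ⊕ Edge} (hy : y ∈ Λ.graph.figures) {x : ℝ × ℝ}
    (hx : x ∈ interior (figureDomain ε y)) : ∃ j, x ∈ zone ε Λ j ∧ y = Λ.zoneFigure j := by
  rcases hy with ⟨v, hv, rfl⟩ | ⟨e, he, rfl⟩
  · change x ∈ interior (v.domain ε) at hx
    have hemp : ∀ {v : Vertex}, v.domain ε = ∅ → x ∉ interior (v.domain ε) := fun h => by simp [h]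
    rcases Λ.mem_vertices.1 hv with ⟨i, rfl⟩ | ⟨k, rfl⟩ | ⟨i, -, rfl⟩ | ⟨-, rfl⟩ | ⟨-, rfl⟩
    · rcases Λ.top_cases i with ⟨hi, h'⟩ | ⟨hi, -, h'⟩ | ⟨-, -, -, h'⟩ | ⟨-, -, -, h'⟩ <;>
        rw [h'] at hx
      · rw [Λ.interior_longChord hi] at hx; exact absurd hx (notMem_empty x)
      · rw [domain_multicup] at hx
        obtain ⟨-, h1, -, -, h2⟩ := interior_box_subset hx
        exact ⟨.inr (.inr (.inl i)), ⟨h1, h2⟩, by simp [zoneFigure, hi]⟩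
      · exact absurd hx (hemp rfl)
      · exact absurd hx (hemp rfl)
    · rw [domain_angle] at hx
      obtain ⟨-, -, h1, h2, -⟩ := interior_box_subset hx
      exact ⟨.inr (.inr (.inr k)), ⟨EReal.coe_lt_coe_iff.1 h2, EReal.coe_lt_coe_iff.1 h1⟩, rfl⟩
    · rw [interior_origin] at hx; exact absurd hx (notMem_empty x)
    · exact absurd hx (hemp rfl)
    · exact absurd hx (hemp rfl)
  · change x ∈ interior (e.domain ε) at hx
    rcases Λ.mem_edges.1 he with ⟨i, hi, rfl⟩ | ⟨i, -, rfl⟩ | ⟨i, -, rfl⟩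
    · rw [Λ.domain_chords hi, Λ.Pk_eq_box] at hx
      obtain ⟨-, h1, -, -, h2⟩ := interior_box_subset hx
      exact ⟨.inr (.inr (.inl i)), ⟨h1, h2⟩, by simp [zoneFigure, hi]⟩
    · rw [domain_R] at hx
      obtain ⟨-, -, -, h1, h2⟩ := interior_box_subset hx
      exact ⟨.inl i, ⟨h1, h2⟩, rfl⟩
    · rw [domain_L] at hx
      obtain ⟨-, h1, h2, -, -⟩ := interior_box_subset hx
      exact ⟨.inr (.inl i), ⟨h1, h2⟩, rfl⟩

lemma figures_disjoint :
    Λ.graph.figures.PairwiseDisjoint fun x => interior (figureDomain ε x) := by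
  intro y hy y' hy' hne
  refine Set.disjoint_left.2 fun x hx hx' => hne ?_
  obtain ⟨j, hj, rfl⟩ := Λ.exists_zone hy hx
  obtain ⟨j', hj', rfl⟩ := Λ.exists_zone hy' hx'
  have hs : x ∈ strip ε := by
    rw [Λ.strip_eq_iUnion]; exact mem_iUnion₂.2 ⟨_, hy, interior_subset hx⟩
  rw [Λ.zone_unique hs hj hj']

theorem isFoliationGraph : Λ.graph.IsFoliationGraph ε := by
  refine ⟨fun v => Λ.wellFormed_vertex, fun e => Λ.wellFormed_edge, fun e he => ?_,
    fun v hv q hq => ?_, fun v hv v' hv' => ?_, Λ.card_edges_add_one, Λ.strip_eq_iUnion,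
    Λ.figures_disjoint⟩
  · obtain ⟨⟨v, hv, hq⟩, v', hv', hq'⟩ := Λ.edge_ends he
    exact ⟨⟨v, ⟨hv, hq⟩, fun y hy => Λ.target_unique hv hy.1 hq hy.2⟩,
      ⟨v', ⟨hv', hq'⟩, fun y hy => Λ.target_unique hv' hy.1 hq' hy.2⟩⟩
  · obtain ⟨e, he, h⟩ := Λ.port_edge hv hq
    exact ⟨e, ⟨he, h⟩, fun e' h' => Λ.edge_eq he h'.1 h h'.2⟩
  · exact ((Λ.connected hv).symm _ _).trans _ _ _ (Λ.connected hv')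

/-- The function of a layout is constructed from its graph. -/
theorem isGenerated
    (hR : ∀ i, Λ.b i = ⊥ → ∀ u : ℝ, IntegrableOn (fun t => deriv f t * Real.exp (t / ε)) (Iic u) ∧
      Λ.mR i u = avR ε (deriv f) u)
    (hL : ∀ i, Λ.a i = ⊤ → ∀ u : ℝ, IntegrableOn (fun t => deriv f t * Real.exp (-t / ε)) (Ici u) ∧
      Λ.mL i u = avL ε (deriv f) u) : IsGenerated f ε Λ.graph Λ.B := by
  refine ⟨Λ.continuousOn_B, fun v hv => ?_, fun e he => ?_⟩
  · rcases Λ.mem_vertices.1 hv with ⟨i, rfl⟩ | ⟨k, rfl⟩ | ⟨i, -, rfl⟩ | ⟨-, rfl⟩ | ⟨-, rfl⟩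
    · rcases Λ.top_cases i with ⟨hi, h'⟩ | ⟨hi, h, h'⟩ | ⟨-, -, -, h'⟩ | ⟨-, -, -, h'⟩ <;> rw [h']
      · exact Λ.isStandard_longChord hi
      · exact Λ.isStandard_multicup hi h
      · exact (Λ.isStandard_infinity _).1
      · exact (Λ.isStandard_infinity _).2
    · exact Λ.isStandard_angle k
    · exact Λ.isStandard_origin _
    · exact (Λ.isStandard_infinity _).1
    · exact (Λ.isStandard_infinity _).2
  · rcases Λ.mem_edges.1 he with ⟨i, hi, rfl⟩ | ⟨i, -, rfl⟩ | ⟨i, -, rfl⟩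
    · exact Λ.standardChords hi
    · exact Λ.standardTangents_R i (hR i)
    · exact Λ.standardTangents_L i (hL i)

end Layout

/-! ## The graph of an adapted layout -/

section generated

variable {f : ℝ → ℝ} {ρ : EssentialRoots f} {ε : ℝ} {Λ : Layout f (deriv f) (deriv (deriv f)) ε ρ.n}
  {C C' R : ℝ}

namespace EssentialRoots.Adapted

/-- The new content is the normalization at infinite ends: integration by parts turns f' minus ε
times the average of f'' into the average of f', and the boundary term vanishes by the exponential
bound. The right end follows by reflection. -/
theorem isGenerated (h : ρ.Adapted Λ) (hreg : Regular f) (hR : 0 ≤ R) (hRε : R * ε < 1)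
    (hb : ExpBound C R (deriv f)) (hb' : ExpBound C' R (deriv (deriv f))) :
    IsGenerated f ε Λ.graph Λ.B := by
  have hε := Λ.pos
  have hd : ContDiff ℝ (1 + 1) f := by norm_num; exact hreg.1
  have hd' : ContDiff ℝ 1 (deriv f) := (contDiff_succ_iff_deriv.1 hd).2.2
  have hF : ∀ t, HasDerivAt (deriv f) (deriv (deriv f) t) t := fun t =>
    (hd'.differentiable one_ne_zero).differentiableAt.hasDerivAt
  have hF' : Measurable (deriv (deriv f)) := measurable_deriv _
  have hm : Measurable (deriv f) := measurable_deriv _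
  refine Λ.isGenerated (fun i hi u => ⟨hb.integrableOn hε hR hRε hm u, ?_⟩)
    fun i hi u => ⟨?_, ?_⟩
  · rw [Layout.mR, h.MR_eq, hi, branch, flatten_bot, sub_avR_eq hε hR hRε hF hF' hb hb']
  · have := (hb.comp_neg.integrableOn hε hR hRε (hm.comp measurable_neg) (-u)).comp_neg
    simpa using this
  · have hn : ∀ t, HasDerivAt (fun t => deriv f (-t)) (-deriv (deriv f) (-t)) t := fun t =>
      ((hF (-t)).comp t (hasDerivAt_neg t)).congr_deriv (by ring)
    have key := sub_avR_eq hε hR hRε hn (hF'.comp measurable_neg).neg hb.comp_neg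
      (C' := C') (fun t => by simpa using hb' (-t)) (-u)
    rw [avL_eq, ← key, Layout.mL, h.ML_eq, hi, EReal.neg_top, branch, flatten_bot, avR, avR]
    simp [integral_neg]

end EssentialRoots.Adapted

end generated

/-! ### Origins, multicups and angles of the graph versus the essential roots. -/

namespace EssentialRoots.Adapted

variable {f : ℝ → ℝ} {ρ : EssentialRoots f} {ε : ℝ} {Λ : Layout f (deriv f) (deriv (deriv f)) ε ρ.n}

lemma origin_mem_iff (h : ρ.Adapted Λ) (p : ℝ) :
    Vertex.origin p ∈ Λ.graph.vertices ↔ ∃ i, ρ.cl i = p ∧ ρ.cr i = p := by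
  rw [Λ.mem_vertices]
  constructor
  · rintro (⟨i, hi⟩ | ⟨k, hk⟩ | ⟨i, hi, hp⟩ | ⟨-, hi⟩ | ⟨-, hi⟩)
    · rcases Λ.top_cases i with ⟨_, h'⟩ | ⟨-, -, h'⟩ | ⟨-, -, -, h'⟩ | ⟨-, -, -, h'⟩ <;>
        rw [h'] at hi <;> simp at hi
    · simp at hk
    · rw [Vertex.origin.injEq] at hp
      have hpt := (h.isCup_iff i).1 hi
      exact ⟨i, by rw [hp, h.p_eq, hpt.cl_eq], by rw [hp, h.p_eq, hpt.cr_eq]⟩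
    · simp at hi
    · simp at hi
  · rintro ⟨i, hl, hr⟩
    have hpt : ρ.IsPt i := ⟨hl.trans hr.symm, by simp [hl], by simp [hl]⟩
    refine Or.inr (Or.inr (Or.inl ⟨i, (h.isCup_iff i).2 hpt, ?_⟩))
    rw [h.p_eq, EReal.coe_eq_coe_iff.1 (hpt.cl_eq.symm.trans hl)]

lemma multicup_mem_iff (h : ρ.Adapted Λ) (arcs : List (EReal × EReal)) :
    Vertex.multicup arcs ∈ Λ.graph.vertices ↔
      ∃ i, ρ.cl i < ρ.cr i ∧ arcs = [(ρ.cl i, ρ.cr i)] := by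
  rw [Λ.mem_vertices]
  constructor
  · rintro (⟨i, hi⟩ | ⟨k, hk⟩ | ⟨i, hi, hp⟩ | ⟨-, hi⟩ | ⟨-, hi⟩)
    · rcases Λ.top_cases i with ⟨_, h'⟩ | ⟨hc, hab, h'⟩ | ⟨-, -, -, h'⟩ | ⟨-, -, -, h'⟩ <;>
        rw [h'] at hi <;> simp at hi
      rw [h.a_eq i hc, h.b_eq i hc] at hab hi
      exact ⟨i, hab, hi⟩
    · simp at hk
    · simp at hp
    · simp at hi
    · simp at hi
  · rintro ⟨i, hlt, rfl⟩
    have hc : ¬ Λ.isCup i := fun hc => hlt.ne ((h.isCup_iff i).1 hc).1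
    refine Or.inl ⟨i, ?_⟩
    rw [Λ.top_flat hc (by rwa [h.a_eq i hc, h.b_eq i hc]), h.a_eq i hc, h.b_eq i hc]

end EssentialRoots.Adapted

lemma Layout.angle_mem_iff {f : ℝ → ℝ} {ε : ℝ} {n : ℕ}
    (Λ : Layout f (deriv f) (deriv (deriv f)) ε n) (u : ℝ) :
    Vertex.angle u ∈ Λ.graph.vertices ↔ ∃ k, u = Λ.w k := by
  refine ⟨fun hu => ?_, fun ⟨k, hk⟩ => hk ▸ Λ.angle_mem k⟩
  rcases Λ.mem_vertices.1 hu with ⟨i, hi⟩ | ⟨k, hk⟩ | ⟨i, hi, hp⟩ | ⟨-, hi⟩ | ⟨-, hi⟩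
  · rcases Λ.top_cases i with ⟨_, h'⟩ | ⟨-, -, h'⟩ | ⟨-, -, -, h'⟩ | ⟨-, -, -, h'⟩ <;>
      rw [h'] at hi <;> simp at hi
  · exact ⟨k, by simpa using hk⟩
  · simp at hp
  · simp at hi
  · simp at hi

end Bellman

end

theorem mainTheorem5 (f : ℝ → ℝ) (εinf : ℝ) (hεinf : 0 < εinf)
    (hreg : Bellman.Regular f) (hsum : Bellman.SummabilityCondition f εinf) :
    Nonempty (Bellman.EssentialRoots f) ∧
    ∀ ρ : Bellman.EssentialRoots f,
      ∃ ε₁ : ℝ, 0 < ε₁ ∧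
      ∃ (Γ : ℝ → Bellman.FoliationGraph) (w : ℝ → Fin ρ.n → ℝ),
        (∀ ε : ℝ, 0 < ε → ε < ε₁ →
          (Γ ε).IsFoliationGraph ε ∧ (Γ ε).IsSimple ε ∧
          (∀ v ∈ (Γ ε).vertices, v.IsSimpleFigure) ∧
          (∃ B : ℝ × ℝ → ℝ, Bellman.IsGenerated f ε (Γ ε) B ∧
            ContDiffOn ℝ 1 B (Bellman.strip ε) ∧
            Bellman.IsBellmanCandidate f ε (Bellman.strip ε) B) ∧
          (∀ p : ℝ, Bellman.Vertex.origin p ∈ (Γ ε).vertices ↔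
            ∃ i, ρ.cl i = p ∧ ρ.cr i = p) ∧
          (∀ arcs, Bellman.Vertex.multicup arcs ∈ (Γ ε).vertices ↔
            ∃ i, ρ.cl i < ρ.cr i ∧ arcs = [(ρ.cl i, ρ.cr i)]) ∧
          (∀ u : ℝ, Bellman.Vertex.angle u ∈ (Γ ε).vertices ↔ ∃ k, u = w ε k) ∧
          StrictMono (w ε) ∧
          (∀ k, ρ.cr k.castSucc < w ε k ∧ w ε k < ρ.cl k.succ)) ∧
        ∀ k, Tendsto (fun ε => w ε k) (𝓝[>] 0) (𝓝ˢ (Icc (ρ.vl k) (ρ.vr k))) := by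
  obtain ⟨C', hC'⟩ := hsum.exists_expBound hεinf
  have hR : 0 < 1 / εinf := by positivity
  have hd : ContDiff ℝ (1 + 1) f := by norm_num; exact hreg.1
  have hd' : ContDiff ℝ 1 (deriv f) := (contDiff_succ_iff_deriv.1 hd).2.2
  obtain ⟨C, hC⟩ := Bellman.ExpBound.of_deriv hR (fun t =>
    (hd'.differentiable one_ne_zero).differentiableAt.hasDerivAt) hC'
  refine ⟨Bellman.exists_essentialRoots hreg, fun ρ => ?_⟩
  -- The bound on f' holds only with twice the rate of the bound on f'', so ε is taken below half of
  -- ε∞ to make the averages of f' converge.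
  have hev := (ρ.eventually_exists_layout hreg hR.le hC').and
    (Bellman.eventually_mul_lt (c := 2 * (1 / εinf)) one_pos)
  obtain ⟨ε₁, hε₁, hsub⟩ := mem_nhdsGT_iff_exists_Ioo_subset.1 hev
  have hΛ : ∀ ε, 0 < ε → ε < ε₁ →
      ∃ Λ : Bellman.Layout f (deriv f) (deriv (deriv f)) ε ρ.n, ρ.Adapted Λ :=
    fun ε h0 h1 => (hsub ⟨h0, h1⟩).1
  choose Λ hΛ using hΛ
  classical
  -- Outside (0, ε₁) the graph and the vertices get dummy values; the limit at 0 from the right does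
  -- not see them.
  refine ⟨ε₁, hε₁, fun ε => if h : 0 < ε ∧ ε < ε₁ then (Λ ε h.1 h.2).graph else ⟨∅, ∅⟩,
    fun ε => if h : 0 < ε ∧ ε < ε₁ then (Λ ε h.1 h.2).w else 0, fun ε h0 h1 => ?_, fun k => ?_⟩
  · have ha := hΛ ε h0 h1
    simp only [dif_pos (And.intro h0 h1)]
    exact ⟨(Λ ε h0 h1).isFoliationGraph, (Λ ε h0 h1).isSimple, fun v => (Λ ε h0 h1).isSimpleFigure,
      ⟨(Λ ε h0 h1).B, ha.isGenerated hreg (by positivity) (hsub ⟨h0, h1⟩).2 hC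
        (hC'.mono (by linarith)), (Λ ε h0 h1).contDiffOn_B, (Λ ε h0 h1).isBellmanCandidate⟩,
      ha.origin_mem_iff, ha.multicup_mem_iff, (Λ ε h0 h1).angle_mem_iff, (Λ ε h0 h1).w_strictMono,
      ha.between⟩
  · refine ρ.tendsto_vertex hreg hR.le hC'
      (w := fun ε => if h : 0 < ε ∧ ε < ε₁ then (Λ ε h.1 h.2).w else 0) ?_ k
    filter_upwards [Ioo_mem_nhdsGT hε₁] with ε hε
    exact ⟨_, hΛ ε hε.1 hε.2, by rw [dif_pos (And.intro hε.1 hε.2)]⟩
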